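/- **Setting.** Consider a translation-invariant spin-1 matrix product state with $D\times D$ component matrices $A_x,A_y,A_z$ (in the basis $|x\rangle,|y\rangle,|z\rangle$ with $S_\mu|\mu\rangle=0$), in canonical form: $\sum_\mu A_\mu A_\mu^\dagger=I$ and $\sum_\mu A_\mu^\dagger\Lambda A_\mu=\Lambda$ with $\Lambda>0$, $\operatorname{tr}\Lambda=1$. It lies in the $S_4$ symmetry-protected topologically ordered phase if (i) it is short-range correlated: up to scalars, $I$ is the only eigenvector of $X\mapsto\sum_\mu A_\mu XA_\mu^\dagger$ whose eigenvalue has modulus one; (ii) it is invariant under the rotation group $O\cong S_4$ of the octahedron: $\sum_\nu g_{\nu\mu}A_\nu=U_gA_\mu U_g^\dagger$ for $g\in O$, with a unitary projective representation $U$ of $O$; and (iii) the projective class of $U$ is non-trivial. **Theorem.** (a) For every such state there is a unitary identification of the virtual space with $\mathbb C^2\otimes\mathbb C^n$ (protected space $\otimes$ junk space) such that $A_\mu=\sigma_\mu\otimes a_\mu$, and $U_g=s_g\otimes w_g$ with $w_g$ unitary and $s_g$ a spin-$\frac12$ operator of the rotation $g$, i.e. unitary with $s_g\sigma_\mu s_g^\dagger=\sum_\nu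 g_{\nu\mu}\sigma_\nu$. Fix any such identification. Suppose that $\zeta_z$ is finite, that is, $a_z$ has an eigenvalue $\lambda_1$ with a single Jordan block, and all its other eigenvalues have strictly smaller modulus. Let $\lambda_2$ be one of these of largest modulus ($\lambda_2=0$ if there is none), $r=|\lambda_2/\lambda_1|<1$ and $\zeta_z=(-\log r)^{-1}$ ($\zeta_z=0$ if $r=0$). Suppose also that $\tilde\xi$ is finite: with $\tilde A^{(m)}_\mu=A_z^mA_\mu A_z^m$, there is $\delta<1$ such that for arbitrarily large $m$ the map $X\mapsto\sum_\mu\tilde A^{(m)}_\mu X\tilde A^{(m)\dagger}_\mu$ has a simple non-zero eigenvalue $\nu_1$ and all its other eigenvalues have modulus at most $\delta|\nu_1|$. For an axis $\kappa$ let $(\kappa,\kappa',\kappa'')$ be the cyclic permutation of $(x,y,z)$ starting with $\kappa$, and write $R_\kappa(\Theta)=e^{-i\Theta\sigma_\kappa/2}$. Postselecting the outcome $|\kappa\rangle$ on $m$ sites on each side of a computational site ($\kappa$-buffering) gives the component matrices $A_\kappa^mA_\mu A_\kappa^m$, with junk operators $\tilde a_\mu=a_\kappa^ma_\mu a_\kappa^m$.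 Then: (b) For each axis $\kappa$ there are scalars $s_m$ and an operator $T\neq0$ with $s_m\tilde a_{\kappa'}\to T$ and $s_m\tilde a_{\kappa''}\to T$, and $s_m(\tilde a_{\kappa'}-\tilde a_{\kappa''})=O(q^m)$ for every $q>r$. (For $\kappa=z$ these are $\tilde a_x,\tilde a_y$.) (c) Let $\rho_J>0$ be a density operator on the junk space. There are $C,m_0$ such that for all $m\ge m_0$, all $\kappa,\Theta$ and all unit vectors $\psi\in\mathbb C^2$, after postselected $\kappa$-buffering the outcomes $\cos\frac\Theta2|\kappa'\rangle-\sin\frac\Theta2|\kappa''\rangle$ and $\sin\frac\Theta2|\kappa'\rangle+\cos\frac\Theta2|\kappa''\rangle$ of the computational site implement $\sigma_{\kappa'}R_\kappa(\Theta)$ and $\sigma_{\kappa''}R_\kappa(\Theta)$, respectively, with gate fidelity at least $1-Cr^m$ (and $r^m=e^{-m/\zeta_z}$ if $r>0$). Here the fidelity of a virtual operation $K$ relative to a gate $G$ is $F=\operatorname{tr}_P\{\operatorname{tr}_J[\mathcal D(\rho)]\,G|\psi\rangle\langle\psi|G^\dagger\}$, with $\rho=|\psi\rangle\langle\psi|\otimes\rho_J$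 and $\mathcal D(\rho)=K\rho K^\dagger/\operatorname{tr}(K\rho K^\dagger)$. (d) Every $W\in U(2)$ is, up to a phase, $R_z(\gamma)R_x(\beta)R_z(\alpha)$ for some real $\alpha,\beta,\gamma$. For any such angles consider the following protocol with buffer length $m$. The three rotations are performed in order, each by attempts on consecutive blocks of $2m+1$ fresh sites. In an attempt at a rotation about $\kappa$, the $2m$ outer sites are measured in the basis $|x\rangle,|y\rangle,|z\rangle$. If all of them give $|\kappa\rangle$, the central site is measured in the basis consisting of the two vectors in (c) and $|\kappa\rangle$, with the sign of $\Theta$ adapted to the Pauli byproduct accumulated so far, and either of the two vectors means success. Otherwise the central site is measured in the Pauli basis too. After a failure the attempt is repeated on the next block. Outcomes are distributed by the Born rule, the probability of a sequence with virtual operation $K$ being $\operatorname{tr}(\Lambda K\rho K^\dagger)/\operatorname{tr}(\Lambda\rho)$. There are $C,m_0$ such that for all $m\ge m_0$, all $W$ and angles, all inputs $\rho=|\psi\rangle\langle\psi|\otimes\rho_J$ with $\psi$ a unit vector and $\rho_J$ a density operator, the protocol halts with probability one and the expectation of its gate fidelity relative to $BW$, $B$ being the accumulated Pauli byproduct, is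 at least $1-Cr^m$. (e) There is $C$ such that for every $0<\epsilon<1$ there is an $m$ for which, for all $W$, angles, $\psi$ and $\rho_J$ as in (d), the protocol halts with probability one, has expected gate fidelity at least $1-\epsilon$, and measures an expected number $\langle N\rangle$ of sites with $$\langle N\rangle\le C\left(1+\zeta_z\log\tfrac1\epsilon\right)\left(\tfrac1\epsilon\right)^{4\zeta_z\log|1/\lambda_1|}.$$ -/

import Mathlib

open Matrix Filter Topology
open scoped ComplexOrder Kronecker

noncomputable section

namespace MPS

/-- The Pauli matrices; the labels `0, 1, 2` stand for `x, y, z`. -/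
def pauli : Fin 3 → Matrix (Fin 2) (Fin 2) ℂ :=
  ![!![0, 1; 1, 0], !![0, -Complex.I; Complex.I, 0], !![1, 0; 0, -1]]

/-- The rotation `exp(-i θ σ_κ / 2)` of one qubit by the angle `θ` about the axis `κ`. -/
def rotation (κ : Fin 3) (θ : ℝ) : Matrix (Fin 2) (Fin 2) ℂ :=
  (Real.cos (θ / 2) : ℂ) • (1 : Matrix (Fin 2) (Fin 2) ℂ)
    - (Complex.I * (Real.sin (θ / 2) : ℂ)) • pauli κ

/-- The transfer map `X ↦ ∑ μ, A μ * X * (A μ)ᴴ` of a spin-1 MPS tensor. -/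
def transfer {ι : Type*} [Fintype ι] (A : Fin 3 → Matrix ι ι ℂ) :
    Matrix ι ι ℂ →ₗ[ℂ] Matrix ι ι ℂ where
  toFun X := ∑ μ, A μ * X * (A μ)ᴴ
  map_add' X Y := by simp [Matrix.mul_add, Matrix.add_mul, Finset.sum_add_distrib]
  map_smul' c X := by simp [Finset.smul_sum]

/-- Canonical form: `∑ A A† = 1` and `∑ A† Λ A = Λ` with `Λ` strictly positive of unit trace. -/
structure IsCanonical {ι : Type*} [Fintype ι] [DecidableEq ι]
    (A : Fin 3 → Matrix ι ι ℂ) (Λ : Matrix ι ι ℂ) : Prop where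
  right_fixed : transfer A 1 = 1
  left_fixed : ∑ μ, (A μ)ᴴ * Λ * A μ = Λ
  posDef : Λ.PosDef
  trace_eq : Λ.trace = 1

/-- Short-range correlation of an MPS tensor in canonical form: up to scalars, `1` is the only
eigenvector of the transfer map whose eigenvalue has modulus one. -/
def IsShortRange {ι : Type*} [Fintype ι] [DecidableEq ι] (A : Fin 3 → Matrix ι ι ℂ) : Prop :=
  ∀ (ν : ℂ) (X : Matrix ι ι ℂ), ‖ν‖ = 1 → transfer A X = ν • X → ∃ c : ℂ, X = c • 1

/-- The rotation group of the octahedron with vertices `±e_x, ±e_y, ±e_z`: the signed permutation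
matrices of determinant one, that is, `SO(3, ℤ)`. It is isomorphic to `S_4`. -/
abbrev Octahedral : Type := Matrix.specialOrthogonalGroup (Fin 3) ℤ

/-- The on-site spin-1 representation in the basis `|x⟩, |y⟩, |z⟩`, in which a rotation acts by its
own matrix. -/
def spinOne (g : Octahedral) : Matrix (Fin 3) (Fin 3) ℂ :=
  (g : Matrix (Fin 3) (Fin 3) ℤ).map (Int.cast : ℤ → ℂ)

/-- A unitary projective representation: `U g * U h = e^{i θ(g,h)} U (g * h)`. -/
structure IsProjectiveRep {G ι : Type*} [Group G] [Fintype ι] [DecidableEq ι]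
    (U : G → Matrix ι ι ℂ) : Prop where
  unitary : ∀ g, U g ∈ Matrix.unitaryGroup ι ℂ
  mul : ∀ g h, ∃ c : ℂ, ‖c‖ = 1 ∧ U g * U h = c • U (g * h)

/-- The projective class is trivial: the phases of the `U g` can be chosen so that `U` becomes a
linear representation. -/
def IsTrivialClass {G ι : Type*} [Group G] [Fintype ι] (U : G → Matrix ι ι ℂ) : Prop :=
  ∃ χ : G → ℂ, (∀ g, ‖χ g‖ = 1) ∧
    ∀ g h, (χ g • U g) * (χ h • U h) = χ (g * h) • U (g * h)

/-- `A` is the tensor, in canonical form with left fixed point `Λ`, of a spin-1 MPS in the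
symmetry-protected topologically ordered phase of on-site octahedral symmetry, the symmetry being
represented on the virtual space by `U`: the MPS is short-range correlated, invariant under the
group, and the projective class of `U` is not the trivial one. -/
structure InSPTOPhase {ι : Type*} [Fintype ι] [DecidableEq ι] (A : Fin 3 → Matrix ι ι ℂ)
    (Λ : Matrix ι ι ℂ) (U : Octahedral → Matrix ι ι ℂ) : Prop where
  canonical : IsCanonical A Λ
  shortRange : IsShortRange A
  projective : IsProjectiveRep U
  nontrivial : ¬ IsTrivialClass U
  invariant : ∀ g μ, ∑ ν, spinOne g ν μ • A ν = U g * A μ * (U g)ᴴ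

/-- The component matrices `σ_μ ⊗ a_μ` on protected space ⊗ junk space. -/
def component {n : ℕ} (a : Fin 3 → Matrix (Fin n) (Fin n) ℂ) (μ : Fin 3) :
    Matrix (Fin 2 × Fin n) (Fin 2 × Fin n) ℂ :=
  pauli μ ⊗ₖ a μ

/-- The unitary `V` identifies the virtual space with protected space ⊗ junk space in such a way
that the component matrices become `σ_μ ⊗ a_μ` and every symmetry operator becomes `s ⊗ w`, with
`s` the spin-1/2 operator of the same rotation (up to a phase). -/
structure IsProtectedJunk {ι : Type*} [Fintype ι] [DecidableEq ι] {n : ℕ}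
    (A : Fin 3 → Matrix ι ι ℂ) (U : Octahedral → Matrix ι ι ℂ)
    (V : Matrix ι (Fin 2 × Fin n) ℂ) (a : Fin 3 → Matrix (Fin n) (Fin n) ℂ) : Prop where
  isometry : Vᴴ * V = 1
  coisometry : V * Vᴴ = 1
  components : ∀ μ, Vᴴ * A μ * V = component a μ
  symmetry : ∀ g, ∃ s ∈ Matrix.unitaryGroup (Fin 2) ℂ, ∃ w ∈ Matrix.unitaryGroup (Fin n) ℂ,
    Vᴴ * U g * V = s ⊗ₖ w ∧ ∀ μ, s * pauli μ * sᴴ = ∑ ν, spinOne g ν μ • pauli ν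

/-- `l` is the eigenvalue of strictly largest modulus of `b`, and it belongs to only one Jordan
block of `b`. -/
def IsLeading {n : ℕ} (b : Matrix (Fin n) (Fin n) ℂ) (l : ℂ) : Prop :=
  Module.finrank ℂ (Module.End.eigenspace (Matrix.toLin' b) l) = 1 ∧
    ∀ μ ∈ spectrum ℂ b, μ ≠ l → ‖μ‖ < ‖l‖

/-- `|λ₂ / λ₁|`, where `λ₁ = l` is leading and `λ₂` is an eigenvalue of largest modulus belonging to
the other Jordan blocks (`0` if there is no other block). -/
def ratio {n : ℕ} (b : Matrix (Fin n) (Fin n) ℂ) (l : ℂ) : ℝ :=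
  sSup ((fun μ : ℂ => ‖μ‖) '' (spectrum ℂ b \ {l})) / ‖l‖

/-- `ζ = (-log |λ₂ / λ₁|)⁻¹`; it is `0` if `λ₂ = 0`, as `Real.log 0 = 0` and `0⁻¹ = 0`. -/
def zeta {n : ℕ} (b : Matrix (Fin n) (Fin n) ℂ) (l : ℂ) : ℝ :=
  (-Real.log (ratio b l))⁻¹

/-- Renormalized component matrices `A_κ^m A_μ A_κ^m`, after postselecting the outcome `κ` on `m`
sites on each side of the computational site. -/
def renorm {n : ℕ} (a : Fin 3 → Matrix (Fin n) (Fin n) ℂ) (κ : Fin 3) (m : ℕ) (μ : Fin 3) :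
    Matrix (Fin 2 × Fin n) (Fin 2 × Fin n) ℂ :=
  component a κ ^ m * component a μ * component a κ ^ m

/-- Renormalized junk operators `a_κ^m a_μ a_κ^m`. -/
def renormJunk {n : ℕ} (a : Fin 3 → Matrix (Fin n) (Fin n) ℂ) (κ : Fin 3) (m : ℕ) (μ : Fin 3) :
    Matrix (Fin n) (Fin n) ℂ :=
  a κ ^ m * a μ * a κ ^ m

/-- `E` has a simple nonzero eigenvalue such that all other eigenvalues are smaller in modulus by a
factor `δ` at least; the correlation length is then at most `(-log δ)⁻¹`. -/
def HasGap {ι : Type*} [Fintype ι] [DecidableEq ι]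
    (E : Matrix ι ι ℂ →ₗ[ℂ] Matrix ι ι ℂ) (δ : ℝ) : Prop :=
  ∃ ν₁ : ℂ, ν₁ ≠ 0 ∧ E.charpoly.rootMultiplicity ν₁ = 1 ∧
    ∀ ν : ℂ, E.charpoly.IsRoot ν → ν ≠ ν₁ → ‖ν‖ ≤ δ * ‖ν₁‖

/-- The renormalized correlation length is finite: the correlation lengths of the `z`-buffered
tensors do not diverge to infinity with the number `m` of buffering sites. -/
def FiniteRenormCorrelation {n : ℕ} (a : Fin 3 → Matrix (Fin n) (Fin n) ℂ) : Prop :=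
  ∃ δ < (1 : ℝ), ∃ᶠ m in atTop, HasGap (transfer (renorm a 2 m)) δ

/-- `A[ψ] = ∑ μ, conj (ψ μ) A μ`, the operator induced by the measurement outcome `ψ`. -/
def outcomeOp {ι : Type*} (A : Fin 3 → Matrix ι ι ℂ) (ψ : Fin 3 → ℂ) : Matrix ι ι ℂ :=
  ∑ μ, star (ψ μ) • A μ

/-- The orthonormal measurement basis for a rotation by `θ` about the axis `κ`. For `κ = z`:
`cos(θ/2)|x⟩ - sin(θ/2)|y⟩` (label `x`), `sin(θ/2)|x⟩ + cos(θ/2)|y⟩` (label `y`) and `|z⟩`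
(label `z`); for the other axes the labels are permuted cyclically. The outcome labelled `c ≠ κ`
induces the rotation followed by the byproduct `σ_c`; the outcome `κ` induces `σ_κ` only. -/
def rotBasis (κ : Fin 3) (θ : ℝ) (c : Fin 3) : Fin 3 → ℂ :=
  if c = κ + 1 then
    Pi.single (κ + 1) (Real.cos (θ / 2) : ℂ) - Pi.single (κ + 2) (Real.sin (θ / 2) : ℂ)
  else if c = κ + 2 then
    Pi.single (κ + 1) (Real.sin (θ / 2) : ℂ) + Pi.single (κ + 2) (Real.cos (θ / 2) : ℂ)
  else Pi.single κ 1

/-- Partial trace over the junk space. -/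
def traceJunk {n : ℕ} (M : Matrix (Fin 2 × Fin n) (Fin 2 × Fin n) ℂ) :
    Matrix (Fin 2) (Fin 2) ℂ :=
  Matrix.of fun i j => ∑ k, M (i, k) (j, k)

/-- The product state `|ψ⟩⟨ψ| ⊗ ρJ`. -/
def productState {n : ℕ} (ψ : Fin 2 → ℂ) (ρJ : Matrix (Fin n) (Fin n) ℂ) :
    Matrix (Fin 2 × Fin n) (Fin 2 × Fin n) ℂ :=
  Matrix.vecMulVec ψ (star ψ) ⊗ₖ ρJ

/-- The gate fidelity `tr_P { tr_J [D(ρ)] G |ψ⟩⟨ψ| G† }` of the operation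
`D(ρ) = K ρ K† / tr (K ρ K†)`, `ρ = |ψ⟩⟨ψ| ⊗ ρJ`, relative to the one-qubit gate `G`. -/
def gateFidelity {n : ℕ} (K : Matrix (Fin 2 × Fin n) (Fin 2 × Fin n) ℂ)
    (G : Matrix (Fin 2) (Fin 2) ℂ) (ψ : Fin 2 → ℂ) (ρJ : Matrix (Fin n) (Fin n) ℂ) : ℝ :=
  (Matrix.trace (traceJunk ((Matrix.trace (K * productState ψ ρJ * Kᴴ))⁻¹ •
      (K * productState ψ ρJ * Kᴴ)) * (G * Matrix.vecMulVec ψ (star ψ) * Gᴴ))).re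

/-! The measurement protocol. Operators of later measured sites stand to the left. -/

/-- The outcomes of one attempt: the labels of the `m` buffering sites on either side and of the
computational site. -/
structure Attempt (m : ℕ) where
  left : Fin m → Fin 3
  comp : Fin 3
  right : Fin m → Fin 3

/-- The buffering succeeds: all `2 m` buffering sites gave the outcome `κ`. -/
def Attempt.Buffered {m : ℕ} (κ : Fin 3) (o : Attempt m) : Prop :=
  (∀ i, o.left i = κ) ∧ ∀ i, o.right i = κ

/-- A rotation about `κ` has been performed: the buffering succeeded and the computational site,
which is then measured in the basis `rotBasis κ θ`, did not give the outcome `κ`. -/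
def Attempt.Success {m : ℕ} (κ : Fin 3) (o : Attempt m) : Prop :=
  o.Buffered κ ∧ o.comp ≠ κ

/-- The list of all labels of an attempt, in the order of the operators. -/
def Attempt.labels {m : ℕ} (o : Attempt m) : List (Fin 3) :=
  List.ofFn o.left ++ o.comp :: List.ofFn o.right

open Classical in
/-- The virtual operator of an attempt at a rotation by `θ` about `κ`. If the buffering succeeds the
computational site is measured in the basis `rotBasis κ θ`, otherwise in the Pauli basis. -/
def attemptOp {n m : ℕ} (a : Fin 3 → Matrix (Fin n) (Fin n) ℂ) (κ : Fin 3) (θ : ℝ)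
    (o : Attempt m) : Matrix (Fin 2 × Fin n) (Fin 2 × Fin n) ℂ :=
  if o.Buffered κ then
    component a κ ^ m * outcomeOp (component a) (rotBasis κ θ o.comp) * component a κ ^ m
  else (o.labels.map (component a)).prod

/-- The accumulated byproduct operator of a list of labels. -/
def byproduct (h : List (Fin 3)) : Matrix (Fin 2) (Fin 2) ℂ := (h.map pauli).prod

/-- The sign `s` with `σ_κ * byproduct h = s • (byproduct h * σ_κ)`. -/
def frameSign (κ : Fin 3) (h : List (Fin 3)) : ℝ := (-1) ^ h.countP (fun ν => ν ≠ κ)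

open Classical in
/-- The virtual operator of a run: the rotations `(κ, θ)` of the first list are to be performed in
order, `h` is the list of the labels obtained so far (the last one first), and each rotation is
attempted on fresh sites until it succeeds, the sign of the angle being adapted to the byproduct
accumulated so far. -/
def runOp {n m : ℕ} (a : Fin 3 → Matrix (Fin n) (Fin n) ℂ) :
    List (Fin 3 × ℝ) → List (Fin 3) → List (Attempt m) →
      Matrix (Fin 2 × Fin n) (Fin 2 × Fin n) ℂ
  | _, _, [] => 1
  | [], _, _ :: _ => 1
  | g :: gs, h, o :: os =>
      runOp a (if o.Success g.1 then gs else g :: gs) (o.labels ++ h) os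
        * attemptOp a g.1 (frameSign g.1 h * g.2) o

open Classical in
/-- The run is complete: its last attempt is the one that finishes the last rotation. -/
def IsComplete {m : ℕ} : List (Fin 3 × ℝ) → List (Attempt m) → Prop
  | [], [] => True
  | [], _ :: _ => False
  | _ :: _, [] => False
  | g :: gs, o :: os => IsComplete (if o.Success g.1 then gs else g :: gs) os

/-- The complete runs of the protocol with `m` buffering sites on each side. -/
abbrev Run (m : ℕ) (gates : List (Fin 3 × ℝ)) : Type :=
  {t : List (Attempt m) // IsComplete gates t}

/-- The virtual operator of a complete run. -/
def Run.op {n m : ℕ} {gates : List (Fin 3 × ℝ)} (a : Fin 3 → Matrix (Fin n) (Fin n) ℂ)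
    (t : Run m gates) : Matrix (Fin 2 × Fin n) (Fin 2 × Fin n) ℂ :=
  runOp a gates [] t.1

/-- The byproduct operator of a complete run. -/
def Run.pauliByproduct {m : ℕ} {gates : List (Fin 3 × ℝ)} (t : Run m gates) :
    Matrix (Fin 2) (Fin 2) ℂ :=
  byproduct (t.1.reverse.flatMap Attempt.labels)

/-- The number of sites measured in a complete run. -/
def Run.sites {m : ℕ} {gates : List (Fin 3 × ℝ)} (t : Run m gates) : ℝ :=
  ((2 * m + 1) * t.1.length : ℕ)

/-- The Born probability of a complete run, for the virtual boundary state `ρ` and a half-infinite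
remaining chain, whose contraction is the left fixed point `Λ`. -/
def Run.prob {n m : ℕ} {gates : List (Fin 3 × ℝ)} (a : Fin 3 → Matrix (Fin n) (Fin n) ℂ)
    (Λ ρ : Matrix (Fin 2 × Fin n) (Fin 2 × Fin n) ℂ) (t : Run m gates) : ℝ :=
  (Matrix.trace (Λ * (t.op a * ρ * (t.op a)ᴴ))).re / (Matrix.trace (Λ * ρ)).re

/-- The rotations `z` by `α`, then `x` by `β`, then `z` by `γ`. -/
def eulerGates (α β γ : ℝ) : List (Fin 3 × ℝ) := [(2, α), (0, β), (2, γ)]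

/-- `W` is the product of these rotations, up to a global phase. -/
def IsEuler (W : Matrix (Fin 2) (Fin 2) ℂ) (α β γ : ℝ) : Prop :=
  ∃ c : ℂ, ‖c‖ = 1 ∧ W = c • (rotation 2 γ * rotation 0 β * rotation 2 α)

/-- For the input state `|ψ⟩⟨ψ| ⊗ ρJ` the protocol with `m` buffering sites on each side halts with
probability one, and the expectation of its gate fidelity relative to `W`, up to the known byproduct
operator, is at least `f`. -/
def ImplementsWithFidelity {n : ℕ} (a : Fin 3 → Matrix (Fin n) (Fin n) ℂ)
    (Λ : Matrix (Fin 2 × Fin n) (Fin 2 × Fin n) ℂ) (m : ℕ) (gates : List (Fin 3 × ℝ))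
    (W : Matrix (Fin 2) (Fin 2) ℂ) (ψ : Fin 2 → ℂ) (ρJ : Matrix (Fin n) (Fin n) ℂ)
    (f : ℝ) : Prop :=
  HasSum (fun t : Run m gates => t.prob a Λ (productState ψ ρJ)) 1 ∧
    ∃ F : ℝ, f ≤ F ∧ HasSum (fun t : Run m gates => t.prob a Λ (productState ψ ρJ) *
      gateFidelity (t.op a) (t.pauliByproduct * W) ψ ρJ) F

/-- The expected number of sites measured by the protocol is finite and at most `N`. -/
def ExpectedSitesLE {n : ℕ} (a : Fin 3 → Matrix (Fin n) (Fin n) ℂ)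
    (Λ : Matrix (Fin 2 × Fin n) (Fin 2 × Fin n) ℂ) (m : ℕ) (gates : List (Fin 3 × ℝ))
    (ψ : Fin 2 → ℂ) (ρJ : Matrix (Fin n) (Fin n) ℂ) (N : ℝ) : Prop :=
  ∃ S : ℝ, S ≤ N ∧
    HasSum (fun t : Run m gates => t.prob a Λ (productState ψ ρJ) * t.sites) S

end MPS

end

/-! Splitting. Lifts of the rotations by π about the axes can be normalized to involutions X, Y, Z
with XY = lZ, permuted cyclically by a lift C of the 3-fold rotation. Consistency forces l⁴ = 1, and
the remaining relations of the group then hold up to powers of l (`liftRel_of`). For l = ±1 the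
lifts, after a change of sign, satisfy the relations of the group, so the class is trivial. Hence l
= ±i in the phase, and X, Y, Z are Pauli operators up to sign. They split the virtual space as qubit
⊗ junk. Since A_μ responds to conjugation by X, Y, Z with the same signs as σ_μ does, the product of
σ_μ ⊗ 1 with A_μ commutes with all Pauli operators of the qubit and is therefore 1 ⊗ a_μ.

Convergence. The rotation exchanging the x and y axes and reversing z acts on the junk space by a
unitary w that commutes with a_z and takes a_x to a_y. Let P be the spectral projection of a_z for
λ₁. A unitary commuting with an operator that has a single Jordan block for λ₁ is a scalar on the
range of P (`exists_unitary_mul_projection`), so P a_x P = P a_y P. Conjugation by a_z^m retains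
only these compressions, up to relative errors q^m for every q > r. On the range of P the normalized
operator is unipotent, so its powers converge projectively when applied to anything nonzero.

That P a_x P ≠ 0 follows from the finiteness of the renormalized correlation length. Otherwise the
buffered transfer map would have, asymptotically, the traces of powers of X ↦ B X B† with B =
A_z^(2m+1) compressed to P. For even powers these are c D^k with c ≥ 4, whereas a simple dominant
eigenvalue ν gives ν^k; comparison of the powers k and 2k yields c ≈ c² (`not_frequently_hasGap`).

Single rotation. The operator of a successful outcome is the wanted gate ⊗ ã plus a Pauli operator ⊗
a multiple of ã_κ' − ã_κ''. The infidelity is quadratic in this difference, so a relative error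
(√r)^m gives exactly r^m. When r = 0 the difference vanishes for large m.

Protocol. Failed blocks apply words of Pauli operators ⊗ junk operators, which act on the qubit
without error, and the target state is updated by the byproduct. The weight of the deviation from
the target thus grows only in two ways: by a bounded factor at each of the three successes, and by
an additive term of order N r^m at every block, N being the squared Hilbert–Schmidt norm of the
renormalized junk operator. Short-range correlation makes the powers of the transfer map mix, so
that after any block the next one succeeds with probability of order N, uniformly in the state
(`IsCanonical.exists_mixing`). Hence the expected number of blocks is of order 1/N, and N cancels
from the accumulated error. Both statements are proved with potentials that do not increase on
average (`timePotential`, `badPotential`).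

Overhead. N is at least a constant times |λ₁|^(4m), and m ≈ ζ log(1/ε) makes r^m of order ε. -/

namespace MPS

/-! ### The octahedral group -/

/-- The rotation by `π` about the `x` axis. -/
def octX : Octahedral := ⟨!![1, 0, 0; 0, -1, 0; 0, 0, -1], by
  rw [Matrix.mem_specialOrthogonalGroup_iff, Matrix.mem_orthogonalGroup_iff]; decide⟩

/-- The rotation `x ↦ y ↦ z ↦ x`. -/
def octC : Octahedral := ⟨!![0, 0, 1; 1, 0, 0; 0, 1, 0], by
  rw [Matrix.mem_specialOrthogonalGroup_iff, Matrix.mem_orthogonalGroup_iff]; decide⟩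

/-- The rotation `x ↦ -y`, `y ↦ -x`, `z ↦ -z`. -/
def octT : Octahedral := ⟨!![0, -1, 0; -1, 0, 0; 0, 0, -1], by
  rw [Matrix.mem_specialOrthogonalGroup_iff, Matrix.mem_orthogonalGroup_iff]; decide⟩

/-- The relations, in any monoid, of generators of the octahedral group. -/
structure OctRel {M : Type*} [Monoid M] (x y z c t : M) : Prop where
  xx : x * x = 1
  xy : x * y = z
  xz : x * z = y
  cx : c * x = y * c
  cy : c * y = z * c
  cz : c * z = x * c
  tx : t * x = y * t
  ty : t * y = x * t
  tz : t * z = z * t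
  ccc : c * (c * c) = 1
  tc : t * c = c * c * t
  tt : t * t = 1

/-- The normal form of the elements of the octahedral group. -/
def octWord {M : Type*} [Monoid M] (x y z c t : M) (p : Fin 4 × Fin 3 × Fin 2) : M :=
  ![1, x, y, z] p.1 * (![1, c, c * c] p.2.1 * ![1, t] p.2.2)

namespace OctRel

variable {M : Type*} [Monoid M] {x y z c t : M}

theorem x_mul_word (h : OctRel x y z c t) (p : Fin 4 × Fin 3 × Fin 2) :
    ∃ p', x * octWord x y z c t p = octWord x y z c t p' := by
  obtain ⟨i, j⟩ := p
  have : ∃ i', x * ![1, x, y, z] i = ![1, x, y, z] i' := by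
    fin_cases i
    · exact ⟨1, by simp⟩
    · exact ⟨0, by simp [h.xx]⟩
    · exact ⟨3, by simp [h.xy]⟩
    · exact ⟨2, by simp [h.xz]⟩
  obtain ⟨i', hi⟩ := this
  exact ⟨(i', j), by simp only [octWord]; rw [← mul_assoc, hi]⟩

theorem c_mul_word (h : OctRel x y z c t) (p : Fin 4 × Fin 3 × Fin 2) :
    ∃ p', c * octWord x y z c t p = octWord x y z c t p' := by
  obtain ⟨i, j, k⟩ := p
  have h1 : ∃ i', c * ![1, x, y, z] i = ![1, x, y, z] i' * c := by
    fin_cases i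
    · exact ⟨0, by simp⟩
    · exact ⟨2, by simp [h.cx]⟩
    · exact ⟨3, by simp [h.cy]⟩
    · exact ⟨1, by simp [h.cz]⟩
  have h2 : ∃ j', c * ![1, c, c * c] j = ![1, c, c * c] j' := by
    fin_cases j
    · exact ⟨1, by simp⟩
    · exact ⟨2, by simp⟩
    · exact ⟨0, by simp [h.ccc]⟩
  obtain ⟨i', hi⟩ := h1
  obtain ⟨j', hj⟩ := h2
  refine ⟨(i', j', k), ?_⟩
  simp only [octWord]
  rw [← mul_assoc, hi, mul_assoc, ← mul_assoc c, hj]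

theorem t_mul_word (h : OctRel x y z c t) (p : Fin 4 × Fin 3 × Fin 2) :
    ∃ p', t * octWord x y z c t p = octWord x y z c t p' := by
  obtain ⟨i, j, k⟩ := p
  have h1 : ∃ i', t * ![1, x, y, z] i = ![1, x, y, z] i' * t := by
    fin_cases i
    · exact ⟨0, by simp⟩
    · exact ⟨2, by simp [h.tx]⟩
    · exact ⟨1, by simp [h.ty]⟩
    · exact ⟨3, by simp [h.tz]⟩
  have h2 : ∃ j', t * ![1, c, c * c] j = ![1, c, c * c] j' * t := by
    fin_cases j
    · exact ⟨0, by simp⟩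
    · exact ⟨2, by simp [h.tc]⟩
    · refine ⟨1, ?_⟩
      calc t * (c * c) = t * c * c := (mul_assoc _ _ _).symm
        _ = c * c * (t * c) := by rw [h.tc, mul_assoc (c * c)]; rw [← h.tc]
        _ = c * (c * (c * c)) * t := by rw [h.tc]; simp only [mul_assoc]
        _ = c * t := by rw [h.ccc, mul_one]
  have h3 : ∃ k', t * ![1, t] k = ![1, t] k' := by
    fin_cases k
    · exact ⟨1, by simp⟩
    · exact ⟨0, by simp [h.tt]⟩
  obtain ⟨i', hi⟩ := h1
  obtain ⟨j', hj⟩ := h2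
  obtain ⟨k', hk⟩ := h3
  refine ⟨(i', j', k'), ?_⟩
  simp only [octWord]
  rw [← mul_assoc, hi, mul_assoc, ← mul_assoc t, hj, mul_assoc, hk]

/-- The elements whose left multiplication preserves normal forms are a submonoid, so it is enough
that it contains x, c and t. Stated in an arbitrary monoid in order to be applied to pairs (group
element, matrix), where one index must serve both coordinates. -/
theorem word_mul_word (h : OctRel x y z c t) (p q : Fin 4 × Fin 3 × Fin 2) :
    ∃ p', octWord x y z c t p * octWord x y z c t q = octWord x y z c t p' := by
  let S : Submonoid M :=
    { carrier := {m | ∀ q, ∃ p', m * octWord x y z c t q = octWord x y z c t p'}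
      one_mem' := fun q => ⟨q, one_mul _⟩
      mul_mem' := by
        intro a b ha hb q
        obtain ⟨q', hq'⟩ := hb q
        obtain ⟨p', hp'⟩ := ha q'
        exact ⟨p', by rw [mul_assoc, hq', hp']⟩ }
  have hx : x ∈ S := h.x_mul_word
  have hc : c ∈ S := h.c_mul_word
  have ht : t ∈ S := h.t_mul_word
  have hy : y ∈ S := by
    have : y = c * x * (c * c) := by rw [h.cx, mul_assoc, h.ccc, mul_one]
    rw [this]
    exact S.mul_mem (S.mul_mem hc hx) (S.mul_mem hc hc)
  have hz : z ∈ S := h.xy ▸ S.mul_mem hx hy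
  have : octWord x y z c t p ∈ S := by
    obtain ⟨i, j, k⟩ := p
    refine S.mul_mem ?_ (S.mul_mem ?_ ?_)
    · fin_cases i
      exacts [S.one_mem, hx, hy, hz]
    · fin_cases j
      exacts [S.one_mem, hc, S.mul_mem hc hc]
    · fin_cases k
      exacts [S.one_mem, ht]
  exact this q

end OctRel

/-- The rotation by `π` about the `y` axis. -/
def octY : Octahedral := octC * octX * (octC * octC)

/-- The rotation by `π` about the `z` axis. -/
def octZ : Octahedral := octX * octY

theorem octRel : OctRel octX octY octZ octC octT := by
  constructor <;> decide +kernel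

theorem octWord_injective : Function.Injective (octWord octX octY octZ octC octT) := by
  decide +kernel

/-- The six signed unit vectors. -/
def signedUnit : Fin 6 → Fin 3 → ℤ :=
  ![![1, 0, 0], ![-1, 0, 0], ![0, 1, 0], ![0, -1, 0], ![0, 0, 1], ![0, 0, -1]]

theorem exists_signedUnit (v : Fin 3 → ℤ) (h : v 0 * v 0 + v 1 * v 1 + v 2 * v 2 = 1) :
    ∃ i, v = signedUnit i := by
  have b : ∀ w : ℤ, w * w ≤ 1 → -1 ≤ w ∧ w ≤ 1 := fun w hw => by constructor <;> nlinarith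
  obtain ⟨a0, a1⟩ := b (v 0) (by nlinarith [mul_self_nonneg (v 1), mul_self_nonneg (v 2)])
  obtain ⟨b0, b1⟩ := b (v 1) (by nlinarith [mul_self_nonneg (v 0), mul_self_nonneg (v 2)])
  obtain ⟨c0, c1⟩ := b (v 2) (by nlinarith [mul_self_nonneg (v 1), mul_self_nonneg (v 0)])
  have hv : v = ![v 0, v 1, v 2] := by ext i; fin_cases i <;> rfl
  rw [hv]
  generalize v 0 = p at *
  generalize v 1 = q at *
  generalize v 2 = r at *
  clear hv
  have key : ∀ p ∈ Finset.Icc (-1 : ℤ) 1, ∀ q ∈ Finset.Icc (-1 : ℤ) 1, ∀ r ∈ Finset.Icc (-1 : ℤ) 1,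
      p * p + q * q + r * r = 1 → ∃ i, ![p, q, r] = signedUnit i := by decide
  exact key p (Finset.mem_Icc.2 ⟨a0, a1⟩) q (Finset.mem_Icc.2 ⟨b0, b1⟩) r
    (Finset.mem_Icc.2 ⟨c0, c1⟩) h

theorem signedUnit_det (i j k : Fin 6)
    (h : (Matrix.of ![signedUnit i, signedUnit j, signedUnit k]).det = 1) :
    ∃ p, Matrix.of ![signedUnit i, signedUnit j, signedUnit k] =
      ((octWord octX octY octZ octC octT p : Octahedral) : Matrix (Fin 3) (Fin 3) ℤ) := by
  revert i j k
  simp only [Matrix.det_fin_three]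
  decide +kernel

/-- The rows of an integral orthogonal matrix are integral unit vectors, hence signed basis vectors.
This leaves 6³ matrices, which are checked by computation. -/
theorem octWord_surjective : Function.Surjective (octWord octX octY octZ octC octT) := by
  intro g
  obtain ⟨h1, h2⟩ := Matrix.mem_specialOrthogonalGroup_iff.1 g.2
  rw [Matrix.mem_orthogonalGroup_iff] at h1
  have row : ∀ r, ∃ i, (g : Matrix (Fin 3) (Fin 3) ℤ) r = signedUnit i := by
    intro r
    apply exists_signedUnit
    have := congrFun (congrFun h1 r) r
    simpa [Matrix.mul_apply, Fin.sum_univ_three, Matrix.star_apply] using this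
  obtain ⟨i, hi⟩ := row 0
  obtain ⟨j, hj⟩ := row 1
  obtain ⟨k, hk⟩ := row 2
  have hg : (g : Matrix (Fin 3) (Fin 3) ℤ) =
      Matrix.of ![signedUnit i, signedUnit j, signedUnit k] := by
    ext r s
    fin_cases r
    · exact congrFun hi s
    · exact congrFun hj s
    · exact congrFun hk s
  rw [hg] at h2
  obtain ⟨p, hp⟩ := signedUnit_det i j k h2
  exact ⟨p, Subtype.ext (by rw [hg, hp])⟩

/-- Every element is a positive word in x, c and t, so no closure under inverses is needed. -/
theorem octahedral_induction {P : Octahedral → Prop} (h1 : P 1)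
    (hmul : ∀ g h, P g → P h → P (g * h)) (hx : P octX) (hc : P octC) (ht : P octT)
    (g : Octahedral) : P g := by
  obtain ⟨⟨i, j, k⟩, rfl⟩ := octWord_surjective g
  have hcc := hmul _ _ hc hc
  have hy : P octY := hmul _ _ (hmul _ _ hc hx) hcc
  have hz : P octZ := hmul _ _ hx hy
  refine hmul _ _ ?_ (hmul _ _ ?_ ?_)
  · fin_cases i
    exacts [h1, hx, hy, hz]
  · fin_cases j
    exacts [h1, hc, hcc]
  · fin_cases k
    exacts [h1, ht]

theorem spinOne_one : spinOne 1 = 1 := by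
  simp [spinOne]

theorem spinOne_mul (g h : Octahedral) : spinOne (g * h) = spinOne g * spinOne h := by
  have := Matrix.map_mul (L := (g : Matrix (Fin 3) (Fin 3) ℤ)) (M := (h : Matrix (Fin 3) (Fin 3) ℤ))
    (f := Int.castRingHom ℂ)
  simpa [spinOne] using this

/-! ### Lifts of group elements along a projective representation -/

/-- `M` is `U g` up to a phase. -/
def IsLift {G ι : Type*} (U : G → Matrix ι ι ℂ) (g : G) (M : Matrix ι ι ℂ) : Prop :=
  ∃ c : ℂ, ‖c‖ = 1 ∧ M = c • U g

namespace IsLift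

variable {G ι : Type*} {U : G → Matrix ι ι ℂ}

theorem self (g : G) : IsLift U g (U g) := ⟨1, by simp, by simp⟩

theorem smul {g : G} {M : Matrix ι ι ℂ} (h : IsLift U g M) {c : ℂ} (hc : ‖c‖ = 1) :
    IsLift U g (c • M) := by
  obtain ⟨d, hd, rfl⟩ := h
  exact ⟨c * d, by simp [hc, hd], by rw [smul_smul]⟩

theorem unique {g : G} {M N : Matrix ι ι ℂ} (hM : IsLift U g M) (hN : IsLift U g N) :
    ∃ c : ℂ, ‖c‖ = 1 ∧ M = c • N := by
  obtain ⟨c, hc, rfl⟩ := hM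
  obtain ⟨d, hd, rfl⟩ := hN
  have : d ≠ 0 := by rintro rfl; simp at hd
  exact ⟨c * d⁻¹, by simp [hc, hd], by rw [smul_smul, mul_assoc, inv_mul_cancel₀ this, mul_one]⟩

variable [Fintype ι]

/-- Conjugation by a lift does not depend on the phase. -/
theorem conj_eq {g : G} {M : Matrix ι ι ℂ} (hM : IsLift U g M) (X : Matrix ι ι ℂ) :
    M * X * Mᴴ = U g * X * (U g)ᴴ := by
  obtain ⟨c, hc, rfl⟩ := hM
  have : star c * c = 1 := by
    rw [Complex.star_def, Complex.conj_mul', hc]; simp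
  simp only [Matrix.conjTranspose_smul, smul_mul_assoc, mul_smul_comm, smul_smul, this, one_smul]

variable [Group G] [DecidableEq ι]

theorem mul (hU : IsProjectiveRep U) {g h : G} {M N : Matrix ι ι ℂ} (hM : IsLift U g M)
    (hN : IsLift U h N) : IsLift U (g * h) (M * N) := by
  obtain ⟨c, hc, rfl⟩ := hM
  obtain ⟨d, hd, rfl⟩ := hN
  obtain ⟨e, he, h⟩ := hU.mul g h
  exact ⟨c * d * e, by simp [hc, hd, he], by simp [h, smul_smul, mul_comm, mul_left_comm]⟩

theorem one (hU : IsProjectiveRep U) : IsLift U 1 (1 : Matrix ι ι ℂ) := by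
  obtain ⟨c, hc, h⟩ := hU.mul 1 1
  rw [mul_one] at h
  have h1 := Matrix.mem_unitaryGroup_iff.1 (hU.unitary 1)
  have hc0 : c ≠ 0 := by rintro rfl; simp at hc
  have : U 1 = c • 1 := by
    calc U 1 = U 1 * U 1 * star (U 1) := by rw [mul_assoc, h1, mul_one]
      _ = c • 1 := by rw [h, smul_mul_assoc, h1]
  exact ⟨c⁻¹, by simp [hc], by rw [this, smul_smul, inv_mul_cancel₀ hc0, one_smul]⟩

theorem pow (hU : IsProjectiveRep U) {g : G} {M : Matrix ι ι ℂ} (hM : IsLift U g M) (k : ℕ) :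
    IsLift U (g ^ k) (M ^ k) := by
  induction k with
  | zero => simpa using one hU
  | succ k ih => rw [pow_succ, pow_succ]; exact ih.mul hU hM

/-- The k-th power of any lift is a phase, and a k-th root of its inverse is again a phase by which
the lift can be corrected. -/
theorem exists_pow_eq_one (hU : IsProjectiveRep U) {g : G} {k : ℕ} (hk : 0 < k) (hg : g ^ k = 1) :
    ∃ M, IsLift U g M ∧ M ^ k = 1 := by
  have h := (self (U := U) g).pow hU k
  rw [hg] at h
  obtain ⟨c, hc, h⟩ := h.unique (one hU)
  have hc0 : c ≠ 0 := by rintro rfl; simp at hc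
  obtain ⟨d, hd⟩ := IsAlgClosed.exists_pow_nat_eq c⁻¹ hk
  have hd1 : ‖d‖ = 1 := by
    have : ‖d‖ ^ k = 1 := by rw [← norm_pow, hd, norm_inv, hc, inv_one]
    exact (pow_eq_one_iff_of_nonneg (norm_nonneg _) hk.ne').1 this
  exact ⟨d • U g, (self g).smul hd1, by
    rw [smul_pow, hd, h, smul_smul, inv_mul_cancel₀ hc0, one_smul]⟩

theorem mem_unitary (hU : IsProjectiveRep U) {g : G} {M : Matrix ι ι ℂ} (hM : IsLift U g M) :
    M * Mᴴ = 1 := by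
  obtain ⟨c, hc, rfl⟩ := hM
  have h1 : U g * (U g)ᴴ = 1 := Matrix.mem_unitaryGroup_iff.1 (hU.unitary g)
  have : c * star c = 1 := by
    rw [Complex.star_def, Complex.mul_conj, Complex.normSq_eq_norm_sq, hc]; simp
  rw [Matrix.conjTranspose_smul, smul_mul_assoc, mul_smul_comm, smul_smul, this, h1, one_smul]

end IsLift

/-! ### The class of a projective representation of the octahedral group -/

theorem smul_one_inj {R : Type*} [Ring R] [Algebra ℂ R] [Nontrivial R] {c d : ℂ}
    (h : c • (1 : R) = d • 1) : c = d :=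
  (algebraMap ℂ R).injective (by rwa [Algebra.algebraMap_eq_smul_one,
      Algebra.algebraMap_eq_smul_one])

/-- Lifts of the generators satisfying the relations of the group up to the scalar `l`, `l ^ 4 = 1`,
which measures the class of the projective representation. -/
structure LiftRel {R : Type*} [Ring R] [Algebra ℂ R] (l : ℂ) (X Y Z C T : R) : Prop where
  pow_four : l ^ 4 = 1
  xx : X * X = 1
  yy : Y * Y = 1
  zz : Z * Z = 1
  xy : X * Y = l • Z
  yz : Y * Z = l • X
  zx : Z * X = l • Y
  xz : X * Z = l⁻¹ • Y
  cx : C * X = Y * C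
  cy : C * Y = Z * C
  cz : C * Z = X * C
  tx : T * X = l ^ 2 • (Y * T)
  ty : T * Y = l ^ 2 • (X * T)
  tz : T * Z = l ^ 2 • (Z * T)
  ccc : C * (C * C) = 1
  tc : T * C = C * C * T
  tt : T * T = 1

/-- Conjugation by C carries XY = lZ to the other two products, and T C = C² T transports the action
of T on X to Y and Z. The two free scalars l and e are then tied by consistency, so that l alone
measures the class. -/
theorem liftRel_of {R : Type*} [Ring R] [Algebra ℂ R] [Nontrivial R] {X C T : R} {l e : ℂ}
    (hl : l ≠ 0) (he : e ≠ 0)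
    (xx : X * X = 1) (ccc : C * (C * C) = 1)
    (tt : T * T = 1) (tc : T * C = C * C * T)
    (xy : X * (C * X * (C * C)) = l • (C * (C * X * (C * C)) * (C * C)))
    (txt : T * X * T = e • (C * X * (C * C))) :
    LiftRel l X (C * X * (C * C)) (C * (C * X * (C * C)) * (C * C)) C T := by
  have ccc' : C * C * C = 1 := by rw [mul_assoc, ccc]
  have cj : ∀ M N : R, (C * M * (C * C)) * (C * N * (C * C)) =
      C * (M * N) * (C * C) := by
    intro M N
    calc (C * M * (C * C)) * (C * N * (C * C)) = C * M * (C * C * C) * (N * (C * C)) := by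
          simp only [mul_assoc]
      _ = C * (M * N) * (C * C) := by rw [ccc']; simp only [mul_assoc, mul_one]
  have cm : ∀ M : R, C * M = (C * M * (C * C)) * C := by
    intro M
    rw [mul_assoc, ccc', mul_one]
  have tj : ∀ M N : R, (T * M * T) * (T * N * T) = T * (M * N) * T := by
    intro M N
    calc (T * M * T) * (T * N * T) = T * M * (T * T) * (N * T) := by simp only [mul_assoc]
      _ = T * (M * N) * T := by rw [tt]; simp only [mul_assoc, mul_one]
  have tm : ∀ M : R, T * M = (T * M * T) * T := by
    intro M
    rw [mul_assoc, tt, mul_one]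
  have cinv : ∀ M : R, C * C * (C * M * (C * C)) * C = M := by
    intro M
    calc C * C * (C * M * (C * C)) * C = (C * C * C) * M * (C * C * C) := by simp only [mul_assoc]
      _ = M := by rw [ccc', one_mul, mul_one]
  have ct : C * T = T * (C * C) := by
    calc C * T = T * T * (C * T) := by rw [tt, one_mul]
      _ = T * (T * C) * T := by simp only [mul_assoc]
      _ = T * (C * C) * (T * T) := by rw [tc]; simp only [mul_assoc]
      _ = T * (C * C) := by rw [tt, mul_one]
  have tcj : ∀ M : R, T * (C * M * (C * C)) * T = C * C * (T * M * T) * C := by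
    intro M
    calc T * (C * M * (C * C)) * T = (T * C) * M * (C * (C * T)) := by simp only [mul_assoc]
      _ = C * C * (T * M) * ((C * T) * (C * C)) := by
          rw [tc, mul_assoc C T, ← ct]; simp only [mul_assoc]
      _ = C * C * (T * M * T) * (C * (C * C * C)) := by rw [ct]; simp only [mul_assoc]
      _ = _ := by rw [ccc', mul_one]
  have c1 : C * 1 * (C * C) = 1 := by rw [mul_one, ccc]
  set Y := C * X * (C * C) with hY
  set Z := C * Y * (C * C) with hZ
  have hX : C * Z * (C * C) = X := by
    calc C * Z * (C * C) = C * C * (C * X * (C * C)) * C * (C * C * C) := by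
          rw [hZ, hY]; simp only [mul_assoc]
      _ = X := by rw [ccc', mul_one, cinv]
  have cs : ∀ (a : ℂ) (M : R), C * (a • M) * (C * C) = a • (C * M * (C * C)) := by
    intro a M; simp
  have yy : Y * Y = 1 := by rw [hY, cj, xx, c1]
  have zz : Z * Z = 1 := by rw [hZ, cj, yy, c1]
  have yz : Y * Z = l • X := by
    conv_lhs => rw [hZ]
    conv_lhs => enter [1]; rw [hY]
    rw [cj, xy, cs, hX]
  have zx : Z * X = l • Y := by
    conv_lhs => rw [← hX, hZ]
    rw [cj, ← hZ, yz, cs]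
  have xz : X * Z = l⁻¹ • Y := by
    calc X * Z = l⁻¹ • (X * (l • Z)) := by
          rw [mul_smul_comm, smul_smul, inv_mul_cancel₀ hl, one_smul]
      _ = l⁻¹ • Y := by rw [← xy, ← mul_assoc, xx, one_mul]
  have yx : Y * X = l⁻¹ • Z := by
    conv_lhs => rw [← hX, hY]
    rw [cj, xz, cs]
  -- From ZX = l² XZ one gets (XZ)² = l², while l XZ = Y squares to 1.
  have l4 : l ^ 4 = 1 := by
    have h1 : Z * X = l ^ 2 • (X * Z) := by
      rw [xz, zx, smul_smul]; congr 1; field_simp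
    have h2 : (l ^ 4) • (1 : R) = (1 : ℂ) • 1 := by
      calc (l ^ 4) • (1 : R) = (l ^ 2 * l ^ 2) • ((X * X) * (Z * Z)) := by
            rw [xx, zz, mul_one]; congr 1; ring
        _ = l ^ 2 • (X * (l ^ 2 • (X * Z)) * Z) := by
            rw [mul_smul_comm, smul_mul_assoc, smul_smul]; simp only [mul_assoc]
        _ = (l • (X * Z)) * (l • (X * Z)) := by
            rw [← h1, smul_mul_assoc, mul_smul_comm, smul_smul, ← pow_two]; simp only [mul_assoc]
        _ = (1 : ℂ) • 1 := by
            rw [xz, smul_smul, mul_inv_cancel₀ hl, one_smul, yy, one_smul]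
    exact smul_one_inj h2
  have tyt : T * Y * T = e • X := by
    conv_lhs => rw [hY]
    rw [tcj, txt, mul_smul_comm, smul_mul_assoc, hY, cinv]
  have tzt : T * Z * T = e • Z := by
    conv_lhs => rw [hZ]
    rw [tcj, tyt, mul_smul_comm, smul_mul_assoc]
    conv_lhs => rw [← hX, cinv]
  -- Conjugation of XY = lZ by T gives e² YX = l e Z, and YX = l⁻¹ Z.
  have hel : e = l ^ 2 := by
    have h1 : (e * e * l⁻¹) • Z = (l * e) • Z := by
      calc (e * e * l⁻¹) • Z = (e • Y) * (e • X) := by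
            rw [smul_mul_assoc, mul_smul_comm, yx, smul_smul, smul_smul, mul_assoc]
        _ = (l * e) • Z := by
            rw [← txt, ← tyt, tj, xy, mul_smul_comm, smul_mul_assoc, tzt, smul_smul]
    have h2 := congrArg (· * Z) h1
    simp only [smul_mul_assoc, zz] at h2
    have h3 := smul_one_inj h2
    field_simp at h3
    linear_combination h3
  subst hel
  refine ⟨l4, xx, yy, zz, xy, yz, zx, xz, cm X, cm Y, ?_, ?_, ?_, ?_, ccc, tc, tt⟩
  · rw [cm Z, hX]
  · rw [tm X, txt, smul_mul_assoc]
  · rw [tm Y, tyt, smul_mul_assoc]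
  · rw [tm Z, tzt, smul_mul_assoc]

/-- The relations are quadratic on the left and linear on the right, so reversing X, Y, Z together
reverses l. Only l up to sign is an invariant. -/
theorem LiftRel.smul {l s : ℂ} (hs : s = 1 ∨ s = -1) {R : Type*} [Ring R]
     [Algebra ℂ R] {X Y Z C T : R}
    (h : LiftRel l X Y Z C T) : LiftRel (s * l) (s • X) (s • Y) (s • Z) C T := by
  rcases hs with rfl | rfl
  · simpa using h
  · obtain ⟨l4, xx, yy, zz, xy, yz, zx, xz, cx, cy, cz, tx, ty, tz, ccc, tc, tt⟩ := h
    refine ⟨by rw [mul_pow, l4]; norm_num, ?_, ?_, ?_, ?_, ?_, ?_, ?_, ?_, ?_, ?_, ?_, ?_, ?_, ccc,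
        tc, tt⟩ <;>
      simp [inv_neg, *]

theorem LiftRel.octRel {R : Type*} [Ring R] [Algebra ℂ R] {X Y Z C T : R}
    (h : LiftRel 1 X Y Z C T) : OctRel X Y Z C T := by
  obtain ⟨-, xx, yy, zz, xy, yz, zx, xz, cx, cy, cz, tx, ty, tz, ccc, tc, tt⟩ := h
  simp only [one_pow, one_smul, inv_one] at *
  exact ⟨xx, xy, xz, cx, cy, cz, tx, ty, tz, ccc, tc, tt⟩

section

variable {ι : Type*} [Fintype ι] [DecidableEq ι]

/-- The phases of X, C, T are fixed by requiring the orders 2, 3, 2; the residual cube root of unity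
in C is used to make the relation of T and C exact. Y and Z are then defined by conjugation. -/
theorem exists_liftRel [Nonempty ι] {U : Octahedral → Matrix ι ι ℂ} (hU : IsProjectiveRep U) :
    ∃ (l : ℂ) (X Y Z C T : Matrix ι ι ℂ), IsLift U octX X ∧ IsLift U octY Y ∧ IsLift U octZ Z ∧
      IsLift U octC C ∧ IsLift U octT T ∧ LiftRel l X Y Z C T := by
  have ne : ∀ {c : ℂ}, ‖c‖ = 1 → c ≠ 0 := by rintro c hc rfl; simp at hc
  obtain ⟨X, hX, xx⟩ := IsLift.exists_pow_eq_one hU (g := octX) (k := 2) (by norm_num)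
    (by rw [pow_two, octRel.xx])
  obtain ⟨C, hC, ccc⟩ := IsLift.exists_pow_eq_one hU (g := octC) (k := 3) (by norm_num)
    (by rw [pow_succ', pow_two, octRel.ccc])
  obtain ⟨T, hT, tt⟩ := IsLift.exists_pow_eq_one hU (g := octT) (k := 2) (by norm_num)
    (by rw [pow_two, octRel.tt])
  rw [pow_two] at xx tt
  rw [pow_succ', pow_two] at ccc
  obtain ⟨m, hm, tc⟩ : ∃ m : ℂ, ‖m‖ = 1 ∧ T * C = m • (C * C * T) := by
    have h1 := hT.mul hU hC
    rw [octRel.tc] at h1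
    exact h1.unique ((hC.mul hU hC).mul hU hT)
  have tct : T * C * T = m • (C * C) := by
    rw [tc, smul_mul_assoc, mul_assoc, tt, mul_one]
  -- Cube TCT = m C². Afterwards C is replaced by m C, which keeps its order and absorbs m in the
  -- relation with T.
  have hm3 : m ^ 3 = 1 := by
    have : (m ^ 3) • (1 : Matrix ι ι ℂ) = (1 : ℂ) • 1 := by
      calc (m ^ 3) • (1 : Matrix ι ι ℂ) = (m * (m * m)) • ((C * (C * C)) * (C * (C * C))) := by
            rw [ccc, mul_one]; congr 1; ring
        _ = (m • (C * C)) * ((m • (C * C)) * (m • (C * C))) := by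
            simp only [smul_mul_assoc, mul_smul_comm, smul_smul]; simp only [mul_assoc]
        _ = T * C * (T * T) * C * (T * T) * C * T := by rw [← tct]; simp only [mul_assoc]
        _ = T * (C * (C * C)) * T := by rw [tt]; simp only [mul_assoc, mul_one]
        _ = (1 : ℂ) • 1 := by rw [ccc, mul_one, tt, one_smul]
    exact smul_one_inj this
  have hC' := hC.smul hm
  have ccc' : (m • C) * ((m • C) * (m • C)) = 1 := by
    simp only [smul_mul_assoc, mul_smul_comm, smul_smul, ccc]
    rw [show m * m * m = 1 by rw [← hm3]; ring, one_smul]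
  have tc' : T * (m • C) = (m • C) * (m • C) * T := by
    simp only [smul_mul_assoc, mul_smul_comm, smul_smul, tc]
  generalize m • C = C' at hC' ccc' tc'
  have hCC := hC'.mul hU hC'
  have hY : IsLift U octY (C' * X * (C' * C')) := (hC'.mul hU hX).mul hU hCC
  have hZ : IsLift U octZ (C' * (C' * X * (C' * C')) * (C' * C')) := by
    have := (hC'.mul hU hY).mul hU hCC
    rwa [octRel.cy, mul_assoc, octRel.ccc, mul_one] at this
  obtain ⟨l, hl, xy⟩ := (hX.mul hU hY).unique hZ
  obtain ⟨e, he, txt⟩ : ∃ e : ℂ, ‖e‖ = 1 ∧ T * X * T = e • (C' * X * (C' * C')) := by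
    have := (hT.mul hU hX).mul hU hT
    rw [octRel.tx, mul_assoc, octRel.tt, mul_one] at this
    exact this.unique hY
  exact ⟨l, X, _, _, C', T, hX, hY, hZ, hC', hT,
    liftRel_of (ne hl) (ne he) xx ccc' tt tc' xy txt⟩

/-- The matrix word in normal form for g fixes the phase of U g. Running the rewriting in the
product monoid shows that the matrix words multiply with the same normal forms as the group
elements, so these choices are multiplicative. -/
theorem isTrivialClass_of_octRel {U : Octahedral → Matrix ι ι ℂ} {X Y Z C T : Matrix ι ι ℂ}
    (hU : IsProjectiveRep U)
    (hX : IsLift U octX X) (hY : IsLift U octY Y) (hZ : IsLift U octZ Z)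
    (hC : IsLift U octC C) (hT : IsLift U octT T) (h : OctRel X Y Z C T) : IsTrivialClass U := by
  have hprod : OctRel (M := Octahedral × Matrix ι ι ℂ) (octX, X) (octY, Y) (octZ, Z) (octC, C)
      (octT, T) := by
    obtain ⟨h1, h2, h3, h4, h5, h6, h7, h8, h9, h10, h11, h12⟩ := h
    obtain ⟨g1, g2, g3, g4, g5, g6, g7, g8, g9, g10, g11, g12⟩ := octRel
    constructor <;> refine Prod.ext ?_ ?_ <;> assumption
  have hfst : ∀ p, octWord (M := Octahedral × Matrix ι ι ℂ) (octX, X) (octY, Y) (octZ, Z)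
      (octC, C) (octT, T) p = (octWord octX octY octZ octC octT p, octWord X Y Z C T p) := by
    rintro ⟨i, j, k⟩
    fin_cases i <;> fin_cases j <;> fin_cases k <;>
      simp [octWord, Prod.one_eq_mk]
  have hlift : ∀ p, IsLift U (octWord octX octY octZ octC octT p) (octWord X Y Z C T p) := by
    rintro ⟨i, j, k⟩
    refine IsLift.mul hU ?_ (IsLift.mul hU ?_ ?_)
    · fin_cases i
      exacts [IsLift.one hU, hX, hY, hZ]
    · fin_cases j
      exacts [IsLift.one hU, hC, hC.mul hU hC]
    · fin_cases k
      exacts [IsLift.one hU, hT]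
  choose idx hidx using octWord_surjective
  have hg : ∀ g, ∃ c : ℂ, ‖c‖ = 1 ∧ octWord X Y Z C T (idx g) = c • U g := by
    intro g
    have := hlift (idx g)
    rwa [hidx] at this
  choose χ hχ hχU using hg
  refine ⟨χ, hχ, fun g k => ?_⟩
  rw [← hχU, ← hχU, ← hχU]
  obtain ⟨p, hp⟩ := hprod.word_mul_word (idx g) (idx k)
  rw [hfst, hfst, hfst, Prod.mk_mul_mk, Prod.mk.injEq, hidx, hidx] at hp
  rw [hp.2]
  congr 1
  exact octWord_injective (by rw [← hp.1, hidx])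

/-- A nontrivial projective representation of the octahedral group contains Pauli operators which
rotate as the components of a vector. -/
theorem exists_pauli_frame [Nonempty ι] {U : Octahedral → Matrix ι ι ℂ} (hU : IsProjectiveRep U)
    (hnt : ¬ IsTrivialClass U) :
    ∃ X Y Z C T : Matrix ι ι ℂ, IsLift U octX X ∧ IsLift U octY Y ∧ IsLift U octZ Z ∧
      IsLift U octC C ∧ IsLift U octT T ∧ LiftRel Complex.I X Y Z C T := by
  obtain ⟨l, X, Y, Z, C, T, hX, hY, hZ, hC, hT, h⟩ := exists_liftRel hU
  have hs : ∀ {s : ℂ}, s = 1 ∨ s = -1 → ‖s‖ = 1 := by rintro s (rfl | rfl) <;> simp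
  have h4 : (l ^ 2 - 1) * (l ^ 2 + 1) = 0 := by linear_combination h.pow_four
  -- If l² = 1, the sign can be chosen so that l = 1, and the class would be trivial. If l² = -1,
  -- the sign can be chosen so that l = i.
  rcases mul_eq_zero.1 h4 with h4 | h4
  · have h2 : l = 1 ∨ l = -1 := sq_eq_one_iff.1 (by linear_combination h4)
    have h' := h.smul h2
    have : l * l = 1 := by linear_combination h4
    rw [this] at h'
    exact absurd (isTrivialClass_of_octRel hU (hX.smul (hs h2)) (hY.smul (hs h2))
      (hZ.smul (hs h2)) hC hT h'.octRel) hnt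
  · have h2 : (-Complex.I * l) = 1 ∨ (-Complex.I * l) = -1 := by
      apply sq_eq_one_iff.1
      rw [mul_pow, neg_sq, Complex.I_sq]
      linear_combination -h4
    rcases h2 with h2 | h2
    · have hl : l = Complex.I := by linear_combination Complex.I * h2 + l * Complex.I_sq
      exact ⟨X, Y, Z, C, T, hX, hY, hZ, hC, hT, hl ▸ h⟩
    · have hl : -1 * l = Complex.I := by
        linear_combination -Complex.I * h2 - l * Complex.I_sq
      refine ⟨_, _, _, C, T, hX.smul (hs (Or.inr rfl)), hY.smul (hs (Or.inr rfl)),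
        hZ.smul (hs (Or.inr rfl)), hC, hT, hl ▸ h.smul (Or.inr rfl)⟩

end

/-! ### Splitting the virtual space -/

theorem pauli_mul_self (μ : Fin 3) : pauli μ * pauli μ = 1 := by
  fin_cases μ <;> simp [pauli, Matrix.one_fin_two]

theorem pauli_conjTranspose (μ : Fin 3) : (pauli μ)ᴴ = pauli μ := by
  ext i j
  fin_cases μ <;> fin_cases i <;> fin_cases j <;> simp [pauli]

theorem pauli_mem_unitaryGroup (μ : Fin 3) : pauli μ ∈ Matrix.unitaryGroup (Fin 2) ℂ := by
  rw [Matrix.mem_unitaryGroup_iff, Matrix.star_eq_conjTranspose, pauli_conjTranspose,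
    pauli_mul_self]

/-- Spin-1/2 operators multiply along with the rotations, so explicit ones for the three generators
suffice; for `octX` it is σ_x. -/
theorem exists_spinHalf (g : Octahedral) : ∃ s ∈ Matrix.unitaryGroup (Fin 2) ℂ,
    ∀ μ, s * pauli μ * sᴴ = ∑ ν, spinOne g ν μ • pauli ν := by
  refine octahedral_induction (P := fun g => ∃ s ∈ Matrix.unitaryGroup (Fin 2) ℂ,
    ∀ μ, s * pauli μ * sᴴ = ∑ ν, spinOne g ν μ • pauli ν) ?_ ?_ ?_ ?_ ?_ g
  · exact ⟨1, one_mem _, fun μ => by simp [spinOne_one, Matrix.one_apply]⟩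
  · rintro g h ⟨s, hs, hs'⟩ ⟨t, ht, ht'⟩
    refine ⟨s * t, mul_mem hs ht, fun μ => ?_⟩
    calc s * t * pauli μ * (s * t)ᴴ = s * (t * pauli μ * tᴴ) * sᴴ := by
          rw [Matrix.conjTranspose_mul]; simp only [Matrix.mul_assoc]
      _ = ∑ ν, spinOne h ν μ • (s * pauli ν * sᴴ) := by
          rw [ht', Finset.mul_sum, Finset.sum_mul]
          simp
      _ = ∑ ν, spinOne (g * h) ν μ • pauli ν := by
          simp only [hs', Finset.smul_sum, smul_smul, spinOne_mul, Matrix.mul_apply,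
            Finset.sum_smul]
          rw [Finset.sum_comm]
          simp only [mul_comm]
  · refine ⟨pauli 0, pauli_mem_unitaryGroup 0, fun μ => ?_⟩
    rw [pauli_conjTranspose]
    ext i j
    fin_cases μ <;> fin_cases i <;> fin_cases j <;>
      simp [pauli, spinOne, octX, Fin.sum_univ_three]
  · obtain ⟨q, hq, hqq⟩ : ∃ q : ℂ, (starRingEnd ℂ) q = q ∧ q ^ 2 = 1 / 4 :=
      ⟨((1 / 2 : ℝ) : ℂ), Complex.conj_ofReal _, by push_cast; norm_num⟩
    -- With q = 1/2 this is (1 - i(σ_x + σ_y + σ_z))/2, the rotation by 2π/3 about the diagonal (1,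
    -- 1, 1).
    refine ⟨q • !![1 - Complex.I, -1 - Complex.I; 1 - Complex.I, 1 + Complex.I], ?_,
      fun μ => ?_⟩
    · rw [Matrix.mem_unitaryGroup_iff, Matrix.star_eq_conjTranspose]
      ext i j
      fin_cases i <;> fin_cases j <;>
      · simp [Matrix.mul_apply, hq]
        ring_nf
        try simp [Complex.I_sq, hqq]
        try norm_num
    · have h3 : Complex.I ^ 3 = -Complex.I := by rw [pow_succ, Complex.I_sq]; ring
      ext i j
      fin_cases μ <;> fin_cases i <;> fin_cases j <;>
      · simp [Matrix.mul_apply, pauli, spinOne, octC, Fin.sum_univ_three, hq]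
        ring_nf
        try simp [Complex.I_sq, h3, hqq]
        try ring_nf
  · obtain ⟨r, hr, hrr⟩ : ∃ r : ℂ, star r = r ∧ r * r * 2 = 1 := by
      refine ⟨(Real.sqrt 2⁻¹ : ℝ), by simp, ?_⟩
      rw [← Complex.ofReal_mul, Real.mul_self_sqrt (by norm_num)]
      norm_num
    have h1 : r * r * (1 + Complex.I) * (1 - Complex.I) = 1 := by
      linear_combination hrr - r * r * Complex.I_sq
    -- (σ_x - σ_y)/√2: the rotation by π about the axis (1, -1, 0), up to a phase.
    refine ⟨r • !![0, 1 + Complex.I; 1 - Complex.I, 0], ?_, fun μ => ?_⟩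
    · rw [Matrix.mem_unitaryGroup_iff, Matrix.star_eq_conjTranspose]
      ext i j
      rw [Complex.star_def] at hr
      fin_cases i <;> fin_cases j <;>
      · simp [Matrix.mul_apply, hr]
        try linear_combination h1
    · ext i j
      rw [Complex.star_def] at hr
      fin_cases μ <;> fin_cases i <;> fin_cases j <;>
      · simp [Matrix.mul_apply, pauli, spinOne, octT, Fin.sum_univ_three, hr]
        try first
          | linear_combination h1
          | linear_combination -h1
          | linear_combination Complex.I * hrr + r * r * Complex.I_sq
          | linear_combination -Complex.I * hrr + r * r * Complex.I_sq
          | linear_combination -hrr + r * r * (2 + Complex.I) * Complex.I_sq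
          | linear_combination hrr + r * r * (Complex.I - 2) * Complex.I_sq

/-- The property passes to products, so the generators suffice. For T the factor l² = -1 in
`LiftRel` is exactly the sign with which `octT` acts on the axes. -/
theorem frame_rotates {ι : Type*} [Fintype ι] [DecidableEq ι] {U : Octahedral → Matrix ι ι ℂ}
    (hU : IsProjectiveRep U) {X Y Z C T : Matrix ι ι ℂ} (hX : IsLift U octX X)
    (hC : IsLift U octC C) (hT : IsLift U octT T) (h : LiftRel Complex.I X Y Z C T)
    (g : Octahedral) (μ : Fin 3) :
    U g * ![X, Y, Z] μ * (U g)ᴴ = ∑ ν, spinOne g ν μ • ![X, Y, Z] ν := by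
  have hmul : ∀ (g h : Octahedral) (M : Matrix ι ι ℂ),
      U (g * h) * M * (U (g * h))ᴴ = U g * (U h * M * (U h)ᴴ) * (U g)ᴴ := by
    intro g h M
    rw [← ((IsLift.self g).mul hU (IsLift.self h)).conj_eq M, Matrix.conjTranspose_mul]
    simp only [Matrix.mul_assoc]
  revert μ
  refine octahedral_induction (P := fun g => ∀ μ, U g * ![X, Y, Z] μ * (U g)ᴴ =
    ∑ ν, spinOne g ν μ • ![X, Y, Z] ν) ?_ ?_ ?_ ?_ ?_ g
  · intro μ
    rw [← (IsLift.one hU).conj_eq]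
    simp [spinOne_one, Matrix.one_apply]
  · intro g h hg hh μ
    rw [hmul, hh, Finset.mul_sum, Finset.sum_mul]
    simp only [mul_smul_comm, smul_mul_assoc, hg, Finset.smul_sum, smul_smul, spinOne_mul,
      Matrix.mul_apply, Finset.sum_smul]
    rw [Finset.sum_comm]
    simp only [mul_comm]
  · have hXX : Xᴴ = X := by
      rw [← mul_one Xᴴ, ← h.xx, ← mul_assoc, mul_eq_one_comm.1 (hX.mem_unitary hU), one_mul]
    have h1 : X * Y * X = -Y := by
      rw [h.xy, smul_mul_assoc, h.zx, smul_smul, Complex.I_mul_I, neg_one_smul]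
    have h2 : X * Z * X = -Z := by
      rw [mul_assoc, h.zx, mul_smul_comm, h.xy, smul_smul, Complex.I_mul_I, neg_one_smul]
    intro μ
    rw [← hX.conj_eq, hXX]
    fin_cases μ <;> simp [spinOne, octX, Fin.sum_univ_three, h1, h2, h.xx]
  · have hCC := hC.mem_unitary hU
    intro μ
    rw [← hC.conj_eq]
    fin_cases μ <;>
      simp [spinOne, octC, Fin.sum_univ_three, h.cx, h.cy, h.cz, mul_assoc, hCC]
  · have hTT := hT.mem_unitary hU
    intro μ
    rw [← hT.conj_eq]
    fin_cases μ <;>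
      simp [spinOne, octT, Fin.sum_univ_three, h.tx, h.ty, h.tz, mul_assoc, hTT]

/-- The columns are an orthonormal basis of the range. -/
theorem exists_isometry_of_projection {D : ℕ} {P : Matrix (Fin D) (Fin D) ℂ} (hP : Pᴴ = P)
    (hPP : P * P = P) :
    ∃ (n : ℕ) (S : Matrix (Fin D) (Fin n) ℂ), Sᴴ * S = 1 ∧ S * Sᴴ = P := by
  let f : EuclideanSpace ℂ (Fin D) →ₗ[ℂ] EuclideanSpace ℂ (Fin D) := Matrix.toEuclideanLin P
  let K := LinearMap.range f
  let b := stdOrthonormalBasis ℂ K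
  refine ⟨Module.finrank ℂ K, Matrix.of fun i k => (b k : EuclideanSpace ℂ (Fin D)) i, ?_, ?_⟩
  · ext j k
    have := (orthonormal_iff_ite.1 b.orthonormal) j k
    rw [Submodule.coe_inner, EuclideanSpace.inner_eq_star_dotProduct] at this
    rw [Matrix.one_apply, ← this]
    simp [Matrix.mul_apply, dotProduct, mul_comm]
  · have hsymm : f.IsSymmetric := Matrix.isHermitian_iff_isSymmetric.1 hP
    have hff : ∀ x, f (f x) = f x := by
      intro x
      simp only [f, Matrix.toLpLin_apply, Matrix.mulVec_mulVec, hPP]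
    have hfb : ∀ k, f (b k) = b k := by
      intro k
      obtain ⟨y, hy⟩ := (b k).2
      rw [← hy, hff]
    ext i j
    have h1 := b.sum_repr' ⟨f (EuclideanSpace.single j 1), LinearMap.mem_range_self _ _⟩
    have h2 := congrArg (fun x : K => (x : EuclideanSpace ℂ (Fin D)) i) h1
    simp only [Submodule.coe_inner, ← hsymm _, hfb] at h2
    have h3 : (f (EuclideanSpace.single j 1)) i = P i j := by
      simp [f, Matrix.toLpLin_apply]
    rw [h3] at h2
    rw [← h2]
    simp [Matrix.mul_apply, mul_comm, EuclideanSpace.inner_single_right]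

/-- σ_z forces M to be block diagonal and σ_x forces the two blocks to be equal: the two Pauli
matrices generate all of M₂(ℂ). -/
theorem exists_one_kronecker_of_commute {n : ℕ} {M : Matrix (Fin 2 × Fin n) (Fin 2 × Fin n) ℂ}
    (hx : pauli 0 ⊗ₖ (1 : Matrix (Fin n) (Fin n) ℂ) * M = M * pauli 0 ⊗ₖ 1)
    (hz : pauli 2 ⊗ₖ (1 : Matrix (Fin n) (Fin n) ℂ) * M = M * pauli 2 ⊗ₖ 1) :
    ∃ w : Matrix (Fin n) (Fin n) ℂ, M = 1 ⊗ₖ w := by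
  have hl : ∀ (s : Matrix (Fin 2) (Fin 2) ℂ) i k j l,
      (s ⊗ₖ (1 : Matrix (Fin n) (Fin n) ℂ) * M) (i, k) (j, l) =
          ∑ i', s i i' * M (i', k) (j, l) := by
    intro s i k j l
    simp [Matrix.mul_apply, Fintype.sum_prod_type, Matrix.one_apply]
  have hr : ∀ (s : Matrix (Fin 2) (Fin 2) ℂ) i k j l,
      (M * s ⊗ₖ (1 : Matrix (Fin n) (Fin n) ℂ)) (i, k) (j, l) =
          ∑ j', M (i, k) (j', l) * s j' j := by
    intro s i k j l
    simp [Matrix.mul_apply, Fintype.sum_prod_type, Matrix.one_apply]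
  have hx' : ∀ i k j l, _ := fun i k j l => (hl (pauli 0) i k j l).symm.trans
    ((congrFun (congrFun hx (i, k)) (j, l)).trans (hr (pauli 0) i k j l))
  have hz' : ∀ i k j l, _ := fun i k j l => (hl (pauli 2) i k j l).symm.trans
    ((congrFun (congrFun hz (i, k)) (j, l)).trans (hr (pauli 2) i k j l))
  refine ⟨Matrix.of fun k l => M (0, k) (0, l), ?_⟩
  ext ⟨i, k⟩ ⟨j, l⟩
  have h1 := hx' 0 k 1 l
  have h2 := hz' 0 k 1 l
  have h3 := hz' 1 k 0 l
  simp only [pauli, Fin.sum_univ_two] at h1 h2 h3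
  simp at h1 h2 h3
  fin_cases i <;> fin_cases j <;> simp
  · linear_combination (1 / 2 : ℂ) * h2
  · linear_combination -(1 / 2 : ℂ) * h3
  · exact h1

theorem pauli_kronecker_injective {n : ℕ} {w w' : Matrix (Fin n) (Fin n) ℂ}
    {s : Matrix (Fin 2) (Fin 2) ℂ}
    (hs : s ≠ 0) (h : s ⊗ₖ w = s ⊗ₖ w') : w = w' := by
  obtain ⟨i, j, hij⟩ : ∃ i j, s i j ≠ 0 := by
    by_contra! hc
    exact hs (by ext i j; simpa using hc i j)
  ext k l
  have := congrFun (congrFun h (i, k)) (j, l)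
  simp only [Matrix.kroneckerMap_apply] at this
  exact mul_left_cancel₀ hij this

theorem pauli_ne_zero (μ : Fin 3) : pauli μ ≠ 0 := by
  intro h
  have := pauli_mul_self μ
  rw [h, mul_zero] at this
  simpa using congrFun (congrFun this 0) 0

theorem pauli_mul_pauli_mul_pauli (ν μ : Fin 3) :
    pauli ν * pauli μ * pauli ν = (if ν = μ then (1 : ℂ) else -1) • pauli μ := by
  ext i j
  fin_cases ν <;> fin_cases μ <;> fin_cases i <;> fin_cases j <;> simp [pauli]

theorem pauli_one_eq : pauli 1 = Complex.I • (pauli 0 * pauli 2) := by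
  ext i j
  fin_cases i <;> fin_cases j <;> simp [pauli]

/-- The virtual space of a tensor in the phase splits into protected qubit and junk space. -/
theorem exists_isProtectedJunk {D : ℕ} {A : Fin 3 → Matrix (Fin D) (Fin D) ℂ}
    {Λ : Matrix (Fin D) (Fin D) ℂ} {U : Octahedral → Matrix (Fin D) (Fin D) ℂ}
    (hA : InSPTOPhase A Λ U) :
    ∃ (n : ℕ) (V : Matrix (Fin D) (Fin 2 × Fin n) ℂ) (a : Fin 3 → Matrix (Fin n) (Fin n) ℂ),
      IsProtectedJunk A U V a := by
  have hU := hA.projective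
  have : Nonempty (Fin D) := by
    by_contra hD
    rw [not_nonempty_iff] at hD
    simpa [Matrix.trace] using hA.canonical.trace_eq
  obtain ⟨X, Y, Z, C, T, hX, hY, hZ, hC, hT, h⟩ := exists_pauli_frame hU hA.nontrivial
  have hrot := frame_rotates hU hX hC hT h
  have herm : ∀ {g : Octahedral} {M : Matrix (Fin D) (Fin D) ℂ}, IsLift U g M → M * M = 1 →
      Mᴴ = M := by
    intro g M hM hMM
    rw [← mul_one Mᴴ, ← hMM, ← mul_assoc, mul_eq_one_comm.1 (hM.mem_unitary hU), one_mul]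
  have hXX := herm hX h.xx
  have hZZ := herm hZ h.zz
  have hzx : Z * X = -(X * Z) := by
    rw [h.zx, h.xz, Complex.inv_I, neg_smul, neg_neg]
  -- S embeds the +1 eigenspace of Z. As X anticommutes with Z, the isometry X S embeds the -1
  -- eigenspace. Side by side they form the unitary V, which turns X, Y, Z into σ ⊗ 1.
  obtain ⟨n, S, hS, hSP⟩ := exists_isometry_of_projection (P := (1 / 2 : ℂ) • (1 + Z))
    (by rw [Matrix.conjTranspose_smul, Matrix.conjTranspose_add, hZZ]; simp)
    (by
      rw [smul_mul_smul_comm, add_mul, mul_add, mul_add, h.zz]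
      simp only [one_mul, mul_one]
      module)
  have hZS : Z * S = S := by
    have : Z * (S * Sᴴ) = S * Sᴴ := by
      rw [hSP, mul_smul_comm, mul_add, h.zz, mul_one, add_comm]
    calc Z * S = Z * (S * Sᴴ) * S := by simp only [Matrix.mul_assoc, hS, Matrix.mul_one]
      _ = S := by rw [this, Matrix.mul_assoc, hS, Matrix.mul_one]
  have hSXS : Sᴴ * (X * S) = 0 := by
    have h1 : Sᴴ * Z = Sᴴ := by
      have := congrArg Matrix.conjTranspose hZS
      rwa [Matrix.conjTranspose_mul, hZZ] at this
    have h2 : Sᴴ * (X * S) = -(Sᴴ * (X * S)) := by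
      calc Sᴴ * (X * S) = Sᴴ * Z * (X * S) := by rw [h1]
        _ = Sᴴ * (Z * X) * S := by simp only [Matrix.mul_assoc]
        _ = -(Sᴴ * (X * (Z * S))) := by
            rw [hzx, Matrix.mul_neg, Matrix.neg_mul]; simp only [Matrix.mul_assoc]
        _ = -(Sᴴ * (X * S)) := by rw [hZS]
    ext i j
    exact self_eq_neg.1 (congrFun (congrFun h2 i) j)
  have hSXXS : (X * S)ᴴ * (X * S) = 1 := by
    rw [Matrix.conjTranspose_mul, hXX, Matrix.mul_assoc, ← Matrix.mul_assoc X X, h.xx,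
      Matrix.one_mul, hS]
  have hSXS' : (X * S)ᴴ * S = 0 := by
    have := congrArg Matrix.conjTranspose hSXS
    rwa [Matrix.conjTranspose_mul, Matrix.conjTranspose_conjTranspose,
      Matrix.conjTranspose_zero] at this
  obtain ⟨S', hS'⟩ : ∃ S', S' = X * S := ⟨_, rfl⟩
  rw [← hS'] at hSXS hSXXS hSXS'
  let V : Matrix (Fin D) (Fin 2 × Fin n) ℂ := Matrix.of fun i p => ![S, S'] p.1 i p.2
  have hVV : Vᴴ * V = 1 := by
    ext ⟨i, k⟩ ⟨j, l⟩
    have : (Vᴴ * V) (i, k) (j, l) = ((![S, S'] i)ᴴ * ![S, S'] j) k l := by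
      simp [V, Matrix.mul_apply]
    rw [this]
    fin_cases i <;> fin_cases j <;>
      simp [hS, hSXS, hSXXS, hSXS', Matrix.one_apply]
  have hVV' : V * Vᴴ = 1 := by
    have h1 : V * Vᴴ = S * Sᴴ + S' * S'ᴴ := by
      ext i j
      simp [V, Matrix.mul_apply, Fintype.sum_prod_type]
    have h2 : S' * S'ᴴ = X * (S * Sᴴ) * X := by
      rw [hS', Matrix.conjTranspose_mul, hXX]; simp only [Matrix.mul_assoc]
    have h3 : X * Z * X = -Z := by
      rw [mul_assoc, hzx, mul_neg, ← mul_assoc, h.xx, one_mul]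
    rw [h1, h2, hSP, mul_smul_comm, smul_mul_assoc, mul_add, add_mul, mul_one, h.xx, h3]
    module
  have hVs : ∀ (s : Matrix (Fin 2) (Fin 2) ℂ) i j k,
      (V * s ⊗ₖ (1 : Matrix (Fin n) (Fin n) ℂ)) i (j, k) = S i k * s 0 j + S' i k * s 1 j := by
    intro s i j k
    simp [V, Matrix.mul_apply, Fintype.sum_prod_type, Matrix.one_apply]
  have hMV : ∀ (M : Matrix (Fin D) (Fin D) ℂ) i j k, (M * V) i (j, k) = (M * ![S, S'] j) i k := by
    intro M i j k
    simp [V, Matrix.mul_apply]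
  have hV0 : X * V = V * pauli 0 ⊗ₖ (1 : Matrix (Fin n) (Fin n) ℂ) := by
    ext i ⟨j, k⟩
    have h2 : X * S' = S := by rw [hS', ← Matrix.mul_assoc, h.xx, Matrix.one_mul]
    rw [hMV, hVs]
    fin_cases j <;> simp [pauli, h2, ← hS']
  have hV2 : Z * V = V * pauli 2 ⊗ₖ (1 : Matrix (Fin n) (Fin n) ℂ) := by
    ext i ⟨j, k⟩
    have h2 : Z * S' = -S' := by
      rw [hS', ← Matrix.mul_assoc, hzx, Matrix.neg_mul, Matrix.mul_assoc, hZS]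
    rw [hMV, hVs]
    fin_cases j <;> simp [pauli, h2, hZS]
  have hV1 : Y * V = V * pauli 1 ⊗ₖ (1 : Matrix (Fin n) (Fin n) ℂ) := by
    have h1 : Y = Complex.I • (X * Z) := by
      rw [h.xz, smul_smul, mul_inv_cancel₀ Complex.I_ne_zero, one_smul]
    have h2 : pauli 1 ⊗ₖ (1 : Matrix (Fin n) (Fin n) ℂ) =
        Complex.I • (pauli 0 ⊗ₖ (1 : Matrix (Fin n) (Fin n) ℂ) *
            pauli 2 ⊗ₖ (1 : Matrix (Fin n) (Fin n) ℂ)) := by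
      rw [← Matrix.mul_kronecker_mul, one_mul, pauli_one_eq, Matrix.smul_kronecker]
    rw [h1, h2, Matrix.smul_mul, Matrix.mul_smul, Matrix.mul_assoc, hV2, ← Matrix.mul_assoc, hV0,
      Matrix.mul_assoc]
  have hV : ∀ μ, ![X, Y, Z] μ * V = V * pauli μ ⊗ₖ (1 : Matrix (Fin n) (Fin n) ℂ) := by
    intro μ
    fin_cases μ
    exacts [hV0, hV1, hV2]
  have hV' : ∀ μ, Vᴴ * ![X, Y, Z] μ = pauli μ ⊗ₖ (1 : Matrix (Fin n) (Fin n) ℂ) * Vᴴ := by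
    intro μ
    have h1 : Vᴴ * (![X, Y, Z] μ * V) * Vᴴ = Vᴴ * ![X, Y, Z] μ := by
      simp only [Matrix.mul_assoc, hVV', Matrix.mul_one]
    rw [← h1, hV, ← Matrix.mul_assoc, hVV, Matrix.one_mul]
  have hlift : ∀ ν, ∃ g : Octahedral, IsLift U g (![X, Y, Z] ν) ∧
      ∀ κ μ, spinOne g κ μ = if κ = μ then (if ν = μ then (1 : ℂ) else -1) else 0 := by
    have e : ∀ ν κ μ : Fin 3,
        (((![octX, octY, octZ] ν : Octahedral) : Matrix (Fin 3) (Fin 3) ℤ) κ μ) =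
        if κ = μ then (if ν = μ then 1 else -1) else 0 := by
      intro ν κ μ
      fin_cases ν <;> fin_cases κ <;> fin_cases μ <;> decide +kernel
    intro ν
    refine ⟨![octX, octY, octZ] ν, ?_, ?_⟩
    · fin_cases ν
      exacts [hX, hY, hZ]
    · intro κ μ
      rw [spinOne, Matrix.map_apply, e]
      split_ifs <;> simp
  have hherm : ∀ ν, (![X, Y, Z] ν)ᴴ = ![X, Y, Z] ν := by
    intro ν
    fin_cases ν
    exacts [hXX, herm hY h.yy, hZZ]
  have hsq : ∀ ν, ![X, Y, Z] ν * ![X, Y, Z] ν = 1 := by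
    intro ν
    fin_cases ν
    exacts [h.xx, h.yy, h.zz]
  have hQA : ∀ ν μ, ![X, Y, Z] ν * A μ = (if ν =
      μ then (1 : ℂ) else -1) • (A μ * ![X, Y, Z] ν) := by
    intro ν μ
    obtain ⟨g, hg, hgs⟩ := hlift ν
    have h1 := hA.invariant g μ
    rw [← hg.conj_eq, hherm] at h1
    simp only [hgs, ite_smul, zero_smul, Finset.sum_ite_eq', Finset.mem_univ, if_true] at h1
    calc ![X, Y, Z] ν * A μ = ![X, Y, Z] ν * A μ * (![X, Y, Z] ν * ![X, Y, Z] ν) := by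
          rw [hsq, mul_one]
      _ = (![X, Y, Z] ν * A μ * ![X, Y, Z] ν) * ![X, Y, Z] ν := by simp only [mul_assoc]
      _ = _ := by rw [← h1]; split_ifs <;> simp
  have hσσ : ∀ ν μ, pauli ν * pauli μ = (if ν = μ then (1 : ℂ) else -1) • (pauli μ * pauli ν) := by
    intro ν μ
    calc pauli ν * pauli μ = pauli ν * pauli μ * pauli ν * pauli ν := by
          rw [mul_assoc _ (pauli ν), pauli_mul_self, mul_one]
      _ = _ := by rw [pauli_mul_pauli_mul_pauli, smul_mul_assoc]
  -- Commuting a frame operator past A_μ produces the same sign as commuting σ_ν past σ_μ. The signs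
  -- cancel in the product, which therefore lies in the commutant of the qubit algebra.
  have hcomm : ∀ ν μ, pauli ν ⊗ₖ (1 : Matrix (Fin n) (Fin n) ℂ) *
      (pauli μ ⊗ₖ (1 : Matrix (Fin n) (Fin n) ℂ) * (Vᴴ * A μ * V)) =
          pauli μ ⊗ₖ (1 : Matrix (Fin n) (Fin n) ℂ) * (Vᴴ * A μ * V) *
              pauli ν ⊗ₖ (1 : Matrix (Fin n) (Fin n) ℂ) := by
    intro ν μ
    have hs : ((if ν = μ then (1 : ℂ) else -1) * if ν = μ then (1 : ℂ) else -1) = 1 := by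
      split_ifs <;> norm_num
    calc pauli ν ⊗ₖ (1 : Matrix (Fin n) (Fin n) ℂ) * (pauli μ ⊗ₖ (1 : Matrix (Fin n) (Fin n) ℂ) *
        (Vᴴ * A μ * V))
        = (pauli ν * pauli μ) ⊗ₖ (1 : Matrix (Fin n) (Fin n) ℂ) * (Vᴴ * A μ * V) := by
          rw [← Matrix.mul_assoc, ← Matrix.mul_kronecker_mul, one_mul]
      _ = (if ν = μ then (1 : ℂ) else -1) • (pauli μ ⊗ₖ (1 : Matrix (Fin n) (Fin n) ℂ) *
          ((pauli ν ⊗ₖ (1 : Matrix (Fin n) (Fin n) ℂ) * Vᴴ) * A μ * V)) := by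
          rw [hσσ, Matrix.smul_kronecker, Matrix.smul_mul, ← one_mul (1 : Matrix (Fin n) (Fin n) ℂ),
            Matrix.mul_kronecker_mul, one_mul]
          simp only [Matrix.mul_assoc]
      _ = (if ν = μ then (1 : ℂ) else -1) • (pauli μ ⊗ₖ (1 : Matrix (Fin n) (Fin n) ℂ) *
          (Vᴴ * (![X, Y, Z] ν * A μ) * V)) := by
          rw [← hV']; simp only [Matrix.mul_assoc]
      _ = pauli μ ⊗ₖ (1 : Matrix (Fin n) (Fin n) ℂ) * (Vᴴ * A μ * (![X, Y, Z] ν * V)) := by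
          rw [hQA, Matrix.mul_smul, Matrix.smul_mul, Matrix.mul_smul, smul_smul, hs, one_smul]
          simp only [Matrix.mul_assoc]
      _ = _ := by rw [hV]; simp only [Matrix.mul_assoc]
  choose a ha using fun μ => exists_one_kronecker_of_commute (hcomm 0 μ) (hcomm 2 μ)
  refine ⟨n, V, a, hVV, hVV', fun μ => ?_, fun g => ?_⟩
  · calc Vᴴ * A μ * V = (pauli μ * pauli μ) ⊗ₖ (1 : Matrix (Fin n) (Fin n) ℂ) * (Vᴴ * A μ * V) := by
          rw [pauli_mul_self, Matrix.one_kronecker_one, Matrix.one_mul]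
      _ = pauli μ ⊗ₖ (1 : Matrix (Fin n) (Fin n) ℂ) * (pauli μ ⊗ₖ (1 : Matrix (Fin n) (Fin n) ℂ) *
          (Vᴴ * A μ * V)) := by
          rw [← Matrix.mul_assoc (pauli μ ⊗ₖ _), ← Matrix.mul_kronecker_mul, one_mul]
      _ = component a μ := by
          rw [ha, ← Matrix.mul_kronecker_mul, one_mul, mul_one, component]
  · obtain ⟨s, hs, hsr⟩ := exists_spinHalf g
    have hs1 : s * sᴴ = 1 := Matrix.mem_unitaryGroup_iff.1 hs
    have hs2 : sᴴ * s = 1 := Matrix.mem_unitaryGroup_iff'.1 hs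
    have hUg : U g * (U g)ᴴ = 1 := Matrix.mem_unitaryGroup_iff.1 (hU.unitary g)
    have hUg' : (U g)ᴴ * U g = 1 := Matrix.mem_unitaryGroup_iff'.1 (hU.unitary g)
    -- Both s and U g rotate the Pauli frame by g, so s† ⊗ 1 undoes the action of U g on the qubit.
    have key : ∀ μ, pauli μ ⊗ₖ (1 : Matrix (Fin n) (Fin n) ℂ) *
        (sᴴ ⊗ₖ (1 : Matrix (Fin n) (Fin n) ℂ) * (Vᴴ * U g * V)) =
        sᴴ ⊗ₖ (1 : Matrix (Fin n) (Fin n) ℂ) * (Vᴴ * U g * V) *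
            pauli μ ⊗ₖ (1 : Matrix (Fin n) (Fin n) ℂ) := by
      intro μ
      have h1 : pauli μ * sᴴ = sᴴ * ∑ ν, spinOne g ν μ • pauli ν := by
        rw [← hsr, ← mul_assoc, ← mul_assoc, hs2, one_mul]
      have h2 : U g * ![X, Y, Z] μ = (∑ ν, spinOne g ν μ • ![X, Y, Z] ν) * U g := by
        rw [← hrot, mul_assoc, hUg', mul_one]
      calc pauli μ ⊗ₖ (1 : Matrix (Fin n) (Fin n) ℂ) * (sᴴ ⊗ₖ (1 : Matrix (Fin n) (Fin n) ℂ) * (Vᴴ *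
          U g * V))
          = (pauli μ * sᴴ) ⊗ₖ (1 : Matrix (Fin n) (Fin n) ℂ) * (Vᴴ * U g * V) := by
            rw [← Matrix.mul_assoc, ← Matrix.mul_kronecker_mul, one_mul]
        _ = sᴴ ⊗ₖ (1 : Matrix (Fin n) (Fin n) ℂ) * (((∑ ν,
            spinOne g ν μ • pauli ν) ⊗ₖ (1 : Matrix (Fin n) (Fin n) ℂ) * Vᴴ) * U g * V) := by
            rw [h1, ← one_mul (1 : Matrix (Fin n) (Fin n) ℂ), Matrix.mul_kronecker_mul, one_mul]
            simp only [Matrix.mul_assoc]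
        _ = sᴴ ⊗ₖ (1 : Matrix (Fin n) (Fin n) ℂ) * ((Vᴴ * ∑ ν, spinOne g ν μ • ![X, Y, Z] ν) * U g *
            V) := by
            congr 3
            rw [Matrix.mul_sum]
            simp only [Matrix.mul_smul, hV']
            ext ⟨i, k⟩ j
            simp [Fin.sum_univ_three, Matrix.add_kronecker, Matrix.smul_kronecker, Matrix.add_mul,
              Matrix.smul_mul]
        _ = sᴴ ⊗ₖ (1 : Matrix (Fin n) (Fin n) ℂ) * (Vᴴ * (U g * ![X, Y, Z] μ) * V) := by
            rw [h2]; simp only [Matrix.mul_assoc]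
        _ = _ := by
            rw [Matrix.mul_assoc Vᴴ, Matrix.mul_assoc (U g), hV]; simp only [Matrix.mul_assoc]
    obtain ⟨w, hw⟩ := exists_one_kronecker_of_commute (key 0) (key 2)
    have hw' : Vᴴ * U g * V = s ⊗ₖ w := by
      calc Vᴴ * U g * V = (s * sᴴ) ⊗ₖ (1 : Matrix (Fin n) (Fin n) ℂ) * (Vᴴ * U g * V) := by
            rw [hs1, Matrix.one_kronecker_one, Matrix.one_mul]
        _ = s ⊗ₖ (1 : Matrix (Fin n) (Fin n) ℂ) * (sᴴ ⊗ₖ (1 : Matrix (Fin n) (Fin n) ℂ) * (Vᴴ *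
            U g * V)) := by
            rw [← Matrix.mul_assoc (s ⊗ₖ _), ← Matrix.mul_kronecker_mul, one_mul]
        _ = s ⊗ₖ w := by rw [hw, ← Matrix.mul_kronecker_mul, one_mul, mul_one]
    refine ⟨s, hs, w, ?_, hw', hsr⟩
    have h1 : (s ⊗ₖ w) * (s ⊗ₖ w)ᴴ = 1 := by
      rw [← hw']
      simp only [Matrix.conjTranspose_mul, Matrix.conjTranspose_conjTranspose]
      calc Vᴴ * U g * V * (Vᴴ * ((U g)ᴴ * V)) = Vᴴ * (U g * (V * Vᴴ) * (U g)ᴴ) * V := by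
            simp only [Matrix.mul_assoc]
        _ = 1 := by rw [hVV', mul_one, hUg, Matrix.mul_one, hVV]
    rw [Matrix.conjTranspose_kronecker, ← Matrix.mul_kronecker_mul, hs1,
      ← Matrix.one_kronecker_one] at h1
    exact Matrix.mem_unitaryGroup_iff.2 (pauli_kronecker_injective one_ne_zero h1)

/-! ### Euler angles -/

theorem rotation_two_eq (θ : ℝ) : rotation 2 θ =
    !![Complex.exp (-(θ / 2 : ℂ) * Complex.I), 0; 0, Complex.exp ((θ / 2 : ℂ) * Complex.I)] := by
  have h1 : Complex.exp (-(θ / 2 : ℂ) * Complex.I) =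
      Complex.cos (θ / 2) - Complex.I * Complex.sin (θ / 2) := by
    rw [Complex.exp_mul_I, Complex.cos_neg, Complex.sin_neg]; ring
  have h2 : Complex.exp ((θ / 2 : ℂ) * Complex.I) =
      Complex.cos (θ / 2) + Complex.I * Complex.sin (θ / 2) := by
    rw [Complex.exp_mul_I]; ring
  rw [h1, h2]
  ext i j
  fin_cases i <;> fin_cases j <;> simp [rotation, pauli]

theorem rotation_zero_eq (θ : ℝ) : rotation 0 θ =
    !![(Real.cos (θ / 2) : ℂ), -Complex.I * (Real.sin (θ / 2) : ℂ);
      -Complex.I * (Real.sin (θ / 2) : ℂ), (Real.cos (θ / 2) : ℂ)] := by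
  ext i j
  fin_cases i <;> fin_cases j <;> simp [rotation, pauli]

/-- After division by a square root e of the determinant, W lies in SU(2) and is determined by its
first column (a, c) of unit length: the moduli give β, the arguments give half the sum and half the
difference of α and γ. -/
theorem exists_isEuler {W : Matrix (Fin 2) (Fin 2) ℂ} (hW : W ∈ Matrix.unitaryGroup (Fin 2) ℂ) :
    ∃ α β γ : ℝ, IsEuler W α β γ := by
  have h1 : Wᴴ * W = 1 := Matrix.mem_unitaryGroup_iff'.1 hW
  obtain ⟨e, he⟩ := IsAlgClosed.exists_pow_nat_eq W.det (n := 2) (by norm_num)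
  have hdet : ‖W.det‖ = 1 := by
    have := Matrix.det_of_mem_unitary hW
    exact CStarRing.norm_of_mem_unitary this
  have hen : ‖e‖ = 1 := by
    have : ‖e‖ ^ 2 = 1 := by rw [← norm_pow, he, hdet]
    exact (pow_eq_one_iff_of_nonneg (norm_nonneg _) two_ne_zero).1 this
  have he0 : e ≠ 0 := by rintro rfl; simp at hen
  have hee : (starRingEnd ℂ) e * e = 1 := by rw [Complex.conj_mul', hen]; simp
  have hadj : W.det • Wᴴ = W.adjugate := by
    calc W.det • Wᴴ = Wᴴ * (W * W.adjugate) := by rw [Matrix.mul_adjugate]; simp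
      _ = W.adjugate := by rw [← mul_assoc, h1, one_mul]
  rw [← he] at hadj
  have hd : e ^ 2 * (starRingEnd ℂ) (W 0 0) = W 1 1 := by
    have := congrFun (congrFun hadj 0) 0
    simpa [Matrix.adjugate_fin_two] using this
  have hb : e ^ 2 * (starRingEnd ℂ) (W 1 0) = -W 0 1 := by
    have := congrFun (congrFun hadj 0) 1
    simpa [Matrix.adjugate_fin_two] using this
  obtain ⟨a, ha⟩ : ∃ a, a = (starRingEnd ℂ) e * W 0 0 := ⟨_, rfl⟩
  obtain ⟨c, hc⟩ : ∃ c, c = (starRingEnd ℂ) e * W 1 0 := ⟨_, rfl⟩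
  have hac : ‖a‖ ^ 2 + ‖c‖ ^ 2 = 1 := by
    have h2 := congrFun (congrFun h1 0) 0
    simp only [Matrix.mul_apply, Fin.sum_univ_two, Matrix.conjTranspose_apply, Matrix.one_apply,
      if_true, Complex.star_def, Complex.conj_mul'] at h2
    have h3 : ‖W 0 0‖ ^ 2 + ‖W 1 0‖ ^ 2 = 1 := by exact_mod_cast h2
    rw [ha, hc]
    simpa [hen] using h3
  set β := 2 * Real.arccos ‖a‖ with hβ
  have hcos : Real.cos (β / 2) = ‖a‖ := by
    rw [hβ, mul_div_cancel_left₀ _ two_ne_zero, Real.cos_arccos]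
    · linarith [norm_nonneg a]
    · nlinarith [norm_nonneg a, sq_nonneg ‖c‖]
  have hsin : Real.sin (β / 2) = ‖c‖ := by
    rw [hβ, mul_div_cancel_left₀ _ two_ne_zero, Real.sin_arccos,
      show 1 - ‖a‖ ^ 2 = ‖c‖ ^ 2 by linarith, Real.sqrt_sq (norm_nonneg _)]
  -- S = (α + γ)/2 and E = (α - γ)/2; the shift by π/2 in E compensates the factor -i in the
  -- off-diagonal entries of the rotation about x.
  set S := -Complex.arg a with hS
  set E := -(Complex.arg c + Real.pi / 2) with hE
  have hexp : Complex.exp (Complex.I * (Real.pi / 2)) = Complex.I := by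
    rw [mul_comm, Complex.exp_mul_I]
    simp
  have haS : a = ‖a‖ * Complex.exp (-(S : ℂ) * Complex.I) := by
    conv_lhs => rw [← Complex.norm_mul_exp_arg_mul_I a]
    simp [hS]
  have hcE : c = -Complex.I * ‖c‖ * Complex.exp (-(E : ℂ) * Complex.I) := by
    conv_lhs => rw [← Complex.norm_mul_exp_arg_mul_I c]
    have : -(E : ℂ) * Complex.I = Complex.arg c * Complex.I + Complex.I * (Real.pi / 2) := by
      rw [hE]; push_cast; ring
    rw [this, Complex.exp_add, hexp]
    linear_combination (‖c‖ * Complex.exp (Complex.arg c * Complex.I)) * Complex.I_sq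
  have haS' : (starRingEnd ℂ) a = ‖a‖ * Complex.exp (S * Complex.I) := by
    conv_lhs => rw [haS]
    rw [map_mul, ← Complex.exp_conj]
    simp
  have hcE' : (starRingEnd ℂ) c = Complex.I * ‖c‖ * Complex.exp (E * Complex.I) := by
    conv_lhs => rw [hcE]
    rw [map_mul, ← Complex.exp_conj]
    simp
  refine ⟨S + E, β, S - E, e, hen, ?_⟩
  rw [rotation_two_eq, rotation_two_eq, rotation_zero_eq, hcos, hsin]
  have hexp2 : ∀ x y z : ℂ, x + y = z → Complex.exp x * Complex.exp y = Complex.exp z := by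
    rintro x y z rfl
    rw [Complex.exp_add]
  have e1 : Complex.exp (-((S - E : ℝ) / 2 : ℂ) * Complex.I) *
      Complex.exp (-((S + E : ℝ) / 2 : ℂ) * Complex.I) = Complex.exp (-(S : ℂ) * Complex.I) :=
    hexp2 _ _ _ (by push_cast; ring)
  have e2 : Complex.exp (-((S - E : ℝ) / 2 : ℂ) * Complex.I) *
      Complex.exp (((S + E : ℝ) / 2 : ℂ) * Complex.I) = Complex.exp ((E : ℂ) * Complex.I) :=
    hexp2 _ _ _ (by push_cast; ring)
  have e3 : Complex.exp (((S - E : ℝ) / 2 : ℂ) * Complex.I) *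
      Complex.exp (-((S + E : ℝ) / 2 : ℂ) * Complex.I) = Complex.exp (-(E : ℂ) * Complex.I) :=
    hexp2 _ _ _ (by push_cast; ring)
  have e4 : Complex.exp (((S - E : ℝ) / 2 : ℂ) * Complex.I) *
      Complex.exp (((S + E : ℝ) / 2 : ℂ) * Complex.I) = Complex.exp ((S : ℂ) * Complex.I) :=
    hexp2 _ _ _ (by push_cast; ring)
  have ha' : (starRingEnd ℂ) a = e * (starRingEnd ℂ) (W 0 0) := by rw [ha]; simp
  have hc' : (starRingEnd ℂ) c = e * (starRingEnd ℂ) (W 1 0) := by rw [hc]; simp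
  generalize Complex.exp (-((S - E : ℝ) / 2 : ℂ) * Complex.I) = x1 at *
  generalize Complex.exp (-((S + E : ℝ) / 2 : ℂ) * Complex.I) = x2 at *
  generalize Complex.exp (((S - E : ℝ) / 2 : ℂ) * Complex.I) = x3 at *
  generalize Complex.exp (((S + E : ℝ) / 2 : ℂ) * Complex.I) = x4 at *
  ext i j
  fin_cases i <;> fin_cases j <;> simp
  · linear_combination -W 0 0 * hee - e * ha + e * haS - e * ‖a‖ * e1
  · linear_combination hb + e * hc' - e * hcE' + e * Complex.I * ‖c‖ * e2
  · linear_combination -W 1 0 * hee - e * hc + e * hcE + e * Complex.I * ‖c‖ * e3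
  · linear_combination -hd - e * ha' + e * haS' - e * ‖a‖ * e4

/-! ### Growth of powers and the leading spectral projection -/

section Growth

open scoped Matrix.Norms.Operator

variable {ι : Type*} [Fintype ι] [DecidableEq ι]

theorem norm_entry_le (M : Matrix ι ι ℂ) (i j : ι) : ‖M i j‖ ≤ ‖M‖ := by
  rw [Matrix.linfty_opNorm_def]
  have h1 : ‖M i j‖₊ ≤ ∑ j, ‖M i j‖₊ :=
    Finset.single_le_sum (f := fun j => ‖M i j‖₊) (fun _ _ => bot_le) (Finset.mem_univ j)
  have h2 := h1.trans (Finset.le_sup (f := fun i => ∑ j, ‖M i j‖₊) (Finset.mem_univ i))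
  exact_mod_cast h2

theorem norm_trace_le (M : Matrix ι ι ℂ) : ‖M.trace‖ ≤ Fintype.card ι * ‖M‖ := by
  refine (norm_sum_le _ _).trans ?_
  refine (Finset.sum_le_sum fun i _ => norm_entry_le M i i).trans ?_
  simp

theorem norm_le_of_entry_le {M : Matrix ι ι ℂ} {c : ℝ} (hc : 0 ≤ c) (h : ∀ i j, ‖M i j‖ ≤ c) :
    ‖M‖ ≤ Fintype.card ι * c := by
  lift c to NNReal using hc
  rw [Matrix.linfty_opNorm_def]
  have : (Finset.univ.sup fun i => ∑ j, ‖M i j‖₊) ≤ Fintype.card ι * c := by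
    refine Finset.sup_le fun i _ => ?_
    refine (Finset.sum_le_sum fun j _ => (show ‖M i j‖₊ ≤ c from h i j)).trans ?_
    simp
  exact_mod_cast this

/-- If the eigenvalues of `M` have modulus less than `ρ`, then `M ^ k = O(ρ ^ k)`. -/
theorem exists_norm_pow_le (M : Matrix ι ι ℂ) {ρ : ℝ} (hρ : 0 < ρ)
    (h : ∀ μ ∈ spectrum ℂ M, ‖μ‖ < ρ) : ∃ C : ℝ, 0 < C ∧ ∀ k : ℕ, ‖M ^ k‖ ≤ C * ρ ^ k := by
  rcases isEmpty_or_nonempty ι with hι | hι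
  · refine ⟨1, one_pos, fun k => ?_⟩
    rw [Subsingleton.elim (M ^ k) 0, norm_zero]
    positivity
  have : CompleteSpace (Matrix ι ι ℂ) := FiniteDimensional.complete ℂ _
  lift ρ to NNReal using hρ.le
  have hr : spectralRadius ℂ M < ρ :=
    spectrum.spectralRadius_lt_of_forall_lt M fun k hk => h k hk
  -- By Gelfand's formula the bound holds with constant 1 for large k; the finitely many other
  -- powers are absorbed into C.
  have ht := (spectrum.pow_nnnorm_pow_one_div_tendsto_nhds_spectralRadius M).eventually_lt_const hr
  obtain ⟨N, hN⟩ := eventually_atTop.1 ht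
  have hbound : ∀ k ≥ N + 1, ‖M ^ k‖ ≤ (ρ : ℝ) ^ k := by
    intro k hk
    have h1 := hN k (by omega)
    have hk0 : (0 : ℝ) < k := by exact_mod_cast (by omega : 0 < k)
    have h2 := ENNReal.rpow_le_rpow h1.le hk0.le
    rw [← ENNReal.rpow_mul, one_div, inv_mul_cancel₀ hk0.ne', ENNReal.rpow_one,
      ENNReal.rpow_natCast] at h2
    exact_mod_cast h2
  refine ⟨1 + ∑ k ∈ Finset.range (N + 1), ‖M ^ k‖ / (ρ : ℝ) ^ k, ?_, fun k => ?_⟩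
  · have : 0 ≤ ∑ k ∈ Finset.range (N + 1), ‖M ^ k‖ / (ρ : ℝ) ^ k :=
      Finset.sum_nonneg fun k _ => by positivity
    linarith
  · have hpos : (0 : ℝ) < (ρ : ℝ) ^ k := pow_pos hρ k
    rw [← div_le_iff₀ hpos]
    have hs : 0 ≤ ∑ k ∈ Finset.range (N + 1), ‖M ^ k‖ / (ρ : ℝ) ^ k :=
      Finset.sum_nonneg fun k _ => by positivity
    by_cases hk : k < N + 1
    · have := Finset.single_le_sum (f := fun k => ‖M ^ k‖ / (ρ : ℝ) ^ k)
        (fun k _ => by positivity) (Finset.mem_range.2 hk)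
      linarith
    · have := (div_le_one hpos).2 (hbound k (by omega))
      linarith

end Growth

/-! ### Spectral projections and the unitaries commuting with a matrix -/

theorem commute_aeval {R : Type*} [Ring R] [Algebra ℂ R] {w b : R} (h : w * b = b * w)
    (p : Polynomial ℂ) : w * Polynomial.aeval b p = Polynomial.aeval b p * w := by
  have h1 : b ∈ Subalgebra.centralizer ℂ ({w} : Set R) := by
    rw [Subalgebra.mem_centralizer_iff]
    simpa using h
  have h2 := Algebra.adjoin_le (Set.singleton_subset_iff.2 h1)
    (Polynomial.aeval_mem_adjoin_singleton ℂ b (p := p))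
  rw [Subalgebra.mem_centralizer_iff] at h2
  exact h2 w rfl

theorem exists_eigenvector {n : ℕ} {b : Matrix (Fin n) (Fin n) ℂ} {μ : ℂ} (h : μ ∈ spectrum ℂ b) :
    ∃ v ≠ 0, b *ᵥ v = μ • v := by
  rw [← Matrix.spectrum_toLin', ← Module.End.hasEigenvalue_iff_mem_spectrum] at h
  obtain ⟨v, hv⟩ := h.exists_hasEigenvector
  exact ⟨v, hv.2, by simpa using hv.apply_eq_smul⟩

theorem mem_spectrum_of_eigenvector {n : ℕ} {b : Matrix (Fin n) (Fin n) ℂ} {μ : ℂ}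
    {v : Fin n → ℂ} (hv : v ≠ 0) (h : b *ᵥ v = μ • v) : μ ∈ spectrum ℂ b := by
  rw [← Matrix.spectrum_toLin', ← Module.End.hasEigenvalue_iff_mem_spectrum]
  exact Module.End.hasEigenvalue_of_hasEigenvector (x := v)
    ⟨Module.End.mem_eigenspace_iff.2 (by simpa using h), hv⟩

theorem IsLeading.exists_eigenvector {n : ℕ} {b : Matrix (Fin n) (Fin n) ℂ} {l : ℂ}
    (h : IsLeading b l) : ∃ v ≠ 0, b *ᵥ v = l • v ∧
      ∀ x, b *ᵥ x = l • x → ∃ c : ℂ, x = c • v := by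
  obtain ⟨⟨v, hv⟩, hv0, hv1⟩ := finrank_eq_one_iff'.1 h.1
  refine ⟨v, fun h0 => hv0 (Subtype.ext h0), ?_, fun x hx => ?_⟩
  · simpa using Module.End.mem_eigenspace_iff.1 hv
  · obtain ⟨c, hc⟩ := hv1 ⟨x, Module.End.mem_eigenspace_iff.2 (by simpa using hx)⟩
    exact ⟨c, by simpa using (congrArg Subtype.val hc).symm⟩

/-- `P` is the spectral projection of `b` onto the generalized eigenspace of `l`. -/
structure IsSpectralProjection {n : ℕ} (b : Matrix (Fin n) (Fin n) ℂ) (l : ℂ)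
    (P : Matrix (Fin n) (Fin n) ℂ) : Prop where
  idem : P * P = P
  poly : ∃ p : Polynomial ℂ, P = Polynomial.aeval b p
  ne_zero : P ≠ 0
  nilpotent : ∃ k, (b - l • 1) ^ k * P = 0
  compl : ∀ μ ∈ spectrum ℂ (b * (1 - P)), μ ≠ 0 → μ ∈ spectrum ℂ b ∧ μ ≠ l

theorem IsSpectralProjection.commute {n : ℕ} {b P : Matrix (Fin n) (Fin n) ℂ} {l : ℂ}
    (hP : IsSpectralProjection b l P) {w : Matrix (Fin n) (Fin n) ℂ} (h : w * b = b * w) :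
    w * P = P * w := by
  obtain ⟨p, rfl⟩ := hP.poly
  exact commute_aeval h p

/-- Write the characteristic polynomial as (X - l)^k q and take Bézout coefficients u (X - l)^k + w
q = 1; then P = (w q)(b). Each required product is a multiple of the characteristic polynomial, so
Cayley–Hamilton applies. An eigenvector of b (1 - P) with nonzero eigenvalue is killed by P, hence
is an eigenvector of b, and not for l because 1 - P kills those. -/
theorem exists_isSpectralProjection {n : ℕ} {b : Matrix (Fin n) (Fin n) ℂ} {l : ℂ}
    (hl : l ∈ spectrum ℂ b) : ∃ P, IsSpectralProjection b l P := by
  obtain ⟨v, hv0, hv⟩ := exists_eigenvector hl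
  set k := b.charpoly.rootMultiplicity l with hk
  have hk0 : 0 < k := by
    rw [hk, Polynomial.rootMultiplicity_pos b.charpoly_monic.ne_zero]
    exact Matrix.mem_spectrum_iff_isRoot_charpoly.1 hl
  obtain ⟨q, hq, hqd⟩ := Polynomial.exists_eq_pow_rootMultiplicity_mul_and_not_dvd b.charpoly
    b.charpoly_monic.ne_zero l
  rw [← hk] at hq
  have hcop : IsCoprime ((Polynomial.X - Polynomial.C l) ^ k) q :=
    ((Polynomial.irreducible_X_sub_C l).coprime_iff_not_dvd.2 hqd).pow_left
  obtain ⟨u, w, huw⟩ := hcop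
  have hX : Polynomial.aeval b (Polynomial.X - Polynomial.C l) = b - l • 1 := by
    simp [Algebra.algebraMap_eq_smul_one]
  have hch : Polynomial.aeval b b.charpoly = 0 := Matrix.aeval_self_charpoly b
  have hQ : 1 - Polynomial.aeval b (w * q) =
      Polynomial.aeval b (u * (Polynomial.X - Polynomial.C l) ^ k) := by
    rw [sub_eq_iff_eq_add, ← map_add, huw, map_one]
  have hQv : ∀ x, b *ᵥ x = l • x → (1 - Polynomial.aeval b (w * q)) *ᵥ x = 0 := by
    intro x hx
    obtain ⟨j, hj⟩ : ∃ j, k = j + 1 := ⟨k - 1, by omega⟩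
    rw [hQ, hj, pow_succ, ← mul_assoc, map_mul, hX, ← Matrix.mulVec_mulVec, Matrix.sub_mulVec, hx,
      Matrix.smul_mulVec, Matrix.one_mulVec, sub_self, Matrix.mulVec_zero]
  have hidem : (1 - Polynomial.aeval b (w * q)) * Polynomial.aeval b (w * q) = 0 := by
    rw [hQ, ← map_mul, show u * (Polynomial.X - Polynomial.C l) ^ k * (w * q) =
      u * w * b.charpoly by rw [hq]; ring, map_mul, hch, mul_zero]
  refine ⟨Polynomial.aeval b (w * q), ?_, ⟨_, rfl⟩, ?_, ⟨k, ?_⟩, ?_⟩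
  · rw [sub_mul, one_mul, sub_eq_zero] at hidem
    exact hidem.symm
  · intro h0
    have := hQv v hv
    rw [h0, sub_zero, Matrix.one_mulVec] at this
    exact hv0 this
  · rw [← hX, ← map_pow, ← map_mul, show (Polynomial.X - Polynomial.C l) ^ k * (w * q) =
      w * b.charpoly by rw [hq]; ring, map_mul, hch, mul_zero]
  · intro μ hμ hμ0
    obtain ⟨x, hx0, hx⟩ := MPS.exists_eigenvector hμ
    have hcomm : Polynomial.aeval b (w * q) * b = b * Polynomial.aeval b (w * q) :=
      (commute_aeval rfl _).symm
    have hPx : Polynomial.aeval b (w * q) *ᵥ x = 0 := by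
      have h1 : Polynomial.aeval b (w * q) * (b * (1 - Polynomial.aeval b (w * q))) = 0 := by
        rw [← mul_assoc, hcomm, mul_assoc, mul_sub, mul_one]
        rw [sub_mul, one_mul] at hidem
        rw [hidem, mul_zero]
      have h2 := congrArg (Polynomial.aeval b (w * q) *ᵥ ·) hx
      simp only [Matrix.mulVec_mulVec, Matrix.mulVec_smul] at h2
      rw [h1, Matrix.zero_mulVec] at h2
      exact (smul_eq_zero.1 h2.symm).resolve_left hμ0
    have hbx : b *ᵥ x = μ • x := by
      rw [← hx, ← Matrix.mulVec_mulVec, Matrix.sub_mulVec, hPx, sub_zero, Matrix.one_mulVec]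
    refine ⟨mem_spectrum_of_eigenvector hx0 hbx, ?_⟩
    rintro rfl
    have := hQv x hbx
    rw [Matrix.sub_mulVec, hPx, sub_zero, Matrix.one_mulVec] at this
    exact hx0 this

/-- A unitary which commutes with `b` is a scalar on the generalized eigenspace of a leading
eigenvalue. -/
theorem exists_unitary_mul_projection {n : ℕ} {b P w : Matrix (Fin n) (Fin n) ℂ} {l : ℂ}
    (hl : IsLeading b l) (hP : IsSpectralProjection b l P) (hw : wᴴ * w = 1) (hwb : w * b = b * w) :
    ∃ ω : ℂ, ω * star ω = 1 ∧ w * P = ω • P := by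
  obtain ⟨v, hv0, hv, hv1⟩ := hl.exists_eigenvector
  obtain ⟨ω, hω⟩ : ∃ ω : ℂ, w *ᵥ v = ω • v := by
    apply hv1
    rw [Matrix.mulVec_mulVec, ← hwb, ← Matrix.mulVec_mulVec, hv, Matrix.mulVec_smul]
  have hvv : star v ⬝ᵥ v ≠ 0 := by
    rwa [Ne, dotProduct_star_self_eq_zero]
  have hωω : star ω * ω = 1 := by
    rw [mul_comm]
    have h1 : star (w *ᵥ v) ⬝ᵥ (w *ᵥ v) = star v ⬝ᵥ v := by
      rw [Matrix.star_mulVec, ← Matrix.dotProduct_mulVec, Matrix.mulVec_mulVec, hw,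
        Matrix.one_mulVec]
    rw [hω] at h1
    simp only [star_smul, smul_dotProduct, dotProduct_smul, smul_eq_mul] at h1
    rw [← mul_assoc] at h1
    exact mul_right_cancel₀ hvv (h1.trans (one_mul _).symm)
  refine ⟨ω, by rw [mul_comm, hωω], ?_⟩
  -- Since v is also an eigenvector of w†, the range of w - ω is orthogonal to v.
  have hwv : wᴴ *ᵥ v = star ω • v := by
    have h1 : v = (star ω * ω) • v := by rw [hωω, one_smul]
    conv_lhs => rw [h1]
    rw [mul_smul, ← hω, Matrix.mulVec_smul, Matrix.mulVec_mulVec, hw, Matrix.one_mulVec]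
  have hbP : b * P = P * b := hP.commute rfl
  have hwP := hP.commute hwb
  obtain ⟨k, hk⟩ := hP.nilpotent
  by_contra hne
  have hu : (w - ω • 1) * P ≠ 0 := by
    intro h0
    rw [sub_mul, smul_mul_assoc, one_mul, sub_eq_zero] at h0
    exact hne h0
  obtain ⟨y, hy⟩ : ∃ y, ((w - ω • 1) * P) *ᵥ y ≠ 0 := by
    by_contra! hc
    exact hu (Matrix.ext_of_mulVec_single fun i => by rw [hc, Matrix.zero_mulVec])
  have hcomm : Commute (b - l • 1) (w - ω • 1) :=
    ((show Commute b w from hwb.symm).sub_right ((Commute.one_right b).smul_right ω)).sub_left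
      ((Commute.one_left _).smul_left l)
  -- Apply b - l to a nonzero vector in the range of (w - ω) P until the last nonzero vector z. It
  -- is an eigenvector for l, hence a multiple of v; but it still lies in the range of w - ω, which
  -- is orthogonal to v.
  have hex : ∃ j, ((b - l • 1) ^ j * ((w - ω • 1) * P)) *ᵥ y = 0 := by
    refine ⟨k, ?_⟩
    have h2 : (b - l • 1) ^ k * (w - ω • 1) = (w - ω • 1) * (b - l • 1) ^ k :=
      hcomm.pow_left k
    rw [← mul_assoc, h2, mul_assoc, hk, mul_zero, Matrix.zero_mulVec]
  classical
  have hfind := Nat.find_spec hex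
  have hmin := fun j => Nat.find_min (m := j) hex
  cases hj : Nat.find hex with
  | zero =>
    rw [hj, pow_zero, one_mul] at hfind
    exact hy hfind
  | succ j =>
    rw [hj] at hfind
    have hz0 := hmin j (by omega)
    set z := ((b - l • 1) ^ j * ((w - ω • 1) * P)) *ᵥ y with hz
    have hbz : b *ᵥ z = l • z := by
      rw [pow_succ', mul_assoc, ← Matrix.mulVec_mulVec, ← hz, Matrix.sub_mulVec, sub_eq_zero,
        Matrix.smul_mulVec, Matrix.one_mulVec] at hfind
      exact hfind
    obtain ⟨c, hc⟩ := hv1 z hbz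
    have hcz : z = (w - ω • 1) *ᵥ (((b - l • 1) ^ j * P) *ᵥ y) := by
      have h2 : (b - l • 1) ^ j * (w - ω • 1) = (w - ω • 1) * (b - l • 1) ^ j :=
        hcomm.pow_left j
      rw [hz, ← mul_assoc, h2, mul_assoc, ← Matrix.mulVec_mulVec]
    have h0 : star v ⬝ᵥ z = 0 := by
      have h3 : star v ᵥ* (w - ω • 1) = 0 := by
        have : star v ᵥ* w = star (wᴴ *ᵥ v) := by
          rw [Matrix.star_mulVec, Matrix.conjTranspose_conjTranspose]
        rw [Matrix.vecMul_sub, this, hwv, Matrix.vecMul_smul, Matrix.vecMul_one, star_smul,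
          star_star, sub_self]
      rw [hcz, Matrix.dotProduct_mulVec, h3, zero_dotProduct]
    rw [hc, dotProduct_smul, smul_eq_mul] at h0
    rcases mul_eq_zero.1 h0 with h0 | h0
    · exact hz0 (by rw [hc, h0, zero_smul])
    · exact hvv h0

/-- The intertwiner w of x and y acts as one and the same scalar ω on both sides of the compression,
and ω cancels. -/
theorem projection_conj_eq {n : ℕ} {b P w x y : Matrix (Fin n) (Fin n) ℂ} {l : ℂ}
    (hl : IsLeading b l) (hP : IsSpectralProjection b l P) (hw : w * wᴴ = 1) (hwb : w * b = b * w)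
    (hxy : w * x = y * w) : P * x * P = P * y * P := by
  have hw' : wᴴ * w = 1 := mul_eq_one_comm.1 hw
  obtain ⟨ω, hω, h⟩ := exists_unitary_mul_projection hl hP hw' hwb
  have hwP := hP.commute hwb
  have h1 : ω • (P * x * P) = ω • (P * y * P) := by
    calc ω • (P * x * P) = w * P * x * P := by rw [h]; simp only [smul_mul_assoc]
      _ = P * (w * x) * P := by rw [hwP]; simp only [mul_assoc]
      _ = P * y * (w * P) := by rw [hxy]; simp only [mul_assoc]
      _ = ω • (P * y * P) := by rw [h]; simp only [mul_smul_comm]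
  have hω0 : ω ≠ 0 := by rintro rfl; simp at hω
  exact smul_right_injective _ hω0 h1

/-! ### Convergence of the renormalized junk operators -/

/-- The sequences `x` and `y` of matrices converge, after a common renormalization by the scalars
`s`, to the same nonzero limit `T`, at the exponential rate `r`; the renormalization is at most
exponential with base `l⁻²`. -/
structure JunkLimit {n : ℕ} (x y : ℕ → Matrix (Fin n) (Fin n) ℂ) (l : ℂ) (r : ℝ)
    (T : Matrix (Fin n) (Fin n) ℂ) (s : ℕ → ℂ) : Prop where
  ne_zero : T ≠ 0
  tendsto_left : Tendsto (fun m => s m • x m) atTop (𝓝 T)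
  tendsto_right : Tendsto (fun m => s m • y m) atTop (𝓝 T)
  decay : ∀ q : ℝ, r < q → ∃ C : ℝ, ∀ (m : ℕ) (i j : Fin n),
    ‖s m * (x m i j - y m i j)‖ ≤ C * q ^ m
  eventually_eq : r = 0 → ∃ m₀, ∀ m ≥ m₀, x m = y m
  scale_le : ∀ m, ‖s m‖ ≤ (‖l‖ ^ (2 * m))⁻¹

/-- Consecutive binomial coefficients have the ratio (j + 1)/(m - j); the general case is a product
of such ratios. -/
theorem tendsto_choose_div_choose {j d : ℕ} (h : j < d) :
    Tendsto (fun m : ℕ => (m.choose j : ℂ) / (m.choose d : ℂ)) atTop (𝓝 0) := by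
  have step : ∀ j : ℕ, Tendsto (fun m : ℕ => (m.choose j : ℂ) / (m.choose (j + 1) : ℂ)) atTop
      (𝓝 0) := by
    intro j
    have h1 : Tendsto (fun m : ℕ => ((j + 1 : ℕ) : ℂ) * ((m : ℂ))⁻¹) atTop (𝓝 (((j + 1 : ℕ) : ℂ) *
        0)) :=
      tendsto_const_nhds.mul (tendsto_inv_atTop_nhds_zero_nat (𝕜 := ℂ))
    rw [mul_zero] at h1
    refine ((tendsto_add_atTop_iff_nat j).1 ((h1.congr' ?_)))
    filter_upwards [eventually_gt_atTop 0] with m hm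
    have h2 := Nat.choose_succ_right_eq (m + j) j
    rw [Nat.add_sub_cancel] at h2
    have h3 : ((m + j).choose (j + 1) : ℂ) * ((j + 1 : ℕ) : ℂ) = (m + j).choose j * m := by
      exact_mod_cast h2
    have h4 : ((m + j).choose (j + 1) : ℂ) ≠ 0 := by
      exact_mod_cast (Nat.choose_pos (by omega)).ne'
    have h5 : (m : ℂ) ≠ 0 := by exact_mod_cast hm.ne'
    field_simp
    linear_combination h3
  induction d with
  | zero => omega
  | succ d ih =>
    rcases Nat.lt_succ_iff_lt_or_eq.1 h with hj | rfl
    · have h1 := (ih hj).mul (step d)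
      rw [zero_mul] at h1
      refine h1.congr' ?_
      filter_upwards [eventually_ge_atTop (d + 1)] with m hm
      have h4 : (m.choose d : ℂ) ≠ 0 := by
        exact_mod_cast (Nat.choose_pos (by omega)).ne'
      rw [div_mul_div_comm, mul_comm, mul_div_mul_left _ _ h4]
    · exact step j

/-- Powers of a unipotent operator, applied to a nonzero vector, converge projectively. -/
theorem exists_tendsto_unipotent_pow {E : Type*} [AddCommGroup E] [Module ℂ E] [TopologicalSpace E]
    [ContinuousAdd E] [ContinuousSMul ℂ E] {N : Module.End ℂ E} (hN : IsNilpotent N) {z : E}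
    (hz : z ≠ 0) : ∃ (d : ℕ) (t : E), t ≠ 0 ∧
      Tendsto (fun m : ℕ => (m.choose d : ℂ)⁻¹ • ((1 + N) ^ m) z) atTop (𝓝 t) := by
  classical
  have hex : ∃ e, (N ^ e) z = 0 := by
    obtain ⟨e, he⟩ := hN
    exact ⟨e, by rw [he, LinearMap.zero_apply]⟩
  have hfind := Nat.find_spec hex
  have hmin := fun j => Nat.find_min (m := j) hex
  cases hd : Nat.find hex with
  | zero => rw [hd, pow_zero] at hfind; exact absurd hfind hz
  | succ d =>
    rw [hd] at hfind hmin
    have hvan : ∀ j, d < j → (N ^ j) z = 0 := by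
      intro j hj
      obtain ⟨i, rfl⟩ := Nat.exists_eq_add_of_le' (Nat.succ_le_of_lt hj)
      rw [pow_add, Module.End.mul_apply, hfind, map_zero]
    -- The binomial series ends at d, the last power of N that does not kill z. Division by C(m, d)
    -- therefore leaves only the top term in the limit.
    have hpow : ∀ m : ℕ, ((1 + N) ^ m) z = ∑ j ∈ Finset.range (d + 1),
        (m.choose j : ℂ) • (N ^ j) z := by
      intro m
      rw [add_comm, (Commute.one_right N).add_pow, LinearMap.sum_apply]
      have h1 : ∀ j, (N ^ j * 1 ^ (m - j) * (m.choose j : Module.End ℂ E)) z =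
          (m.choose j : ℂ) • (N ^ j) z := by
        intro j
        rw [one_pow, mul_one, ← nsmul_eq_mul', LinearMap.smul_apply, Nat.cast_smul_eq_nsmul]
      simp only [h1]
      have h2 : ∑ j ∈ Finset.range (m + 1), (m.choose j : ℂ) • (N ^ j) z =
          ∑ j ∈ Finset.range (m + d + 1), (m.choose j : ℂ) • (N ^ j) z := by
        refine Finset.sum_subset (Finset.range_subset_range.2 (by omega)) fun j _ hj => ?_
        rw [Nat.choose_eq_zero_of_lt (by simpa using hj), Nat.cast_zero, zero_smul]
      rw [h2]
      refine (Finset.sum_subset (Finset.range_subset_range.2 (by omega)) fun j _ hj => ?_).symm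
      rw [hvan j (by simpa using hj), smul_zero]
    refine ⟨d, (N ^ d) z, hmin d (by omega), ?_⟩
    have hlim : Tendsto (fun m : ℕ => ∑ j ∈ Finset.range (d + 1),
        ((m.choose j : ℂ) / (m.choose d : ℂ)) • (N ^ j) z) atTop
        (𝓝 (∑ j ∈ Finset.range (d + 1), (if j = d then (1 : ℂ) else 0) • (N ^ j) z)) := by
      refine tendsto_finsetSum _ fun j hj => Tendsto.smul_const ?_ _
      rcases (Nat.lt_succ_iff_lt_or_eq.1 (Finset.mem_range.1 hj)) with h | rfl
      · rw [if_neg h.ne]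
        exact tendsto_choose_div_choose h
      · rw [if_pos rfl]
        refine tendsto_const_nhds.congr' ?_
        filter_upwards [eventually_ge_atTop j] with m hm
        rw [div_self]
        exact_mod_cast (Nat.choose_pos hm).ne'
    simp only [ite_smul, one_smul, zero_smul, Finset.sum_ite_eq', Finset.mem_range,
      Nat.lt_succ_self, if_true] at hlim
    refine hlim.congr fun m => ?_
    rw [hpow, Finset.smul_sum]
    refine Finset.sum_congr rfl fun j _ => ?_
    rw [smul_smul, div_eq_inv_mul]

theorem isNilpotent_of_spectrum {n : ℕ} {b : Matrix (Fin n) (Fin n) ℂ}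
    (h : ∀ μ ∈ spectrum ℂ b, μ = 0) : b ^ n = 0 := by
  have hs := IsAlgClosed.splits b.charpoly
  have hr : b.charpoly.roots = Multiset.replicate n 0 := by
    refine Multiset.eq_replicate.2 ⟨?_, fun μ hμ => h μ ?_⟩
    · rw [← hs.natDegree_eq_card_roots, Matrix.charpoly_natDegree_eq_dim, Fintype.card_fin]
    · exact Matrix.mem_spectrum_iff_isRoot_charpoly.2 (Polynomial.isRoot_of_mem_roots hμ)
  have hc : b.charpoly = Polynomial.X ^ n := by
    rw [hs.eq_prod_roots_of_monic b.charpoly_monic, hr]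
    simp
  have := Matrix.aeval_self_charpoly b
  rwa [hc, map_pow, Polynomial.aeval_X] at this

section

open scoped Matrix.Norms.Operator

variable {n : ℕ} {b P : Matrix (Fin n) (Fin n) ℂ} {l : ℂ} {r : ℝ}

theorem pow_mul_compl (hP : IsSpectralProjection b l P) (m : ℕ) :
    b ^ m * (1 - P) = (b * (1 - P)) ^ m * (1 - P) := by
  have hbP : b * P = P * b := hP.commute rfl
  have hQ : (1 - P) * (1 - P) = 1 - P := by
    simp only [mul_sub, sub_mul, hP.idem, mul_one, one_mul, sub_self, sub_zero]
  have hQb : Commute b (1 - P) := (Commute.one_right b).sub_right hbP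
  rw [hQb.mul_pow, mul_assoc]
  congr 1
  induction m with
  | zero => simp
  | succ m ih => rw [pow_succ, mul_assoc, hQ, ← ih]

/-- Off the leading eigenspace, conjugation by `b ^ m` is exponentially smaller. -/
theorem exists_norm_off_block_le (hP : IsSpectralProjection b l P) (hl : l ≠ 0) (hr0 : 0 ≤ r)
    (hr1 : r < 1) (hsp : ∀ μ ∈ spectrum ℂ b, μ ≠ l → ‖μ‖ ≤ r * ‖l‖) (z : Matrix (Fin n) (Fin n) ℂ)
    {q : ℝ} (hq : r < q) :
    ∃ C : ℝ, ∀ m : ℕ, ‖b ^ m * z * b ^ m - b ^ m * (P * z * P) * b ^ m‖ ≤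
      C * q ^ m * ‖l‖ ^ (2 * m) := by
  have hl' : 0 < ‖l‖ := norm_pos_iff.2 hl
  obtain ⟨q', hrq, hqq, hq1⟩ : ∃ q', r < q' ∧ q' ≤ q ∧ q' ≤ 1 :=
    ⟨min q 1, lt_min hq hr1, min_le_left _ _, min_le_right _ _⟩
  -- The leading block may grow like C(m, d) |l|^m, so it is estimated by (R |l|)^m with R > 1, and
  -- the rest by (ρ |l|)^m. With R ρ = q' the cross terms have the rate q' ≤ q, and ρ² ≤ q because ρ
  -- < q' ≤ 1.
  set ρ := (r + q') / 2 with hρ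
  have hρ0 : 0 < ρ := by linarith
  have hρr : r < ρ := by linarith
  have hρq : ρ < q' := by linarith
  have hq0 : 0 < q' := by linarith
  set R := q' / ρ with hR
  have hR1 : 1 < R := (one_lt_div hρ0).2 hρq
  have hRρ : R * ρ = q' := div_mul_cancel₀ _ hρ0.ne'
  obtain ⟨C₁, hC₁, h₁⟩ := exists_norm_pow_le b (ρ := R * ‖l‖) (by positivity) (by
    intro μ hμ
    by_cases h : μ = l
    · rw [h]; nlinarith
    · have := hsp μ hμ h
      nlinarith)
  obtain ⟨C₂, hC₂, h₂⟩ := exists_norm_pow_le (b * (1 - P)) (ρ := ρ * ‖l‖) (by positivity) (by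
    intro μ hμ
    by_cases h : μ = 0
    · rw [h, norm_zero]; positivity
    · obtain ⟨h1, h2⟩ := hP.compl μ hμ h
      have := hsp μ h1 h2
      nlinarith)
  have hbP : b * P = P * b := hP.commute rfl
  have hbmP : ∀ m, b ^ m * P = P * b ^ m := fun m => (show Commute b P from hbP).pow_left m
  set c := ‖P‖ + ‖(1 - P : Matrix (Fin n) (Fin n) ℂ)‖ with hc
  have hcP : ‖P‖ ≤ c := by linarith [norm_nonneg (1 - P : Matrix (Fin n) (Fin n) ℂ)]
  have hcQ : ‖(1 - P : Matrix (Fin n) (Fin n) ℂ)‖ ≤ c := by linarith [norm_nonneg P]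
  have hc0 : 0 ≤ c := by positivity
  have hu : ∀ m, ‖b ^ m * P‖ ≤ C₁ * (R * ‖l‖) ^ m * c := fun m =>
    (norm_mul_le _ _).trans (mul_le_mul (h₁ m) hcP (norm_nonneg _) (by positivity))
  have hv : ∀ m, ‖b ^ m * (1 - P)‖ ≤ C₂ * (ρ * ‖l‖) ^ m * c := fun m => by
    rw [pow_mul_compl hP]
    exact (norm_mul_le _ _).trans (mul_le_mul (h₂ m) hcQ (norm_nonneg _) (by positivity))
  refine ⟨(2 * C₁ * C₂ + C₂ * C₂) * c * c * ‖z‖, fun m => ?_⟩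
  set u := b ^ m * P with hudef
  set v := b ^ m * (1 - P) with hvdef
  have hsplit : b ^ m * z * b ^ m - b ^ m * (P * z * P) * b ^ m =
      u * z * v + v * z * u + v * z * v := by
    have h1 : b ^ m = u + v := by rw [hudef, hvdef, ← mul_add, add_sub_cancel, mul_one]
    have h2 : b ^ m * (P * z * P) * b ^ m = u * z * u := by
      rw [mul_assoc, mul_assoc (P * z), ← hbmP]
      simp only [hudef, mul_assoc]
    rw [h2]
    nth_rewrite 1 [h1]
    nth_rewrite 1 [h1]
    noncomm_ring
  rw [hsplit]
  have hb : ∀ (x y : Matrix (Fin n) (Fin n) ℂ) (p q : ℝ), ‖x‖ ≤ p → ‖y‖ ≤ q →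
      ‖x * z * y‖ ≤ p * ‖z‖ * q := fun x y p q hx hy =>
    (norm_mul_le _ _).trans (mul_le_mul ((norm_mul_le _ _).trans
      (mul_le_mul_of_nonneg_right hx (norm_nonneg _))) hy (norm_nonneg _)
      (mul_nonneg ((norm_nonneg _).trans hx) (norm_nonneg _)))
  have hρm : (ρ ^ m) * ρ ^ m ≤ q ^ m := by
    rw [← mul_pow]
    exact pow_le_pow_left₀ (by positivity) (by nlinarith) m
  have hRm : R ^ m * ρ ^ m ≤ q ^ m := by
    rw [← mul_pow, hRρ]
    exact pow_le_pow_left₀ hq0.le hqq m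
  have hlm : ‖l‖ ^ (2 * m) = ‖l‖ ^ m * ‖l‖ ^ m := by rw [two_mul, pow_add]
  calc ‖u * z * v + v * z * u + v * z * v‖
      ≤ (C₁ * (R * ‖l‖) ^ m * c) * ‖z‖ * (C₂ * (ρ * ‖l‖) ^ m * c) +
        (C₂ * (ρ * ‖l‖) ^ m * c) * ‖z‖ * (C₁ * (R * ‖l‖) ^ m * c) +
        (C₂ * (ρ * ‖l‖) ^ m * c) * ‖z‖ * (C₂ * (ρ * ‖l‖) ^ m * c) :=
        norm_add_le_of_le (norm_add_le_of_le (hb _ _ _ _ (hu m) (hv m)) (hb _ _ _ _ (hv m) (hu m)))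
          (hb _ _ _ _ (hv m) (hv m))
    _ = (2 * C₁ * C₂ * (R ^ m * ρ ^ m) + C₂ * C₂ * (ρ ^ m * ρ ^ m)) *
        (c * c * ‖z‖ * ‖l‖ ^ (2 * m)) := by rw [hlm]; simp only [mul_pow]; ring
    _ ≤ (2 * C₁ * C₂ * q ^ m + C₂ * C₂ * q ^ m) * (c * c * ‖z‖ * ‖l‖ ^ (2 * m)) := by
        gcongr
    _ = _ := by ring

/-- On the range of P, b equals l (1 + N) with N nilpotent. Conjugation by b^m is thus l^(2m) times
the m-th power of left times right multiplication by 1 + N, a unipotent operator on matrices. -/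
theorem exists_tendsto_leading_block (hP : IsSpectralProjection b l P) (hl : l ≠ 0)
    {x : Matrix (Fin n) (Fin n) ℂ} (hx : P * x * P ≠ 0) :
    ∃ (d : ℕ) (T : Matrix (Fin n) (Fin n) ℂ), T ≠ 0 ∧
      Tendsto (fun m : ℕ => (l ^ (2 * m) * (m.choose d : ℂ))⁻¹ • (b ^ m * (P * x * P) * b ^ m))
        atTop (𝓝 T) := by
  have hbP : b * P = P * b := hP.commute rfl
  obtain ⟨k, hk⟩ := hP.nilpotent
  set N := l⁻¹ • ((b - l • 1) * P) with hN
  have hNnil : IsNilpotent N := by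
    have hcomm : Commute (b - l • 1) P :=
      (show Commute b P from hbP).sub_left ((Commute.one_left P).smul_left l)
    refine ⟨k + 1, ?_⟩
    have h0 : (b - l • 1) ^ (k + 1) * P ^ (k + 1) = 0 := by
      rw [pow_succ', pow_succ' P, mul_assoc, ← mul_assoc _ P, hk, zero_mul, mul_zero]
    rw [hN, smul_pow, hcomm.mul_pow, h0, smul_zero]
  have hβ : (1 + N) * P = l⁻¹ • (b * P) := by
    rw [add_mul, one_mul, hN, smul_mul_assoc, mul_assoc, hP.idem, sub_mul, smul_sub,
      smul_mul_assoc, one_mul, smul_smul, inv_mul_cancel₀ hl, one_smul]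
    abel
  have hNP : Commute N P := by
    have : Commute (b - l • 1) P :=
      (show Commute b P from hbP).sub_left ((Commute.one_left P).smul_left l)
    exact (this.mul_left (Commute.refl P)).smul_left _
  have hβP : Commute (1 + N) P := (Commute.one_left P).add_left hNP
  have hpow : ∀ m : ℕ, b ^ m * P = l ^ m • ((1 + N) ^ m * P) := by
    intro m
    induction m with
    | zero => simp
    | succ m ih =>
      rw [pow_succ', mul_assoc, ih, mul_smul_comm, pow_succ' (1 + N), mul_assoc,
        (hβP.pow_left m).eq, ← mul_assoc b, ← mul_assoc (1 + N), hβ, smul_mul_assoc, smul_smul,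
        pow_succ, mul_assoc (l ^ m), mul_inv_cancel₀ hl, mul_one]
  have hPpow : ∀ m : ℕ, P * b ^ m = l ^ m • (P * (1 + N) ^ m) := by
    intro m
    rw [← ((show Commute b P from hbP).pow_left m).eq, hpow, (hβP.pow_left m).eq]
  set L : Module.End ℂ (Matrix (Fin n) (Fin n) ℂ) :=
    LinearMap.mulLeft ℂ (1 + N) * LinearMap.mulRight ℂ (1 + N) with hL
  have hLcomm : Commute (LinearMap.mulLeft ℂ N) (LinearMap.mulRight ℂ N) :=
    LinearMap.commute_mulLeft_right N N
  have hLN : IsNilpotent (L - 1) := by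
    have h1 : L - 1 = LinearMap.mulLeft ℂ N + LinearMap.mulRight ℂ N +
        LinearMap.mulLeft ℂ N * LinearMap.mulRight ℂ N := by
      ext1 z
      simp only [hL, LinearMap.sub_apply, Module.End.mul_apply, LinearMap.mulLeft_apply,
        LinearMap.mulRight_apply, Module.End.one_apply, LinearMap.add_apply]
      noncomm_ring
    have h2 : IsNilpotent (LinearMap.mulLeft ℂ N) := (LinearMap.isNilpotent_mulLeft_iff ℂ N).2 hNnil
    have h3 : IsNilpotent (LinearMap.mulRight ℂ N) :=
      (LinearMap.isNilpotent_mulRight_iff ℂ N).2 hNnil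
    rw [h1]
    refine Commute.isNilpotent_add ?_ (hLcomm.isNilpotent_add h2 h3)
      (hLcomm.isNilpotent_mul_right h2)
    exact ((Commute.refl _).mul_right hLcomm).add_left (hLcomm.symm.mul_right (Commute.refl _))
  have hLpow : ∀ (m : ℕ) z, (L ^ m) z = (1 + N) ^ m * z * (1 + N) ^ m := by
    intro m z
    rw [hL, (LinearMap.commute_mulLeft_right (1 + N) (1 + N)).mul_pow, LinearMap.pow_mulLeft,
      LinearMap.pow_mulRight, Module.End.mul_apply, LinearMap.mulLeft_apply,
      LinearMap.mulRight_apply, mul_assoc]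
  obtain ⟨d, T, hT, hlim⟩ := exists_tendsto_unipotent_pow hLN hx
  rw [add_sub_cancel] at hlim
  refine ⟨d, T, hT, hlim.congr fun m => ?_⟩
  have h1 : b ^ m * (P * x * P) * b ^ m =
      l ^ (2 * m) • ((1 + N) ^ m * (P * x * P) * (1 + N) ^ m) := by
    calc b ^ m * (P * x * P) * b ^ m = (b ^ m * P) * x * (P * b ^ m) := by
          simp only [mul_assoc]
      _ = _ := by
          rw [hpow, hPpow, smul_mul_assoc, smul_mul_assoc, mul_smul_comm, smul_smul, ← pow_add,
            two_mul]
          simp only [mul_assoc]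
  rw [h1, hLpow, smul_smul, mul_inv, mul_right_comm, inv_mul_cancel₀ (pow_ne_zero _ hl), one_mul]

/-- The leading blocks of x and y coincide and converge after renormalization, while everything off
the leading block is exponentially smaller. The difference x - y has no leading block at all, whence
the rate of its decay. -/
theorem exists_junkLimit (hP : IsSpectralProjection b l P) (hl : l ≠ 0) (hr0 : 0 ≤ r)
    (hr1 : r < 1) (hsp : ∀ μ ∈ spectrum ℂ b, μ ≠ l → ‖μ‖ ≤ r * ‖l‖) {x y : Matrix (Fin n) (Fin n) ℂ}
    (hxy : P * x * P = P * y * P) (hx : P * x * P ≠ 0) :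
    ∃ T s, JunkLimit (fun m => b ^ m * x * b ^ m) (fun m => b ^ m * y * b ^ m) l r T s := by
  obtain ⟨d, T, hT, hlim⟩ := exists_tendsto_leading_block hP hl hx
  have hl' : 0 < ‖l‖ := norm_pos_iff.2 hl
  set s : ℕ → ℂ := fun m => (l ^ (2 * m) * (m.choose d : ℂ))⁻¹ with hs
  have hsle : ∀ m, ‖s m‖ ≤ (‖l‖ ^ (2 * m))⁻¹ := by
    intro m
    rw [hs]
    simp only [norm_inv, norm_mul, norm_pow, Complex.norm_natCast]
    -- For m < d the binomial coefficient vanishes and s m is 0 by the convention 0⁻¹ = 0.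
    rcases Nat.eq_zero_or_pos (m.choose d) with h | h
    · rw [h]; simp
    · have : (1 : ℝ) ≤ m.choose d := by exact_mod_cast h
      apply inv_anti₀ (by positivity)
      nlinarith [pow_pos hl' (2 * m)]
  have hoff : ∀ (z : Matrix (Fin n) (Fin n) ℂ) {q : ℝ}, r < q → ∃ C : ℝ, ∀ m : ℕ,
      ‖s m • (b ^ m * z * b ^ m - b ^ m * (P * z * P) * b ^ m)‖ ≤ C * q ^ m := by
    intro z q hq
    obtain ⟨C, hC⟩ := exists_norm_off_block_le hP hl hr0 hr1 hsp z hq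
    refine ⟨C, fun m => ?_⟩
    rw [norm_smul]
    calc ‖s m‖ * ‖b ^ m * z * b ^ m - b ^ m * (P * z * P) * b ^ m‖
        ≤ (‖l‖ ^ (2 * m))⁻¹ * (C * q ^ m * ‖l‖ ^ (2 * m)) :=
          mul_le_mul (hsle m) (hC m) (norm_nonneg _) (by positivity)
      _ = C * q ^ m := by field_simp
  have hoff0 : ∀ z : Matrix (Fin n) (Fin n) ℂ, Tendsto (fun m : ℕ =>
      s m • (b ^ m * z * b ^ m - b ^ m * (P * z * P) * b ^ m)) atTop (𝓝 0) := by
    intro z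
    obtain ⟨C, hC⟩ := hoff z (q := (r + 1) / 2) (by linarith)
    refine squeeze_zero_norm hC ?_
    rw [← mul_zero C]
    exact (tendsto_pow_atTop_nhds_zero_of_lt_one (by linarith) (by linarith)).const_mul C
  have hlim' : ∀ z : Matrix (Fin n) (Fin n) ℂ, P * z * P = P * x * P →
      Tendsto (fun m : ℕ => s m • (b ^ m * z * b ^ m)) atTop (𝓝 T) := by
    intro z hz
    have h1 := hlim.add (hoff0 z)
    rw [add_zero] at h1
    refine h1.congr fun m => ?_
    rw [hz, ← smul_add, add_sub_cancel]
  have hdiff : ∀ m, b ^ m * x * b ^ m - b ^ m * y * b ^ m = b ^ m * (x - y) * b ^ m := by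
    intro m
    rw [mul_sub, sub_mul]
  have hPd : P * (x - y) * P = 0 := by
    rw [mul_sub, sub_mul, hxy, sub_self]
  refine ⟨T, s, hT, hlim' x rfl, hlim' y hxy.symm, ?_, ?_, hsle⟩
  · intro q hq
    obtain ⟨C, hC⟩ := hoff (x - y) hq
    refine ⟨C, fun m i j => ?_⟩
    refine le_trans ?_ (hC m)
    rw [hPd, mul_zero, zero_mul, sub_zero, ← hdiff]
    exact norm_entry_le (s m • (b ^ m * x * b ^ m - b ^ m * y * b ^ m)) i j
  -- If all other eigenvalues vanish, b (1 - P) is nilpotent, so b^m = P b^m for m ≥ n and the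
  -- leading blocks are everything. Exact equality is needed here: the decay clause only covers q >
  -- 0, whereas r^m = 0.
  · intro hr
    have hnil : (b * (1 - P)) ^ n = 0 := by
      refine isNilpotent_of_spectrum fun μ hμ => ?_
      by_contra hμ0
      obtain ⟨h1, h2⟩ := hP.compl μ hμ hμ0
      have := hsp μ h1 h2
      rw [hr, zero_mul, norm_le_zero_iff] at this
      exact hμ0 this
    refine ⟨n, fun m hm => ?_⟩
    have h0 : b ^ m * (1 - P) = 0 := by
      rw [pow_mul_compl hP, ← Nat.sub_add_cancel hm, pow_add, hnil, mul_zero, zero_mul]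
    rw [mul_sub, mul_one, sub_eq_zero] at h0
    have h0' : b ^ m = P * b ^ m := by
      rw [← ((show Commute b P from hP.commute rfl).pow_left m).eq, ← h0]
    rw [← sub_eq_zero, hdiff]
    calc b ^ m * (x - y) * b ^ m = (b ^ m * P) * (x - y) * (P * b ^ m) := by rw [← h0, ← h0']
      _ = b ^ m * (P * (x - y) * P) * b ^ m := by simp only [mul_assoc]
      _ = 0 := by rw [hPd, mul_zero, zero_mul]

end

theorem JunkLimit.conj {n : ℕ} {x y : ℕ → Matrix (Fin n) (Fin n) ℂ} {l : ℂ} {r : ℝ}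
    {T : Matrix (Fin n) (Fin n) ℂ} {s : ℕ → ℂ} (h : JunkLimit x y l r T s)
    {w w' : Matrix (Fin n) (Fin n) ℂ} (hw : w' * w = 1) :
    JunkLimit (fun m => w * x m * w') (fun m => w * y m * w') l r (w * T * w') s := by
  have hw' : w * w' = 1 := mul_eq_one_comm.1 hw
  have ht : ∀ z : ℕ → Matrix (Fin n) (Fin n) ℂ, Tendsto (fun m => s m • z m) atTop (𝓝 T) →
      Tendsto (fun m => s m • (w * z m * w')) atTop (𝓝 (w * T * w')) := by
    intro z hz
    have := (hz.const_mul w).mul_const w'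
    refine this.congr fun m => ?_
    rw [mul_smul_comm, smul_mul_assoc]
  refine ⟨?_, ht x h.tendsto_left, ht y h.tendsto_right, ?_, ?_, h.scale_le⟩
  · intro h0
    apply h.ne_zero
    calc T = (w' * w) * T * (w' * w) := by rw [hw, one_mul, mul_one]
      _ = w' * (w * T * w') * w := by simp only [mul_assoc]
      _ = 0 := by rw [h0, mul_zero, zero_mul]
  · intro q hq
    obtain ⟨C, hC⟩ := h.decay q hq
    obtain ⟨K, hK⟩ : ∃ K : ℝ, ∀ i j k k', ‖w i k‖ * ‖w' k' j‖ ≤ K := by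
      obtain ⟨K, hK⟩ := (Set.finite_range fun p : Fin n × Fin n × Fin n × Fin n =>
        ‖w p.1 p.2.2.1‖ * ‖w' p.2.2.2 p.2.1‖).bddAbove
      exact ⟨K, fun i j k k' => hK ⟨(i, j, k, k'), rfl⟩⟩
    refine ⟨∑ k : Fin n, ∑ k' : Fin n, K * C, fun m i j => ?_⟩
    have h1 : s m * ((w * x m * w') i j - (w * y m * w') i j) =
        ∑ k', ∑ k, w i k * (s m * (x m k k' - y m k k')) * w' k' j := by
      simp only [Matrix.mul_apply, Finset.sum_mul, ← Finset.sum_sub_distrib, Finset.mul_sum]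
      refine Finset.sum_congr rfl fun _ _ => Finset.sum_congr rfl fun _ _ => by ring
    have hCq : ∀ k k', ‖s m * (x m k k' - y m k k')‖ ≤ C * q ^ m := fun k k' => hC m k k'
    rw [h1, Finset.sum_mul]
    refine norm_sum_le_of_le _ fun k' _ => ?_
    rw [Finset.sum_mul]
    refine norm_sum_le_of_le _ fun k _ => ?_
    have h2 := hK i j k k'
    have h3 := hCq k k'
    have h0 : 0 ≤ K := le_trans (by positivity) h2
    rw [norm_mul, norm_mul, mul_right_comm]
    calc ‖w i k‖ * ‖w' k' j‖ * ‖s m * (x m k k' - y m k k')‖ ≤ K * (C * q ^ m) :=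
          mul_le_mul h2 h3 (norm_nonneg _) h0
      _ = K * C * q ^ m := by ring
  · intro hr
    obtain ⟨m₀, hm⟩ := h.eventually_eq hr
    exact ⟨m₀, fun m hmm => by simp only [hm m hmm]⟩

/-! ### Traces of powers and the spectral gap -/

section TracePow

variable {E : Type*} [AddCommGroup E] [Module ℂ E] [FiniteDimensional ℂ E]

theorem trace_pow_of_isNilpotent_sub (g : Module.End ℂ E) (μ : ℂ)
    (h : IsNilpotent (g - algebraMap ℂ (Module.End ℂ E) μ)) (k : ℕ) :
    LinearMap.trace ℂ E (g ^ k) = Module.finrank ℂ E * μ ^ k := by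
  induction k with
  | zero => rw [pow_zero, LinearMap.trace_one, pow_zero, mul_one]
  | succ k ih =>
    rw [pow_succ, Module.End.mul_eq_comp,
      LinearMap.trace_comp_eq_mul_of_commute_of_isNilpotent μ ((Commute.refl g).pow_left k) h, ih]
    ring

/-- The generalized eigenspaces are invariant and span, and on each of them the map is a scalar plus
a nilpotent part, which does not contribute to traces of powers. -/
theorem trace_pow_eq_sum_roots (f : Module.End ℂ E) (k : ℕ) :
    LinearMap.trace ℂ E (f ^ k) = ∑ μ ∈ f.charpoly.roots.toFinset,
      (f.charpoly.rootMultiplicity μ : ℂ) * μ ^ k := by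
  classical
  have hint := DirectSum.isInternal_submodule_of_iSupIndep_of_iSup_eq_top
    f.independent_maxGenEigenspace f.iSup_maxGenEigenspace_eq_top
  have hfin : {μ | f.maxGenEigenspace μ ≠ ⊥}.Finite :=
    WellFoundedGT.finite_ne_bot_of_iSupIndep f.independent_maxGenEigenspace
  have hmaps : ∀ μ, Set.MapsTo (f ^ k) (f.maxGenEigenspace μ) (f.maxGenEigenspace μ) := fun μ =>
    Module.End.mapsTo_maxGenEigenspace_of_comm ((Commute.refl f).pow_right k) μ
  have hmaps1 : ∀ μ, Set.MapsTo f (f.maxGenEigenspace μ) (f.maxGenEigenspace μ) := fun μ =>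
    Module.End.mapsTo_maxGenEigenspace_of_comm (Commute.refl f) μ
  rw [LinearMap.trace_eq_sum_trace_restrict' hint hfin hmaps]
  have hset : hfin.toFinset = f.charpoly.roots.toFinset := by
    ext μ
    simp only [Set.Finite.mem_toFinset, Set.mem_ofPred_eq, Multiset.mem_toFinset]
    rw [← Multiset.count_pos, Polynomial.count_roots,
      ← LinearMap.finrank_maxGenEigenspace_eq, Module.finrank_pos_iff,
      Submodule.nontrivial_iff_ne_bot]
  rw [hset]
  refine Finset.sum_congr rfl fun μ _ => ?_
  rw [← LinearMap.finrank_maxGenEigenspace_eq, ← Module.End.pow_restrict k (hmaps1 μ)]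
  exact trace_pow_of_isNilpotent_sub _ μ
    (Module.End.isNilpotent_restrict_maxGenEigenspace_sub_algebraMap f μ) k

end TracePow

/-- The number of the other eigenvalues is at most the dimension, the square of the size of the
matrices. `max δ 0` is used because δ may be negative. -/
theorem HasGap.norm_trace_pow_sub_le {ι : Type*} [Fintype ι] [DecidableEq ι]
    {E : Matrix ι ι ℂ →ₗ[ℂ] Matrix ι ι ℂ} {δ : ℝ} (h : HasGap E δ) :
    ∃ ν₁ : ℂ, ν₁ ≠ 0 ∧ ∀ k : ℕ, ‖LinearMap.trace ℂ _ (E ^ k) - ν₁ ^ k‖ ≤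
      (Fintype.card ι ^ 2 : ℕ) * (max δ 0 * ‖ν₁‖) ^ k := by
  obtain ⟨ν₁, hν, hm, hgap⟩ := h
  refine ⟨ν₁, hν, fun k => ?_⟩
  have hmem : ν₁ ∈ E.charpoly.roots.toFinset := by
    rw [Multiset.mem_toFinset, ← Multiset.count_pos, Polynomial.count_roots, hm]
    exact one_pos
  rw [trace_pow_eq_sum_roots, ← Finset.add_sum_erase _ _ hmem, hm, Nat.cast_one, one_mul,
    add_sub_cancel_left]
  have hb : ∀ μ ∈ E.charpoly.roots.toFinset.erase ν₁,
      ‖(E.charpoly.rootMultiplicity μ : ℂ) * μ ^ k‖ ≤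
        (E.charpoly.rootMultiplicity μ : ℝ) * (max δ 0 * ‖ν₁‖) ^ k := by
    intro μ hμ
    rw [Finset.mem_erase, Multiset.mem_toFinset] at hμ
    rw [norm_mul, norm_pow, Complex.norm_natCast]
    have h1 := hgap μ (Polynomial.isRoot_of_mem_roots hμ.2) hμ.1
    have h2 : δ * ‖ν₁‖ ≤ max δ 0 * ‖ν₁‖ :=
      mul_le_mul_of_nonneg_right (le_max_left _ _) (norm_nonneg _)
    exact mul_le_mul_of_nonneg_left (pow_le_pow_left₀ (norm_nonneg _) (h1.trans h2) k)
      (Nat.cast_nonneg _)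
  refine (norm_sum_le _ _).trans ((Finset.sum_le_sum hb).trans ?_)
  rw [← Finset.sum_mul]
  refine mul_le_mul_of_nonneg_right ?_ (by positivity)
  have h3 : ∑ μ ∈ E.charpoly.roots.toFinset, E.charpoly.rootMultiplicity μ ≤
      Fintype.card ι ^ 2 := by
    simp_rw [← Polynomial.count_roots]
    rw [Multiset.toFinset_sum_count_eq]
    refine (Polynomial.card_roots' _).trans ?_
    rw [LinearMap.charpoly_natDegree, Module.finrank_matrix]
    simp [sq]
  have h4 := Finset.sum_le_sum_of_subset (f := fun μ => E.charpoly.rootMultiplicity μ)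
    (Finset.erase_subset ν₁ E.charpoly.roots.toFinset)
  exact_mod_cast h4.trans h3

/-! ### The matrix of the transfer map -/

section Doubling

variable {ι : Type*} [Fintype ι] [DecidableEq ι]

/-- The matrix `conj B ⊗ B` of the map `X ↦ B X B†`. -/
def double (B : Matrix ι ι ℂ) : Matrix (ι × ι) (ι × ι) ℂ := B.map star ⊗ₖ B

theorem double_mul (B C : Matrix ι ι ℂ) : double (B * C) = double B * double C := by
  have : (B * C).map star = B.map star * C.map star := by
    ext i j
    simp [Matrix.mul_apply]
  rw [double, double, double, this, Matrix.mul_kronecker_mul]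

theorem double_one : double (1 : Matrix ι ι ℂ) = 1 := by
  have : (1 : Matrix ι ι ℂ).map star = 1 := by simp
  rw [double, this, Matrix.one_kronecker_one]

theorem double_zero : double (0 : Matrix ι ι ℂ) = 0 := by
  rw [double, Matrix.kronecker_zero]

theorem double_pow (B : Matrix ι ι ℂ) (k : ℕ) : double (B ^ k) = double B ^ k := by
  induction k with
  | zero => rw [pow_zero, pow_zero, double_one]
  | succ k ih => rw [pow_succ, pow_succ, double_mul, ih]

theorem trace_double (B : Matrix ι ι ℂ) : (double B).trace = (‖B.trace‖ ^ 2 : ℝ) := by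
  rw [double, Matrix.trace_kronecker]
  have : (B.map star).trace = star B.trace := by simp [Matrix.trace]
  rw [this, Complex.ofReal_pow, ← Complex.conj_mul']
  rfl

/-- Vectorization of square matrices as a linear equivalence. -/
noncomputable def vecEquiv (ι : Type*) : Matrix ι ι ℂ ≃ₗ[ℂ] (ι × ι → ℂ) :=
  LinearEquiv.ofBijective
    { toFun := Matrix.vec
      map_add' := Matrix.vec_add
      map_smul' := Matrix.vec_smul } Matrix.vec_bijective

/-- Vectorization identifies X ↦ A X A† with conj A ⊗ A. Traces of powers can then be estimated in a
matrix algebra, where the buffers factor off by cyclicity. -/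
theorem trace_transfer_pow (A : Fin 3 → Matrix ι ι ℂ) (k : ℕ) :
    LinearMap.trace ℂ _ (transfer A ^ k) = ((∑ μ, double (A μ)) ^ k).trace := by
  let e := vecEquiv ι
  have h1 : e.conj (transfer A) = Matrix.toLin' (∑ μ, double (A μ)) := by
    refine LinearMap.ext fun x => ?_
    obtain ⟨X, rfl⟩ := e.surjective x
    rw [LinearEquiv.conj_apply, LinearMap.comp_apply, LinearMap.comp_apply,
      LinearEquiv.coe_coe, LinearEquiv.coe_coe, LinearEquiv.symm_apply_apply, Matrix.toLin'_apply,
      Matrix.sum_mulVec]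
    change Matrix.vec (∑ μ, A μ * X * (A μ)ᴴ) = _
    rw [Matrix.vec_sum]
    refine Finset.sum_congr rfl fun μ _ => ?_
    change _ = (((A μ).map star) ⊗ₖ A μ) *ᵥ Matrix.vec X
    rw [Matrix.kronecker_mulVec_vec]
    rfl
  rw [← LinearMap.trace_conj' _ e]
  have h2 : e.conj (transfer A ^ k) = (e.conj (transfer A)) ^ k :=
    map_pow (LinearEquiv.conjRingEquiv e) _ _
  rw [h2, h1, ← Matrix.toLin'_pow, Matrix.trace_toLin'_eq]

theorem trace_mul_pow_comm (x y : Matrix ι ι ℂ) (k : ℕ) :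
    ((x * y) ^ k).trace = ((y * x) ^ k).trace := by
  cases k with
  | zero => simp
  | succ k =>
    have h : SemiconjBy x (y * x) (x * y) := by
      rw [SemiconjBy, mul_assoc]
    have h2 : x * (y * x) ^ k = (x * y) ^ k * x := h.pow_right k
    rw [pow_succ, ← mul_assoc, ← h2, mul_assoc, Matrix.trace_mul_comm, mul_assoc, ← pow_succ]

open scoped Matrix.Norms.Operator

theorem norm_map_star_kronecker_le (B C : Matrix ι ι ℂ) :
    ‖B.map star ⊗ₖ C‖ ≤ (Fintype.card ι ^ 2 : ℕ) * (‖B‖ * ‖C‖) := by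
  have := norm_le_of_entry_le (M := B.map star ⊗ₖ C) (c := ‖B‖ * ‖C‖) (by positivity) (by
    intro i j
    rw [Matrix.kroneckerMap_apply, norm_mul, Matrix.map_apply, norm_star]
    gcongr <;> exact norm_entry_le _ _ _)
  rwa [Fintype.card_prod, ← sq] at this

/-- Telescoping, with one factor β kept: when y is small compared with x, so is the difference of
the powers. -/
theorem norm_pow_add_sub_pow_le {R : Type*} [NormedRing R] {x y : R} {α β : ℝ} (hx : ‖x‖ ≤ α)
    (hy : ‖y‖ ≤ β) (k : ℕ) : ‖(x + y) ^ (k + 1) - x ^ (k + 1)‖ ≤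
      (k + 1 : ℕ) * (β * (α + β) ^ k) := by
  have hα : 0 ≤ α := (norm_nonneg x).trans hx
  have hβ : 0 ≤ β := (norm_nonneg y).trans hy
  have hxy : ‖x + y‖ ≤ α + β := (norm_add_le x y).trans (add_le_add hx hy)
  induction k with
  | zero => simpa using hy
  | succ k ih =>
    have h1 : (x + y) ^ (k + 1 + 1) - x ^ (k + 1 + 1) =
        (x + y) ^ (k + 1) * y + ((x + y) ^ (k + 1) - x ^ (k + 1)) * x := by
      rw [pow_succ (x + y) (k + 1), pow_succ x (k + 1)]
      noncomm_ring
    rw [h1]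
    have h2 : ‖(x + y) ^ (k + 1) * y‖ ≤ (α + β) ^ (k + 1) * β := by
      refine (norm_mul_le _ _).trans ?_
      gcongr
      exact (norm_pow_le' _ (Nat.succ_pos k)).trans (by gcongr)
    have h3 : ‖((x + y) ^ (k + 1) - x ^ (k + 1)) * x‖ ≤
        ((k + 1 : ℕ) * (β * (α + β) ^ k)) * (α + β) := by
      refine (norm_mul_le _ _).trans ?_
      gcongr
      exact hx.trans (by linarith)
    refine (norm_add_le _ _).trans ((add_le_add h2 h3).trans (le_of_eq ?_))
    push_cast
    ring

end Doubling

/-! ### A spectral gap excludes degenerate renormalized tensors -/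

section Renorm

open scoped Matrix.Norms.Operator

variable {ι : Type*} [Fintype ι] [DecidableEq ι]

/-- If `Q` kills the components other than `A 2`, then up to terms with a factor `1 - Q` the traces
of the powers of the transfer map of the buffered tensor are those of a pure power of `A 2`. -/
theorem trace_pow_projected (A : Fin 3 → Matrix ι ι ℂ) {Q : Matrix ι ι ℂ} (hQ : Q * Q = Q)
    (hc : A 2 * Q = Q * A 2) (h0 : Q * A 0 * Q = 0) (h1 : Q * A 1 * Q = 0) (m k : ℕ) :
    (((∑ μ, double (A μ)) * double (A 2 ^ (2 * m) * Q)) ^ (k + 1)).trace =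
      (‖(A 2 ^ ((2 * m + 1) * (k + 1)) * Q).trace‖ ^ 2 : ℝ) := by
  have hcQ : ∀ j, A 2 ^ j * Q = Q * A 2 ^ j := fun j =>
    ((show Commute (A 2) Q from hc).pow_left j).eq
  have hd : ∀ B, double (Q * B * Q) = double Q * double B * double Q := fun B => by
    rw [double_mul, double_mul]
  -- Between two factors Q only the component μ = 2 survives.
  have hG : double Q * (∑ μ, double (A μ)) * double Q = double (A 2 * Q) := by
    rw [Finset.mul_sum, Finset.sum_mul, Fin.sum_univ_three, ← hd, ← hd, ← hd, h0, h1, double_zero,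
      zero_add, zero_add, ← hc, mul_assoc, hQ]
  set G := ∑ μ, double (A μ)
  have e1 : G * double (A 2 ^ (2 * m) * Q) =
      (G * double Q * double (A 2 ^ (2 * m))) * double Q := by
    rw [mul_assoc, mul_assoc, ← double_mul, ← double_mul, ← mul_assoc, ← hcQ, mul_assoc _ Q Q, hQ]
  have e2 : double Q * (G * double Q * double (A 2 ^ (2 * m))) =
      double (A 2 ^ (2 * m + 1) * Q) := by
    rw [← mul_assoc, ← mul_assoc, hG, ← double_mul, mul_assoc, ← hcQ, ← mul_assoc, pow_succ']
  have e3 : ∀ j k, (A 2 ^ j * Q) ^ (k + 1) = A 2 ^ (j * (k + 1)) * Q := by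
    intro j k
    rw [(show Commute (A 2 ^ j) Q from hcQ j).mul_pow, ← pow_mul]
    congr 1
    exact (show IsIdempotentElem Q from hQ).pow_succ_eq k
  rw [e1, trace_mul_pow_comm, e2, ← double_pow, e3, trace_double]

theorem trace_transfer_buffered_pow (A : Fin 3 → Matrix ι ι ℂ) (m k : ℕ) :
    LinearMap.trace ℂ _ (transfer (fun μ => A 2 ^ m * A μ * A 2 ^ m) ^ k) =
      (((∑ μ, double (A μ)) * double (A 2 ^ (2 * m))) ^ k).trace := by
  rw [trace_transfer_pow]
  have : ∑ μ, double (A 2 ^ m * A μ * A 2 ^ m) =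
      double (A 2 ^ m) * ((∑ μ, double (A μ)) * double (A 2 ^ m)) := by
    rw [Finset.sum_mul, Finset.mul_sum]
    exact Finset.sum_congr rfl fun μ _ => by rw [double_mul, double_mul, mul_assoc]
  rw [this, trace_mul_pow_comm, mul_assoc, ← double_mul, ← pow_add, two_mul]

/-- Split the buffers A₂^(2m) by Q and 1 - Q. Without 1 - Q one has the pure power of
`trace_pow_projected`; each remaining term contains a factor of relative size q^(2m), which beats
the subexponential growth of the other factors for fixed k. -/
theorem tendsto_trace_transfer_buffered (A : Fin 3 → Matrix ι ι ℂ) {Q : Matrix ι ι ℂ}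
    (hQ : Q * Q = Q) (hc : A 2 * Q = Q * A 2) (h0 : Q * A 0 * Q = 0) (h1 : Q * A 1 * Q = 0)
    {d q : ℝ} (hd : 0 < d) (hq : 0 < q) (hq1 : q < 1)
    (hα : ∀ ρ : ℝ, 1 < ρ → ∃ C : ℝ, ∀ m, ‖A 2 ^ m * Q‖ ≤ C * (ρ * d) ^ m)
    (hβ : ∃ C : ℝ, ∀ m, ‖A 2 ^ m * (1 - Q)‖ ≤ C * (q * d) ^ m) (k : ℕ) :
    Tendsto (fun m : ℕ => (LinearMap.trace ℂ _
        (transfer (fun μ => A 2 ^ m * A μ * A 2 ^ m) ^ (k + 1)) -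
      ((‖(A 2 ^ ((2 * m + 1) * (k + 1)) * Q).trace‖ ^ 2 : ℝ) : ℂ)) /
        ((d ^ (2 * ((2 * m + 1) * (k + 1))) : ℝ) : ℂ)) atTop (𝓝 0) := by
  -- ρ bounds the polynomial growth from Jordan blocks. It occurs at most 4(k + 1) times, so it is
  -- taken close enough to 1 for q to win.
  obtain ⟨ρ, hρ1, hρ⟩ : ∃ ρ : ℝ, 1 < ρ ∧ ρ ^ (2 * (k + 1)) * q < 1 := by
    have hcont : Tendsto (fun ρ : ℝ => ρ ^ (2 * (k + 1)) * q) (𝓝[>] 1) (𝓝 (1 ^ (2 * (k + 1)) *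
        q)) :=
      ((continuous_pow _).mul continuous_const).continuousAt.tendsto.mono_left nhdsWithin_le_nhds
    rw [one_pow, one_mul] at hcont
    obtain ⟨ρ, h⟩ := ((hcont.eventually_lt_const hq1).and self_mem_nhdsWithin).exists
    exact ⟨ρ, h.2, h.1⟩
  obtain ⟨C₁, hC₁⟩ := hα ρ hρ1
  obtain ⟨C₂, hC₂⟩ := hβ
  set C := max C₁ (max C₂ 1)
  have hC0 : 0 < C := lt_of_lt_of_le one_pos ((le_max_right _ _).trans (le_max_right _ _))
  set N : ℝ := ((Fintype.card ι ^ 2 : ℕ) : ℝ)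
  set g := ‖∑ μ, double (A μ)‖
  set c₀ := g * (N * C ^ 2)
  have hN0 : 0 ≤ N := Nat.cast_nonneg _
  have hg0 : 0 ≤ g := norm_nonneg _
  have hc₀ : 0 ≤ c₀ := by positivity
  -- the bound of the difference
  have key : ∀ m : ℕ, ‖(LinearMap.trace ℂ _
        (transfer (fun μ => A 2 ^ m * A μ * A 2 ^ m) ^ (k + 1)) -
      ((‖(A 2 ^ ((2 * m + 1) * (k + 1)) * Q).trace‖ ^ 2 : ℝ) : ℂ))‖ ≤
      (Fintype.card (ι × ι) * ((k + 1 : ℕ) * (3 * c₀ * (4 * c₀) ^ k))) *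
        (d ^ (4 * m * (k + 1)) * ((ρ ^ (2 * (k + 1)) * q) ^ 2) ^ m) := by
    intro m
    rw [trace_transfer_buffered_pow, ← trace_pow_projected A hQ hc h0 h1]
    have hx : ‖A 2 ^ (2 * m) * Q‖ ≤ C * (ρ * d) ^ (2 * m) :=
      (hC₁ _).trans (mul_le_mul_of_nonneg_right (le_max_left _ _) (by positivity))
    have hy : ‖A 2 ^ (2 * m) * (1 - Q)‖ ≤ C * (q * d) ^ (2 * m) :=
      (hC₂ _).trans (mul_le_mul_of_nonneg_right
        ((le_max_left _ _).trans (le_max_right _ _)) (by positivity))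
    set x := A 2 ^ (2 * m) * Q
    set y := A 2 ^ (2 * m) * (1 - Q)
    have hxy : A 2 ^ (2 * m) = x + y := by simp only [x, y]; rw [← mul_add, add_sub_cancel, mul_one]
    have hdd : double (A 2 ^ (2 * m)) =
        double x + (x.map star ⊗ₖ y + y.map star ⊗ₖ x + y.map star ⊗ₖ y) := by
      rw [hxy, double, double]
      have : (x + y).map star = x.map star + y.map star := by ext i j; simp
      rw [this, Matrix.add_kronecker, Matrix.kronecker_add, Matrix.kronecker_add]
      abel
    rw [hdd, mul_add, ← Matrix.trace_sub]
    refine (norm_trace_le _).trans ?_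
    have hqρ : q ≤ ρ := (hq1.trans hρ1).le
    have ha : ‖(∑ μ, double (A μ)) * double x‖ ≤ c₀ * (ρ ^ 4 * d ^ 4) ^ m := by
      refine (norm_mul_le _ _).trans ?_
      rw [show c₀ * (ρ ^ 4 * d ^ 4) ^ m = g * (N * ((C * (ρ * d) ^ (2 * m)) * (C * (ρ * d) ^ (2 *
          m))))
        by simp only [c₀]; rw [pow_mul, ← mul_pow]; ring]
      refine mul_le_mul_of_nonneg_left ((norm_map_star_kronecker_le _ _).trans ?_) hg0
      exact mul_le_mul_of_nonneg_left (mul_le_mul hx hx (norm_nonneg _) (by positivity)) hN0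
    have hb : ‖(∑ μ, double (A μ)) * (x.map star ⊗ₖ y + y.map star ⊗ₖ x + y.map star ⊗ₖ y)‖ ≤
        3 * c₀ * (ρ ^ 2 * q ^ 2 * d ^ 4) ^ m := by
      refine (norm_mul_le _ _).trans ?_
      rw [show 3 * c₀ * (ρ ^ 2 * q ^ 2 * d ^ 4) ^ m = g *
        (N * ((C * (ρ * d) ^ (2 * m)) * (C * (q * d) ^ (2 * m))) +
         N * ((C * (ρ * d) ^ (2 * m)) * (C * (q * d) ^ (2 * m))) +
         N * ((C * (ρ * d) ^ (2 * m)) * (C * (q * d) ^ (2 * m))))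
        by simp only [c₀, pow_mul, mul_pow]; ring]
      have hy' : ‖y‖ ≤ C * (ρ * d) ^ (2 * m) := hy.trans (by gcongr)
      refine mul_le_mul_of_nonneg_left ?_ hg0
      refine (norm_add₃_le).trans (add_le_add (add_le_add ?_ ?_) ?_)
      · exact (norm_map_star_kronecker_le _ _).trans (mul_le_mul_of_nonneg_left
          (mul_le_mul hx hy (norm_nonneg _) (by positivity)) hN0)
      · rw [mul_comm (C * (ρ * d) ^ (2 * m))]
        exact (norm_map_star_kronecker_le _ _).trans (mul_le_mul_of_nonneg_left
          (mul_le_mul hy hx (norm_nonneg _) (by positivity)) hN0)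
      · exact (norm_map_star_kronecker_le _ _).trans (mul_le_mul_of_nonneg_left
          (mul_le_mul hy' hy (norm_nonneg _) (by positivity)) hN0)
    have hab := norm_pow_add_sub_pow_le ha hb k
    rw [mul_assoc]
    refine mul_le_mul_of_nonneg_left (hab.trans ?_) (Nat.cast_nonneg (Fintype.card (ι × ι)))
    rw [mul_assoc ((k + 1 : ℕ) : ℝ) (3 * c₀ * (4 * c₀) ^ k)]
    refine mul_le_mul_of_nonneg_left ?_ (Nat.cast_nonneg (k + 1))
    have h4 : c₀ * (ρ ^ 4 * d ^ 4) ^ m + 3 * c₀ * (ρ ^ 2 * q ^ 2 * d ^ 4) ^ m ≤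
        4 * c₀ * (ρ ^ 4 * d ^ 4) ^ m := by
      have : ρ ^ 2 * q ^ 2 * d ^ 4 ≤ ρ ^ 4 * d ^ 4 := by
        rw [show ρ ^ 4 * d ^ 4 = ρ ^ 2 * ρ ^ 2 * d ^ 4 by ring]
        gcongr
      have h5 : (ρ ^ 2 * q ^ 2 * d ^ 4) ^ m ≤ (ρ ^ 4 * d ^ 4) ^ m := by gcongr
      nlinarith
    have h6 : (c₀ * (ρ ^ 4 * d ^ 4) ^ m + 3 * c₀ * (ρ ^ 2 * q ^ 2 * d ^ 4) ^ m) ^ k ≤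
        (4 * c₀ * (ρ ^ 4 * d ^ 4) ^ m) ^ k := pow_le_pow_left₀ (by positivity) h4 k
    have h7 : (ρ ^ 2 * q ^ 2 * d ^ 4) ^ m * ((ρ ^ 4 * d ^ 4) ^ m) ^ k ≤
        d ^ (4 * m * (k + 1)) * ((ρ ^ (2 * (k + 1)) * q) ^ 2) ^ m := by
      have h8 : ρ ^ 2 ≤ ρ ^ 4 := pow_le_pow_right₀ hρ1.le (by norm_num)
      calc (ρ ^ 2 * q ^ 2 * d ^ 4) ^ m * ((ρ ^ 4 * d ^ 4) ^ m) ^ k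
          ≤ (ρ ^ 4 * q ^ 2 * d ^ 4) ^ m * ((ρ ^ 4 * d ^ 4) ^ m) ^ k := by gcongr
        _ = _ := by
          rw [show 4 * m * (k + 1) = 4 * (k + 1) * m by ring, pow_mul d, ← mul_pow, ← pow_mul,
            mul_comm m k, pow_mul _ k m, ← mul_pow]
          congr 1
          ring
    calc _ ≤ 3 * c₀ * (ρ ^ 2 * q ^ 2 * d ^ 4) ^ m * (4 * c₀ * (ρ ^ 4 * d ^ 4) ^ m) ^ k :=
          mul_le_mul_of_nonneg_left h6 (by positivity)
      _ = 3 * c₀ * (4 * c₀) ^ k * ((ρ ^ 2 * q ^ 2 * d ^ 4) ^ m * ((ρ ^ 4 * d ^ 4) ^ m) ^ k) := by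
          rw [mul_pow]; ring
      _ ≤ _ := mul_le_mul_of_nonneg_left h7 (by positivity)
  set B : ℝ := Fintype.card (ι × ι) * ((k + 1 : ℕ) * (3 * c₀ * (4 * c₀) ^ k))
  have hlim : Tendsto (fun m : ℕ => B / d ^ (2 * (k + 1)) * ((ρ ^ (2 * (k + 1)) * q) ^ 2) ^ m)
      atTop (𝓝 0) := by
    have := (tendsto_pow_atTop_nhds_zero_of_lt_one (r := (ρ ^ (2 * (k + 1)) * q) ^ 2)
      (by positivity) (pow_lt_one₀ (by positivity) hρ two_ne_zero)).const_mul
        (B / d ^ (2 * (k + 1)))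
    rwa [mul_zero] at this
  refine squeeze_zero_norm (fun m => ?_) hlim
  rw [norm_div, Complex.norm_real, Real.norm_of_nonneg (by positivity), div_le_iff₀ (by positivity)]
  refine (key m).trans (le_of_eq ?_)
  rw [show 2 * ((2 * m + 1) * (k + 1)) = 4 * m * (k + 1) + 2 * (k + 1) by ring, pow_add]
  field_simp

/-- A sequence of maps whose traces of even powers converge to those of a multiple eigenvalue has
no gap. -/
theorem not_frequently_hasGap {E : ℕ → (Matrix ι ι ℂ →ₗ[ℂ] Matrix ι ι ℂ)} {D : ℕ → ℝ} {c : ℝ}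
    (hD : ∀ m, 0 < D m) (hc : 4 ≤ c)
    (h : ∀ k, Even k → k ≠ 0 →
      Tendsto (fun m => LinearMap.trace ℂ _ (E m ^ k) / ((D m ^ k : ℝ) : ℂ)) atTop (𝓝 (c : ℂ)))
    {δ : ℝ} (hδ : δ < 1) : ¬ ∃ᶠ m in atTop, HasGap (E m) δ := by
  intro hfreq
  set N : ℝ := ((Fintype.card ι ^ 2 : ℕ) : ℝ)
  set δ' := max δ 0
  have hδ0 : 0 ≤ δ' := le_max_right _ _
  have hδ1 : δ' < 1 := max_lt hδ one_pos
  -- For this k all eigenvalues other than ν together amount to at most a tenth of |ν|^k in the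
  -- trace, and likewise at 2k.
  obtain ⟨k, hk0, hke, hk⟩ : ∃ k, k ≠ 0 ∧ Even k ∧ N * δ' ^ k ≤ 1 / 10 := by
    have h1 : Tendsto (fun k => N * δ' ^ k) atTop (𝓝 (N * 0)) :=
      (tendsto_pow_atTop_nhds_zero_of_lt_one hδ0 hδ1).const_mul N
    rw [mul_zero] at h1
    obtain ⟨k₀, hk₀⟩ := eventually_atTop.1 (h1.eventually_le_const (by norm_num : (0 : ℝ) < 1 / 10))
    exact ⟨2 * (k₀ + 1), by omega, ⟨k₀ + 1, by ring⟩, hk₀ _ (by omega)⟩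
  have hk2 : N * δ' ^ (2 * k) ≤ 1 / 10 :=
    (mul_le_mul_of_nonneg_left (pow_le_pow_of_le_one hδ0 hδ1.le (by omega))
      (Nat.cast_nonneg _)).trans hk
  have hn : ∀ j, Even j → j ≠ 0 → Tendsto (fun m =>
      ‖LinearMap.trace ℂ _ (E m ^ j) / ((D m ^ j : ℝ) : ℂ)‖) atTop (𝓝 c) := by
    intro j hj hj0
    have := (h j hj hj0).norm
    rwa [Complex.norm_real, Real.norm_of_nonneg (by linarith)] at this
  have e1 := (hn k hke hk0).eventually_const_lt (show c * (99 / 100) < c by linarith)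
  have e2 := (hn (2 * k) (even_two_mul k) (by omega)).eventually_lt_const
    (show c < c * (101 / 100) by linarith)
  obtain ⟨m, ⟨hgap, h1⟩, h2⟩ := ((hfreq.and_eventually e1).and_eventually e2).exists
  obtain ⟨ν, -, hν⟩ := hgap.norm_trace_pow_sub_le
  have hν1 := hν k
  have hν2 := hν (2 * k)
  rw [norm_div, Complex.norm_real, Real.norm_of_nonneg (pow_nonneg (hD m).le _)] at h1 h2
  rw [lt_div_iff₀ (pow_pos (hD m) _)] at h1
  rw [div_lt_iff₀ (pow_pos (hD m) _)] at h2
  change _ ≤ N * (δ' * ‖ν‖) ^ k at hν1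
  change _ ≤ N * (δ' * ‖ν‖) ^ (2 * k) at hν2
  rw [mul_pow, ← mul_assoc] at hν1 hν2
  set t₁ := LinearMap.trace ℂ _ (E m ^ k)
  set t₂ := LinearMap.trace ℂ _ (E m ^ (2 * k))
  have h3 : ‖t₁‖ ≤ ‖ν‖ ^ k + ‖ν‖ ^ k / 10 := by
    have := norm_le_norm_add_norm_sub' t₁ (ν ^ k)
    rw [norm_pow] at this
    have h5 := mul_le_mul_of_nonneg_right hk (pow_nonneg (norm_nonneg ν) k)
    linarith
  have h4 : ‖ν‖ ^ (2 * k) - ‖ν‖ ^ (2 * k) / 10 ≤ ‖t₂‖ := by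
    have := norm_le_norm_add_norm_sub t₂ (ν ^ (2 * k))
    rw [norm_pow] at this
    have h5 := mul_le_mul_of_nonneg_right hk2 (pow_nonneg (norm_nonneg ν) (2 * k))
    linarith
  have hz : ‖ν‖ ^ (2 * k) = (‖ν‖ ^ k) ^ 2 := by rw [← pow_mul, mul_comm]
  have hDz : D m ^ (2 * k) = (D m ^ k) ^ 2 := by rw [← pow_mul, mul_comm]
  rw [hz] at h4
  rw [hDz] at h2
  have hDk := pow_pos (hD m) k
  generalize ‖ν‖ ^ k = z at *
  generalize D m ^ k = w at *
  -- The power k gives z > 0.9 c w, the power 2k gives 0.9 z² < 1.01 c w². Together c < 1.4, against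
  -- c ≥ 4.
  have hz1 : c * (99 / 100) * w < 11 / 10 * z := by linarith
  have hcw : 0 < c * (99 / 100) * w := by positivity
  have hsq : (c * (99 / 100) * w) ^ 2 < (11 / 10 * z) ^ 2 := pow_lt_pow_left₀ hz1 hcw.le two_ne_zero
  have hup : z ^ 2 * (9 / 10) < c * (101 / 100) * w ^ 2 := by linarith
  have hw2 : 0 < w ^ 2 := by positivity
  nlinarith [mul_pos hw2 (by linarith : 0 < c),
      mul_nonneg (mul_nonneg hw2.le (by linarith : 0 ≤ c)) (by linarith : 0 ≤ c - 4)]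

end Renorm

/-! ### Convergence of the renormalized junk operators in the phase -/

section Ratio

variable {n : ℕ} {b : Matrix (Fin n) (Fin n) ℂ} {l : ℂ}

theorem ratio_nonneg (b : Matrix (Fin n) (Fin n) ℂ) (l : ℂ) : 0 ≤ ratio b l :=
  div_nonneg (Real.sSup_nonneg (by rintro _ ⟨μ, -, rfl⟩; exact norm_nonneg μ)) (norm_nonneg l)

theorem finite_norm_image (b : Matrix (Fin n) (Fin n) ℂ) (l : ℂ) :
    ((fun μ : ℂ => ‖μ‖) '' (spectrum ℂ b \ {l})).Finite :=
  (b.finite_spectrum.subset Set.sdiff_subset).image _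

theorem norm_le_ratio_mul (hl0 : l ≠ 0) {μ : ℂ} (hμ : μ ∈ spectrum ℂ b) (hne : μ ≠ l) :
    ‖μ‖ ≤ ratio b l * ‖l‖ := by
  rw [ratio, div_mul_cancel₀ _ (norm_ne_zero_iff.2 hl0)]
  exact le_csSup (finite_norm_image b l).bddAbove ⟨μ, ⟨hμ, hne⟩, rfl⟩

theorem IsLeading.ratio_lt_one (hl : IsLeading b l) (hl0 : l ≠ 0) : ratio b l < 1 := by
  rw [ratio, div_lt_one (norm_pos_iff.2 hl0)]
  -- Without another eigenvalue the supremum is that of the empty set, which is 0 by convention.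
  rcases Set.eq_empty_or_nonempty ((fun μ : ℂ => ‖μ‖) '' (spectrum ℂ b \ {l})) with h | h
  · rw [h, Real.sSup_empty]
    exact norm_pos_iff.2 hl0
  · obtain ⟨μ, hμ, he⟩ := h.csSup_mem (finite_norm_image b l)
    rw [← he]
    exact hl.2 μ hμ.1 hμ.2

theorem IsLeading.mem_spectrum (hl : IsLeading b l) : l ∈ spectrum ℂ b := by
  obtain ⟨v, hv0, hv, -⟩ := hl.exists_eigenvector
  exact mem_spectrum_of_eigenvector hv0 hv

end Ratio

theorem component_pow {n : ℕ} (a : Fin 3 → Matrix (Fin n) (Fin n) ℂ) (κ : Fin 3) (m : ℕ) :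
    component a κ ^ m = (pauli κ ^ m) ⊗ₖ (a κ ^ m) := by
  induction m with
  | zero => rw [pow_zero, pow_zero, pow_zero, Matrix.one_kronecker_one]
  | succ m ih => rw [pow_succ, pow_succ, pow_succ, ih, component, Matrix.mul_kronecker_mul]

theorem renorm_eq {n : ℕ} (a : Fin 3 → Matrix (Fin n) (Fin n) ℂ) (κ : Fin 3) (m : ℕ) (μ : Fin 3) :
    renorm a κ m μ = (pauli κ ^ m * pauli μ * pauli κ ^ m) ⊗ₖ renormJunk a κ m μ := by
  rw [renorm, renormJunk, component_pow, component, ← Matrix.mul_kronecker_mul,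
    ← Matrix.mul_kronecker_mul]

/-- If the leading eigenvalue were 0, a_z would be nilpotent and all long buffers would vanish, so
the buffered transfer maps would have no nonzero eigenvalue. -/
theorem leading_ne_zero {n : ℕ} {a : Fin 3 → Matrix (Fin n) (Fin n) ℂ} {l : ℂ}
    (hl : IsLeading (a 2) l) (h : FiniteRenormCorrelation a) : l ≠ 0 := by
  rintro rfl
  have hnil : a 2 ^ n = 0 := isNilpotent_of_spectrum fun μ hμ => by
    by_contra hμ0
    have := hl.2 μ hμ hμ0
    rw [norm_zero] at this
    exact absurd this (not_lt.2 (norm_nonneg μ))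
  obtain ⟨δ, -, hf⟩ := h
  obtain ⟨m, ⟨ν, hν, hm, -⟩, hmn⟩ := (hf.and_eventually (eventually_ge_atTop n)).exists
  have h0 : a 2 ^ m = 0 := by rw [← Nat.sub_add_cancel hmn, pow_add, hnil, mul_zero]
  have ht : transfer (renorm a 2 m) = 0 := by
    refine LinearMap.ext fun X => ?_
    change ∑ μ, renorm a 2 m μ * X * (renorm a 2 m μ)ᴴ = 0
    refine Finset.sum_eq_zero fun μ _ => ?_
    rw [renorm_eq, renormJunk, h0, mul_zero, Matrix.kronecker_zero, Matrix.zero_mul,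
      Matrix.zero_mul]
  rw [ht, LinearMap.charpoly_zero, ← Polynomial.count_roots, Polynomial.roots_X_pow,
    Multiset.count_nsmul, Multiset.count_singleton, if_neg hν, mul_zero] at hm
  exact zero_ne_one hm

section NonVanishing

variable {n : ℕ} {a : Fin 3 → Matrix (Fin n) (Fin n) ℂ} {l : ℂ} {P : Matrix (Fin n) (Fin n) ℂ}

/-- (b - l) P is nilpotent and commutes with b, so it contributes nothing to the trace. -/
theorem IsSpectralProjection.trace_pow_mul {b : Matrix (Fin n) (Fin n) ℂ}
    (hP : IsSpectralProjection b l P) (m : ℕ) : (b ^ m * P).trace = l ^ m * P.trace := by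
  induction m with
  | zero => rw [pow_zero, pow_zero, one_mul, one_mul]
  | succ m ih =>
    obtain ⟨k, hk⟩ := hP.nilpotent
    have hbP : Commute b P := hP.commute rfl
    have hlP : Commute (b - l • 1) P :=
      hbP.sub_left ((Commute.one_left P).smul_left l)
    have hlb : Commute b (b - l • 1) :=
      (Commute.refl b).sub_right ((Commute.one_right b).smul_right l)
    have h1 : IsNilpotent (b ^ m * ((b - l • 1) * P)) := by
      have h2 : IsNilpotent ((b - l • 1) * P) := by
        refine ⟨k + 1, ?_⟩
        rw [hlP.mul_pow, (show IsIdempotentElem P from hP.idem).pow_succ_eq, pow_succ', mul_assoc,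
          hk, mul_zero]
      exact ((hlb.mul_right hbP).pow_left m).isNilpotent_mul_left h2
    have h3 : (b ^ m * ((b - l • 1) * P)).trace = 0 :=
      (Matrix.isNilpotent_trace_of_isNilpotent h1).eq_zero
    rw [sub_mul, smul_mul_assoc, one_mul, mul_sub, mul_smul_comm, Matrix.trace_sub,
      Matrix.trace_smul, ih, sub_eq_zero, ← mul_assoc, ← pow_succ, smul_eq_mul] at h3
    rw [h3, pow_succ']
    ring

/-- The trace of an idempotent is its rank. -/
theorem IsSpectralProjection.one_le_norm_trace {b : Matrix (Fin n) (Fin n) ℂ}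
    (hP : IsSpectralProjection b l P) : 1 ≤ ‖P.trace‖ := by
  have hid : IsIdempotentElem (Matrix.toLin' P) := by
    rw [IsIdempotentElem, Module.End.mul_eq_comp, ← Matrix.toLin'_mul, hP.idem]
  have h1 : P.trace = (Module.finrank ℂ (LinearMap.range (Matrix.toLin' P)) : ℂ) := by
    rw [← Matrix.trace_toLin'_eq]
    exact (LinearMap.IsIdempotentElem.isProj_range _ hid).trace
  have h2 : Module.finrank ℂ (LinearMap.range (Matrix.toLin' P)) ≠ 0 := by
    rw [Ne, Submodule.finrank_eq_zero, LinearMap.range_eq_bot]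
    simpa using hP.ne_zero
  rw [h1, Complex.norm_natCast]
  exact_mod_cast Nat.one_le_iff_ne_zero.2 h2

open scoped Matrix.Norms.Operator in
theorem norm_pauli_pow_kronecker_le (κ : Fin 3) (m : ℕ) (M : Matrix (Fin n) (Fin n) ℂ) :
    ‖(pauli κ ^ m) ⊗ₖ M‖ ≤ (2 * n : ℕ) * ‖M‖ := by
  have := norm_le_of_entry_le (M := (pauli κ ^ m) ⊗ₖ M) (norm_nonneg M) fun i j => by
    rw [Matrix.kroneckerMap_apply, norm_mul]
    have h1 := entry_norm_bound_of_unitary (pow_mem (pauli_mem_unitaryGroup κ) m) i.1 j.1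
    calc _ ≤ 1 * ‖M‖ := mul_le_mul h1 (norm_entry_le M _ _) (norm_nonneg _) zero_le_one
      _ = ‖M‖ := one_mul _
  simpa using this

-- If both compressions vanished, long z-buffering would leave only the outcome z. The limiting map
-- is X ↦ B X B† with B = σ_z ⊗ (leading part of a_z^(2m+1)); its leading modulus is attained 4
-- (rank P)² times, which contradicts the gap.
open scoped Matrix.Norms.Operator in
theorem projection_conj_ne_zero (hl : IsLeading (a 2) l) (hP : IsSpectralProjection (a 2) l P)
    (hgap : FiniteRenormCorrelation a) (h01 : P * a 0 * P = P * a 1 * P) : P * a 0 * P ≠ 0 := by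
  intro h0
  rw [h0] at h01
  have hl0 := leading_ne_zero hl hgap
  have hd : 0 < ‖l‖ := norm_pos_iff.2 hl0
  have hbP : Commute (a 2) P := hP.commute rfl
  set Q : Matrix (Fin 2 × Fin n) (Fin 2 × Fin n) ℂ := 1 ⊗ₖ P with hQdef
  have hQ : Q * Q = Q := by rw [hQdef, ← Matrix.mul_kronecker_mul, hP.idem, mul_one]
  have hc : component a 2 * Q = Q * component a 2 := by
    rw [hQdef, component, ← Matrix.mul_kronecker_mul, ← Matrix.mul_kronecker_mul, hbP.eq, mul_one,
      one_mul]
  have hQx : ∀ μ, P * a μ * P = 0 → Q * component a μ * Q = 0 := by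
    intro μ hμ
    rw [hQdef, component, ← Matrix.mul_kronecker_mul, ← Matrix.mul_kronecker_mul, hμ,
      Matrix.kronecker_zero]
  have hr1 := hl.ratio_lt_one hl0
  have hr0 := ratio_nonneg (a 2) l
  set q := (1 + ratio (a 2) l) / 2 with hq
  have hq0 : 0 < q := by positivity
  have hq1 : q < 1 := by linarith
  have hα : ∀ ρ : ℝ, 1 < ρ → ∃ C : ℝ, ∀ m, ‖component a 2 ^ m * Q‖ ≤ C * (ρ * ‖l‖) ^ m := by
    intro ρ hρ
    obtain ⟨C, hC0, hC⟩ := exists_norm_pow_le (a 2) (ρ := ρ * ‖l‖) (by positivity) fun μ hμ => by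
      have h1 : ‖l‖ < ρ * ‖l‖ := by nlinarith
      rcases eq_or_ne μ l with rfl | hne
      · exact h1
      · exact (hl.2 μ hμ hne).trans h1
    refine ⟨(2 * n : ℕ) * (C * ‖P‖), fun m => ?_⟩
    rw [component_pow, hQdef, ← Matrix.mul_kronecker_mul, mul_one]
    refine (norm_pauli_pow_kronecker_le 2 m _).trans ?_
    rw [mul_assoc]
    refine mul_le_mul_of_nonneg_left ((norm_mul_le _ _).trans ?_) (Nat.cast_nonneg _)
    calc _ ≤ C * (ρ * ‖l‖) ^ m * ‖P‖ := mul_le_mul_of_nonneg_right (hC m) (norm_nonneg _)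
      _ = _ := by ring
  have hβ : ∃ C : ℝ, ∀ m, ‖component a 2 ^ m * (1 - Q)‖ ≤ C * (q * ‖l‖) ^ m := by
    obtain ⟨C, hC0, hC⟩ := exists_norm_pow_le (a 2 * (1 - P)) (ρ := q * ‖l‖) (by positivity)
      fun μ hμ => by
        rcases eq_or_ne μ 0 with rfl | h0
        · rw [norm_zero]; positivity
        · obtain ⟨h1, h2⟩ := hP.compl μ hμ h0
          refine (norm_le_ratio_mul hl0 h1 h2).trans_lt ?_
          exact mul_lt_mul_of_pos_right (by linarith) hd
    refine ⟨(2 * n : ℕ) * (C * ‖1 - P‖), fun m => ?_⟩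
    have h1Q : 1 - Q = (1 : Matrix (Fin 2) (Fin 2) ℂ) ⊗ₖ (1 - P) := by
      rw [← Matrix.one_kronecker_one, hQdef, sub_eq_iff_eq_add, ← Matrix.kronecker_add,
          sub_add_cancel]
    rw [component_pow, h1Q, ← Matrix.mul_kronecker_mul, mul_one, pow_mul_compl hP]
    refine (norm_pauli_pow_kronecker_le 2 m _).trans ?_
    rw [mul_assoc]
    refine mul_le_mul_of_nonneg_left ((norm_mul_le _ _).trans ?_) (Nat.cast_nonneg _)
    calc _ ≤ C * (q * ‖l‖) ^ m * ‖1 - P‖ := mul_le_mul_of_nonneg_right (hC m) (norm_nonneg _)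
      _ = _ := by ring
  obtain ⟨δ, hδ, hf⟩ := hgap
  -- D m is the modulus of the leading eigenvalues of X ↦ B X B†. The factor 4 in c is the squared
  -- dimension of the qubit.
  refine not_frequently_hasGap (E := fun m => transfer (renorm a 2 m))
    (D := fun m => ‖l‖ ^ (2 * (2 * m + 1))) (c := 4 * ‖P.trace‖ ^ 2) (fun m => by positivity)
    (by nlinarith [hP.one_le_norm_trace]) ?_ hδ hf
  intro k hk hk0
  obtain ⟨j, rfl⟩ := Nat.exists_eq_succ_of_ne_zero hk0
  have hlim := tendsto_trace_transfer_buffered (component a) hQ hc (hQx 0 h0) (hQx 1 h01.symm) hd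
    hq0 hq1 hα hβ j
  have htr : ∀ m, (component a 2 ^ ((2 * m + 1) * (j + 1)) * Q).trace =
      2 * (l ^ ((2 * m + 1) * (j + 1)) * P.trace) := by
    intro m
    -- Only even powers are used: for odd ones the qubit factor would be σ_z, with trace 0.
    have he : pauli 2 ^ ((2 * m + 1) * (j + 1)) = 1 := by
      obtain ⟨i, hi⟩ := hk.mul_left (2 * m + 1)
      rw [show (2 * m + 1) * (j + 1) = 2 * i by rw [← two_mul] at hi; exact hi, pow_mul, sq,
        pauli_mul_self, one_pow]
    rw [component_pow, he, hQdef, ← Matrix.mul_kronecker_mul, mul_one, Matrix.trace_kronecker,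
      hP.trace_pow_mul]
    simp
  have hlim2 := hlim.add_const ((4 * ‖P.trace‖ ^ 2 : ℝ) : ℂ)
  rw [zero_add] at hlim2
  refine hlim2.congr fun m => ?_
  rw [htr, ← pow_mul, show 2 * (2 * m + 1) * j.succ = 2 * ((2 * m + 1) * (j + 1)) by
    rw [Nat.succ_eq_add_one]; ring, sub_div]
  have hne : ((‖l‖ ^ (2 * ((2 * m + 1) * (j + 1))) : ℝ) : ℂ) ≠ 0 := by
    exact_mod_cast (pow_pos hd _).ne'
  have h2 : ((‖2 * (l ^ ((2 * m + 1) * (j + 1)) * P.trace)‖ ^ 2 : ℝ) : ℂ) /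
      ((‖l‖ ^ (2 * ((2 * m + 1) * (j + 1))) : ℝ) : ℂ) = ((4 * ‖P.trace‖ ^ 2 : ℝ) : ℂ) := by
    rw [div_eq_iff hne, ← Complex.ofReal_mul, norm_mul, norm_mul, norm_pow, Complex.norm_ofNat,
      mul_pow, mul_pow, ← pow_mul, mul_comm _ 2]
    congr 1
    ring
  rw [h2, sub_add_cancel]
  rfl

end NonVanishing

section Symmetry

variable {D n : ℕ} {A : Fin 3 → Matrix (Fin D) (Fin D) ℂ} {Λ : Matrix (Fin D) (Fin D) ℂ}
  {U : Octahedral → Matrix (Fin D) (Fin D) ℂ} {V : Matrix (Fin D) (Fin 2 × Fin n) ℂ}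
  {a : Fin 3 → Matrix (Fin n) (Fin n) ℂ}

/-- The Pauli matrices and the components A_μ are rotated in the same way, so the sign c occurs on
both sides and cancels: the junk operators are permuted without signs. -/
theorem IsProtectedJunk.exists_unitary_conj (hA : InSPTOPhase A Λ U) (h : IsProtectedJunk A U V a)
    (g : Octahedral) : ∃ w : Matrix (Fin n) (Fin n) ℂ, w * wᴴ = 1 ∧ ∀ (μ ν : Fin 3) (c : ℂ),
      c ≠ 0 → (∀ ν', spinOne g ν' μ = if ν' = ν then c else 0) → w * a μ * wᴴ = a ν := by
  obtain ⟨s, hs, w, hw, hVU, hsp⟩ := h.symmetry g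
  refine ⟨w, (Matrix.mem_unitaryGroup_iff).1 hw, fun μ ν c hc hg => ?_⟩
  have hsum : ∀ {m : Type} (M : Fin 3 → Matrix m m ℂ), ∑ ν', spinOne g ν' μ • M ν' = c • M ν := by
    intro m M
    simp_rw [hg, ite_smul, zero_smul, Finset.sum_ite_eq', Finset.mem_univ, if_true]
  have h1 := congrArg (fun M => Vᴴ * M * V) (hA.invariant g μ)
  simp only [hsum] at h1
  have h2 : Vᴴ * (U g * A μ * (U g)ᴴ) * V = (Vᴴ * U g * V) * (Vᴴ * A μ * V) * (Vᴴ * U g * V)ᴴ := by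
    rw [Matrix.conjTranspose_mul, Matrix.conjTranspose_mul, Matrix.conjTranspose_conjTranspose]
    have h3 : ∀ {p : Type} [Fintype p] (X : Matrix (Fin D) p ℂ), V * (Vᴴ * X) = X :=
      fun X => by rw [← Matrix.mul_assoc, h.coisometry, Matrix.one_mul]
    simp only [Matrix.mul_assoc, h3]
  rw [h2, hVU, h.components, component, Matrix.mul_smul, Matrix.smul_mul, h.components, component,
    Matrix.conjTranspose_kronecker, ← Matrix.mul_kronecker_mul, ← Matrix.mul_kronecker_mul, hsp,
    hsum, ← Matrix.smul_kronecker] at h1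
  exact (pauli_kronecker_injective (smul_ne_zero hc (pauli_ne_zero ν)) h1).symm

theorem IsProtectedJunk.exists_conj_renormJunk (hA : InSPTOPhase A Λ U)
    (h : IsProtectedJunk A U V a) : ∃ w : Matrix (Fin n) (Fin n) ℂ, wᴴ * w = 1 ∧
      ∀ (κ : Fin 3) (m : ℕ) (μ : Fin 3),
        w * renormJunk a κ m μ * wᴴ = renormJunk a (κ + 1) m (μ + 1) := by
  obtain ⟨w, hw, hwa⟩ := h.exists_unitary_conj hA octC
  have hw' : wᴴ * w = 1 := mul_eq_one_comm.1 hw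
  have hc : ∀ μ, w * a μ * wᴴ = a (μ + 1) := fun μ => hwa μ (μ + 1) 1 one_ne_zero (by
    intro ν'
    fin_cases μ <;> fin_cases ν' <;> simp [spinOne, octC])
  have hpow : ∀ x m, w * x ^ m * wᴴ = (w * x * wᴴ) ^ m := by
    intro x m
    induction m with
    | zero => rw [pow_zero, pow_zero, mul_one, hw]
    | succ m ih =>
      rw [pow_succ, pow_succ, ← ih]
      simp only [mul_assoc]
      rw [← mul_assoc wᴴ w, hw', one_mul]
  refine ⟨w, hw', fun κ m μ => ?_⟩
  rw [renormJunk, renormJunk, ← hc, ← hc, ← hpow]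
  have h3 : ∀ X, wᴴ * (w * X) = X := fun X => by rw [← mul_assoc, hw', one_mul]
  simp only [mul_assoc, h3]

/-- The 3-fold rotation relates the axes by a junk unitary. A common Hilbert–Schmidt norm allows one
success probability for all axes. -/
theorem IsProtectedJunk.trace_renormJunk (hA : InSPTOPhase A Λ U) (h : IsProtectedJunk A U V a)
    (κ : Fin 3) (m : ℕ) : ((renormJunk a κ m (κ + 1))ᴴ * renormJunk a κ m (κ + 1)).trace =
      ((renormJunk a 2 m 0)ᴴ * renormJunk a 2 m 0).trace := by
  obtain ⟨w, hw, hren⟩ := h.exists_conj_renormJunk hA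
  have step : ∀ κ, ((renormJunk a (κ + 1) m (κ + 1 + 1))ᴴ *
      renormJunk a (κ + 1) m (κ + 1 + 1)).trace
      = ((renormJunk a κ m (κ + 1))ᴴ * renormJunk a κ m (κ + 1)).trace := by
    intro κ
    have h3 : ∀ X, wᴴ * (w * X) = X := fun X => by rw [← mul_assoc, hw, one_mul]
    rw [← hren, Matrix.conjTranspose_mul, Matrix.conjTranspose_mul,
      Matrix.conjTranspose_conjTranspose]
    simp only [mul_assoc, h3]
    rw [Matrix.trace_mul_comm]
    simp only [mul_assoc, hw, mul_one]
  have h2 := step 2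
  have h0 := step 0
  fin_cases κ
  · exact h2
  · exact h0.trans h2
  · rfl

/-- The axis z is treated with the rotation that exchanges x and y; the other axes follow by
conjugation with the unitary of the 3-fold rotation, with the same scalars s. -/
theorem IsProtectedJunk.exists_junkLimit (hA : InSPTOPhase A Λ U) (h : IsProtectedJunk A U V a)
    {l : ℂ} (hl : IsLeading (a 2) l) (hgap : FiniteRenormCorrelation a) (κ : Fin 3) :
    ∃ T s, JunkLimit (fun m => renormJunk a κ m (κ + 1)) (fun m => renormJunk a κ m (κ + 2)) l
      (ratio (a 2) l) T s := by
  have hl0 := leading_ne_zero hl hgap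
  have h2 : ∃ T s, JunkLimit (fun m => renormJunk a 2 m 0) (fun m => renormJunk a 2 m 1) l
      (ratio (a 2) l) T s := by
    obtain ⟨P, hP⟩ := exists_isSpectralProjection hl.mem_spectrum
    obtain ⟨w, hw, hwa⟩ := h.exists_unitary_conj hA octT
    have hw' : wᴴ * w = 1 := mul_eq_one_comm.1 hw
    have hmul : ∀ x y, w * x * wᴴ = y → w * x = y * w := by
      rintro x _ rfl
      rw [mul_assoc _ wᴴ w, hw', mul_one]
    -- The junk unitary of `octT` takes a_x to a_y and commutes with a_z, as required by
    -- `projection_conj_eq`.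
    have e0 := hmul _ _ (hwa 0 1 (-1) (by norm_num) (by intro ν'; fin_cases ν' <;> simp [spinOne,
        octT]))
    have e2 := hmul _ _ (hwa 2 2 (-1) (by norm_num) (by intro ν'; fin_cases ν' <;> simp [spinOne,
        octT]))
    have hxy := projection_conj_eq hl hP hw e2 e0
    exact MPS.exists_junkLimit hP hl0 (ratio_nonneg _ _) (hl.ratio_lt_one hl0)
      (fun μ hμ hne => norm_le_ratio_mul hl0 hμ hne) hxy (projection_conj_ne_zero hl hP hgap hxy)
  have step : ∀ κ, (∃ T s, JunkLimit (fun m => renormJunk a κ m (κ + 1))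
      (fun m => renormJunk a κ m (κ + 2)) l (ratio (a 2) l) T s) →
      ∃ T s, JunkLimit (fun m => renormJunk a (κ + 1) m (κ + 1 + 1))
      (fun m => renormJunk a (κ + 1) m (κ + 1 + 2)) l (ratio (a 2) l) T s := by
    rintro κ ⟨T, s, hJ⟩
    obtain ⟨w, hw', hren⟩ := h.exists_conj_renormJunk hA
    refine ⟨w * T * wᴴ, s, ?_⟩
    have := hJ.conj hw'
    simp only [hren] at this
    rwa [add_right_comm κ 2 1] at this
  fin_cases κ
  · exact step 2 h2
  · exact step 0 (step 2 h2)
  · exact h2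

end Symmetry

/-! ### Expectation values of positive operators -/

/-- The real part of `tr (M X)`. -/
def weight {ι : Type*} [Fintype ι] (M X : Matrix ι ι ℂ) : ℝ := (M * X).trace.re

section Weight

variable {ι : Type*} [Fintype ι]

theorem weight_comm (M X : Matrix ι ι ℂ) : weight M X = weight X M := by
  rw [weight, weight, Matrix.trace_mul_comm]

theorem weight_add_left (M N X : Matrix ι ι ℂ) : weight (M + N) X = weight M X + weight N X := by
  rw [weight, Matrix.add_mul, Matrix.trace_add, Complex.add_re, weight, weight]

theorem weight_add_right (M X Y : Matrix ι ι ℂ) : weight M (X + Y) = weight M X + weight M Y := by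
  rw [weight_comm, weight_add_left, weight_comm X, weight_comm Y]

theorem weight_sum_right {α : Type*} (s : Finset α) (M : Matrix ι ι ℂ) (X : α → Matrix ι ι ℂ) :
    weight M (∑ i ∈ s, X i) = ∑ i ∈ s, weight M (X i) := by
  simp_rw [weight, Matrix.mul_sum, Matrix.trace_sum, Complex.re_sum]

theorem weight_sum_left {α : Type*} (s : Finset α) (M : α → Matrix ι ι ℂ) (X : Matrix ι ι ℂ) :
    weight (∑ i ∈ s, M i) X = ∑ i ∈ s, weight (M i) X := by
  simp_rw [weight, Matrix.sum_mul, Matrix.trace_sum, Complex.re_sum]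

theorem weight_smul_left (c : ℝ) (M X : Matrix ι ι ℂ) :
    weight ((c : ℂ) • M) X = c * weight M X := by
  rw [weight, Matrix.smul_mul, Matrix.trace_smul, smul_eq_mul, Complex.re_ofReal_mul, weight]

theorem weight_conj (M K X : Matrix ι ι ℂ) : weight M (K * X * Kᴴ) = weight (Kᴴ * M * K) X := by
  rw [weight, weight, Matrix.mul_assoc Kᴴ, Matrix.mul_assoc Kᴴ, Matrix.trace_mul_comm Kᴴ]
  simp only [Matrix.mul_assoc]

theorem weight_one_left [DecidableEq ι] (X : Matrix ι ι ℂ) : weight 1 X = X.trace.re := by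
  rw [weight, Matrix.one_mul]

open scoped MatrixOrder in
theorem exists_eq_conjTranspose_mul_self {M : Matrix ι ι ℂ} (hM : M.PosSemidef) :
    ∃ B : Matrix ι ι ℂ, M = Bᴴ * B := by
  classical
  exact CStarAlgebra.nonneg_iff_eq_star_mul_self.mp hM.nonneg

/-- A trace of a product of positive matrices is a squared Hilbert–Schmidt norm; positivity and the
Cauchy–Schwarz bound follow from this form. -/
theorem weight_gram (B C : Matrix ι ι ℂ) :
    weight (Bᴴ * B) (Cᴴ * C) = ∑ i, ∑ j, ‖(B * Cᴴ) i j‖ ^ 2 := by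
  have : (Bᴴ * B * (Cᴴ * C)).trace = ((B * Cᴴ) * (B * Cᴴ)ᴴ).trace := by
    rw [Matrix.conjTranspose_mul, Matrix.conjTranspose_conjTranspose, Matrix.mul_assoc,
      Matrix.trace_mul_comm]
    simp only [Matrix.mul_assoc]
  rw [weight, this, Matrix.trace, Complex.re_sum]
  refine Finset.sum_congr rfl fun i _ => ?_
  rw [Matrix.diag_apply, Matrix.mul_apply, Complex.re_sum]
  refine Finset.sum_congr rfl fun j _ => ?_
  rw [Matrix.conjTranspose_apply, Complex.star_def, Complex.mul_conj']
  norm_cast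

theorem trace_gram (B : Matrix ι ι ℂ) : (Bᴴ * B).trace.re = ∑ i, ∑ j, ‖B i j‖ ^ 2 := by
  classical
  have h := weight_gram B 1
  rwa [Matrix.conjTranspose_one, Matrix.mul_one, Matrix.mul_one, weight, Matrix.mul_one] at h

theorem weight_nonneg {M X : Matrix ι ι ℂ} (hM : M.PosSemidef) (hX : X.PosSemidef) :
    0 ≤ weight M X := by
  obtain ⟨B, rfl⟩ := exists_eq_conjTranspose_mul_self hM
  obtain ⟨C, rfl⟩ := exists_eq_conjTranspose_mul_self hX
  rw [weight_gram]
  positivity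

theorem trace_re_nonneg {X : Matrix ι ι ℂ} (hX : X.PosSemidef) : 0 ≤ X.trace.re := by
  classical
  rw [← weight_one_left]
  exact weight_nonneg .one hX

theorem weight_le_weight {M N X : Matrix ι ι ℂ} (h : (N - M).PosSemidef) (hX : X.PosSemidef) :
    weight M X ≤ weight N X := by
  have h1 := weight_nonneg h hX
  have h2 := weight_add_left (N - M) M X
  rw [sub_add_cancel] at h2
  linarith

theorem weight_le_trace_mul_trace {M X : Matrix ι ι ℂ} (hM : M.PosSemidef) (hX : X.PosSemidef) :
    weight M X ≤ M.trace.re * X.trace.re := by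
  obtain ⟨B, rfl⟩ := exists_eq_conjTranspose_mul_self hM
  obtain ⟨C, rfl⟩ := exists_eq_conjTranspose_mul_self hX
  rw [weight_gram, trace_gram, trace_gram, Finset.sum_mul_sum]
  refine Finset.sum_le_sum fun i _ => Finset.sum_le_sum fun j _ => ?_
  have h1 : ‖(B * Cᴴ) i j‖ ≤ ∑ k, ‖B i k‖ * ‖C j k‖ := by
    rw [Matrix.mul_apply]
    refine (norm_sum_le _ _).trans (le_of_eq ?_)
    simp
  exact (pow_le_pow_left₀ (norm_nonneg _) h1 2).trans (Finset.sum_mul_sq_le_sq_mul_sq _ _ _)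

theorem norm_entry_le_trace {X : Matrix ι ι ℂ} (hX : X.PosSemidef) (i j : ι) :
    ‖X i j‖ ≤ X.trace.re := by
  classical
  obtain ⟨B, rfl⟩ := exists_eq_conjTranspose_mul_self hX
  have hcol : ∀ j, ∑ k, ‖B k j‖ ^ 2 ≤ (Bᴴ * B).trace.re := by
    intro j
    rw [trace_gram, Finset.sum_comm]
    exact Finset.single_le_sum (f := fun j => ∑ k, ‖B k j‖ ^ 2)
      (fun _ _ => by positivity) (Finset.mem_univ j)
  rw [Matrix.mul_apply]
  have h1 : ‖∑ k, Bᴴ i k * B k j‖ ≤ ∑ k, (‖B k i‖ ^ 2 + ‖B k j‖ ^ 2) / 2 := by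
    refine (norm_sum_le _ _).trans (Finset.sum_le_sum fun k _ => ?_)
    rw [norm_mul, Matrix.conjTranspose_apply, norm_star]
    nlinarith [sq_nonneg (‖B k i‖ - ‖B k j‖)]
  rw [← Finset.sum_div, Finset.sum_add_distrib] at h1
  linarith [hcol i, hcol j]

/-- With M = B†B, write X = B⁻¹ (B X B†) B⁻¹†: the middle factor has trace tr(M X), and the outer
ones contribute tr M⁻¹. -/
theorem trace_le_mul_weight [DecidableEq ι] {M X : Matrix ι ι ℂ} (hM : M.PosDef)
    (hX : X.PosSemidef) : X.trace.re ≤ (M⁻¹).trace.re * weight M X := by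
  obtain ⟨B, hB⟩ := exists_eq_conjTranspose_mul_self hM.posSemidef
  have hu : IsUnit (Bᴴ * B) := hB ▸ hM.isUnit
  have hdet : IsUnit B.det := by
    rw [Matrix.isUnit_iff_isUnit_det, Matrix.det_mul] at hu
    exact isUnit_of_mul_isUnit_right hu
  have h1 : weight M X = (B * X * Bᴴ).trace.re := by
    rw [← weight_one_left, weight_conj, Matrix.mul_one, hB]
  have h2 : X.trace.re = weight (M⁻¹) (M * X) := by
    rw [weight, ← Matrix.mul_assoc, Matrix.nonsing_inv_mul _ ((Matrix.isUnit_iff_isUnit_det _).1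
      hM.isUnit), Matrix.one_mul]
  have h3 : X = B⁻¹ * (B * X * Bᴴ) * (B⁻¹)ᴴ := by
    have h4 : Bᴴ * (B⁻¹)ᴴ = 1 := by
      rw [← Matrix.conjTranspose_mul, Matrix.nonsing_inv_mul _ hdet, Matrix.conjTranspose_one]
    rw [Matrix.mul_assoc _ _ (B⁻¹)ᴴ, Matrix.mul_assoc _ Bᴴ, h4, Matrix.mul_one, ← Matrix.mul_assoc,
      Matrix.nonsing_inv_mul _ hdet, Matrix.one_mul]
  have h5 : X.trace.re = weight ((B⁻¹)ᴴ * B⁻¹) (B * X * Bᴴ) := by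
    conv_lhs => rw [h3]
    rw [← weight_one_left, weight_conj, Matrix.mul_one]
  have h6 : M⁻¹.trace = ((B⁻¹)ᴴ * B⁻¹).trace := by
    rw [hB, Matrix.mul_inv_rev, Matrix.trace_mul_comm, Matrix.conjTranspose_nonsing_inv]
  rw [h5, h1, h6]
  exact weight_le_trace_mul_trace (Matrix.posSemidef_conjTranspose_mul_self _)
    (hX.mul_mul_conjTranspose_same B)

theorem weight_pos [DecidableEq ι] {M X : Matrix ι ι ℂ} (hM : M.PosDef) (hX : X.PosSemidef)
    (h0 : X ≠ 0) : 0 < weight M X := by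
  have h1 : 0 < X.trace.re := by
    refine lt_of_le_of_ne (trace_re_nonneg hX) fun h => h0 ?_
    ext i j
    have := norm_entry_le_trace hX i j
    rw [← h] at this
    exact norm_le_zero_iff.1 this
  have h2 := trace_le_mul_weight hM hX
  have h3 := weight_nonneg hM.posSemidef hX
  refine lt_of_le_of_ne h3 fun h => ?_
  rw [← h, mul_zero] at h2
  linarith

/-- The parallelogram law, without one of the terms. -/
theorem weight_add_conj_le {M X : Matrix ι ι ℂ} (hM : M.PosSemidef) (hX : X.PosSemidef)
    (K L : Matrix ι ι ℂ) : weight M ((K + L) * X * (K + L)ᴴ) ≤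
      2 * weight M (K * X * Kᴴ) + 2 * weight M (L * X * Lᴴ) := by
  have h1 := weight_nonneg hM (hX.mul_mul_conjTranspose_same (K - L))
  have h2 : (K + L) * X * (K + L)ᴴ + (K - L) * X * (K - L)ᴴ =
      (K * X * Kᴴ + K * X * Kᴴ) + (L * X * Lᴴ + L * X * Lᴴ) := by
    rw [Matrix.conjTranspose_add, Matrix.conjTranspose_sub]
    simp only [Matrix.add_mul, Matrix.mul_add, Matrix.sub_mul, Matrix.mul_sub]
    abel
  have h3 := congrArg (weight M) h2
  simp only [weight_add_right] at h3
  linarith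

end Weight

/-! ### Mixing of the transfer map -/

section Mixing

variable {ι : Type*} [Fintype ι] [DecidableEq ι] {A : Fin 3 → Matrix ι ι ℂ} {Λ : Matrix ι ι ℂ}

theorem transfer_apply (A : Fin 3 → Matrix ι ι ℂ) (X : Matrix ι ι ℂ) :
    transfer A X = ∑ μ, A μ * X * (A μ)ᴴ := rfl

theorem trace_mul_transfer {Y : Matrix ι ι ℂ} (hY : ∑ μ, (A μ)ᴴ * Y * A μ = Y)
    (X : Matrix ι ι ℂ) : (Y * transfer A X).trace = (Y * X).trace := by
  conv_rhs => rw [← hY]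
  rw [transfer_apply, Finset.mul_sum, Finset.sum_mul, Matrix.trace_sum, Matrix.trace_sum]
  refine Finset.sum_congr rfl fun μ _ => ?_
  rw [mul_assoc (A μ)ᴴ, mul_assoc (A μ)ᴴ, Matrix.trace_mul_comm (A μ)ᴴ]
  simp only [mul_assoc]

theorem trace_mul_transfer_pow {Y : Matrix ι ι ℂ} (hY : ∑ μ, (A μ)ᴴ * Y * A μ = Y)
    (X : Matrix ι ι ℂ) (k : ℕ) : (Y * (transfer A ^ k) X).trace = (Y * X).trace := by
  induction k with
  | zero => rfl
  | succ k ih => rw [pow_succ', Module.End.mul_apply, trace_mul_transfer hY, ih]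

theorem transfer_conjTranspose (A : Fin 3 → Matrix ι ι ℂ) (X : Matrix ι ι ℂ) :
    (transfer A X)ᴴ = transfer A Xᴴ := by
  rw [transfer_apply, transfer_apply, Matrix.conjTranspose_sum]
  refine Finset.sum_congr rfl fun μ _ => ?_
  rw [Matrix.conjTranspose_mul, Matrix.conjTranspose_mul, Matrix.conjTranspose_conjTranspose,
    mul_assoc]

/-- The Kadison–Schwarz inequality. -/
theorem IsCanonical.schwarz (h : IsCanonical A Λ) (X : Matrix ι ι ℂ) :
    (transfer A (X * Xᴴ) - transfer A X * (transfer A X)ᴴ).PosSemidef := by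
  set Y := transfer A X with hY
  have h1 : transfer A (X * Xᴴ) - Y * Yᴴ =
      ∑ μ, (A μ * X - Y * A μ) * (A μ * X - Y * A μ)ᴴ := by
    have e1 : ∀ μ, (A μ * X - Y * A μ) * (A μ * X - Y * A μ)ᴴ =
        A μ * (X * Xᴴ) * (A μ)ᴴ - (A μ * X * (A μ)ᴴ) * Yᴴ - Y * (A μ * Xᴴ * (A μ)ᴴ) +
          Y * (A μ * 1 * (A μ)ᴴ) * Yᴴ := by
      intro μ
      rw [Matrix.conjTranspose_sub, Matrix.conjTranspose_mul, Matrix.conjTranspose_mul]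
      simp only [mul_sub, sub_mul, mul_assoc, one_mul]
      abel
    simp_rw [e1]
    rw [Finset.sum_add_distrib, Finset.sum_sub_distrib, Finset.sum_sub_distrib, ← Finset.sum_mul,
      ← Finset.mul_sum, ← Finset.sum_mul, ← Finset.mul_sum, ← transfer_apply, ← transfer_apply,
      ← transfer_apply, ← transfer_apply, h.right_fixed, ← transfer_conjTranspose, ← hY, mul_one]
    abel
  rw [h1]
  exact Matrix.posSemidef_sum _ fun μ _ => Matrix.posSemidef_self_mul_conjTranspose _

/-- Pair the Kadison–Schwarz inequality for an eigenvector X with the invariant Λ: |ν|² tr(Λ X X†) ≤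
tr(Λ X X†), and the trace is positive because Λ is faithful. -/
theorem IsCanonical.norm_le_one (h : IsCanonical A Λ) {ν : ℂ} {X : Matrix ι ι ℂ} (hX : X ≠ 0)
    (hν : transfer A X = ν • X) : ‖ν‖ ≤ 1 := by
  have h1 := weight_nonneg h.posDef.posSemidef (h.schwarz X)
  have hpos : 0 < weight Λ (X * Xᴴ) :=
    weight_pos h.posDef (Matrix.posSemidef_self_mul_conjTranspose X)
      (by rwa [Ne, Matrix.self_mul_conjTranspose_eq_zero])
  have h2 : transfer A X * (transfer A X)ᴴ = ((‖ν‖ ^ 2 : ℝ) : ℂ) • (X * Xᴴ) := by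
    rw [hν, Matrix.conjTranspose_smul, smul_mul_smul_comm, Complex.star_def, Complex.mul_conj',
      Complex.ofReal_pow]
  have h3 : weight Λ (transfer A (X * Xᴴ)) = weight Λ (X * Xᴴ) := by
    rw [weight, weight, trace_mul_transfer h.left_fixed]
  have h4 := weight_add_right Λ (transfer A (X * Xᴴ) - transfer A X * (transfer A X)ᴴ)
    (transfer A X * (transfer A X)ᴴ)
  rw [sub_add_cancel, h3, h2, weight_comm Λ (((‖ν‖ ^ 2 : ℝ) : ℂ) • (X * Xᴴ)), weight_smul_left,
    weight_comm _ Λ] at h4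
  rw [h2] at h1
  have h5 : ‖ν‖ ^ 2 * weight Λ (X * Xᴴ) ≤ 1 * weight Λ (X * Xᴴ) := by linarith
  have h6 := le_of_mul_le_mul_right h5 hpos
  exact (sq_le_one_iff₀ (norm_nonneg ν)).1 h6

/-- The deviation of the transfer map from its limit. -/
def transferDefect (A : Fin 3 → Matrix ι ι ℂ) (Λ : Matrix ι ι ℂ) :
    Module.End ℂ (Matrix ι ι ℂ) where
  toFun X := transfer A X - (Λ * X).trace • 1
  map_add' X Y := by
    rw [map_add, mul_add, Matrix.trace_add, add_smul]
    abel
  map_smul' c X := by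
    rw [map_smul, Matrix.mul_smul, Matrix.trace_smul, RingHom.id_apply, smul_sub, smul_assoc]

theorem transferDefect_apply (X : Matrix ι ι ℂ) :
    transferDefect A Λ X = transfer A X - (Λ * X).trace • 1 := rfl

theorem IsCanonical.trace_mul_transferDefect (h : IsCanonical A Λ) (X : Matrix ι ι ℂ) :
    (Λ * transferDefect A Λ X).trace = 0 := by
  rw [transferDefect_apply, mul_sub, Matrix.trace_sub, trace_mul_transfer h.left_fixed,
    Matrix.mul_smul, mul_one, Matrix.trace_smul, h.trace_eq, smul_eq_mul, mul_one, sub_self]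

/-- The range of the defect is annihilated by tr(Λ ·), so an eigenvector with nonzero eigenvalue is
an eigenvector of the transfer map itself. Modulus one would make it a scalar matrix, and a scalar
annihilated by tr(Λ ·) is 0. -/
theorem IsCanonical.transferDefect_eigenvalue (h : IsCanonical A Λ) (hs : IsShortRange A) {ν : ℂ}
    {X : Matrix ι ι ℂ} (hX : X ≠ 0) (hν : transferDefect A Λ X = ν • X) : ‖ν‖ < 1 := by
  rcases eq_or_ne ν 0 with rfl | hν0
  · simp
  have h0 : (Λ * X).trace = 0 := by
    have := h.trace_mul_transferDefect X
    rw [hν, Matrix.mul_smul, Matrix.trace_smul] at this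
    exact (smul_eq_zero.1 this).resolve_left hν0
  rw [transferDefect_apply, h0, zero_smul, sub_zero] at hν
  refine lt_of_le_of_ne (h.norm_le_one hX hν) fun h1 => ?_
  obtain ⟨c, rfl⟩ := hs ν X h1 hν
  rw [Matrix.mul_smul, mul_one, Matrix.trace_smul, h.trace_eq, smul_eq_mul, mul_one] at h0
  exact hX (by rw [h0, zero_smul])

/-- The defect and the projection X ↦ tr(Λ X) 1 annihilate each other, so cross terms vanish. The
zeroth power has to be excluded. -/
theorem IsCanonical.transfer_pow_eq (h : IsCanonical A Λ) (X : Matrix ι ι ℂ) (k : ℕ) :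
    (transfer A ^ (k + 1)) X = (transferDefect A Λ ^ (k + 1)) X + (Λ * X).trace • 1 := by
  induction k with
  | zero => rw [zero_add, pow_one, pow_one, transferDefect_apply, sub_add_cancel]
  | succ k ih =>
    have h1 : (Λ * (transferDefect A Λ ^ (k + 1)) X).trace = 0 := by
      rw [pow_succ', Module.End.mul_apply, h.trace_mul_transferDefect]
    rw [pow_succ', Module.End.mul_apply, ih, map_add, map_smul, h.right_fixed,
      pow_succ' (transferDefect A Λ) (k + 1), Module.End.mul_apply,
      transferDefect_apply ((transferDefect A Λ ^ (k + 1)) X), h1, zero_smul, sub_zero]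

open scoped Matrix.Norms.Operator in
/-- Powers of an operator on matrices whose eigenvalues have modulus less than one decay. -/
theorem exists_norm_end_pow_le (f : Module.End ℂ (Matrix ι ι ℂ))
    (hf : ∀ (ν : ℂ) (X : Matrix ι ι ℂ), X ≠ 0 → f X = ν • X → ‖ν‖ < 1) :
    ∃ C ρ : ℝ, 0 ≤ C ∧ 0 ≤ ρ ∧ ρ < 1 ∧ ∀ (k : ℕ) (X : Matrix ι ι ℂ) (x : ℝ), (∀ i j, ‖X i j‖ ≤ x) →
      ∀ i j, ‖(f ^ k) X i j‖ ≤ C * ρ ^ k * x := by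
  set e := vecEquiv ι
  set M := LinearMap.toMatrix' (e.conj f) with hM
  have hMf : ∀ X, M *ᵥ e X = e (f X) := fun X => by
    rw [hM, LinearMap.toMatrix'_mulVec, LinearEquiv.conj_apply, LinearMap.comp_apply,
      LinearMap.comp_apply, LinearEquiv.coe_coe, LinearEquiv.coe_coe, LinearEquiv.symm_apply_apply]
  have hMk : ∀ k X, M ^ k *ᵥ e X = e ((f ^ k) X) := fun k X => by
    induction k generalizing X with
    | zero => rw [pow_zero, pow_zero, Matrix.one_mulVec, Module.End.one_apply]
    | succ k ih => rw [pow_succ, ← Matrix.mulVec_mulVec, hMf, ih, pow_succ, Module.End.mul_apply]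
  have hsp : ∀ ν ∈ spectrum ℂ M, ‖ν‖ < 1 := by
    intro ν hν
    rw [← Matrix.spectrum_toLin', ← Module.End.hasEigenvalue_iff_mem_spectrum] at hν
    obtain ⟨v, hv⟩ := hν.exists_hasEigenvector
    have hv1 : M *ᵥ v = ν • v := by simpa using hv.apply_eq_smul
    obtain ⟨X, rfl⟩ := e.surjective v
    rw [hMf, ← map_smul] at hv1
    exact hf ν X (fun h0 => hv.2 (by rw [h0, map_zero])) (e.injective hv1)
  obtain ⟨ρ, hρ0, hρ1, hρ⟩ : ∃ ρ : ℝ, 0 < ρ ∧ ρ < 1 ∧ ∀ ν ∈ spectrum ℂ M, ‖ν‖ < ρ := by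
    have hfin : ((fun ν : ℂ => ‖ν‖) '' spectrum ℂ M).Finite := M.finite_spectrum.image _
    rcases Set.eq_empty_or_nonempty (spectrum ℂ M) with h0 | hne
    · exact ⟨1 / 2, by norm_num, by norm_num, by simp [h0]⟩
    · have hmem := (hne.image (fun ν : ℂ => ‖ν‖)).csSup_mem hfin
      obtain ⟨ν, hν, he⟩ := hmem
      have h1 := hsp ν hν
      have hle : ∀ ν' ∈ spectrum ℂ M, ‖ν'‖ ≤ ‖ν‖ := fun ν' hν' => by
        have := le_csSup hfin.bddAbove ⟨ν', hν', rfl⟩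
        rwa [← he] at this
      exact ⟨(1 + ‖ν‖) / 2, by positivity, by linarith, fun ν' hν' => by linarith [hle ν' hν']⟩
  obtain ⟨C, hC0, hC⟩ := exists_norm_pow_le M hρ0 hρ
  refine ⟨Fintype.card (ι × ι) * C, ρ, by positivity, hρ0.le, hρ1, fun k X x hx i j => ?_⟩
  have hx0 : 0 ≤ x := (norm_nonneg _).trans (hx i j)
  have h1 : (f ^ k) X i j = (M ^ k *ᵥ e X) (j, i) := by rw [hMk]; rfl
  rw [h1, Matrix.mulVec, dotProduct]
  refine (norm_sum_le _ _).trans ?_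
  have h2 : ∀ p : ι × ι, ‖(M ^ k) (j, i) p * e X p‖ ≤ C * ρ ^ k * x := by
    intro p
    rw [norm_mul]
    exact mul_le_mul ((norm_entry_le _ _ _).trans (hC k)) (hx p.2 p.1) (norm_nonneg _)
      (by positivity)
  refine (Finset.sum_le_sum fun p _ => h2 p).trans (le_of_eq ?_)
  rw [Finset.sum_const, Finset.card_univ, nsmul_eq_mul]
  ring

/-- High powers of the transfer map send X to nearly tr(Λ X) 1. The error is bounded by a multiple
of tr S · tr X, and tr X is at most a multiple of tr(Λ X), so the error is relative to the main
term. Hence k₀ depends neither on X nor on S, which matters because the success observable becomes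
exponentially small as the buffers grow. -/
theorem IsCanonical.exists_mixing (h : IsCanonical A Λ) (hs : IsShortRange A) :
    ∃ k₀ : ℕ, ∀ k ≥ k₀, ∀ X S : Matrix ι ι ℂ, X.PosSemidef → S.PosSemidef →
      weight Λ X * S.trace.re / 2 ≤ weight S ((transfer A ^ k) X) := by
  obtain ⟨C, ρ, hC0, hρ0, hρ1, hC⟩ := exists_norm_end_pow_le (transferDefect A Λ)
    fun ν X hX hν => h.transferDefect_eigenvalue hs hX hν
  set c := (Λ⁻¹).trace.re
  set N : ℝ := ((Fintype.card ι ^ 2 : ℕ) : ℝ) with hN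
  have hlim : Tendsto (fun k => N * C * c * ρ ^ k) atTop (𝓝 (N * C * c * 0)) :=
    (tendsto_pow_atTop_nhds_zero_of_lt_one hρ0 hρ1).const_mul _
  rw [mul_zero] at hlim
  obtain ⟨k₀, hk₀⟩ := eventually_atTop.1 (hlim.eventually_le_const (by norm_num : (0 : ℝ) < 1 / 2))
  refine ⟨k₀ + 1, fun k hk X S hX hS => ?_⟩
  obtain ⟨j, rfl⟩ : ∃ j, k = j + 1 := ⟨k - 1, by omega⟩
  have hk := hk₀ (j + 1) (by omega)
  rw [h.transfer_pow_eq, weight_add_right]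
  have h1 : weight S ((Λ * X).trace • 1) = weight Λ X * S.trace.re := by
    have hr : (Λ * X).trace = ((weight Λ X : ℝ) : ℂ) := by
      obtain ⟨B, hB⟩ := exists_eq_conjTranspose_mul_self h.posDef.posSemidef
      have hp : 0 ≤ (Λ * X).trace := by
        rw [hB, mul_assoc, Matrix.trace_mul_comm]
        exact (hX.mul_mul_conjTranspose_same B).trace_nonneg
      exact Complex.eq_re_of_ofReal_le hp
    rw [hr, weight_comm, weight_smul_left, weight_one_left]
  have h2 : ‖(S * (transferDefect A Λ ^ (j + 1)) X).trace‖ ≤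
      N * (S.trace.re * (C * ρ ^ (j + 1) * X.trace.re)) := by
    rw [Matrix.trace]
    refine (norm_sum_le _ _).trans ?_
    have h3 : ∀ i, ‖(S * (transferDefect A Λ ^ (j + 1)) X).diag i‖ ≤
        Fintype.card ι * (S.trace.re * (C * ρ ^ (j + 1) * X.trace.re)) := by
      intro i
      rw [Matrix.diag_apply, Matrix.mul_apply]
      refine (norm_sum_le _ _).trans ?_
      refine (Finset.sum_le_sum (g := fun _ => S.trace.re * (C * ρ ^ (j + 1) * X.trace.re))
        fun l _ => ?_).trans (le_of_eq ?_)
      · rw [norm_mul]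
        exact mul_le_mul (norm_entry_le_trace hS i l) (hC _ X _ (norm_entry_le_trace hX) l i)
          (norm_nonneg _) (trace_re_nonneg hS)
      · rw [Finset.sum_const, Finset.card_univ, nsmul_eq_mul]
    refine (Finset.sum_le_sum fun i _ => h3 i).trans (le_of_eq ?_)
    rw [Finset.sum_const, Finset.card_univ, nsmul_eq_mul, hN]
    push_cast
    ring
  have h4 : -weight S ((transferDefect A Λ ^ (j + 1)) X) ≤
      N * (S.trace.re * (C * ρ ^ (j + 1) * X.trace.re)) :=
    (neg_le_abs _).trans ((Complex.abs_re_le_norm _).trans h2)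
  have h5 : N * (S.trace.re * (C * ρ ^ (j + 1) * X.trace.re)) ≤
      1 / 2 * (S.trace.re * weight Λ X) := by
    have h6 := trace_le_mul_weight h.posDef hX
    have hS0 := trace_re_nonneg hS
    have hw := weight_nonneg h.posDef.posSemidef hX
    calc N * (S.trace.re * (C * ρ ^ (j + 1) * X.trace.re))
        ≤ N * (S.trace.re * (C * ρ ^ (j + 1) * (c * weight Λ X))) := by gcongr
      _ = (N * C * c * ρ ^ (j + 1)) * (S.trace.re * weight Λ X) := by ring
      _ ≤ _ := by gcongr
  rw [h1]
  linarith

/-- The left fixed point is unique. -/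
theorem IsCanonical.eq_of_left_fixed (h : IsCanonical A Λ) (hs : IsShortRange A)
    {Y : Matrix ι ι ℂ} (hY : ∑ μ, (A μ)ᴴ * Y * A μ = Y) : Y = Y.trace • Λ := by
  obtain ⟨C, ρ, hC0, hρ0, hρ1, hC⟩ := exists_norm_end_pow_le (transferDefect A Λ)
    fun ν X hX hν => h.transferDefect_eigenvalue hs hX hν
  -- An invariant functional is unchanged by any number of steps, while the iterates of X tend to
  -- tr(Λ X) 1.
  have key : ∀ X : Matrix ι ι ℂ, (Y * X).trace = (Λ * X).trace * Y.trace := by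
    intro X
    have h1 : ∀ k, (Y * X).trace - (Λ * X).trace * Y.trace =
        (Y * (transferDefect A Λ ^ (k + 1)) X).trace := by
      intro k
      have := trace_mul_transfer_pow hY X (k + 1)
      rw [h.transfer_pow_eq, mul_add, Matrix.trace_add, Matrix.mul_smul, mul_one,
        Matrix.trace_smul, smul_eq_mul] at this
      rw [← this, add_sub_cancel_right]
    have h2 : Tendsto (fun k => (transferDefect A Λ ^ (k + 1)) X) atTop (𝓝 0) := by
      refine tendsto_pi_nhds.2 fun i => tendsto_pi_nhds.2 fun j => ?_
      obtain ⟨x, hx⟩ : ∃ x : ℝ, ∀ i j, ‖X i j‖ ≤ x := by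
        refine ⟨∑ i, ∑ j, ‖X i j‖, fun i j => ?_⟩
        exact (Finset.single_le_sum (f := fun j => ‖X i j‖) (fun _ _ => norm_nonneg _)
          (Finset.mem_univ j)).trans (Finset.single_le_sum (f := fun i => ∑ j, ‖X i j‖)
            (fun _ _ => by positivity) (Finset.mem_univ i))
      refine squeeze_zero_norm (fun k => hC (k + 1) X x hx i j) ?_
      have h3 := ((tendsto_pow_atTop_nhds_zero_of_lt_one hρ0 hρ1).comp
        (tendsto_add_atTop_nat 1)).const_mul C |>.mul_const x
      simpa using h3
    have h4 : Tendsto (fun k => (Y * (transferDefect A Λ ^ (k + 1)) X).trace) atTop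
        (𝓝 (Y * 0).trace) := by
      have hcont : Continuous fun Z : Matrix ι ι ℂ => (Y * Z).trace := by fun_prop
      exact (hcont.tendsto 0).comp h2
    rw [mul_zero, Matrix.trace_zero] at h4
    have h5 := tendsto_nhds_unique (h4.congr fun k => (h1 k).symm) tendsto_const_nhds
    exact sub_eq_zero.1 h5.symm
  refine Matrix.ext_iff_trace_mul_right.2 fun X => ?_
  rw [key, Matrix.smul_mul, Matrix.trace_smul, smul_eq_mul, mul_comm]

end Mixing

/-! ### The fixed point on protected space ⊗ junk space -/

section FixedPoint

variable {D n : ℕ} {A : Fin 3 → Matrix (Fin D) (Fin D) ℂ} {Λ : Matrix (Fin D) (Fin D) ℂ}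
  {U : Octahedral → Matrix (Fin D) (Fin D) ℂ} {V : Matrix (Fin D) (Fin 2 × Fin n) ℂ}
  {a : Fin 3 → Matrix (Fin n) (Fin n) ℂ}

theorem IsProtectedJunk.mul_cancel (h : IsProtectedJunk A U V a) {p : Type*}
    (X : Matrix (Fin D) p ℂ) : V * (Vᴴ * X) = X := by
  rw [← Matrix.mul_assoc, h.coisometry, Matrix.one_mul]

theorem IsProtectedJunk.mul_cancel' (h : IsProtectedJunk A U V a) {p : Type*}
    (X : Matrix (Fin 2 × Fin n) p ℂ) : Vᴴ * (V * X) = X := by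
  rw [← Matrix.mul_assoc, h.isometry, Matrix.one_mul]

theorem IsProtectedJunk.conjTranspose_component (h : IsProtectedJunk A U V a) (μ : Fin 3) :
    (component a μ)ᴴ = Vᴴ * (A μ)ᴴ * V := by
  rw [← h.components, Matrix.conjTranspose_mul, Matrix.conjTranspose_mul,
    Matrix.conjTranspose_conjTranspose, Matrix.mul_assoc]

theorem IsProtectedJunk.transfer_component (h : IsProtectedJunk A U V a)
    (X : Matrix (Fin 2 × Fin n) (Fin 2 × Fin n) ℂ) :
    transfer (component a) X = Vᴴ * transfer A (V * X * Vᴴ) * V := by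
  rw [transfer_apply, transfer_apply, Matrix.mul_sum, Matrix.sum_mul]
  refine Finset.sum_congr rfl fun μ _ => ?_
  rw [h.conjTranspose_component, ← h.components]
  simp only [Matrix.mul_assoc]

theorem IsProtectedJunk.isCanonical (h : IsProtectedJunk A U V a) (hA : IsCanonical A Λ) :
    IsCanonical (component a) (Vᴴ * Λ * V) where
  right_fixed := by
    rw [h.transfer_component, Matrix.mul_one, h.coisometry, hA.right_fixed, Matrix.mul_one,
      h.isometry]
  left_fixed := by
    conv_rhs => rw [← hA.left_fixed]
    rw [Matrix.mul_sum, Matrix.sum_mul]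
    refine Finset.sum_congr rfl fun μ _ => ?_
    rw [h.conjTranspose_component, ← h.components]
    simp only [Matrix.mul_assoc, h.mul_cancel]
  posDef := by
    refine hA.posDef.conjTranspose_mul_mul_same ?_
    intro x y hxy
    have := congrArg (Vᴴ *ᵥ ·) hxy
    simpa only [Matrix.mulVec_mulVec, h.isometry, Matrix.one_mulVec] using this
  trace_eq := by
    rw [Matrix.mul_assoc, Matrix.trace_mul_comm, Matrix.mul_assoc, h.coisometry, Matrix.mul_one,
      hA.trace_eq]

theorem IsProtectedJunk.isShortRange (h : IsProtectedJunk A U V a) (hA : IsShortRange A) :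
    IsShortRange (component a) := by
  intro ν X hν hX
  rw [h.transfer_component] at hX
  have h1 : transfer A (V * X * Vᴴ) = ν • (V * X * Vᴴ) := by
    have := congrArg (fun Y => V * Y * Vᴴ) hX
    simp only [Matrix.mul_assoc, h.mul_cancel] at this
    rw [h.coisometry, Matrix.mul_one] at this
    simpa [Matrix.mul_assoc] using this
  obtain ⟨c, hc⟩ := hA ν _ hν h1
  refine ⟨c, ?_⟩
  have := congrArg (fun Y => Vᴴ * Y * V) hc
  simp only [Matrix.mul_assoc, h.mul_cancel', h.isometry, Matrix.mul_one] at this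
  simpa [h.isometry] using this

/-- A left fixed point is trivial on the protected space. -/
structure IsJunkFixedPoint {n : ℕ} (a : Fin 3 → Matrix (Fin n) (Fin n) ℂ)
    (L : Matrix (Fin n) (Fin n) ℂ) : Prop where
  fixed : ∑ μ, (a μ)ᴴ * L * a μ = L
  posSemidef : L.PosSemidef

theorem conjTranspose_component (a : Fin 3 → Matrix (Fin n) (Fin n) ℂ) (μ : Fin 3) :
    (component a μ)ᴴ = pauli μ ⊗ₖ (a μ)ᴴ := by
  rw [component, Matrix.conjTranspose_kronecker, pauli_conjTranspose]

/-- Conjugation by σ_κ ⊗ 1 changes the components only by signs, so it maps left fixed points to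
left fixed points of the same trace. By uniqueness the fixed point commutes with the qubit algebra.
-/
theorem exists_isJunkFixedPoint {Y : Matrix (Fin 2 × Fin n) (Fin 2 × Fin n) ℂ}
    (h : IsCanonical (component a) Y) (hs : IsShortRange (component a)) :
    ∃ L, Y = 1 ⊗ₖ L ∧ IsJunkFixedPoint a L := by
  have hcomm : ∀ κ, (pauli κ ⊗ₖ (1 : Matrix (Fin n) (Fin n) ℂ)) * Y *
      (pauli κ ⊗ₖ (1 : Matrix (Fin n) (Fin n) ℂ)) = Y := by
    intro κ
    set S := pauli κ ⊗ₖ (1 : Matrix (Fin n) (Fin n) ℂ) with hS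
    have hSS : S * S = 1 := by
      rw [hS, ← Matrix.mul_kronecker_mul, pauli_mul_self, Matrix.mul_one, Matrix.one_kronecker_one]
    have hSc : ∀ μ, S * component a μ * S = (if κ = μ then (1 : ℂ) else -1) • component a μ := by
      intro μ
      rw [hS, component, ← Matrix.mul_kronecker_mul, ← Matrix.mul_kronecker_mul,
        pauli_mul_pauli_mul_pauli, Matrix.mul_one, Matrix.one_mul, Matrix.smul_kronecker]
    have hSc' : ∀ μ, S * (component a μ)ᴴ * S =
        (if κ = μ then (1 : ℂ) else -1) • (component a μ)ᴴ := by
      intro μ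
      rw [hS, conjTranspose_component, ← Matrix.mul_kronecker_mul, ← Matrix.mul_kronecker_mul,
        pauli_mul_pauli_mul_pauli, Matrix.mul_one, Matrix.one_mul, Matrix.smul_kronecker]
    have hfix : ∑ μ, (component a μ)ᴴ * (S * Y * S) * component a μ = S * Y * S := by
      conv_rhs => rw [← h.left_fixed]
      rw [Finset.mul_sum, Finset.sum_mul]
      refine Finset.sum_congr rfl fun μ _ => ?_
      have e1 : (component a μ)ᴴ * S = S * (S * (component a μ)ᴴ * S) := by
        simp only [← mul_assoc, hSS, one_mul]
      have e2 : S * component a μ = (S * component a μ * S) * S := by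
        simp only [mul_assoc, hSS, mul_one]
      calc (component a μ)ᴴ * (S * Y * S) * component a μ
          = ((component a μ)ᴴ * S) * Y * (S * component a μ) := by simp only [mul_assoc]
        _ = S * ((component a μ)ᴴ * Y * component a μ) * S := by
            rw [e1, e2, hSc, hSc']
            simp only [Matrix.mul_smul, Matrix.smul_mul, smul_smul, mul_assoc]
            split_ifs <;> simp
    have := h.eq_of_left_fixed hs hfix
    rwa [mul_assoc, Matrix.trace_mul_comm, mul_assoc, hSS, mul_one, h.trace_eq, one_smul,
      ← mul_assoc] at this
  have hcomm' : ∀ κ, Y * (pauli κ ⊗ₖ (1 : Matrix (Fin n) (Fin n) ℂ)) =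
      (pauli κ ⊗ₖ (1 : Matrix (Fin n) (Fin n) ℂ)) * Y := by
    intro κ
    have hSS : (pauli κ ⊗ₖ (1 : Matrix (Fin n) (Fin n) ℂ)) *
        (pauli κ ⊗ₖ (1 : Matrix (Fin n) (Fin n) ℂ)) = 1 := by
      rw [← Matrix.mul_kronecker_mul, pauli_mul_self, Matrix.mul_one, Matrix.one_kronecker_one]
    conv_lhs => rw [← hcomm κ]
    rw [mul_assoc, hSS, mul_one]
  obtain ⟨L, hL⟩ := exists_one_kronecker_of_commute (hcomm' 0).symm (hcomm' 2).symm
  refine ⟨L, hL, ?_, ?_⟩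
  · have h1 := h.left_fixed
    rw [hL] at h1
    have h2 : ∀ μ, (component a μ)ᴴ * (1 ⊗ₖ L) * component a μ = 1 ⊗ₖ ((a μ)ᴴ * L * a μ) := by
      intro μ
      rw [conjTranspose_component, component, ← Matrix.mul_kronecker_mul,
        ← Matrix.mul_kronecker_mul, mul_one, pauli_mul_self]
    simp_rw [h2] at h1
    have h3 : ∑ μ, (1 : Matrix (Fin 2) (Fin 2) ℂ) ⊗ₖ ((a μ)ᴴ * L * a μ) =
        1 ⊗ₖ (∑ μ, (a μ)ᴴ * L * a μ) := by
      rw [Fin.sum_univ_three, Fin.sum_univ_three, Matrix.kronecker_add, Matrix.kronecker_add]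
    rw [h3] at h1
    exact pauli_kronecker_injective one_ne_zero h1
  · have h1 := h.posDef.posSemidef.submatrix (fun i : Fin n => ((0 : Fin 2), i))
    have h2 : Y.submatrix (fun i : Fin n => ((0 : Fin 2), i)) (fun i : Fin n => ((0 : Fin 2), i)) =
        L := by
      rw [hL]
      ext i j
      simp
    rwa [h2] at h1

end FixedPoint

/-! ### Deviation from the target state -/

section Orth

/-- The projection onto the orthogonal complement of the unit vector `φ`. -/
def orth (φ : Fin 2 → ℂ) : Matrix (Fin 2) (Fin 2) ℂ := 1 - Matrix.vecMulVec φ (star φ)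

theorem orth_mul_self {φ : Fin 2 → ℂ} (hφ : star φ ⬝ᵥ φ = 1) : orth φ * orth φ = orth φ := by
  have : Matrix.vecMulVec φ (star φ) * Matrix.vecMulVec φ (star φ) =
      Matrix.vecMulVec φ (star φ) := by
    rw [Matrix.vecMulVec_mul_vecMulVec, hφ, one_smul]
  rw [orth, mul_sub, sub_mul, sub_mul, this, one_mul, mul_one, one_mul, sub_self, sub_zero]

theorem orth_conjTranspose (φ : Fin 2 → ℂ) : (orth φ)ᴴ = orth φ := by
  rw [orth, Matrix.conjTranspose_sub, Matrix.conjTranspose_one, Matrix.conjTranspose_vecMulVec,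
    star_star]

theorem orth_posSemidef {φ : Fin 2 → ℂ} (hφ : star φ ⬝ᵥ φ = 1) : (orth φ).PosSemidef := by
  have := Matrix.posSemidef_conjTranspose_mul_self (orth φ)
  rwa [orth_conjTranspose, orth_mul_self hφ] at this

theorem orth_smul {c : ℂ} (hc : ‖c‖ = 1) (φ : Fin 2 → ℂ) : orth (c • φ) = orth φ := by
  rw [orth, star_smul, Matrix.smul_vecMulVec, Matrix.vecMulVec_smul, smul_smul, Complex.star_def,
    Complex.mul_conj', hc, Complex.ofReal_one, one_pow, one_smul, orth]

theorem orth_mulVec {G : Matrix (Fin 2) (Fin 2) ℂ} (hG : G * Gᴴ = 1) (φ : Fin 2 → ℂ) :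
    orth (G *ᵥ φ) = G * orth φ * Gᴴ := by
  rw [orth, orth, mul_sub, sub_mul, mul_one, hG, Matrix.star_mulVec, Matrix.mul_vecMulVec,
    Matrix.vecMulVec_mul]

theorem star_mulVec_dotProduct {G : Matrix (Fin 2) (Fin 2) ℂ} (hG : Gᴴ * G = 1) {φ : Fin 2 → ℂ}
    (hφ : star φ ⬝ᵥ φ = 1) : star (G *ᵥ φ) ⬝ᵥ (G *ᵥ φ) = 1 := by
  rw [Matrix.star_mulVec, ← Matrix.dotProduct_mulVec, Matrix.mulVec_mulVec, hG, Matrix.one_mulVec,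
    hφ]

variable {n : ℕ}

theorem weight_orth_conj {G : Matrix (Fin 2) (Fin 2) ℂ} (hG : G ∈ Matrix.unitaryGroup (Fin 2) ℂ)
    (φ : Fin 2 → ℂ) (k M : Matrix (Fin n) (Fin n) ℂ)
    (X : Matrix (Fin 2 × Fin n) (Fin 2 × Fin n) ℂ) :
    weight (orth (G *ᵥ φ) ⊗ₖ M) ((G ⊗ₖ k) * X * (G ⊗ₖ k)ᴴ) = weight (orth φ ⊗ₖ (kᴴ * M * k)) X := by
  have h1 := Matrix.mem_unitaryGroup_iff.1 hG
  have h2 := Matrix.mem_unitaryGroup_iff'.1 hG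
  rw [Matrix.star_eq_conjTranspose] at h1 h2
  rw [weight_conj, Matrix.conjTranspose_kronecker, ← Matrix.mul_kronecker_mul,
    ← Matrix.mul_kronecker_mul, orth_mulVec h1]
  congr 2
  rw [mul_assoc, mul_assoc (G * orth φ), h2, mul_one, ← mul_assoc, h2, one_mul]

theorem weight_orth_le {φ : Fin 2 → ℂ} {M : Matrix (Fin n) (Fin n) ℂ}
    (hM : M.PosSemidef) {X : Matrix (Fin 2 × Fin n) (Fin 2 × Fin n) ℂ} (hX : X.PosSemidef) :
    weight (orth φ ⊗ₖ M) X ≤ weight (1 ⊗ₖ M) X := by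
  refine weight_le_weight ?_ hX
  have : (1 : Matrix (Fin 2) (Fin 2) ℂ) ⊗ₖ M - orth φ ⊗ₖ M = Matrix.vecMulVec φ (star φ) ⊗ₖ M := by
    rw [orth, sub_eq_iff_eq_add, ← Matrix.add_kronecker]
    abel_nf
  rw [this]
  exact (Matrix.posSemidef_vecMulVec_self_star φ).kronecker hM

theorem trace_traceJunk_mul (M : Matrix (Fin 2 × Fin n) (Fin 2 × Fin n) ℂ)
    (N : Matrix (Fin 2) (Fin 2) ℂ) :
    (traceJunk M * N).trace = ((N ⊗ₖ (1 : Matrix (Fin n) (Fin n) ℂ)) * M).trace := by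
  rw [Matrix.trace_mul_comm]
  simp only [Matrix.trace, Matrix.diag_apply, Matrix.mul_apply, traceJunk, Matrix.of_apply,
    Fintype.sum_prod_type, Matrix.kroneckerMap_apply, Matrix.one_apply, mul_ite, mul_one, mul_zero,
    ite_mul, zero_mul, Finset.sum_ite_eq, Finset.mem_univ, if_true, Finset.mul_sum]
  refine Finset.sum_congr rfl fun i _ => ?_
  exact Finset.sum_comm

theorem productState_posSemidef (ψ : Fin 2 → ℂ) {ρJ : Matrix (Fin n) (Fin n) ℂ}
    (hρ : ρJ.PosSemidef) : (productState ψ ρJ).PosSemidef :=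
  (Matrix.posSemidef_vecMulVec_self_star ψ).kronecker hρ

theorem trace_productState {ψ : Fin 2 → ℂ} (hψ : star ψ ⬝ᵥ ψ = 1)
    {ρJ : Matrix (Fin n) (Fin n) ℂ} (hρ : ρJ.trace = 1) : (productState ψ ρJ).trace = 1 := by
  rw [productState, Matrix.trace_kronecker, hρ, Matrix.trace_vecMulVec, dotProduct_comm, hψ,
    one_mul]

theorem trace_eq_ofReal {ι : Type*} [Fintype ι] {X : Matrix ι ι ℂ} (hX : X.PosSemidef) :
    X.trace = ((X.trace.re : ℝ) : ℂ) :=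
  Complex.eq_re_of_ofReal_le (r := 0) (by simpa using hX.trace_nonneg)

/-- The infidelity is linear in the unnormalized final state: the expectation of the projection onto
the complement of the target vector. The estimates can thus be made with `weight`. -/
theorem one_sub_gateFidelity {ψ : Fin 2 → ℂ} {ρJ : Matrix (Fin n) (Fin n) ℂ}
    (hρ : ρJ.PosSemidef) (K : Matrix (Fin 2 × Fin n) (Fin 2 × Fin n) ℂ)
    (G : Matrix (Fin 2) (Fin 2) ℂ) (h0 : (K * productState ψ ρJ * Kᴴ).trace.re ≠ 0) :
    1 - gateFidelity K G ψ ρJ = weight (orth (G *ᵥ ψ) ⊗ₖ 1) (K * productState ψ ρJ * Kᴴ) /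
      (K * productState ψ ρJ * Kᴴ).trace.re := by
  have hY := (productState_posSemidef ψ hρ).mul_mul_conjTranspose_same K
  have h1 : G * Matrix.vecMulVec ψ (star ψ) * Gᴴ = 1 - orth (G *ᵥ ψ) := by
    rw [orth, sub_sub_cancel, Matrix.star_mulVec, Matrix.mul_vecMulVec, Matrix.vecMulVec_mul]
  have h2 : (1 - orth (G *ᵥ ψ)) ⊗ₖ (1 : Matrix (Fin n) (Fin n) ℂ) =
      1 - orth (G *ᵥ ψ) ⊗ₖ (1 : Matrix (Fin n) (Fin n) ℂ) := by
    rw [eq_sub_iff_add_eq, ← Matrix.add_kronecker, sub_add_cancel, Matrix.one_kronecker_one]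
  rw [gateFidelity, trace_traceJunk_mul, h1, h2]
  generalize K * productState ψ ρJ * Kᴴ = Y at *
  obtain ⟨t, ht⟩ : ∃ t : ℝ, Y.trace = t := ⟨_, trace_eq_ofReal hY⟩
  rw [ht, Complex.ofReal_re] at h0 ⊢
  rw [Matrix.mul_smul, Matrix.trace_smul, smul_eq_mul, ← Complex.ofReal_inv, Complex.re_ofReal_mul,
    sub_mul, one_mul, Matrix.trace_sub, Complex.sub_re, ht, Complex.ofReal_re, ← weight]
  field_simp
  ring

end Orth

/-! ### Buffered rotations -/

theorem kronecker_sub {m n : Type*} (M : Matrix m m ℂ) (N N' : Matrix n n ℂ) :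
    M ⊗ₖ (N - N') = M ⊗ₖ N - M ⊗ₖ N' := by
  ext i j
  simp [mul_sub]

theorem sub_kronecker {m n : Type*} (M M' : Matrix m m ℂ) (N : Matrix n n ℂ) :
    (M - M') ⊗ₖ N = M ⊗ₖ N - M' ⊗ₖ N := by
  ext i j
  simp [sub_mul]

theorem pauli_mul_rotation_left (κ : Fin 3) (θ : ℝ) : pauli (κ + 1) * rotation κ θ =
    (Real.cos (θ / 2) : ℂ) • pauli (κ + 1) - (Real.sin (θ / 2) : ℂ) • pauli (κ + 2) := by
  ext i j
  fin_cases κ <;> fin_cases i <;> fin_cases j <;>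
    simp [rotation, pauli, Matrix.mul_apply, mul_comm, mul_left_comm, ← mul_assoc]

theorem pauli_mul_rotation_right (κ : Fin 3) (θ : ℝ) : pauli (κ + 2) * rotation κ θ =
    (Real.sin (θ / 2) : ℂ) • pauli (κ + 1) + (Real.cos (θ / 2) : ℂ) • pauli (κ + 2) := by
  ext i j
  fin_cases κ <;> fin_cases i <;> fin_cases j <;>
    simp [rotation, pauli, Matrix.mul_apply, mul_comm, mul_left_comm, ← mul_assoc] <;>
    linear_combination (-Complex.sin (θ / 2)) * Complex.I_sq

theorem rotation_conjTranspose_mul (κ : Fin 3) (θ : ℝ) :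
    (rotation κ θ)ᴴ * rotation κ θ = 1 := by
  have h : (Real.cos (θ / 2) : ℂ) * Real.cos (θ / 2) + Real.sin (θ / 2) * Real.sin (θ / 2) = 1 := by
    rw [← sq, ← sq]
    exact_mod_cast Real.cos_sq_add_sin_sq (θ / 2)
  rw [rotation, Matrix.conjTranspose_sub, Matrix.conjTranspose_smul, Matrix.conjTranspose_smul,
    Matrix.conjTranspose_one, pauli_conjTranspose]
  generalize (Real.cos (θ / 2)) = x at *
  generalize (Real.sin (θ / 2)) = y at *
  simp only [sub_mul, mul_sub, Matrix.smul_mul, Matrix.mul_smul, mul_one, one_mul, pauli_mul_self,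
    smul_smul, star_mul', Complex.star_def, Complex.conj_I, Complex.conj_ofReal]
  rw [show (1 : Matrix (Fin 2) (Fin 2) ℂ) = ((x : ℂ) * x + y * y) • 1 by rw [h, one_smul]]
  match_scalars
  all_goals first
    | ring1
    | linear_combination ((x : ℂ) * x + y * y) * h - ((x : ℂ) * x + y * y) * (y * y) * Complex.I_sq

theorem rotation_mem_unitaryGroup (κ : Fin 3) (θ : ℝ) :
    rotation κ θ ∈ Matrix.unitaryGroup (Fin 2) ℂ :=
  Matrix.mem_unitaryGroup_iff'.2 (rotation_conjTranspose_mul κ θ)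

theorem pauli_pow_conj {κ μ : Fin 3} (h : μ ≠ κ) (m : ℕ) :
    pauli κ ^ m * pauli μ * pauli κ ^ m = (-1 : ℂ) ^ m • pauli μ := by
  induction m with
  | zero => simp
  | succ m ih =>
    calc pauli κ ^ (m + 1) * pauli μ * pauli κ ^ (m + 1)
        = pauli κ * (pauli κ ^ m * pauli μ * pauli κ ^ m) * pauli κ := by
          rw [pow_succ', mul_assoc, mul_assoc, ← pow_succ', pow_succ]
          simp only [mul_assoc]
      _ = _ := by
          rw [ih, Matrix.mul_smul, Matrix.smul_mul, pauli_mul_pauli_mul_pauli, if_neg h.symm,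
            smul_smul, pow_succ]

theorem outcomeOp_rotBasis_left {ι : Type*} (A : Fin 3 → Matrix ι ι ℂ) (κ : Fin 3) (θ : ℝ) :
    outcomeOp A (rotBasis κ θ (κ + 1)) =
      (Real.cos (θ / 2) : ℂ) • A (κ + 1) - (Real.sin (θ / 2) : ℂ) • A (κ + 2) := by
  simp only [outcomeOp, rotBasis, if_true, Pi.sub_apply, star_sub, sub_smul,
    Finset.sum_sub_distrib, Pi.single_apply, apply_ite star, star_zero, ite_smul, zero_smul,
    Finset.sum_ite_eq', Finset.mem_univ, Complex.star_def, Complex.conj_ofReal]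

theorem outcomeOp_rotBasis_right {ι : Type*} (A : Fin 3 → Matrix ι ι ℂ) (κ : Fin 3) (θ : ℝ) :
    outcomeOp A (rotBasis κ θ (κ + 2)) =
      (Real.sin (θ / 2) : ℂ) • A (κ + 1) + (Real.cos (θ / 2) : ℂ) • A (κ + 2) := by
  have h12 : κ + 2 ≠ κ + 1 := (by decide : ∀ κ : Fin 3, κ + 2 ≠ κ + 1) κ
  simp only [outcomeOp, rotBasis, if_true, if_neg h12, Pi.add_apply, star_add, add_smul,
    Finset.sum_add_distrib, Pi.single_apply, apply_ite star, star_zero, ite_smul, zero_smul,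
    Finset.sum_ite_eq', Finset.mem_univ, Complex.star_def, Complex.conj_ofReal]

theorem outcomeOp_rotBasis_self {ι : Type*} (A : Fin 3 → Matrix ι ι ℂ) (κ : Fin 3) (θ : ℝ) :
    outcomeOp A (rotBasis κ θ κ) = A κ := by
  have h1 : κ ≠ κ + 1 := (by decide : ∀ κ : Fin 3, κ ≠ κ + 1) κ
  have h2 : κ ≠ κ + 2 := (by decide : ∀ κ : Fin 3, κ ≠ κ + 2) κ
  simp [outcomeOp, rotBasis, h1, h2, Pi.single_apply, apply_ite (starRingEnd ℂ)]

section Buffered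

variable {n : ℕ} (a : Fin 3 → Matrix (Fin n) (Fin n) ℂ)

/-- The protected part of the operator of a successful attempt at a rotation. -/
noncomputable def bufferedGate (κ : Fin 3) (m : ℕ) (θ : ℝ) (c : Fin 3) : Matrix (Fin 2) (Fin 2) ℂ :=
  (pauli κ ^ m * pauli c * pauli κ ^ m) * rotation κ θ

/-- The difference of the two renormalized junk operators. -/
def junkDefect (κ : Fin 3) (m : ℕ) : Matrix (Fin n) (Fin n) ℂ :=
  renormJunk a κ m (κ + 1) - renormJunk a κ m (κ + 2)

theorem bufferedGate_mem_unitaryGroup (κ : Fin 3) (m : ℕ) (θ : ℝ) (c : Fin 3) :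
    bufferedGate κ m θ c ∈ Matrix.unitaryGroup (Fin 2) ℂ :=
  mul_mem (mul_mem (mul_mem (pow_mem (pauli_mem_unitaryGroup κ) m) (pauli_mem_unitaryGroup c))
    (pow_mem (pauli_mem_unitaryGroup κ) m)) (rotation_mem_unitaryGroup κ θ)

/-- If the two renormalized junk operators were equal, the outcome would factor as gate ⊗ junk
operator. Replacing the second by the first costs a Pauli operator tensored with a multiple e, a
sine or cosine up to sign, of their difference. -/
theorem exists_outcomeOp_renorm (κ : Fin 3) (m : ℕ) (θ : ℝ) {c : Fin 3} (hc : c ≠ κ) :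
    ∃ e : ℂ, ‖e‖ ≤ 1 ∧ outcomeOp (renorm a κ m) (rotBasis κ θ c) =
      bufferedGate κ m θ c ⊗ₖ renormJunk a κ m (κ + 1) +
        pauli (κ + 2) ⊗ₖ (e • junkDefect a κ m) := by
  have h1 : κ + 1 ≠ κ := (by decide : ∀ κ : Fin 3, κ + 1 ≠ κ) κ
  have h2 : κ + 2 ≠ κ := (by decide : ∀ κ : Fin 3, κ + 2 ≠ κ) κ
  have hp : ‖(-1 : ℂ) ^ m‖ = 1 := by simp
  obtain rfl | rfl := (by decide : ∀ κ c : Fin 3, c ≠ κ → c = κ + 1 ∨ c = κ + 2) κ c hc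
  · refine ⟨(-1) ^ m * Real.sin (θ / 2), ?_, ?_⟩
    · rw [norm_mul, hp, one_mul, Complex.norm_real]
      exact Real.abs_sin_le_one _
    · rw [outcomeOp_rotBasis_left, renorm_eq, renorm_eq, bufferedGate, pauli_pow_conj h1,
        pauli_pow_conj h2,
        Matrix.smul_mul, pauli_mul_rotation_left, junkDefect]
      simp only [smul_sub, sub_kronecker, Matrix.smul_kronecker, Matrix.kronecker_smul,
        kronecker_sub, smul_smul]
      module
  · refine ⟨-((-1) ^ m * Real.cos (θ / 2)), ?_, ?_⟩
    · rw [norm_neg, norm_mul, hp, one_mul, Complex.norm_real]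
      exact Real.abs_cos_le_one _
    · rw [outcomeOp_rotBasis_right, renorm_eq, renorm_eq, bufferedGate, pauli_pow_conj h1,
        pauli_pow_conj h2,
        Matrix.smul_mul, pauli_mul_rotation_right, junkDefect]
      simp only [smul_sub, smul_add, Matrix.add_kronecker, Matrix.smul_kronecker,
        Matrix.kronecker_smul, kronecker_sub, smul_smul]
      module

variable {a} {M : Matrix (Fin n) (Fin n) ℂ} {X : Matrix (Fin 2 × Fin n) (Fin 2 × Fin n) ℂ}

theorem weight_defect_le (hM : M.PosSemidef) (hX : X.PosSemidef) (μ : Fin 3) {e : ℂ}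
    (he : ‖e‖ ≤ 1) (Δ : Matrix (Fin n) (Fin n) ℂ) :
    weight (1 ⊗ₖ M) ((pauli μ ⊗ₖ (e • Δ)) * X * (pauli μ ⊗ₖ (e • Δ))ᴴ) ≤
      weight (1 ⊗ₖ (Δᴴ * M * Δ)) X := by
  have hpos : 0 ≤ weight (1 ⊗ₖ (Δᴴ * M * Δ)) X :=
    weight_nonneg (PosSemidef.one.kronecker (hM.conjTranspose_mul_mul_same Δ)) hX
  have h1 : (pauli μ ⊗ₖ (e • Δ))ᴴ * (1 ⊗ₖ M) * (pauli μ ⊗ₖ (e • Δ)) =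
      ((‖e‖ ^ 2 : ℝ) : ℂ) • (1 ⊗ₖ (Δᴴ * M * Δ)) := by
    rw [Matrix.conjTranspose_kronecker, ← Matrix.mul_kronecker_mul, ← Matrix.mul_kronecker_mul,
      mul_one, pauli_conjTranspose, pauli_mul_self, Matrix.conjTranspose_smul,
      ← Matrix.kronecker_smul, Matrix.smul_mul, Matrix.smul_mul, Matrix.mul_smul, smul_smul,
      Complex.star_def, Complex.conj_mul', Complex.ofReal_pow]
  rw [weight_conj, h1, weight_smul_left]
  have : ‖e‖ ^ 2 ≤ 1 := pow_le_one₀ (norm_nonneg e) he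
  nlinarith

/-- A buffered rotation increases the deviation from the target state at most by a factor, up to
the contribution of the difference of the renormalized junk operators. -/
theorem weight_orth_outcomeOp_le (hM : M.PosSemidef) (hX : X.PosSemidef) {φ : Fin 2 → ℂ}
    (hφ : star φ ⬝ᵥ φ = 1) (κ : Fin 3) (m : ℕ) (θ : ℝ) {c : Fin 3} (hc : c ≠ κ) :
    weight (orth (bufferedGate κ m θ c *ᵥ φ) ⊗ₖ M) (outcomeOp (renorm a κ m) (rotBasis κ θ c) * X *
      (outcomeOp (renorm a κ m) (rotBasis κ θ c))ᴴ) ≤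
      2 * weight (orth φ ⊗ₖ ((renormJunk a κ m (κ + 1))ᴴ * M * renormJunk a κ m (κ + 1))) X +
        2 * weight (1 ⊗ₖ ((junkDefect a κ m)ᴴ * M * junkDefect a κ m)) X := by
  obtain ⟨e, he, hK⟩ := exists_outcomeOp_renorm a κ m θ hc
  have hG := bufferedGate_mem_unitaryGroup κ m θ c
  have hφ' := star_mulVec_dotProduct (Matrix.mem_unitaryGroup_iff'.1 hG) hφ
  rw [hK]
  refine (weight_add_conj_le ((orth_posSemidef hφ').kronecker hM) hX _ _).trans ?_
  rw [weight_orth_conj hG]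
  have h1 := weight_orth_le (φ := bufferedGate κ m θ c *ᵥ φ) hM
    (hX.mul_mul_conjTranspose_same (pauli (κ + 2) ⊗ₖ (e • junkDefect a κ m)))
  have h2 := weight_defect_le hM hX (κ + 2) he (junkDefect a κ m)
  linarith

/-- The parallelogram estimate with the roles exchanged: the ideal operator is the actual one minus
the defect. It bounds the normalization of the final state from below. -/
theorem weight_outcomeOp_ge (hX : X.PosSemidef) (κ : Fin 3) (m : ℕ) (θ : ℝ) {c : Fin 3}
    (hc : c ≠ κ) :
    weight (1 ⊗ₖ ((renormJunk a κ m (κ + 1))ᴴ * renormJunk a κ m (κ + 1))) X ≤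
      2 * (outcomeOp (renorm a κ m) (rotBasis κ θ c) * X *
        (outcomeOp (renorm a κ m) (rotBasis κ θ c))ᴴ).trace.re +
        2 * weight (1 ⊗ₖ ((junkDefect a κ m)ᴴ * junkDefect a κ m)) X := by
  obtain ⟨e, he, hK⟩ := exists_outcomeOp_renorm a κ m θ hc
  have hG := Matrix.mem_unitaryGroup_iff'.1 (bufferedGate_mem_unitaryGroup κ m θ c)
  rw [Matrix.star_eq_conjTranspose] at hG
  set G := bufferedGate κ m θ c ⊗ₖ renormJunk a κ m (κ + 1) with hGdef
  have h1 : G = outcomeOp (renorm a κ m) (rotBasis κ θ c) +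
      pauli (κ + 2) ⊗ₖ ((-e) • junkDefect a κ m) := by
    rw [hK, neg_smul, add_assoc, ← Matrix.kronecker_add, add_neg_cancel, Matrix.kronecker_zero,
      add_zero]
  have h2 : weight 1 (G * X * Gᴴ) =
      weight (1 ⊗ₖ ((renormJunk a κ m (κ + 1))ᴴ * renormJunk a κ m (κ + 1))) X := by
    rw [weight_conj, mul_one, hGdef, Matrix.conjTranspose_kronecker, ← Matrix.mul_kronecker_mul, hG]
  have h3 := weight_add_conj_le .one hX (outcomeOp (renorm a κ m) (rotBasis κ θ c))
    (pauli (κ + 2) ⊗ₖ ((-e) • junkDefect a κ m))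
  rw [← h1, h2] at h3
  have h4 := weight_defect_le .one hX (κ + 2) (by rwa [norm_neg] : ‖-e‖ ≤ 1) (junkDefect a κ m)
  rw [Matrix.one_kronecker_one, mul_one] at h4
  rw [weight_one_left] at h3
  linarith

end Buffered

section Bounds

variable {n : ℕ}

/-- Quantitative form of the convergence of the renormalized junk operators. -/
theorem JunkLimit.exists_bounds {x y : ℕ → Matrix (Fin n) (Fin n) ℂ} {l : ℂ} {r : ℝ}
    {T : Matrix (Fin n) (Fin n) ℂ} {s : ℕ → ℂ} (h : JunkLimit x y l r T s) (hl : l ≠ 0)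
    (hr0 : 0 ≤ r) (hr1 : r < 1) : ∃ (C c : ℝ) (m₀ : ℕ), 0 < c ∧ ∀ m ≥ m₀,
      ((x m - y m)ᴴ * (x m - y m)).trace.re ≤ C * r ^ m * ((x m)ᴴ * x m).trace.re ∧
      c * ‖l‖ ^ (4 * m) ≤ ((x m)ᴴ * x m).trace.re := by
  set τ := (Tᴴ * T).trace.re with hτ
  have hτ0 : 0 < τ := by
    obtain ⟨i, j, hij⟩ : ∃ i j, T i j ≠ 0 := by
      by_contra! hc
      exact h.ne_zero (by ext i j; exact hc i j)
    rw [hτ, trace_gram]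
    refine Finset.sum_pos' (fun _ _ => by positivity) ⟨i, Finset.mem_univ i, ?_⟩
    exact Finset.sum_pos' (fun _ _ => by positivity) ⟨j, Finset.mem_univ j, by positivity⟩
  have hlim : Tendsto (fun m => ‖s m‖ ^ 2 * ((x m)ᴴ * x m).trace.re) atTop (𝓝 τ) := by
    have hcont : Continuous fun Z : Matrix (Fin n) (Fin n) ℂ => (Zᴴ * Z).trace.re := by fun_prop
    refine ((hcont.tendsto T).comp h.tendsto_left).congr fun m => ?_
    simp only [Function.comp_apply, trace_gram, Matrix.smul_apply, norm_smul, mul_pow,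
      Finset.mul_sum]
  obtain ⟨m₁, hm₁⟩ := eventually_atTop.1 (hlim.eventually_const_le (half_lt_self hτ0))
  have hd : 0 < ‖l‖ := norm_pos_iff.2 hl
  have hx0 : ∀ z : Matrix (Fin n) (Fin n) ℂ, 0 ≤ (zᴴ * z).trace.re := fun z =>
    trace_re_nonneg (Matrix.posSemidef_conjTranspose_mul_self z)
  have hlow : ∀ m ≥ m₁, τ / 2 * ‖l‖ ^ (4 * m) ≤ ((x m)ᴴ * x m).trace.re := by
    intro m hm
    have h1 := hm₁ m hm
    have h2 : ‖s m‖ ^ 2 ≤ ((‖l‖ ^ (4 * m))⁻¹) := by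
      refine (pow_le_pow_left₀ (norm_nonneg _) (h.scale_le m) 2).trans (le_of_eq ?_)
      rw [inv_pow, ← pow_mul]
      congr 2
      ring
    have h3 := h1.trans (mul_le_mul_of_nonneg_right h2 (hx0 _))
    rwa [inv_mul_eq_div, le_div_iff₀ (by positivity)] at h3
  -- For r = 0 no q = √r > r is available; the difference vanishes exactly instead.
  rcases hr0.eq_or_lt with hr | hr
  · obtain ⟨m₂, hm₂⟩ := h.eventually_eq hr.symm
    refine ⟨0, τ / 2, max m₁ m₂, by positivity, fun m hm => ⟨?_, hlow m (le_of_max_le_left hm)⟩⟩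
    rw [hm₂ m (le_of_max_le_right hm), sub_self, Matrix.mul_zero, Matrix.trace_zero, zero_mul,
      zero_mul, Complex.zero_re]
  · have hq : r < Real.sqrt r := by
      rw [Real.lt_sqrt hr0]
      nlinarith
    obtain ⟨C, hC⟩ := h.decay _ hq
    refine ⟨2 * (n ^ 2 * C ^ 2) / τ, τ / 2, m₁, by positivity, fun m hm => ⟨?_, hlow m hm⟩⟩
    have h1 := hm₁ m hm
    have hs : 0 < ‖s m‖ ^ 2 := by
      by_contra hs
      have : ‖s m‖ ^ 2 = 0 := le_antisymm (not_lt.1 hs) (by positivity)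
      rw [this, zero_mul] at h1
      linarith
    refine le_of_mul_le_mul_left ?_ hs
    have h2 : ‖s m‖ ^ 2 * ((x m - y m)ᴴ * (x m - y m)).trace.re ≤ n ^ 2 * C ^ 2 * r ^ m := by
      rw [trace_gram, Finset.mul_sum]
      have h3 : ∀ i j, ‖s m‖ ^ 2 * ‖(x m - y m) i j‖ ^ 2 ≤ C ^ 2 * r ^ m := by
        intro i j
        have h4 := pow_le_pow_left₀ (norm_nonneg _) (hC m i j) 2
        rw [norm_mul, mul_pow, mul_pow, ← pow_mul, mul_comm m 2, pow_mul, Real.sq_sqrt hr0] at h4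
        exact h4
      simp_rw [Finset.mul_sum]
      refine (Finset.sum_le_sum fun i _ => Finset.sum_le_sum fun j _ => h3 i j).trans (le_of_eq ?_)
      simp
      ring
    refine h2.trans ?_
    calc (n : ℝ) ^ 2 * C ^ 2 * r ^ m = 2 * (n ^ 2 * C ^ 2) / τ * r ^ m * (τ / 2) := by
          field_simp
      _ ≤ 2 * (n ^ 2 * C ^ 2) / τ * r ^ m * (‖s m‖ ^ 2 * ((x m)ᴴ * x m).trace.re) :=
          mul_le_mul_of_nonneg_left h1 (by positivity)
      _ = _ := by ring

end Bounds

/-! ### Fidelity of a single rotation -/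

theorem bufferedGate_mulVec {κ c : Fin 3} (hc : c ≠ κ) (m : ℕ) (θ : ℝ) (φ : Fin 2 → ℂ) :
    bufferedGate κ m θ c *ᵥ φ = (-1 : ℂ) ^ m • ((pauli c * rotation κ θ) *ᵥ φ) := by
  rw [bufferedGate, pauli_pow_conj hc, Matrix.smul_mul, Matrix.smul_mulVec]

theorem orth_bufferedGate {κ c : Fin 3} (hc : c ≠ κ) (m : ℕ) (θ : ℝ) (φ : Fin 2 → ℂ) :
    orth (bufferedGate κ m θ c *ᵥ φ) = orth ((pauli c * rotation κ θ) *ᵥ φ) := by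
  rw [bufferedGate_mulVec hc, orth_smul (by simp)]

theorem weight_productState {n : ℕ} (N : Matrix (Fin 2) (Fin 2) ℂ) (M : Matrix (Fin n) (Fin n) ℂ)
    (ψ : Fin 2 → ℂ) (ρJ : Matrix (Fin n) (Fin n) ℂ) : weight (N ⊗ₖ M) (productState ψ ρJ) =
      ((N * Matrix.vecMulVec ψ (star ψ)).trace * (M * ρJ).trace).re := by
  rw [weight, productState, ← Matrix.mul_kronecker_mul, Matrix.trace_kronecker]

theorem weight_one_productState {n : ℕ} (M : Matrix (Fin n) (Fin n) ℂ) {ψ : Fin 2 → ℂ}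
    (hψ : star ψ ⬝ᵥ ψ = 1) (ρJ : Matrix (Fin n) (Fin n) ℂ) :
    weight (1 ⊗ₖ M) (productState ψ ρJ) = weight M ρJ := by
  rw [weight_productState, one_mul, Matrix.trace_vecMulVec, dotProduct_comm, hψ, one_mul, weight]

theorem weight_orth_productState {n : ℕ} (M : Matrix (Fin n) (Fin n) ℂ) {ψ : Fin 2 → ℂ}
    (hψ : star ψ ⬝ᵥ ψ = 1) (ρJ : Matrix (Fin n) (Fin n) ℂ) :
    weight (orth ψ ⊗ₖ M) (productState ψ ρJ) = 0 := by
  have : orth ψ * Matrix.vecMulVec ψ (star ψ) = 0 := by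
    rw [orth, sub_mul, one_mul, Matrix.vecMulVec_mul_vecMulVec, hψ, one_smul, sub_self]
  rw [weight_productState, this, Matrix.trace_zero, zero_mul, Complex.zero_re]

section Single

variable {D n : ℕ} {A : Fin 3 → Matrix (Fin D) (Fin D) ℂ} {Λ : Matrix (Fin D) (Fin D) ℂ}
  {U : Octahedral → Matrix (Fin D) (Fin D) ℂ} {V : Matrix (Fin D) (Fin 2 × Fin n) ℂ}
  {a : Fin 3 → Matrix (Fin n) (Fin n) ℂ} {l : ℂ}

/-- Bounds of the renormalized junk operators, relative to the squared Hilbert–Schmidt norm. -/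
structure JunkBounds (a : Fin 3 → Matrix (Fin n) (Fin n) ℂ) (l : ℂ) (r C c : ℝ) (m₀ : ℕ) :
    Prop where
  nonneg : 0 ≤ C
  pos : 0 < c
  defect_le : ∀ κ : Fin 3, ∀ m ≥ m₀, ((junkDefect a κ m)ᴴ * junkDefect a κ m).trace.re ≤
    C * r ^ m * ((renormJunk a κ m (κ + 1))ᴴ * renormJunk a κ m (κ + 1)).trace.re
  le_norm : ∀ κ : Fin 3, ∀ m ≥ m₀, c * ‖l‖ ^ (4 * m) ≤
    ((renormJunk a κ m (κ + 1))ᴴ * renormJunk a κ m (κ + 1)).trace.re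

theorem IsProtectedJunk.exists_junkBounds (hA : InSPTOPhase A Λ U) (h : IsProtectedJunk A U V a)
    (hl : IsLeading (a 2) l) (hgap : FiniteRenormCorrelation a) :
    ∃ C c m₀, JunkBounds a l (ratio (a 2) l) C c m₀ := by
  have hl0 := leading_ne_zero hl hgap
  have hr0 := ratio_nonneg (a 2) l
  have key : ∀ κ : Fin 3, ∃ (C c : ℝ) (m₀ : ℕ), 0 < c ∧ ∀ m ≥ m₀,
      ((junkDefect a κ m)ᴴ * junkDefect a κ m).trace.re ≤ C * ratio (a 2) l ^ m *
        ((renormJunk a κ m (κ + 1))ᴴ * renormJunk a κ m (κ + 1)).trace.re ∧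
      c * ‖l‖ ^ (4 * m) ≤ ((renormJunk a κ m (κ + 1))ᴴ * renormJunk a κ m (κ + 1)).trace.re := by
    intro κ
    obtain ⟨T, s, hJ⟩ := h.exists_junkLimit hA hl hgap κ
    exact hJ.exists_bounds hl0 hr0 (hl.ratio_lt_one hl0)
  choose C c m₀ hc hm using key
  refine ⟨∑ κ, |C κ|, min (c 0) (min (c 1) (c 2)), ∑ κ, m₀ κ, ?_, ?_, ?_, ?_⟩
  · exact Finset.sum_nonneg fun _ _ => abs_nonneg _
  · exact lt_min (hc 0) (lt_min (hc 1) (hc 2))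
  · intro κ m hmm
    have h1 : m₀ κ ≤ ∑ κ, m₀ κ :=
        Finset.single_le_sum (fun _ _ => Nat.zero_le _) (Finset.mem_univ κ)
    refine (hm κ m (h1.trans hmm)).1.trans ?_
    have h2 : C κ ≤ ∑ κ, |C κ| := (le_abs_self _).trans
      (Finset.single_le_sum (f := fun κ => |C κ|) (fun _ _ => abs_nonneg _) (Finset.mem_univ κ))
    have h3 := trace_re_nonneg
      (Matrix.posSemidef_conjTranspose_mul_self (renormJunk a κ m (κ + 1)))
    gcongr
  · intro κ m hmm
    have h1 : m₀ κ ≤ ∑ κ, m₀ κ :=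
        Finset.single_le_sum (fun _ _ => Nat.zero_le _) (Finset.mem_univ κ)
    refine le_trans ?_ (hm κ m (h1.trans hmm)).2
    refine mul_le_mul_of_nonneg_right ?_ (by positivity)
    fin_cases κ
    · exact min_le_left _ _
    · exact (min_le_right _ _).trans (min_le_left _ _)
    · exact (min_le_right _ _).trans (min_le_right _ _)

/-- Since ρJ is faithful, the Hilbert–Schmidt norm of the renormalized operator is at most tr ρJ⁻¹
times its weight t in ρJ. The defect is then at most t/4 for large m, the normalization is at least
t/4, and the quotient 2d/(t/4) yields the factor 8. -/
theorem JunkBounds.exists_gateFidelity_ge {r C c : ℝ} {m₀ : ℕ} (hJ : JunkBounds a l r C c m₀)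
    (hl0 : l ≠ 0) (hr0 : 0 ≤ r) (hr1 : r < 1) {ρJ : Matrix (Fin n) (Fin n) ℂ} (hρ : ρJ.PosDef)
    (htr : ρJ.trace = 1) : ∃ (C : ℝ) (m₀ : ℕ), ∀ m ≥ m₀, ∀ κ c : Fin 3, c ≠ κ →
      ∀ (θ : ℝ) (ψ : Fin 2 → ℂ), star ψ ⬝ᵥ ψ = 1 →
        1 - C * r ^ m ≤ gateFidelity (outcomeOp (renorm a κ m) (rotBasis κ θ c))
          (pauli c * rotation κ θ) ψ ρJ := by
  set t₀ := (ρJ⁻¹).trace.re with ht₀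
  have ht₀pos : 0 ≤ t₀ := trace_re_nonneg hρ.inv.posSemidef
  have hlim : Tendsto (fun m => C * t₀ * r ^ m) atTop (𝓝 (C * t₀ * 0)) :=
    (tendsto_pow_atTop_nhds_zero_of_lt_one hr0 hr1).const_mul _
  rw [mul_zero] at hlim
  obtain ⟨m₁, hm₁⟩ := eventually_atTop.1 (hlim.eventually_le_const (by norm_num : (0 : ℝ) < 1 / 4))
  refine ⟨8 * (C * t₀), max m₀ m₁, fun m hm κ b hb θ ψ hψ => ?_⟩
  have hX := productState_posSemidef ψ hρ.posSemidef
  have h1 := hJ.defect_le κ m (le_of_max_le_left hm)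
  have h2 := hJ.le_norm κ m (le_of_max_le_left hm)
  have h3 := hm₁ m (le_of_max_le_right hm)
  have hup := weight_orth_outcomeOp_le (a := a) .one hX hψ κ m θ hb
  have hlow := weight_outcomeOp_ge (a := a) hX κ m θ hb
  rw [mul_one, mul_one, weight_orth_productState _ hψ, weight_one_productState _ hψ,
    orth_bufferedGate hb] at hup
  rw [weight_one_productState _ hψ, weight_one_productState _ hψ] at hlow
  set d := weight ((junkDefect a κ m)ᴴ * junkDefect a κ m) ρJ
  set t := weight ((renormJunk a κ m (κ + 1))ᴴ * renormJunk a κ m (κ + 1)) ρJ with ht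
  set N := ((renormJunk a κ m (κ + 1))ᴴ * renormJunk a κ m (κ + 1)).trace.re with hN
  have hd : d ≤ ((junkDefect a κ m)ᴴ * junkDefect a κ m).trace.re := by
    have := weight_le_trace_mul_trace
      (Matrix.posSemidef_conjTranspose_mul_self (junkDefect a κ m)) hρ.posSemidef
    rwa [htr, Complex.one_re, mul_one] at this
  have hNt : N ≤ t₀ * t := by
    have := trace_le_mul_weight hρ
      (Matrix.posSemidef_conjTranspose_mul_self (renormJunk a κ m (κ + 1)))
    rwa [weight_comm] at this
  have hN0 : 0 < N := lt_of_lt_of_le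
    (mul_pos hJ.pos (pow_pos (norm_pos_iff.2 hl0) _)) h2
  have ht0 : 0 < t := by
    by_contra hneg
    have := mul_nonpos_of_nonneg_of_nonpos ht₀pos (not_lt.1 hneg)
    linarith
  have hdt : d ≤ C * t₀ * r ^ m * t := by
    have h4 : C * r ^ m * N ≤ C * r ^ m * (t₀ * t) :=
      mul_le_mul_of_nonneg_left hNt (mul_nonneg hJ.nonneg (pow_nonneg hr0 m))
    calc d ≤ C * r ^ m * (t₀ * t) := hd.trans (h1.trans h4)
      _ = _ := by ring
  have hdt' : d ≤ t / 4 := by nlinarith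
  set y := (outcomeOp (renorm a κ m) (rotBasis κ θ b) * productState ψ ρJ *
    (outcomeOp (renorm a κ m) (rotBasis κ θ b))ᴴ).trace.re with hy
  have hy0 : t / 4 ≤ y := by linarith
  have hypos : 0 < y := by linarith
  have hF := one_sub_gateFidelity (ψ := ψ) hρ.posSemidef
    (outcomeOp (renorm a κ m) (rotBasis κ θ b)) (pauli b * rotation κ θ) hypos.ne'
  have h5 : 1 - gateFidelity (outcomeOp (renorm a κ m) (rotBasis κ θ b))
      (pauli b * rotation κ θ) ψ ρJ ≤ 8 * (C * t₀) * r ^ m := by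
    rw [hF, ← hy, div_le_iff₀ hypos]
    have h6 : 0 ≤ C * t₀ * r ^ m :=
      mul_nonneg (mul_nonneg hJ.nonneg ht₀pos) (pow_nonneg hr0 m)
    nlinarith [mul_le_mul_of_nonneg_left hy0 h6]
  linarith

end Single

/-! ### The outcomes of one attempt -/

/-- An attempt as a tuple of labels. -/
def attemptEquiv (m : ℕ) : Attempt m ≃ (Fin m → Fin 3) × Fin 3 × (Fin m → Fin 3) where
  toFun o := (o.left, o.comp, o.right)
  invFun p := ⟨p.1, p.2.1, p.2.2⟩
  left_inv _ := rfl
  right_inv _ := rfl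

noncomputable instance (m : ℕ) : Fintype (Attempt m) := Fintype.ofEquiv _ (attemptEquiv m).symm

section Words

variable {ι : Type*} [Fintype ι] [DecidableEq ι] (A : Fin 3 → Matrix ι ι ℂ)

theorem sum_fin_succ {β M : Type*} [Fintype β] [AddCommMonoid M] (m : ℕ)
    (f : (Fin (m + 1) → β) → M) : ∑ v, f v = ∑ c, ∑ v : Fin m → β, f (Fin.cons c v) := by
  rw [← (Fin.consEquiv fun _ : Fin (m + 1) => β).sum_comp, Fintype.sum_prod_type]
  rfl

theorem prod_map_cons (m : ℕ) (c : Fin 3) (v : Fin m → Fin 3) :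
    ((List.ofFn (Fin.cons c v : Fin (m + 1) → Fin 3)).map A).prod =
      A c * ((List.ofFn v).map A).prod := by
  simp [List.ofFn_succ]

theorem sum_word_conj (m : ℕ) (X : Matrix ι ι ℂ) :
    ∑ v : Fin m → Fin 3, ((List.ofFn v).map A).prod * X * ((List.ofFn v).map A).prodᴴ =
      (transfer A ^ m) X := by
  induction m with
  | zero => simp
  | succ m ih =>
    rw [sum_fin_succ, pow_succ', Module.End.mul_apply, ← ih, transfer_apply]
    refine Finset.sum_congr rfl fun c _ => ?_
    rw [Finset.mul_sum, Finset.sum_mul]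
    refine Finset.sum_congr rfl fun v _ => ?_
    rw [prod_map_cons, Matrix.conjTranspose_mul]
    simp only [mul_assoc]

variable {A}

theorem sum_word_conj_dual {Y : Matrix ι ι ℂ} (hY : ∑ μ, (A μ)ᴴ * Y * A μ = Y) (m : ℕ) :
    ∑ v : Fin m → Fin 3, ((List.ofFn v).map A).prodᴴ * Y * ((List.ofFn v).map A).prod = Y := by
  induction m with
  | zero => simp
  | succ m ih =>
    rw [sum_fin_succ, Finset.sum_comm]
    conv_rhs => rw [← ih]
    refine Finset.sum_congr rfl fun v _ => ?_
    conv_rhs => rw [← hY]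
    rw [Finset.mul_sum, Finset.sum_mul]
    refine Finset.sum_congr rfl fun c _ => ?_
    rw [prod_map_cons, Matrix.conjTranspose_mul]
    simp only [mul_assoc]

variable (A)

theorem prod_labels {m : ℕ} (o : Attempt m) : (o.labels.map A).prod =
    ((List.ofFn o.left).map A).prod * A o.comp * ((List.ofFn o.right).map A).prod := by
  simp [Attempt.labels, mul_assoc]

theorem sum_attempt_prod {M : Type*} [AddCommMonoid M] {m : ℕ} (f : Attempt m → M) :
    ∑ o, f o = ∑ u, ∑ c, ∑ v, f ⟨u, c, v⟩ := by
  rw [← (attemptEquiv m).symm.sum_comp, Fintype.sum_prod_type]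
  refine Finset.sum_congr rfl fun u _ => ?_
  rw [Fintype.sum_prod_type]
  rfl

theorem sum_attempt_conj (m : ℕ) (X : Matrix ι ι ℂ) :
    ∑ o : Attempt m, (o.labels.map A).prod * X * (o.labels.map A).prodᴴ =
      (transfer A ^ (2 * m + 1)) X := by
  rw [sum_attempt_prod, two_mul, add_assoc, pow_add, pow_succ', Module.End.mul_apply,
    Module.End.mul_apply, ← sum_word_conj A m (transfer A _)]
  refine Finset.sum_congr rfl fun u _ => ?_
  rw [transfer_apply, Finset.mul_sum, Finset.sum_mul]
  refine Finset.sum_congr rfl fun c _ => ?_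
  rw [← sum_word_conj A m X, Finset.mul_sum, Finset.sum_mul, Finset.mul_sum, Finset.sum_mul]
  refine Finset.sum_congr rfl fun v _ => ?_
  rw [prod_labels]
  simp only [Matrix.conjTranspose_mul, mul_assoc]

variable {A}

theorem sum_attempt_conj_dual {Y : Matrix ι ι ℂ} (hY : ∑ μ, (A μ)ᴴ * Y * A μ = Y) (m : ℕ) :
    ∑ o : Attempt m, (o.labels.map A).prodᴴ * Y * (o.labels.map A).prod = Y := by
  rw [sum_attempt_prod, Finset.sum_comm]
  conv_rhs => rw [← sum_word_conj_dual hY m]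
  rw [Finset.sum_congr rfl fun c _ => Finset.sum_comm, Finset.sum_comm]
  refine Finset.sum_congr rfl fun v _ => ?_
  conv_rhs => rw [← hY]
  rw [Finset.mul_sum, Finset.sum_mul]
  refine Finset.sum_congr rfl fun c _ => ?_
  conv_rhs => rw [← sum_word_conj_dual hY m]
  simp only [Finset.mul_sum, Finset.sum_mul]
  refine Finset.sum_congr rfl fun u _ => ?_
  rw [prod_labels]
  simp only [Matrix.conjTranspose_mul, mul_assoc]

end Words

/-- The attempt with all buffering outcomes equal to `κ`. -/
def bufferedAttempt (m : ℕ) (κ c : Fin 3) : Attempt m := ⟨fun _ => κ, c, fun _ => κ⟩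

theorem Attempt.buffered_iff {m : ℕ} {κ : Fin 3} {o : Attempt m} :
    o.Buffered κ ↔ o = bufferedAttempt m κ o.comp := by
  obtain ⟨u, c, v⟩ := o
  constructor
  · rintro ⟨h1, h2⟩
    simp only [bufferedAttempt, Attempt.mk.injEq, true_and]
    exact ⟨funext h1, funext h2⟩
  · intro h
    simp only [bufferedAttempt, Attempt.mk.injEq, true_and] at h
    exact ⟨fun i => congrFun h.1 i, fun i => congrFun h.2 i⟩

theorem bufferedAttempt_buffered (m : ℕ) (κ c : Fin 3) : (bufferedAttempt m κ c).Buffered κ :=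
  ⟨fun _ => rfl, fun _ => rfl⟩

theorem bufferedAttempt_success {m : ℕ} {κ c : Fin 3} (hc : c ≠ κ) :
    (bufferedAttempt m κ c).Success κ :=
  ⟨bufferedAttempt_buffered m κ c, hc⟩

theorem prod_labels_bufferedAttempt {M : Type*} [Monoid M] (f : Fin 3 → M) (m : ℕ) (κ c : Fin 3) :
    ((bufferedAttempt m κ c).labels.map f).prod = f κ ^ m * f c * f κ ^ m := by
  simp [Attempt.labels, bufferedAttempt, mul_assoc]

-- Exactly two outcomes are successes: all buffers κ and the central label one of the two others.
open Classical in
theorem sum_attempt_eq {M : Type*} [AddCommMonoid M] {m : ℕ} (κ : Fin 3) (f : Attempt m → M) :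
    ∑ o, f o = ∑ o with ¬ o.Success κ, f o +
      (f (bufferedAttempt m κ (κ + 1)) + f (bufferedAttempt m κ (κ + 2))) := by
  have h1 : κ + 1 ≠ κ := (by decide : ∀ κ : Fin 3, κ + 1 ≠ κ) κ
  have h2 : κ + 2 ≠ κ := (by decide : ∀ κ : Fin 3, κ + 2 ≠ κ) κ
  have h12 : κ + 1 ≠ κ + 2 := (by decide : ∀ κ : Fin 3, κ + 1 ≠ κ + 2) κ
  rw [← Finset.sum_filter_add_sum_filter_not Finset.univ (fun o : Attempt m => ¬ o.Success κ)]
  congr 1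
  have hset : (Finset.univ.filter fun o : Attempt m => ¬¬ o.Success κ) =
      {bufferedAttempt m κ (κ + 1), bufferedAttempt m κ (κ + 2)} := by
    ext o
    simp only [Finset.mem_filter, Finset.mem_univ, true_and, not_not, Finset.mem_insert,
      Finset.mem_singleton]
    constructor
    · rintro ⟨hb, hc⟩
      rw [Attempt.buffered_iff] at hb
      rcases (by decide : ∀ κ c : Fin 3, c ≠ κ → c = κ + 1 ∨ c = κ + 2) κ _ hc with h | h
      · exact Or.inl (by rw [← h]; exact hb)
      · exact Or.inr (by rw [← h]; exact hb)
    · rintro (rfl | rfl)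
      · exact bufferedAttempt_success h1
      · exact bufferedAttempt_success h2
  rw [hset, Finset.sum_pair]
  intro h
  exact h12 (congrArg Attempt.comp h)

section AttemptOp

variable {n m : ℕ} (a : Fin 3 → Matrix (Fin n) (Fin n) ℂ)

theorem buffer_outcomeOp (κ : Fin 3) (ψ : Fin 3 → ℂ) :
    component a κ ^ m * outcomeOp (component a) ψ * component a κ ^ m =
      outcomeOp (renorm a κ m) ψ := by
  rw [outcomeOp, outcomeOp, Finset.mul_sum, Finset.sum_mul]
  refine Finset.sum_congr rfl fun μ _ => ?_
  rw [Matrix.mul_smul, Matrix.smul_mul, renorm]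

theorem attemptOp_bufferedAttempt (κ : Fin 3) (θ : ℝ) (c : Fin 3) :
    attemptOp a κ θ (bufferedAttempt m κ c) = outcomeOp (renorm a κ m) (rotBasis κ θ c) := by
  rw [attemptOp, if_pos (bufferedAttempt_buffered m κ c), buffer_outcomeOp]
  rfl

/-- Failure after successful buffering means the central label κ, whose vector in `rotBasis` is |κ⟩
itself. So every failure applies a plain word of components, without error on the qubit. -/
theorem attemptOp_of_not_success {κ : Fin 3} (θ : ℝ) {o : Attempt m} (h : ¬ o.Success κ) :
    attemptOp a κ θ o = (o.labels.map (component a)).prod := by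
  by_cases hb : o.Buffered κ
  · have hc : o.comp = κ := by
      by_contra hc
      exact h ⟨hb, hc⟩
    rw [Attempt.buffered_iff, hc] at hb
    rw [hb, attemptOp_bufferedAttempt, outcomeOp_rotBasis_self, renorm, prod_labels_bufferedAttempt]
  · rw [attemptOp, if_neg hb]

/-- The two vectors are an orthogonal rotation of |κ'⟩, |κ''⟩, and the sum over an orthonormal basis
does not depend on the basis. -/
theorem sum_outcomeOp_conj {ι : Type*} [Fintype ι] (A : Fin 3 → Matrix ι ι ℂ) (κ : Fin 3) (θ : ℝ)
    (X : Matrix ι ι ℂ) :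
    outcomeOp A (rotBasis κ θ (κ + 1)) * X * (outcomeOp A (rotBasis κ θ (κ + 1)))ᴴ +
      outcomeOp A (rotBasis κ θ (κ + 2)) * X * (outcomeOp A (rotBasis κ θ (κ + 2)))ᴴ =
      A (κ + 1) * X * (A (κ + 1))ᴴ + A (κ + 2) * X * (A (κ + 2))ᴴ := by
  have h : (Real.cos (θ / 2) : ℂ) ^ 2 + (Real.sin (θ / 2) : ℂ) ^ 2 = 1 := by
    exact_mod_cast Real.cos_sq_add_sin_sq (θ / 2)
  rw [outcomeOp_rotBasis_left, outcomeOp_rotBasis_right]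
  generalize (Real.cos (θ / 2)) = x at *
  generalize (Real.sin (θ / 2)) = y at *
  simp only [Matrix.conjTranspose_add, Matrix.conjTranspose_sub, Matrix.conjTranspose_smul,
    Complex.star_def, Complex.conj_ofReal, Matrix.sub_mul, Matrix.mul_sub, Matrix.add_mul,
    Matrix.mul_add, Matrix.smul_mul, Matrix.mul_smul, smul_sub, smul_add, smul_smul]
  match_scalars
  all_goals first
    | ring1
    | linear_combination h

open Classical in
/-- The total operation of an attempt does not depend on the angle. -/
theorem sum_attemptOp_conj (κ : Fin 3) (θ : ℝ)
    (X : Matrix (Fin 2 × Fin n) (Fin 2 × Fin n) ℂ) :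
    ∑ o : Attempt m, attemptOp a κ θ o * X * (attemptOp a κ θ o)ᴴ =
      (transfer (component a) ^ (2 * m + 1)) X := by
  rw [← sum_attempt_conj, sum_attempt_eq κ, sum_attempt_eq κ
    (fun o => (o.labels.map (component a)).prod * X * (o.labels.map (component a)).prodᴴ)]
  congr 1
  · refine Finset.sum_congr rfl fun o ho => ?_
    rw [attemptOp_of_not_success a θ (Finset.mem_filter.1 ho).2]
  · rw [attemptOp_bufferedAttempt, attemptOp_bufferedAttempt, sum_outcomeOp_conj,
      prod_labels_bufferedAttempt, prod_labels_bufferedAttempt]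
    rfl

end AttemptOp

/-! ### Potentials of the protocol -/

section Potential

variable {n m : ℕ} {a : Fin 3 → Matrix (Fin n) (Fin n) ℂ}
  {Y : Matrix (Fin 2 × Fin n) (Fin 2 × Fin n) ℂ} {L : Matrix (Fin n) (Fin n) ℂ}

/-- The observable measuring the probability that a rotation about `κ` succeeds at the next
attempt. -/
def successOp (a : Fin 3 → Matrix (Fin n) (Fin n) ℂ) (m : ℕ)
    (Y : Matrix (Fin 2 × Fin n) (Fin 2 × Fin n) ℂ) (κ : Fin 3) :
    Matrix (Fin 2 × Fin n) (Fin 2 × Fin n) ℂ :=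
  (renorm a κ m (κ + 1))ᴴ * Y * renorm a κ m (κ + 1) +
    (renorm a κ m (κ + 2))ᴴ * Y * renorm a κ m (κ + 2)

theorem successOp_posSemidef (a : Fin 3 → Matrix (Fin n) (Fin n) ℂ) (m : ℕ)
    (hY : Y.PosSemidef) (κ : Fin 3) : (successOp a m Y κ).PosSemidef :=
  (hY.conjTranspose_mul_mul_same _).add (hY.conjTranspose_mul_mul_same _)

/-- The gates which remain to be performed after an attempt. -/
noncomputable def nextGates (g : Fin 3 × ℝ) (gs : List (Fin 3 × ℝ)) (o : Attempt m) :
    List (Fin 3 × ℝ) :=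
  open Classical in if o.Success g.1 then gs else g :: gs

theorem nextGates_of_success {g : Fin 3 × ℝ} (gs : List (Fin 3 × ℝ)) {o : Attempt m}
    (h : o.Success g.1) : nextGates g gs o = gs := if_pos h

theorem nextGates_of_not_success {g : Fin 3 × ℝ} (gs : List (Fin 3 × ℝ)) {o : Attempt m}
    (h : ¬ o.Success g.1) : nextGates g gs o = g :: gs := if_neg h

/-- An upper bound for the expected number of the remaining attempts. -/
noncomputable def timePotential (a : Fin 3 → Matrix (Fin n) (Fin n) ℂ) (m : ℕ)
    (Y : Matrix (Fin 2 × Fin n) (Fin 2 × Fin n) ℂ) (p : ℝ) :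
    List (Fin 3 × ℝ) → Matrix (Fin 2 × Fin n) (Fin 2 × Fin n) ℂ → ℝ
  | [], _ => 0
  | g :: gs, X => (gs.length + 1) * (2 / p) * weight Y X - weight (successOp a m Y g.1) X / p

/-- The hypotheses on the fixed point `Y` and the success probability `p` of one attempt. -/
structure Mixes (a : Fin 3 → Matrix (Fin n) (Fin n) ℂ) (m : ℕ)
    (Y : Matrix (Fin 2 × Fin n) (Fin 2 × Fin n) ℂ) (p : ℝ) : Prop where
  fixed : ∑ μ, (component a μ)ᴴ * Y * component a μ = Y
  posSemidef : Y.PosSemidef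
  pos : 0 < p
  mixes : ∀ κ X, X.PosSemidef →
    p * weight Y X ≤ weight (successOp a m Y κ) ((transfer (component a) ^ (2 * m + 1)) X)

theorem weight_successOp (κ : Fin 3) (θ : ℝ) (X : Matrix (Fin 2 × Fin n) (Fin 2 × Fin n) ℂ) :
    weight (successOp a m Y κ) X =
      weight Y (attemptOp a κ θ (bufferedAttempt m κ (κ + 1)) * X *
        (attemptOp a κ θ (bufferedAttempt m κ (κ + 1)))ᴴ) +
      weight Y (attemptOp a κ θ (bufferedAttempt m κ (κ + 2)) * X *
        (attemptOp a κ θ (bufferedAttempt m κ (κ + 2)))ᴴ) := by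
  rw [attemptOp_bufferedAttempt, attemptOp_bufferedAttempt, ← weight_add_right,
    sum_outcomeOp_conj, weight_add_right, weight_conj, weight_conj, ← weight_add_left]
  rfl

open Classical in
theorem Mixes.sum_weight {p : ℝ} (h : Mixes a m Y p) (κ : Fin 3) (θ : ℝ)
    (X : Matrix (Fin 2 × Fin n) (Fin 2 × Fin n) ℂ) :
    ∑ o : Attempt m, weight Y (attemptOp a κ θ o * X * (attemptOp a κ θ o)ᴴ) = weight Y X := by
  rw [← weight_sum_right, sum_attemptOp_conj, weight, trace_mul_transfer_pow h.fixed, weight]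

theorem Mixes.weight_successOp_le {p : ℝ} (h : Mixes a m Y p) (κ : Fin 3)
    {X : Matrix (Fin 2 × Fin n) (Fin 2 × Fin n) ℂ} (hX : X.PosSemidef) :
    weight (successOp a m Y κ) X ≤ weight Y X := by
  classical
  have h1 := h.sum_weight κ 0 X
  rw [sum_attempt_eq κ, ← weight_successOp] at h1
  have h2 : 0 ≤ ∑ o : Attempt m with ¬ o.Success κ,
      weight Y (attemptOp a κ 0 o * X * (attemptOp a κ 0 o)ᴴ) :=
    Finset.sum_nonneg fun o _ => weight_nonneg h.posSemidef (hX.mul_mul_conjTranspose_same _)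
  linarith

theorem Mixes.timePotential_nonneg {p : ℝ} (h : Mixes a m Y p) (gs : List (Fin 3 × ℝ))
    {X : Matrix (Fin 2 × Fin n) (Fin 2 × Fin n) ℂ} (hX : X.PosSemidef) :
    0 ≤ timePotential a m Y p gs X := by
  cases gs with
  | nil => exact le_rfl
  | cons g gs =>
    rw [timePotential, sub_nonneg]
    have hp := h.pos
    have h1 := h.weight_successOp_le g.1 hX
    have h2 := weight_nonneg h.posSemidef hX
    have h3 : (gs.length + 1 : ℝ) * (2 / p) * weight Y X =
        ((gs.length + 1 : ℝ) * 2 * weight Y X) / p := by ring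
    rw [h3]
    refine div_le_div_of_nonneg_right ?_ hp.le
    nlinarith [mul_nonneg (Nat.cast_nonneg (α := ℝ) gs.length) h2]

theorem Mixes.timePotential_le {p : ℝ} (h : Mixes a m Y p) (gs : List (Fin 3 × ℝ))
    {X : Matrix (Fin 2 × Fin n) (Fin 2 × Fin n) ℂ} (hX : X.PosSemidef) :
    timePotential a m Y p gs X ≤ gs.length * (2 / p) * weight Y X := by
  cases gs with
  | nil => simp [timePotential]
  | cons g gs =>
    rw [timePotential, List.length_cons]
    push_cast
    have := div_nonneg (weight_nonneg (successOp_posSemidef a m h.posSemidef g.1) hX) h.pos.le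
    linarith

/-- The chance of success at the coming block has no lower bound for an arbitrary state; only one
further block restores it. The subtracted success weight in the potential accounts for this delay:
one copy of 1/p pays for the block, the second makes up for the subtracted term. -/
theorem Mixes.timePotential_step {p : ℝ} (h : Mixes a m Y p) (g : Fin 3 × ℝ)
    (gs : List (Fin 3 × ℝ)) (θ : ℝ) {X : Matrix (Fin 2 × Fin n) (Fin 2 × Fin n) ℂ}
    (hX : X.PosSemidef) :
    weight Y X + ∑ o : Attempt m, timePotential a m Y p (nextGates g gs o)
      (attemptOp a g.1 θ o * X * (attemptOp a g.1 θ o)ᴴ) ≤ timePotential a m Y p (g :: gs) X := by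
  classical
  have hp := h.pos
  have hXo : ∀ o : Attempt m, (attemptOp a g.1 θ o * X * (attemptOp a g.1 θ o)ᴴ).PosSemidef :=
    fun o => hX.mul_mul_conjTranspose_same _
  have h1 : g.1 + 1 ≠ g.1 := (by decide : ∀ κ : Fin 3, κ + 1 ≠ κ) g.1
  have h2 : g.1 + 2 ≠ g.1 := (by decide : ∀ κ : Fin 3, κ + 2 ≠ κ) g.1
  have hmass := h.sum_weight g.1 θ X
  rw [sum_attempt_eq g.1, ← weight_successOp] at hmass
  have hmix := h.mixes g.1 X hX
  rw [← sum_attemptOp_conj a g.1 θ X, weight_sum_right, sum_attempt_eq g.1] at hmix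
  have hs1 := h.weight_successOp_le g.1 (hXo (bufferedAttempt m g.1 (g.1 + 1)))
  have hs2 := h.weight_successOp_le g.1 (hXo (bufferedAttempt m g.1 (g.1 + 2)))
  have hτ := weight_successOp (a := a) (m := m) (Y := Y) g.1 θ X
  have ht1 := h.timePotential_le gs (hXo (bufferedAttempt m g.1 (g.1 + 1)))
  have ht2 := h.timePotential_le gs (hXo (bufferedAttempt m g.1 (g.1 + 2)))
  rw [sum_attempt_eq g.1, nextGates_of_success gs (bufferedAttempt_success h1),
    nextGates_of_success gs (bufferedAttempt_success h2)]
  have hfail : ∑ o : Attempt m with ¬ o.Success g.1, timePotential a m Y p (nextGates g gs o)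
      (attemptOp a g.1 θ o * X * (attemptOp a g.1 θ o)ᴴ) =
      (gs.length + 1) * (2 / p) * ∑ o : Attempt m with ¬ o.Success g.1,
        weight Y (attemptOp a g.1 θ o * X * (attemptOp a g.1 θ o)ᴴ) -
      (∑ o : Attempt m with ¬ o.Success g.1,
        weight (successOp a m Y g.1) (attemptOp a g.1 θ o * X * (attemptOp a g.1 θ o)ᴴ)) / p := by
    rw [Finset.mul_sum, Finset.sum_div, ← Finset.sum_sub_distrib]
    refine Finset.sum_congr rfl fun o ho => ?_
    rw [nextGates_of_not_success gs (Finset.mem_filter.1 ho).2, timePotential]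
  rw [hfail, timePotential]
  generalize weight (successOp a m Y g.1) X = τ at *
  generalize weight Y (attemptOp a g.1 θ (bufferedAttempt m g.1 (g.1 + 1)) * X *
        (attemptOp a g.1 θ (bufferedAttempt m g.1 (g.1 + 1)))ᴴ) = y₁ at *
  generalize weight Y (attemptOp a g.1 θ (bufferedAttempt m g.1 (g.1 + 2)) * X *
        (attemptOp a g.1 θ (bufferedAttempt m g.1 (g.1 + 2)))ᴴ) = y₂ at *
  generalize (∑ o : Attempt m with ¬ o.Success g.1,
        weight Y (attemptOp a g.1 θ o * X * (attemptOp a g.1 θ o)ᴴ)) = F at *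
  generalize (∑ o : Attempt m with ¬ o.Success g.1,
        weight (successOp a m Y g.1) (attemptOp a g.1 θ o * X * (attemptOp a g.1 θ o)ᴴ)) = S at *
  generalize (gs.length : ℝ) = k at *
  generalize weight Y X = M at *
  -- Mixing bounds the success weight after all outcomes from below by p M; the two successful
  -- outcomes contribute at most their own mass τ to it.
  have h3 : S / p ≥ M - τ / p := by
    rw [ge_iff_le, sub_le_iff_le_add, ← add_div, le_div_iff₀ hp]
    linarith
  have h4 : k * (2 / p) * y₁ + k * (2 / p) * y₂ = k * (2 / p) * τ := by rw [hτ]; ring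
  have h5 : F = M - τ := by linarith
  have h6 : (k + 1) * (2 / p) * (M - τ) + k * (2 / p) * τ =
      (k + 1) * (2 / p) * M - 2 * (τ / p) := by
    ring
  rw [h5]
  linarith

/-! ### Byproducts and the ideal state -/

/-- The product of the gates in the order in which they are performed. -/
noncomputable def gateProd : List (Fin 3 × ℝ) → Matrix (Fin 2) (Fin 2) ℂ
  | [] => 1
  | g :: gs => gateProd gs * rotation g.1 g.2

theorem gateProd_mem_unitaryGroup (gs : List (Fin 3 × ℝ)) :
    gateProd gs ∈ Matrix.unitaryGroup (Fin 2) ℂ := by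
  induction gs with
  | nil => exact one_mem _
  | cons g gs ih => exact mul_mem ih (rotation_mem_unitaryGroup _ _)

theorem byproduct_append (h h' : List (Fin 3)) : byproduct (h ++ h') =
    byproduct h * byproduct h' := by
  simp [byproduct]

theorem byproduct_mem_unitaryGroup (h : List (Fin 3)) :
    byproduct h ∈ Matrix.unitaryGroup (Fin 2) ℂ := by
  induction h with
  | nil => exact one_mem _
  | cons ν h ih =>
    rw [byproduct, List.map_cons, List.prod_cons]
    exact mul_mem (pauli_mem_unitaryGroup ν) ih

theorem pauli_mul_rotation (ν κ : Fin 3) (θ : ℝ) :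
    pauli ν * rotation κ θ = rotation κ ((if ν = κ then 1 else -1) * θ) * pauli ν := by
  have h1 : pauli ν * pauli κ = (if ν = κ then (1 : ℂ) else -1) • (pauli κ * pauli ν) := by
    have h2 := pauli_mul_pauli_mul_pauli ν κ
    calc pauli ν * pauli κ = (pauli ν * pauli κ * pauli ν) * pauli ν := by
          rw [mul_assoc, pauli_mul_self, mul_one]
      _ = _ := by rw [h2, Matrix.smul_mul]
  rw [rotation, rotation, mul_sub, sub_mul, Matrix.mul_smul, Matrix.mul_smul, Matrix.smul_mul,
    Matrix.smul_mul, mul_one, one_mul, h1]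
  split_ifs with h3
  · simp
  · rw [neg_one_mul, neg_div, Real.cos_neg, Real.sin_neg, Complex.ofReal_neg]
    simp

/-- Each Pauli factor different from σ_κ reverses the angle, so only the parity of their number
matters. -/
theorem byproduct_mul_rotation (h : List (Fin 3)) (κ : Fin 3) (θ : ℝ) :
    byproduct h * rotation κ θ = rotation κ (frameSign κ h * θ) * byproduct h := by
  induction h with
  | nil => simp [byproduct, frameSign]
  | cons ν h ih =>
    rw [byproduct, List.map_cons, List.prod_cons, ← byproduct, mul_assoc, ih, ← mul_assoc,
      pauli_mul_rotation, mul_assoc, ← mul_assoc _ (frameSign κ h)]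
    congr 3
    rw [frameSign, frameSign, List.countP_cons]
    split_ifs <;> simp_all [pow_succ]

/-- The state of the protected qubit in an ideal run. -/
noncomputable def idealState (v : Fin 2 → ℂ) (gs : List (Fin 3 × ℝ)) (h : List (Fin 3)) :
    Fin 2 → ℂ :=
  byproduct h *ᵥ ((gateProd gs)ᴴ *ᵥ v)

theorem idealState_unit {v : Fin 2 → ℂ} (hv : star v ⬝ᵥ v = 1) (gs : List (Fin 3 × ℝ))
    (h : List (Fin 3)) : star (idealState v gs h) ⬝ᵥ idealState v gs h = 1 := by
  refine star_mulVec_dotProduct (Matrix.mem_unitaryGroup_iff'.1 (byproduct_mem_unitaryGroup h)) ?_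
  refine star_mulVec_dotProduct ?_ hv
  rw [Matrix.conjTranspose_conjTranspose]
  exact Matrix.mem_unitaryGroup_iff.1 (gateProd_mem_unitaryGroup gs)

theorem idealState_append (v : Fin 2 → ℂ) (gs : List (Fin 3 × ℝ)) (h h' : List (Fin 3)) :
    idealState v gs (h' ++ h) = byproduct h' *ᵥ idealState v gs h := by
  rw [idealState, byproduct_append, ← Matrix.mulVec_mulVec, idealState]

/-- The adapted angle lets the rotation pass through the accumulated byproduct, so the gate just
performed leaves the list of remaining gates and only the new labels join the byproduct. -/
theorem idealState_success (v : Fin 2 → ℂ) (g : Fin 3 × ℝ) (gs : List (Fin 3 × ℝ))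
    (h : List (Fin 3)) (c : Fin 3) :
    idealState v gs ((bufferedAttempt m g.1 c).labels ++ h) =
      bufferedGate g.1 m (frameSign g.1 h * g.2) c *ᵥ idealState v (g :: gs) h := by
  have h1 : rotation g.1 g.2 * (rotation g.1 g.2)ᴴ = 1 :=
    mul_eq_one_comm.1 (rotation_conjTranspose_mul _ _)
  have h2 : byproduct h = rotation g.1 (frameSign g.1 h * g.2) * byproduct h *
      (rotation g.1 g.2)ᴴ := by
    rw [← byproduct_mul_rotation, mul_assoc, h1, mul_one]
  have h3 : idealState v (g :: gs) h =
      (byproduct h * (rotation g.1 g.2)ᴴ) *ᵥ ((gateProd gs)ᴴ *ᵥ v) := by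
    rw [idealState, gateProd, Matrix.conjTranspose_mul, ← Matrix.mulVec_mulVec,
      Matrix.mulVec_mulVec]
  rw [idealState_append, byproduct, prod_labels_bufferedAttempt, h3, idealState, bufferedGate]
  conv_lhs => rw [h2]
  simp only [Matrix.mulVec_mulVec]
  congr 1
  simp only [mul_assoc]

theorem prod_map_component (w : List (Fin 3)) :
    (w.map (component a)).prod = byproduct w ⊗ₖ (w.map a).prod := by
  induction w with
  | nil => simp [byproduct]
  | cons μ w ih =>
    rw [List.map_cons, List.prod_cons, ih, component, ← Matrix.mul_kronecker_mul, byproduct,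
      byproduct, List.map_cons, List.map_cons, List.prod_cons, List.prod_cons]

/-! ### Growth of the deviation from the ideal state -/

/-- The weight of the deviation from the ideal state. -/
noncomputable def bad (L : Matrix (Fin n) (Fin n) ℂ) (v : Fin 2 → ℂ) (gs : List (Fin 3 × ℝ))
    (h : List (Fin 3)) (X : Matrix (Fin 2 × Fin n) (Fin 2 × Fin n) ℂ) : ℝ :=
  weight (orth (idealState v gs h) ⊗ₖ L) X

theorem bad_nonneg (hL : L.PosSemidef) {v : Fin 2 → ℂ} (hv : star v ⬝ᵥ v = 1)
    (gs : List (Fin 3 × ℝ)) (h : List (Fin 3)) {X : Matrix (Fin 2 × Fin n) (Fin 2 × Fin n) ℂ}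
    (hX : X.PosSemidef) : 0 ≤ bad L v gs h X :=
  weight_nonneg ((orth_posSemidef (idealState_unit hv gs h)).kronecker hL) hX

-- Failures move state and target together and merely redistribute the weight of the deviation,
-- since L is invariant under the sum over all words. Each of the two successes costs at most twice
-- the weight of the word κ^m (κ+1) κ^m plus twice the defect; the division by 4 makes their sum fit
-- into the share of this word.
open Classical in
theorem bad_step (hL : IsJunkFixedPoint a L) {v : Fin 2 → ℂ} (hv : star v ⬝ᵥ v = 1)
    (g : Fin 3 × ℝ) (gs : List (Fin 3 × ℝ)) (h : List (Fin 3))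
    {X : Matrix (Fin 2 × Fin n) (Fin 2 × Fin n) ℂ} (hX : X.PosSemidef)
    {K : Attempt m → Matrix (Fin 2 × Fin n) (Fin 2 × Fin n) ℂ}
    (hK : K = attemptOp a g.1 (frameSign g.1 h * g.2)) :
    ∑ o : Attempt m with ¬ o.Success g.1, bad L v (g :: gs) (o.labels ++ h) (K o * X * (K o)ᴴ) +
      (bad L v gs ((bufferedAttempt m g.1 (g.1 + 1)).labels ++ h)
          (K (bufferedAttempt m g.1 (g.1 + 1)) * X * (K (bufferedAttempt m g.1 (g.1 + 1)))ᴴ) +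
        bad L v gs ((bufferedAttempt m g.1 (g.1 + 2)).labels ++ h)
          (K (bufferedAttempt m g.1 (g.1 + 2)) * X * (K (bufferedAttempt m g.1 (g.1 + 2)))ᴴ)) / 4 ≤
      bad L v (g :: gs) h X +
        weight (1 ⊗ₖ ((junkDefect a g.1 m)ᴴ * L * junkDefect a g.1 m)) X := by
  subst hK
  set φ := idealState v (g :: gs) h with hφdef
  have hφ : star φ ⬝ᵥ φ = 1 := idealState_unit hv _ _
  have h1 : g.1 + 1 ≠ g.1 := (by decide : ∀ κ : Fin 3, κ + 1 ≠ κ) g.1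
  have h2 : g.1 + 2 ≠ g.1 := (by decide : ∀ κ : Fin 3, κ + 2 ≠ κ) g.1
  have hs : ∀ c, c ≠ g.1 → bad L v gs ((bufferedAttempt m g.1 c).labels ++ h)
      (attemptOp a g.1 (frameSign g.1 h * g.2) (bufferedAttempt m g.1 c) * X *
        (attemptOp a g.1 (frameSign g.1 h * g.2) (bufferedAttempt m g.1 c))ᴴ) ≤
      2 * weight (orth φ ⊗ₖ ((renormJunk a g.1 m (g.1 + 1))ᴴ * L *
          renormJunk a g.1 m (g.1 + 1))) X +
        2 * weight (1 ⊗ₖ ((junkDefect a g.1 m)ᴴ * L * junkDefect a g.1 m)) X := by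
    intro c hc
    rw [bad, attemptOp_bufferedAttempt, idealState_success]
    exact weight_orth_outcomeOp_le hL.posSemidef hX hφ g.1 m _ hc
  -- Invariance of L also accounts for the two words replaced by rotated outcomes.
  have hf : ∑ o : Attempt m, weight (orth φ ⊗ₖ ((o.labels.map a).prodᴴ * L *
      (o.labels.map a).prod)) X
      = weight (orth φ ⊗ₖ L) X := by
    rw [← weight_sum_left]
    congr 1
    conv_rhs => rw [← sum_attempt_conj_dual hL.fixed m]
    ext i j
    simp [Matrix.sum_apply, Finset.mul_sum]
  rw [sum_attempt_eq g.1, prod_labels_bufferedAttempt, prod_labels_bufferedAttempt,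
    ← renormJunk, ← renormJunk] at hf
  have hfail : ∑ o : Attempt m with ¬ o.Success g.1, bad L v (g :: gs) (o.labels ++ h)
      (attemptOp a g.1 (frameSign g.1 h * g.2) o * X *
        (attemptOp a g.1 (frameSign g.1 h * g.2) o)ᴴ) =
      ∑ o : Attempt m with ¬ o.Success g.1,
        weight (orth φ ⊗ₖ ((o.labels.map a).prodᴴ * L * (o.labels.map a).prod)) X := by
    refine Finset.sum_congr rfl fun o ho => ?_
    rw [bad, attemptOp_of_not_success a _ (Finset.mem_filter.1 ho).2, idealState_append,
      prod_map_component, weight_orth_conj (byproduct_mem_unitaryGroup _)]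
  rw [hfail]
  have hs1 := hs _ h1
  have hs2 := hs _ h2
  have hpos : 0 ≤ weight (orth φ ⊗ₖ ((renormJunk a g.1 m (g.1 + 2))ᴴ * L *
      renormJunk a g.1 m (g.1 + 2))) X :=
    weight_nonneg ((orth_posSemidef hφ).kronecker (hL.posSemidef.conjTranspose_mul_mul_same _)) hX
  have hb : bad L v (g :: gs) h X = weight (orth φ ⊗ₖ L) X := rfl
  rw [hb]
  linarith

/-- A potential which bounds the expected final deviation from the ideal state. -/
noncomputable def badPotential (a : Fin 3 → Matrix (Fin n) (Fin n) ℂ) (m : ℕ)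
    (L : Matrix (Fin n) (Fin n) ℂ) (p η : ℝ) (v : Fin 2 → ℂ) (gs : List (Fin 3 × ℝ))
    (h : List (Fin 3)) (X : Matrix (Fin 2 × Fin n) (Fin 2 × Fin n) ℂ) : ℝ :=
  4 ^ gs.length * (bad L v gs h X + η * timePotential a m (1 ⊗ₖ L) p gs X)

/-- The factor 4 is lost only at a success, hence 4 to the number of remaining gates. The additive
defect occurs at every block, so it is charged to the expected number of blocks still to come. -/
theorem badPotential_step (hL : IsJunkFixedPoint a L) {p η : ℝ} (hM : Mixes a m (1 ⊗ₖ L) p)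
    (hη0 : 0 ≤ η) (hη : ∀ (κ : Fin 3) (X : Matrix (Fin 2 × Fin n) (Fin 2 × Fin n) ℂ), X.PosSemidef →
      weight ((1 : Matrix (Fin 2) (Fin 2) ℂ) ⊗ₖ ((junkDefect a κ m)ᴴ * L * junkDefect a κ m)) X ≤
        η * weight ((1 : Matrix (Fin 2) (Fin 2) ℂ) ⊗ₖ L) X)
    {v : Fin 2 → ℂ} (hv : star v ⬝ᵥ v = 1) (g : Fin 3 × ℝ) (gs : List (Fin 3 × ℝ))
    (h : List (Fin 3)) {X : Matrix (Fin 2 × Fin n) (Fin 2 × Fin n) ℂ} (hX : X.PosSemidef) :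
    ∑ o : Attempt m, badPotential a m L p η v (nextGates g gs o) (o.labels ++ h)
      (attemptOp a g.1 (frameSign g.1 h * g.2) o * X *
        (attemptOp a g.1 (frameSign g.1 h * g.2) o)ᴴ) ≤ badPotential a m L p η v (g :: gs) h X := by
  classical
  set K : Attempt m → _ := attemptOp a g.1 (frameSign g.1 h * g.2) with hK
  have hXo : ∀ o : Attempt m, (K o * X * (K o)ᴴ).PosSemidef :=
    fun o => hX.mul_mul_conjTranspose_same _
  have h1 : g.1 + 1 ≠ g.1 := (by decide : ∀ κ : Fin 3, κ + 1 ≠ κ) g.1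
  have h2 : g.1 + 2 ≠ g.1 := (by decide : ∀ κ : Fin 3, κ + 2 ≠ κ) g.1
  have hb := bad_step hL hv g gs h hX hK
  have he := hη g.1 X hX
  have ht := hM.timePotential_step g gs (frameSign g.1 h * g.2) hX
  rw [← hK, sum_attempt_eq g.1, nextGates_of_success gs (bufferedAttempt_success h1),
    nextGates_of_success gs (bufferedAttempt_success h2)] at ht
  rw [sum_attempt_eq g.1, nextGates_of_success gs (bufferedAttempt_success h1),
    nextGates_of_success gs (bufferedAttempt_success h2)]
  have hfail : ∑ o : Attempt m with ¬ o.Success g.1,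
      badPotential a m L p η v (nextGates g gs o) (o.labels ++ h) (K o * X * (K o)ᴴ) =
      4 ^ (gs.length + 1) * (∑ o : Attempt m with ¬ o.Success g.1,
        bad L v (g :: gs) (o.labels ++ h) (K o * X * (K o)ᴴ) +
        η * ∑ o : Attempt m with ¬ o.Success g.1,
          timePotential a m (1 ⊗ₖ L) p (nextGates g gs o) (K o * X * (K o)ᴴ)) := by
    rw [Finset.mul_sum, ← Finset.sum_add_distrib, Finset.mul_sum]
    refine Finset.sum_congr rfl fun o ho => ?_
    rw [nextGates_of_not_success gs (Finset.mem_filter.1 ho).2, badPotential, List.length_cons]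
  have hn1 := mul_nonneg hη0 (hM.timePotential_nonneg gs (hXo (bufferedAttempt m g.1 (g.1 + 1))))
  have hn2 := mul_nonneg hη0 (hM.timePotential_nonneg gs (hXo (bufferedAttempt m g.1 (g.1 + 2))))
  have ht' := mul_le_mul_of_nonneg_left ht hη0
  rw [hfail, badPotential, badPotential, badPotential, List.length_cons]
  generalize (∑ o : Attempt m with ¬ o.Success g.1,
    timePotential a m (1 ⊗ₖ L) p (nextGates g gs o) (K o * X * (K o)ᴴ)) = S at *
  generalize (∑ o : Attempt m with ¬ o.Success g.1,
    bad L v (g :: gs) (o.labels ++ h) (K o * X * (K o)ᴴ)) = B at *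
  generalize bad L v gs ((bufferedAttempt m g.1 (g.1 + 1)).labels ++ h) _ = b₁ at *
  generalize bad L v gs ((bufferedAttempt m g.1 (g.1 + 2)).labels ++ h) _ = b₂ at *
  generalize timePotential a m (1 ⊗ₖ L) p gs (K (bufferedAttempt m g.1 (g.1 + 1)) * X * _) = t₁ at *
  generalize timePotential a m (1 ⊗ₖ L) p gs (K (bufferedAttempt m g.1 (g.1 + 2)) * X * _) = t₂ at *
  have key : B + η * S + ((b₁ + η * t₁) + (b₂ + η * t₂)) / 4 ≤
      bad L v (g :: gs) h X + η * timePotential a m (1 ⊗ₖ L) p (g :: gs) X := by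
    linarith
  have := mul_le_mul_of_nonneg_left key (by positivity : (0 : ℝ) ≤ 4 ^ (gs.length + 1))
  rw [pow_succ] at this ⊢
  linarith

end Potential

/-! ### Sums over runs -/

section Runs

variable {n m : ℕ} {a : Fin 3 → Matrix (Fin n) (Fin n) ℂ}

/-- The sum of `w` over the complete runs which consist of `N` attempts; the arguments of `w` are
the list of all labels and the unnormalized final state. -/
noncomputable def runWeight (a : Fin 3 → Matrix (Fin n) (Fin n) ℂ) (m : ℕ)
    (w : List (Fin 3) → Matrix (Fin 2 × Fin n) (Fin 2 × Fin n) ℂ → ℝ) :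
    ℕ → List (Fin 3 × ℝ) → List (Fin 3) → Matrix (Fin 2 × Fin n) (Fin 2 × Fin n) ℂ → ℝ
  | 0, [], h, X => w h X
  | 0, _ :: _, _, _ => 0
  | _ + 1, [], _, _ => 0
  | N + 1, g :: gs, h, X => ∑ o : Attempt m, runWeight a m w N (nextGates g gs o) (o.labels ++ h)
      (attemptOp a g.1 (frameSign g.1 h * g.2) o * X *
        (attemptOp a g.1 (frameSign g.1 h * g.2) o)ᴴ)

variable {w : List (Fin 3) → Matrix (Fin 2 × Fin n) (Fin 2 × Fin n) ℂ → ℝ}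

theorem runWeight_nonneg (hw : ∀ h X, X.PosSemidef → 0 ≤ w h X) (N : ℕ) (gs : List (Fin 3 × ℝ))
    (h : List (Fin 3)) {X : Matrix (Fin 2 × Fin n) (Fin 2 × Fin n) ℂ} (hX : X.PosSemidef) :
    0 ≤ runWeight a m w N gs h X := by
  induction N generalizing gs h X with
  | zero => cases gs with
    | nil => exact hw h X hX
    | cons g gs => exact le_rfl
  | succ N ih => cases gs with
    | nil => exact le_rfl
    | cons g gs => exact Finset.sum_nonneg fun o _ => ih _ _ (hX.mul_mul_conjTranspose_same _)

theorem sum_runWeight_cons (f : ℕ → ℝ) (N : ℕ) (g : Fin 3 × ℝ) (gs : List (Fin 3 × ℝ))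
    (h : List (Fin 3)) (X : Matrix (Fin 2 × Fin n) (Fin 2 × Fin n) ℂ) :
    ∑ k ∈ Finset.range (N + 1), f k * runWeight a m w k (g :: gs) h X =
      ∑ o : Attempt m, ∑ k ∈ Finset.range N, f (k + 1) * runWeight a m w k (nextGates g gs o)
        (o.labels ++ h) (attemptOp a g.1 (frameSign g.1 h * g.2) o * X *
        (attemptOp a g.1 (frameSign g.1 h * g.2) o)ᴴ) := by
  rw [Finset.sum_range_succ', Finset.sum_comm]
  simp only [runWeight, Finset.mul_sum, mul_zero, add_zero]

theorem sum_runWeight_nil (f : ℕ → ℝ) (N : ℕ) (h : List (Fin 3))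
    (X : Matrix (Fin 2 × Fin n) (Fin 2 × Fin n) ℂ) :
    ∑ k ∈ Finset.range (N + 1), f k * runWeight a m w k [] h X = f 0 * w h X := by
  rw [Finset.sum_range_succ']
  simp [runWeight]

/-- A potential which does not increase on average bounds the expectation of the terminal value. -/
theorem sum_runWeight_le
    {Φ : List (Fin 3 × ℝ) → List (Fin 3) → Matrix (Fin 2 × Fin n) (Fin 2 × Fin n) ℂ → ℝ}
    (hΦ : ∀ gs h X, X.PosSemidef → 0 ≤ Φ gs h X) (hw : ∀ h X, X.PosSemidef → w h X ≤ Φ [] h X)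
    (hstep : ∀ (g : Fin 3 × ℝ) (gs : List (Fin 3 × ℝ)) (h : List (Fin 3))
      (X : Matrix (Fin 2 × Fin n) (Fin 2 × Fin n) ℂ), X.PosSemidef →
      ∑ o : Attempt m, Φ (nextGates g gs o) (o.labels ++ h)
        (attemptOp a g.1 (frameSign g.1 h * g.2) o * X *
          (attemptOp a g.1 (frameSign g.1 h * g.2) o)ᴴ) ≤ Φ (g :: gs) h X)
    (N : ℕ) (gs : List (Fin 3 × ℝ)) (h : List (Fin 3))
    {X : Matrix (Fin 2 × Fin n) (Fin 2 × Fin n) ℂ} (hX : X.PosSemidef) :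
    ∑ k ∈ Finset.range N, runWeight a m w k gs h X ≤ Φ gs h X := by
  induction N generalizing gs h X with
  | zero => simpa using hΦ gs h X hX
  | succ N ih => cases gs with
    | nil =>
      have := sum_runWeight_nil (a := a) (m := m) (w := w) (fun _ => 1) N h X
      simp only [one_mul] at this
      rw [this]
      exact hw h X hX
    | cons g gs =>
      have := sum_runWeight_cons (a := a) (m := m) (w := w) (fun _ => 1) N g gs h X
      simp only [one_mul] at this
      rw [this]
      exact (Finset.sum_le_sum fun o _ => ih _ _ (hX.mul_mul_conjTranspose_same _)).trans
        (hstep g gs h X hX)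

variable {Y : Matrix (Fin 2 × Fin n) (Fin 2 × Fin n) ℂ} {p : ℝ}

theorem Mixes.sum_runWeight_le_weight (hM : Mixes a m Y p) (N : ℕ) (gs : List (Fin 3 × ℝ))
    (h : List (Fin 3)) {X : Matrix (Fin 2 × Fin n) (Fin 2 × Fin n) ℂ} (hX : X.PosSemidef) :
    ∑ k ∈ Finset.range N, runWeight a m (fun _ => weight Y) k gs h X ≤ weight Y X := by
  refine sum_runWeight_le (Φ := fun _ _ => weight Y)
      (fun _ _ X hX => weight_nonneg hM.posSemidef hX)
    (fun _ _ _ => le_rfl) (fun g gs h X _ => ?_) N gs h hX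
  exact (hM.sum_weight g.1 _ X).le

/-- The left side is the unnormalized expectation of min(number of blocks, N): runs that are not
complete before N blocks count N. It gives both halting with probability one and the finite mean. -/
theorem Mixes.sum_mul_runWeight_add_le (hM : Mixes a m Y p) (N : ℕ) (gs : List (Fin 3 × ℝ))
    (h : List (Fin 3)) {X : Matrix (Fin 2 × Fin n) (Fin 2 × Fin n) ℂ} (hX : X.PosSemidef) :
    ∑ k ∈ Finset.range N, k * runWeight a m (fun _ => weight Y) k gs h X +
      N * (weight Y X - ∑ k ∈ Finset.range N, runWeight a m (fun _ => weight Y) k gs h X) ≤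
      timePotential a m Y p gs X := by
  induction N generalizing gs h X with
  | zero => simpa using hM.timePotential_nonneg gs hX
  | succ N ih => cases gs with
    | nil =>
      have h1 := sum_runWeight_nil (a := a) (m := m) (w := fun _ => weight Y) (fun k => k) N h X
      have h2 := sum_runWeight_nil (a := a) (m := m) (w := fun _ => weight Y) (fun _ => 1) N h X
      simp only [one_mul] at h2
      rw [h1, h2]
      simp [timePotential]
    | cons g gs =>
      have h1 := sum_runWeight_cons (a := a) (m := m) (w := fun _ => weight Y)
          (fun k => k) N g gs h X
      have h2 := sum_runWeight_cons (a := a) (m := m) (w := fun _ => weight Y)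
          (fun _ => 1) N g gs h X
      simp only [one_mul] at h2
      have h3 := hM.timePotential_step g gs (frameSign g.1 h * g.2) hX
      have h4 := Finset.sum_le_sum fun (o : Attempt m) (_ : o ∈ Finset.univ) =>
        ih (nextGates g gs o) (o.labels ++ h) (hX.mul_mul_conjTranspose_same
          (attemptOp a g.1 (frameSign g.1 h * g.2) o))
      have h5 := hM.sum_weight g.1 (frameSign g.1 h * g.2) X
      rw [h1, h2]
      simp only [Nat.cast_add, Nat.cast_one, add_mul, one_mul, Finset.sum_add_distrib,
        ← Finset.mul_sum, Finset.sum_sub_distrib, mul_sub, h5] at h4 ⊢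
      linarith

/-- The truncated expectation bounds N times the mass still running, so this mass is at most the
potential divided by N. -/
theorem Mixes.hasSum_runWeight (hM : Mixes a m Y p) (gs : List (Fin 3 × ℝ))
    (h : List (Fin 3)) {X : Matrix (Fin 2 × Fin n) (Fin 2 × Fin n) ℂ} (hX : X.PosSemidef) :
    HasSum (fun N => runWeight a m (fun _ => weight Y) N gs h X) (weight Y X) := by
  have h0 : ∀ N, 0 ≤ runWeight a m (fun _ => weight Y) N gs h X := fun N =>
    runWeight_nonneg (fun _ _ hX => weight_nonneg hM.posSemidef hX) N gs h hX
  rw [hasSum_iff_tendsto_nat_of_nonneg h0]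
  have h1 : Tendsto (fun N : ℕ => weight Y X - timePotential a m Y p gs X * (1 / (N : ℝ))) atTop
      (𝓝 (weight Y X)) := by
    simpa using tendsto_const_nhds.sub (tendsto_one_div_atTop_nhds_zero_nat.const_mul
      (timePotential a m Y p gs X))
  refine tendsto_of_tendsto_of_tendsto_of_le_of_le' h1 tendsto_const_nhds ?_
    (Eventually.of_forall fun N => hM.sum_runWeight_le_weight N gs h hX)
  filter_upwards [eventually_gt_atTop 0] with N hN
  have h2 := hM.sum_mul_runWeight_add_le N gs h hX
  have h3 : 0 ≤ ∑ k ∈ Finset.range N, k * runWeight a m (fun _ => weight Y) k gs h X :=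
    Finset.sum_nonneg fun k _ => mul_nonneg (Nat.cast_nonneg k) (h0 k)
  have hN' : (0 : ℝ) < N := Nat.cast_pos.2 hN
  have h4 : weight Y X - ∑ k ∈ Finset.range N, runWeight a m (fun _ => weight Y) k gs h X ≤
      timePotential a m Y p gs X * (1 / (N : ℝ)) := by
    rw [mul_one_div, le_div_iff₀ hN']
    linarith
  linarith

theorem Mixes.exists_hasSum_mul_runWeight (hM : Mixes a m Y p) (gs : List (Fin 3 × ℝ))
    (h : List (Fin 3)) {X : Matrix (Fin 2 × Fin n) (Fin 2 × Fin n) ℂ} (hX : X.PosSemidef) :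
    ∃ S ≤ timePotential a m Y p gs X,
      HasSum (fun N : ℕ => N * runWeight a m (fun _ => weight Y) N gs h X) S := by
  have h0 : ∀ N : ℕ, 0 ≤ N * runWeight a m (fun _ => weight Y) N gs h X := fun N =>
    mul_nonneg (Nat.cast_nonneg N)
      (runWeight_nonneg (fun _ _ hX => weight_nonneg hM.posSemidef hX) N gs h hX)
  have h1 : ∀ N, ∑ k ∈ Finset.range N, k * runWeight a m (fun _ => weight Y) k gs h X ≤
      timePotential a m Y p gs X := fun N => by
    have h2 := hM.sum_mul_runWeight_add_le N gs h hX
    have h3 := mul_nonneg (Nat.cast_nonneg (α := ℝ) N)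
      (sub_nonneg.2 (hM.sum_runWeight_le_weight N gs h hX))
    linarith
  exact ⟨_, Real.tsum_le_of_sum_range_le h0 h1, (summable_of_sum_range_le h0 h1).hasSum⟩

open Classical in
/-- The contribution of one run to `runWeight`. -/
noncomputable def runValue (a : Fin 3 → Matrix (Fin n) (Fin n) ℂ)
    (w : List (Fin 3) → Matrix (Fin 2 × Fin n) (Fin 2 × Fin n) ℂ → ℝ) (gs : List (Fin 3 × ℝ))
    (h : List (Fin 3)) (X : Matrix (Fin 2 × Fin n) (Fin 2 × Fin n) ℂ) (t : List (Attempt m)) : ℝ :=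
  if IsComplete gs t then
    w (t.reverse.flatMap Attempt.labels ++ h) (runOp a gs h t * X * (runOp a gs h t)ᴴ)
  else 0

theorem runValue_cons (g : Fin 3 × ℝ) (gs : List (Fin 3 × ℝ)) (h : List (Fin 3))
    (X : Matrix (Fin 2 × Fin n) (Fin 2 × Fin n) ℂ) (o : Attempt m) (t : List (Attempt m)) :
    runValue a w (g :: gs) h X (o :: t) = runValue a w (nextGates g gs o) (o.labels ++ h)
      (attemptOp a g.1 (frameSign g.1 h * g.2) o * X *
        (attemptOp a g.1 (frameSign g.1 h * g.2) o)ᴴ) t := by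
  have h1 : IsComplete (g :: gs) (o :: t) ↔ IsComplete (nextGates g gs o) t := by
    rw [IsComplete, nextGates]
  have h2 : runOp a (g :: gs) h (o :: t) = runOp a (nextGates g gs o) (o.labels ++ h) t *
      attemptOp a g.1 (frameSign g.1 h * g.2) o := by
    rw [runOp, nextGates]
  rw [runValue, runValue, show IsComplete (g :: gs) (o :: t) = IsComplete (nextGates g gs o) t
    from propext h1]
  simp only [h2, Matrix.conjTranspose_mul, List.reverse_cons, List.flatMap_append,
    List.flatMap_cons, List.flatMap_nil, List.append_nil, List.append_assoc, Matrix.mul_assoc]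

theorem sum_runValue (N : ℕ) (gs : List (Fin 3 × ℝ)) (h : List (Fin 3))
    (X : Matrix (Fin 2 × Fin n) (Fin 2 × Fin n) ℂ) :
    ∑ t : Fin N → Attempt m, runValue a w gs h X (List.ofFn t) = runWeight a m w N gs h X := by
  induction N generalizing gs h X with
  | zero => cases gs <;> simp [runValue, runWeight, IsComplete, runOp]
  | succ N ih =>
    rw [sum_fin_succ]
    cases gs with
    | nil => simp [runValue, runWeight, IsComplete]
    | cons g gs =>
      rw [runWeight]
      refine Finset.sum_congr rfl fun o _ => ?_
      rw [← ih]
      refine Finset.sum_congr rfl fun t _ => ?_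
      rw [List.ofFn_cons, runValue_cons]

/-- Lists are sorted by length; nonnegativity makes summability by lengths sufficient. -/
theorem hasSum_list_of_nonneg {α : Type*} [Fintype α] {G : List α → ℝ} (hG : ∀ t, 0 ≤ G t) {S : ℝ}
    (hS : HasSum (fun N => ∑ t : Fin N → α, G (List.ofFn t)) S) : HasSum G S := by
  rw [← (List.equivSigmaTuple (α := α)).symm.hasSum_iff]
  have h1 : Summable (G ∘ (List.equivSigmaTuple (α := α)).symm) := by
    refine (summable_sigma_of_nonneg fun x => hG _).2 ⟨fun N => Summable.of_finite, ?_⟩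
    refine hS.summable.congr fun N => ?_
    rw [tsum_fintype]
    rfl
  refine (HasSum.sigma h1.hasSum fun N => hasSum_fintype _).unique hS ▸ h1.hasSum

theorem hasSum_run {gs : List (Fin 3 × ℝ)} {f : Run m gs → ℝ}
    {G : List (Attempt m) → ℝ} (hG : ∀ t, 0 ≤ G t) (hGf : ∀ t : Run m gs, G t.1 = f t)
    (hG0 : ∀ t, ¬ IsComplete gs t → G t = 0) {S : ℝ}
    (hS : HasSum (fun N => ∑ t : Fin N → Attempt m, G (List.ofFn t)) S) : HasSum f S := by
  have h1 := hasSum_list_of_nonneg hG hS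
  have h2 : f = G ∘ ((↑) : Run m gs → List (Attempt m)) := funext fun t => (hGf t).symm
  rw [h2]
  exact (hasSum_subtype_iff_of_support_subset fun t ht => by_contra fun hc => ht (hG0 t hc)).2 h1

theorem runValue_nonneg (hw : ∀ h X, X.PosSemidef → 0 ≤ w h X) (gs : List (Fin 3 × ℝ))
    (h : List (Fin 3)) {X : Matrix (Fin 2 × Fin n) (Fin 2 × Fin n) ℂ} (hX : X.PosSemidef)
    (t : List (Attempt m)) : 0 ≤ runValue a w gs h X t := by
  rw [runValue]
  split_ifs
  · exact hw _ _ (hX.mul_mul_conjTranspose_same _)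
  · exact le_rfl

theorem runValue_run {gs : List (Fin 3 × ℝ)} (X : Matrix (Fin 2 × Fin n) (Fin 2 × Fin n) ℂ)
    (t : Run m gs) : runValue a w gs [] X t.1 =
      w (t.1.reverse.flatMap Attempt.labels) (t.op a * X * (t.op a)ᴴ) := by
  rw [runValue, if_pos t.2, List.append_nil, Run.op]

theorem hasSum_run_value (hw : ∀ h X, X.PosSemidef → 0 ≤ w h X) {gs : List (Fin 3 × ℝ)}
    {X : Matrix (Fin 2 × Fin n) (Fin 2 × Fin n) ℂ} (hX : X.PosSemidef) {S : ℝ}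
    (hS : HasSum (fun N => runWeight a m w N gs [] X) S) :
    HasSum (fun t : Run m gs =>
      w (t.1.reverse.flatMap Attempt.labels) (t.op a * X * (t.op a)ᴴ)) S :=
  hasSum_run (runValue_nonneg hw gs [] hX) (runValue_run X)
    (fun _ ht => if_neg ht) (by simpa only [sum_runValue] using hS)

theorem hasSum_run_length_mul_value (hw : ∀ h X, X.PosSemidef → 0 ≤ w h X) {gs : List (Fin 3 × ℝ)}
    {X : Matrix (Fin 2 × Fin n) (Fin 2 × Fin n) ℂ} (hX : X.PosSemidef) {S : ℝ}
    (hS : HasSum (fun N : ℕ => N * runWeight a m w N gs [] X) S) :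
    HasSum (fun t : Run m gs => t.1.length *
      w (t.1.reverse.flatMap Attempt.labels) (t.op a * X * (t.op a)ᴴ)) S := by
  refine hasSum_run (G := fun t => t.length * runValue a w gs [] X t)
    (fun t => mul_nonneg (Nat.cast_nonneg _) (runValue_nonneg hw gs [] hX t))
    (fun t => by rw [runValue_run]) (fun t ht => by rw [runValue, if_neg ht, mul_zero]) ?_
  simpa only [List.length_ofFn, ← Finset.mul_sum, sum_runValue] using hS

end Runs

/-! ### Fidelity and overhead of the protocol -/

section Protocol

variable {n m : ℕ} {a : Fin 3 → Matrix (Fin n) (Fin n) ℂ} {L : Matrix (Fin n) (Fin n) ℂ}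
  {p η : ℝ}

/-- The fixed point is a density operator on protected space ⊗ junk space. -/
structure IsFaithful (L : Matrix (Fin n) (Fin n) ℂ) : Prop where
  posDef : ((1 : Matrix (Fin 2) (Fin 2) ℂ) ⊗ₖ L).PosDef
  trace_eq : ((1 : Matrix (Fin 2) (Fin 2) ℂ) ⊗ₖ L).trace = 1

/-- The norm of the inverse of the fixed point. -/
noncomputable def invTrace (L : Matrix (Fin n) (Fin n) ℂ) : ℝ :=
  ((1 : Matrix (Fin 2) (Fin 2) ℂ) ⊗ₖ L)⁻¹.trace.re

theorem IsFaithful.weight_le_trace (hF : IsFaithful L)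
    {X : Matrix (Fin 2 × Fin n) (Fin 2 × Fin n) ℂ} (hX : X.PosSemidef) :
    weight (1 ⊗ₖ L) X ≤ X.trace.re := by
  simpa [hF.trace_eq] using weight_le_trace_mul_trace hF.posDef.posSemidef hX

theorem IsFaithful.trace_le (hF : IsFaithful L)
    {X : Matrix (Fin 2 × Fin n) (Fin 2 × Fin n) ℂ} (hX : X.PosSemidef) :
    X.trace.re ≤ invTrace L * weight (1 ⊗ₖ L) X :=
  trace_le_mul_weight hF.posDef hX

theorem IsFaithful.invTrace_pos (hF : IsFaithful L) : 0 < invTrace L := by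
  have h1 := hF.trace_le hF.posDef.posSemidef
  rw [hF.trace_eq, Complex.one_re] at h1
  have h2 := weight_nonneg hF.posDef.posSemidef hF.posDef.posSemidef
  by_contra h
  have := mul_nonpos_of_nonpos_of_nonneg (not_lt.1 h) h2
  linarith

/-- Compare trace and weight for X compressed to the complement of φ, so that the faithfulness of L
is used on the deviation alone. -/
theorem IsFaithful.weight_orth_one_le (hF : IsFaithful L) {φ : Fin 2 → ℂ}
    (hφ : star φ ⬝ᵥ φ = 1) {X : Matrix (Fin 2 × Fin n) (Fin 2 × Fin n) ℂ} (hX : X.PosSemidef) :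
    weight (orth φ ⊗ₖ 1) X ≤ invTrace L * weight (orth φ ⊗ₖ L) X := by
  have h1 := hF.trace_le (hX.mul_mul_conjTranspose_same (orth φ ⊗ₖ (1 : Matrix (Fin n) (Fin n) ℂ)))
  rw [← weight_one_left, weight_conj, weight_conj, Matrix.conjTranspose_kronecker,
    orth_conjTranspose, Matrix.conjTranspose_one, mul_one, ← Matrix.mul_kronecker_mul,
    ← Matrix.mul_kronecker_mul, ← Matrix.mul_kronecker_mul, mul_one, orth_mul_self hφ, mul_one,
    one_mul, mul_one, orth_mul_self hφ] at h1
  exact h1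

theorem IsFaithful.weight_productState_pos (hF : IsFaithful L) {ψ : Fin 2 → ℂ}
    (hψ : star ψ ⬝ᵥ ψ = 1) {ρJ : Matrix (Fin n) (Fin n) ℂ} (hρ : ρJ.PosSemidef)
    (htr : ρJ.trace = 1) : 0 < weight (1 ⊗ₖ L) (productState ψ ρJ) := by
  refine weight_pos hF.posDef (productState_posSemidef ψ hρ) fun h => ?_
  have := trace_productState hψ htr
  rw [h, Matrix.trace_zero] at this
  exact zero_ne_one this

theorem Mixes.hasSum_prob (hF : IsFaithful L) (hM : Mixes a m (1 ⊗ₖ L) p)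
    (gs : List (Fin 3 × ℝ)) {ψ : Fin 2 → ℂ} (hψ : star ψ ⬝ᵥ ψ = 1)
    {ρJ : Matrix (Fin n) (Fin n) ℂ} (hρ : ρJ.PosSemidef) (htr : ρJ.trace = 1) :
    HasSum (fun t : Run m gs => t.prob a (1 ⊗ₖ L) (productState ψ ρJ)) 1 := by
  have hX := productState_posSemidef ψ hρ
  have h1 := hasSum_run_value (w := fun _ => weight (1 ⊗ₖ L))
    (fun _ _ hX => weight_nonneg hM.posSemidef hX) hX (hM.hasSum_runWeight gs [] hX)
  have h2 := h1.div_const (weight (1 ⊗ₖ L) (productState ψ ρJ))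
  rw [div_self (hF.weight_productState_pos hψ hρ htr).ne'] at h2
  exact h2

theorem Mixes.expectedSitesLE (hF : IsFaithful L) (hM : Mixes a m (1 ⊗ₖ L) p)
    (gs : List (Fin 3 × ℝ)) {ψ : Fin 2 → ℂ} (hψ : star ψ ⬝ᵥ ψ = 1)
    {ρJ : Matrix (Fin n) (Fin n) ℂ} (hρ : ρJ.PosSemidef) (htr : ρJ.trace = 1) :
    ExpectedSitesLE a (1 ⊗ₖ L) m gs ψ ρJ ((2 * m + 1) * (gs.length * (2 / p))) := by
  have hX := productState_posSemidef ψ hρ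
  have hw := hF.weight_productState_pos hψ hρ htr
  obtain ⟨S, hS, hsum⟩ := hM.exists_hasSum_mul_runWeight gs [] hX
  have h1 := hasSum_run_length_mul_value (w := fun _ => weight (1 ⊗ₖ L))
    (fun _ _ hX => weight_nonneg hM.posSemidef hX) hX hsum
  refine ⟨(2 * m + 1) * (S / weight (1 ⊗ₖ L) (productState ψ ρJ)), ?_, ?_⟩
  · refine mul_le_mul_of_nonneg_left ?_ (by positivity)
    rw [div_le_iff₀ hw]
    exact hS.trans (hM.timePotential_le gs hX)
  · refine ((h1.div_const (weight (1 ⊗ₖ L) (productState ψ ρJ))).mul_left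
      (2 * (m : ℝ) + 1)).congr_fun ?_
    intro t
    rw [Run.prob, Run.sites]
    change weight (1 ⊗ₖ L) (t.op a * productState ψ ρJ * (t.op a)ᴴ) /
      weight (1 ⊗ₖ L) (productState ψ ρJ) * _ = _
    push_cast
    ring

/-- The loss of fidelity, weighted with the probability of the run. -/
noncomputable def fidelityLoss (L : Matrix (Fin n) (Fin n) ℂ) (v : Fin 2 → ℂ) (h : List (Fin 3))
    (X : Matrix (Fin 2 × Fin n) (Fin 2 × Fin n) ℂ) : ℝ :=
  weight (1 ⊗ₖ L) X * (weight (orth (byproduct h *ᵥ v) ⊗ₖ 1) X / X.trace.re)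

theorem byproduct_mulVec_unit {v : Fin 2 → ℂ} (hv : star v ⬝ᵥ v = 1) (h : List (Fin 3)) :
    star (byproduct h *ᵥ v) ⬝ᵥ (byproduct h *ᵥ v) = 1 :=
  star_mulVec_dotProduct (Matrix.mem_unitaryGroup_iff'.1 (byproduct_mem_unitaryGroup h)) hv

theorem fidelityLoss_nonneg (hL : L.PosSemidef) {v : Fin 2 → ℂ} (hv : star v ⬝ᵥ v = 1)
    (h : List (Fin 3)) {X : Matrix (Fin 2 × Fin n) (Fin 2 × Fin n) ℂ} (hX : X.PosSemidef) :
    0 ≤ fidelityLoss L v h X :=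
  mul_nonneg (weight_nonneg (Matrix.PosSemidef.one.kronecker hL) hX)
    (div_nonneg (weight_nonneg ((orth_posSemidef (byproduct_mulVec_unit hv h)).kronecker .one) hX)
      (trace_re_nonneg hX))

/-- The Born weight of a run never exceeds the trace of its state, so the normalization in the
fidelity cancels and a linear expression remains. -/
theorem IsFaithful.fidelityLoss_le (hF : IsFaithful L) {v : Fin 2 → ℂ}
    (hv : star v ⬝ᵥ v = 1) (h : List (Fin 3)) {X : Matrix (Fin 2 × Fin n) (Fin 2 × Fin n) ℂ}
    (hX : X.PosSemidef) : fidelityLoss L v h X ≤ invTrace L * bad L v [] h X := by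
  have h1 : bad L v [] h X = weight (orth (byproduct h *ᵥ v) ⊗ₖ L) X := by
    rw [bad, idealState, gateProd, Matrix.conjTranspose_one, Matrix.one_mulVec]
  have hu := byproduct_mulVec_unit hv h
  have h2 := hF.weight_orth_one_le hu hX
  have h3 := weight_nonneg ((orth_posSemidef hu).kronecker
    (Matrix.PosSemidef.one (n := Fin n) (R := ℂ))) hX
  have h4 := hF.weight_le_trace hX
  rw [h1, fidelityLoss]
  refine le_trans ?_ h2
  rw [← mul_div_assoc]
  refine div_le_of_le_mul₀ (trace_re_nonneg hX) h3 ?_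
  rw [mul_comm]
  exact mul_le_mul_of_nonneg_left h4 h3

/-- The initial state has no deviation, so only the time part of the potential remains: η times the
bound on the number of blocks, with 4 per gate and `invTrace L` for the passage from L to the trace.
-/
theorem Mixes.implementsWithFidelity (hF : IsFaithful L) (hL : IsJunkFixedPoint a L)
    (hM : Mixes a m (1 ⊗ₖ L) p) (hη0 : 0 ≤ η)
    (hη : ∀ (κ : Fin 3) (X : Matrix (Fin 2 × Fin n) (Fin 2 × Fin n) ℂ), X.PosSemidef →
      weight ((1 : Matrix (Fin 2) (Fin 2) ℂ) ⊗ₖ ((junkDefect a κ m)ᴴ * L * junkDefect a κ m)) X ≤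
        η * weight ((1 : Matrix (Fin 2) (Fin 2) ℂ) ⊗ₖ L) X)
    (gs : List (Fin 3 × ℝ)) {W : Matrix (Fin 2) (Fin 2) ℂ} {c : ℂ} (hc : ‖c‖ = 1)
    (hW : W = c • gateProd gs) {ψ : Fin 2 → ℂ} (hψ : star ψ ⬝ᵥ ψ = 1)
    {ρJ : Matrix (Fin n) (Fin n) ℂ} (hρ : ρJ.PosSemidef) (htr : ρJ.trace = 1) :
    ImplementsWithFidelity a (1 ⊗ₖ L) m gs W ψ ρJ
      (1 - invTrace L * (4 ^ gs.length * (η * (gs.length * (2 / p))))) := by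
  have hX := productState_posSemidef ψ hρ
  have hw := hF.weight_productState_pos hψ hρ htr
  have hp := hF.invTrace_pos
  have hG := gateProd_mem_unitaryGroup gs
  set v := c • (gateProd gs *ᵥ ψ) with hv
  have hWψ : W *ᵥ ψ = v := by rw [hW, Matrix.smul_mulVec, hv]
  have hv1 : star v ⬝ᵥ v = 1 := by
    rw [hv, star_smul, smul_dotProduct, dotProduct_smul,
      star_mulVec_dotProduct (Matrix.mem_unitaryGroup_iff'.1 hG) hψ, smul_smul, Complex.star_def,
      Complex.conj_mul', hc]
    simp
  have hstart : bad L v gs [] (productState ψ ρJ) = 0 := by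
    have h1 : idealState v gs [] = c • ψ := by
      have h2 : (gateProd gs)ᴴ * gateProd gs = 1 := Matrix.mem_unitaryGroup_iff'.1 hG
      rw [idealState, byproduct, List.map_nil, List.prod_nil, Matrix.one_mulVec, hv,
        Matrix.mulVec_smul, Matrix.mulVec_mulVec, h2, Matrix.one_mulVec]
    rw [bad, h1, orth_smul hc, weight_orth_productState _ hψ]
  have hloss : ∀ N, ∑ k ∈ Finset.range N, runWeight a m (fidelityLoss L v) k gs []
      (productState ψ ρJ) ≤ invTrace L * badPotential a m L p η v gs [] (productState ψ ρJ) := by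
    intro N
    refine sum_runWeight_le (Φ := fun gs h X => invTrace L * badPotential a m L p η v gs h X)
      (fun gs h X hX => ?_) (fun h X hX => ?_) (fun g gs h X hX => ?_) N gs [] hX
    · exact mul_nonneg hp.le (mul_nonneg (by positivity) (add_nonneg
        (bad_nonneg hL.posSemidef hv1 gs h hX) (mul_nonneg hη0 (hM.timePotential_nonneg gs hX))))
    · refine (hF.fidelityLoss_le hv1 h hX).trans (le_of_eq ?_)
      simp [badPotential, timePotential]
    · rw [← Finset.mul_sum]
      exact mul_le_mul_of_nonneg_left (badPotential_step hL hM hη0 hη hv1 g gs h hX) hp.le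
  have hnn : ∀ k, 0 ≤ runWeight a m (fidelityLoss L v) k gs [] (productState ψ ρJ) := fun k =>
    runWeight_nonneg (fun h X hX => fidelityLoss_nonneg hL.posSemidef hv1 h hX) k gs [] hX
  have hS := (summable_of_sum_range_le hnn hloss).hasSum
  have hSle := Real.tsum_le_of_sum_range_le hnn hloss
  set S := ∑' k, runWeight a m (fidelityLoss L v) k gs [] (productState ψ ρJ)
  have hrun := hasSum_run_value (fun h X hX => fidelityLoss_nonneg hL.posSemidef hv1 h hX) hX hS
  have hprob := hM.hasSum_prob hF gs hψ hρ htr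
  refine ⟨hprob, 1 - S / weight (1 ⊗ₖ L) (productState ψ ρJ), ?_, ?_⟩
  · refine sub_le_sub_left ?_ 1
    rw [div_le_iff₀ hw]
    refine hSle.trans ?_
    rw [badPotential, hstart, zero_add, mul_assoc]
    refine mul_le_mul_of_nonneg_left ?_ hp.le
    rw [mul_assoc, mul_assoc]
    refine mul_le_mul_of_nonneg_left ?_ (by positivity)
    exact mul_le_mul_of_nonneg_left (hM.timePotential_le gs hX) hη0
  · refine (hprob.sub (hrun.div_const (weight (1 ⊗ₖ L) (productState ψ ρJ)))).congr_fun ?_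
    intro t
    set Z := t.op a * productState ψ ρJ * (t.op a)ᴴ with hZ
    have hZpos : Z.PosSemidef := hX.mul_mul_conjTranspose_same _
    have hpr : t.prob a (1 ⊗ₖ L) (productState ψ ρJ) =
      weight (1 ⊗ₖ L) Z / weight (1 ⊗ₖ L) (productState ψ ρJ) := rfl
    rw [hpr, fidelityLoss]
    -- Runs with vanishing final state have a fidelity defined through division by 0, but their
    -- probability is 0.
    by_cases h0 : Z.trace.re = 0
    · have h1 : weight (1 ⊗ₖ L) Z = 0 :=
        le_antisymm ((hF.weight_le_trace hZpos).trans h0.le) (weight_nonneg hM.posSemidef hZpos)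
      simp [h1]
    · have h1 := one_sub_gateFidelity hρ (t.op a) (t.pauliByproduct * W) h0
      rw [← Matrix.mulVec_mulVec, hWψ, ← hZ] at h1
      rw [Run.pauliByproduct] at h1 ⊢
      rw [← h1]
      ring

end Protocol

/-! ### Uniform bounds for the protocol -/

/-- For r > 0 take m = ⌈ζ log(1/ε)⌉ + m₁: the first summand makes r^k ≤ ε, the fixed m₁ absorbs C
and m₀. Rounding up costs at most exp(4 |log b|), with an absolute value as the sign of log b is not
known. -/
theorem exists_buffer_length {r b K : ℝ} (hr0 : 0 ≤ r) (hr1 : r < 1) (hb : 0 < b) (hK : 0 ≤ K)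
    (C : ℝ) (m₀ : ℕ) : ∃ C' : ℝ, ∀ ε : ℝ, 0 < ε → ε < 1 → ∃ m ≥ m₀, C * r ^ m ≤ ε ∧
      (2 * (m : ℝ) + 1) * (K * b ^ (4 * m)) ≤ C' * (1 + (-Real.log r)⁻¹ * Real.log (1 / ε)) *
        (1 / ε) ^ (4 * (-Real.log r)⁻¹ * Real.log b) := by
  rcases hr0.eq_or_lt with rfl | hr
  -- For r = 0 one m serves all ε; it must be positive for 0^m = 0. Since log 0 = 0 and 0⁻¹ = 0, the
  -- right side reduces to the constant.
  · refine ⟨(2 * ((m₀ + 1 : ℕ) : ℝ) + 1) * (K * b ^ (4 * (m₀ + 1))), fun ε hε _ =>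
      ⟨m₀ + 1, by omega, ?_, ?_⟩⟩
    · rw [zero_pow (Nat.succ_ne_zero _), mul_zero]
      exact hε.le
    · simp
  set z := (-Real.log r)⁻¹ with hz
  have hlog : 0 < -Real.log r := neg_pos.2 (Real.log_neg hr hr1)
  have hz0 : 0 < z := inv_pos.2 hlog
  have hlim : Tendsto (fun m : ℕ => C * r ^ m) atTop (𝓝 (C * 0)) :=
    (tendsto_pow_atTop_nhds_zero_of_lt_one hr0 hr1).const_mul _
  rw [mul_zero] at hlim
  obtain ⟨m₁, hm₁, hm₀⟩ := ((hlim.eventually_le_const one_pos).and (eventually_ge_atTop m₀)).exists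
  refine ⟨(2 * (m₁ : ℝ) + 3) * (K * b ^ (4 * m₁) * Real.exp (4 * |Real.log b|)),
    fun ε hε hε1 => ?_⟩
  have hx0 : 0 ≤ z * Real.log (1 / ε) :=
    mul_nonneg hz0.le (Real.log_nonneg (by rw [le_div_iff₀ hε]; linarith))
  set x := z * Real.log (1 / ε) with hx
  have hk1 := Nat.le_ceil x
  have hk2 := (Nat.ceil_lt_add_one hx0).le
  set k := ⌈x⌉₊
  refine ⟨k + m₁, by omega, ?_, ?_⟩
  · have h1 : r ^ k ≤ ε := by
      rw [← Real.rpow_natCast]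
      refine (Real.rpow_le_rpow_of_exponent_ge hr hr1.le hk1).trans (le_of_eq ?_)
      rw [Real.rpow_def_of_pos hr, hx, ← mul_assoc, hz, inv_neg, mul_neg,
        mul_inv_cancel₀ (by linarith), neg_one_mul, one_div, Real.log_inv, neg_neg,
        Real.exp_log hε]
    calc C * r ^ (k + m₁) = r ^ k * (C * r ^ m₁) := by rw [pow_add]; ring
      _ ≤ r ^ k * 1 := mul_le_mul_of_nonneg_left hm₁ (pow_nonneg hr0 k)
      _ ≤ ε := by rwa [mul_one]
  · have h2 : b ^ (4 * k) ≤ Real.exp (4 * |Real.log b|) *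
        (1 / ε) ^ (4 * z * Real.log b) := by
      rw [Real.rpow_def_of_pos (by positivity), ← Real.exp_add, ← Real.rpow_natCast,
        Real.rpow_def_of_pos hb]
      refine Real.exp_le_exp.2 ?_
      have h3 : Real.log b * (k - x) ≤ |Real.log b| * 1 :=
        mul_le_mul (le_abs_self _) (by linarith) (by linarith) (abs_nonneg _)
      have h4 : Real.log (1 / ε) * (4 * z * Real.log b) = 4 * (Real.log b * x) := by rw [hx]; ring
      rw [h4]
      push_cast
      linarith
    have h5 : 2 * ((k + m₁ : ℕ) : ℝ) + 1 ≤ (2 * m₁ + 3) * (1 + x) := by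
      push_cast
      nlinarith [mul_nonneg (Nat.cast_nonneg (α := ℝ) m₁) hx0]
    calc (2 * ((k + m₁ : ℕ) : ℝ) + 1) * (K * b ^ (4 * (k + m₁)))
        ≤ (2 * m₁ + 3) * (1 + x) * (K * (b ^ (4 * m₁) * (Real.exp (4 * |Real.log b|) *
        (1 / ε) ^ (4 * z * Real.log b)))) := by
          rw [mul_add 4 k m₁, add_comm (4 * k), pow_add]
          gcongr
      _ = _ := by ring

theorem ImplementsWithFidelity.mono {n m : ℕ} {a : Fin 3 → Matrix (Fin n) (Fin n) ℂ}
    {Λ : Matrix (Fin 2 × Fin n) (Fin 2 × Fin n) ℂ} {gs : List (Fin 3 × ℝ)}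
    {W : Matrix (Fin 2) (Fin 2) ℂ} {ψ : Fin 2 → ℂ} {ρJ : Matrix (Fin n) (Fin n) ℂ} {f f' : ℝ}
    (h : ImplementsWithFidelity a Λ m gs W ψ ρJ f) (hf : f' ≤ f) :
    ImplementsWithFidelity a Λ m gs W ψ ρJ f' := by
  obtain ⟨h1, F, hF, h2⟩ := h
  exact ⟨h1, F, hf.trans hF, h2⟩

theorem ExpectedSitesLE.mono {n m : ℕ} {a : Fin 3 → Matrix (Fin n) (Fin n) ℂ}
    {Λ : Matrix (Fin 2 × Fin n) (Fin 2 × Fin n) ℂ} {gs : List (Fin 3 × ℝ)} {ψ : Fin 2 → ℂ}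
    {ρJ : Matrix (Fin n) (Fin n) ℂ} {N N' : ℝ} (h : ExpectedSitesLE a Λ m gs ψ ρJ N)
    (hN : N ≤ N') : ExpectedSitesLE a Λ m gs ψ ρJ N' := by
  obtain ⟨S, hS, h1⟩ := h
  exact ⟨S, hS.trans hN, h1⟩

theorem trace_one_kronecker {n : ℕ} (M : Matrix (Fin n) (Fin n) ℂ) :
    ((1 : Matrix (Fin 2) (Fin 2) ℂ) ⊗ₖ M).trace.re = 2 * M.trace.re := by
  rw [Matrix.trace_kronecker, Matrix.trace_one, Fintype.card_fin]
  simp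

theorem IsFaithful.le_trace_successOp {n : ℕ} {a : Fin 3 → Matrix (Fin n) (Fin n) ℂ}
    {L : Matrix (Fin n) (Fin n) ℂ} (hF : IsFaithful L) (m : ℕ) (κ : Fin 3) :
    2 * ((renormJunk a κ m (κ + 1))ᴴ * renormJunk a κ m (κ + 1)).trace.re / invTrace L ≤
      (successOp a m (1 ⊗ₖ L) κ).trace.re := by
  have h1 : ∀ μ, ((renorm a κ m μ)ᴴ * (1 ⊗ₖ L) * renorm a κ m μ).trace.re =
      weight (1 ⊗ₖ L) (renorm a κ m μ * 1 * (renorm a κ m μ)ᴴ) := fun μ => by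
    rw [weight_conj, weight_comm, weight_one_left]
  have h2 : (renorm a κ m (κ + 1) * 1 * (renorm a κ m (κ + 1))ᴴ).trace.re =
      2 * ((renormJunk a κ m (κ + 1))ᴴ * renormJunk a κ m (κ + 1)).trace.re := by
    have hQ : pauli κ ^ m * pauli (κ + 1) * pauli κ ^ m ∈ Matrix.unitaryGroup (Fin 2) ℂ :=
      mul_mem (mul_mem (pow_mem (pauli_mem_unitaryGroup _) _) (pauli_mem_unitaryGroup _))
        (pow_mem (pauli_mem_unitaryGroup _) _)
    have hQ' := Matrix.mem_unitaryGroup_iff'.1 hQ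
    rw [Matrix.star_eq_conjTranspose] at hQ'
    rw [mul_one, Matrix.trace_mul_comm, renorm_eq, Matrix.conjTranspose_kronecker,
      ← Matrix.mul_kronecker_mul, hQ', trace_one_kronecker]
  have h3 := hF.trace_le (Matrix.PosSemidef.one.mul_mul_conjTranspose_same (renorm a κ m (κ + 1)))
  have h4 := weight_nonneg hF.posDef.posSemidef
    (Matrix.PosSemidef.one.mul_mul_conjTranspose_same (renorm a κ m (κ + 2)))
  rw [successOp, Matrix.trace_add, Complex.add_re, h1, h1, ← h2, div_le_iff₀ hF.invTrace_pos]
  nlinarith [hF.invTrace_pos, mul_nonneg hF.invTrace_pos.le h4]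

theorem IsFaithful.weight_conj_le {n : ℕ} {L : Matrix (Fin n) (Fin n) ℂ} (hF : IsFaithful L)
    (M : Matrix (Fin n) (Fin n) ℂ) {X : Matrix (Fin 2 × Fin n) (Fin 2 × Fin n) ℂ}
    (hX : X.PosSemidef) : weight ((1 : Matrix (Fin 2) (Fin 2) ℂ) ⊗ₖ (Mᴴ * L * M)) X ≤
      2 * (Mᴴ * M).trace.re * (invTrace L * weight (1 ⊗ₖ L) X) := by
  have h1 : (1 : Matrix (Fin 2) (Fin 2) ℂ) ⊗ₖ (Mᴴ * L * M) =
      ((1 : Matrix (Fin 2) (Fin 2) ℂ) ⊗ₖ M)ᴴ * (1 ⊗ₖ L) * (1 ⊗ₖ M) := by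
    rw [Matrix.conjTranspose_kronecker, Matrix.conjTranspose_one, ← Matrix.mul_kronecker_mul,
      ← Matrix.mul_kronecker_mul, one_mul, one_mul]
  have h2 : ((1 : Matrix (Fin 2) (Fin 2) ℂ) ⊗ₖ M)ᴴ * 1 * (1 ⊗ₖ M) = 1 ⊗ₖ (Mᴴ * M) := by
    rw [mul_one, Matrix.conjTranspose_kronecker, Matrix.conjTranspose_one,
      ← Matrix.mul_kronecker_mul, one_mul]
  have h3 := Matrix.posSemidef_conjTranspose_mul_self M
  rw [h1, ← weight_conj]
  refine (hF.weight_le_trace (hX.mul_mul_conjTranspose_same _)).trans ?_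
  rw [← weight_one_left, weight_conj, h2]
  refine (weight_le_trace_mul_trace (Matrix.PosSemidef.one.kronecker h3) hX).trans ?_
  rw [trace_one_kronecker]
  exact mul_le_mul_of_nonneg_left (hF.trace_le hX)
    (mul_nonneg zero_le_two (trace_re_nonneg h3))

section Uniform

variable {D n : ℕ} {A : Fin 3 → Matrix (Fin D) (Fin D) ℂ} {Λ : Matrix (Fin D) (Fin D) ℂ}
  {U : Octahedral → Matrix (Fin D) (Fin D) ℂ} {V : Matrix (Fin D) (Fin 2 × Fin n) ℂ}
  {a : Fin 3 → Matrix (Fin n) (Fin n) ℂ} {l : ℂ}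

/-- The success probability p is of order N and the defect η of order N r^m, so N cancels in η/p.
The lower bound c |l|^(4m) of N enters only the number of sites. -/
theorem IsProtectedJunk.exists_protocol_bounds (hA : InSPTOPhase A Λ U)
    (h : IsProtectedJunk A U V a) (hl : IsLeading (a 2) l) (hgap : FiniteRenormCorrelation a) :
    ∃ (C K : ℝ) (m₀ : ℕ), 0 ≤ K ∧ ∀ m ≥ m₀, ∀ (W : Matrix (Fin 2) (Fin 2) ℂ) (α β γ : ℝ),
      IsEuler W α β γ → ∀ (ψ : Fin 2 → ℂ) (ρJ : Matrix (Fin n) (Fin n) ℂ),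
        star ψ ⬝ᵥ ψ = 1 → ρJ.PosSemidef → ρJ.trace = 1 →
        ImplementsWithFidelity a (Vᴴ * Λ * V) m (eulerGates α β γ) W ψ ρJ
          (1 - C * ratio (a 2) l ^ m) ∧
        ExpectedSitesLE a (Vᴴ * Λ * V) m (eulerGates α β γ) ψ ρJ
          ((2 * (m : ℝ) + 1) * (K * (1 / ‖l‖) ^ (4 * m))) := by
  have hl0 := norm_pos_iff.2 (leading_ne_zero hl hgap)
  have hr0 := ratio_nonneg (a 2) l
  obtain ⟨C, c, m₁, hJ⟩ := h.exists_junkBounds hA hl hgap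
  have hcan := h.isCanonical hA.canonical
  obtain ⟨L, hY, hL⟩ := exists_isJunkFixedPoint hcan (h.isShortRange hA.shortRange)
  obtain ⟨k₀, hk₀⟩ := hcan.exists_mixing (h.isShortRange hA.shortRange)
  rw [hY] at hcan hk₀ ⊢
  have hF : IsFaithful L := ⟨hcan.posDef, hcan.trace_eq⟩
  have ht := hF.invTrace_pos
  set t := invTrace L with ht_def
  -- 768 = 4³ · 2 · 6: three successes, the 2 in η, and 3 · 2 from the time potential. The three
  -- factors t come from η, from 1/p, and from the comparison of L with the trace.
  refine ⟨768 * (C * t ^ 3), 6 * t / c, max m₁ k₀, div_nonneg (by positivity) hJ.pos.le, ?_⟩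
  rintro m hm W α β γ ⟨e, he, hW⟩ ψ ρJ hψ hρ htr
  set N := ((renormJunk a 2 m 0)ᴴ * renormJunk a 2 m 0).trace.re with hN
  have hNκ : ∀ κ, ((renormJunk a κ m (κ + 1))ᴴ * renormJunk a κ m (κ + 1)).trace.re = N :=
    fun κ => by rw [h.trace_renormJunk hA, hN]
  have hNl : c * ‖l‖ ^ (4 * m) ≤ N := by
    rw [← hNκ 2]
    exact hJ.le_norm 2 m (le_of_max_le_left hm)
  have hcl : 0 < c * ‖l‖ ^ (4 * m) := mul_pos hJ.pos (pow_pos hl0 _)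
  have hN0 : 0 < N := hcl.trans_le hNl
  -- Mixing supplies half the trace of the success observable, which is at least 2N/t. As k₀ does
  -- not depend on that observable, m ≥ k₀ suffices.
  have hM : Mixes a m (1 ⊗ₖ L) (N / t) := by
    refine ⟨hcan.left_fixed, hcan.posDef.posSemidef, div_pos hN0 ht, fun κ X hX => ?_⟩
    refine le_trans ?_ (hk₀ (2 * m + 1) (by have := le_of_max_le_right hm; omega) X _ hX
      (successOp_posSemidef a m hcan.posDef.posSemidef κ))
    have h1 := hF.le_trace_successOp (a := a) m κ
    rw [hNκ κ, mul_div_assoc] at h1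
    have h2 := mul_le_mul_of_nonneg_left h1 (weight_nonneg hcan.posDef.posSemidef hX)
    linarith
  have hη0 : 0 ≤ 2 * (C * ratio (a 2) l ^ m * N) * t := by
    have := hJ.nonneg
    positivity
  have hη : ∀ (κ : Fin 3) (X : Matrix (Fin 2 × Fin n) (Fin 2 × Fin n) ℂ), X.PosSemidef →
      weight ((1 : Matrix (Fin 2) (Fin 2) ℂ) ⊗ₖ ((junkDefect a κ m)ᴴ * L * junkDefect a κ m)) X ≤
        2 * (C * ratio (a 2) l ^ m * N) * t * weight ((1 : Matrix (Fin 2) (Fin 2) ℂ) ⊗ₖ L) X := by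
    intro κ X hX
    refine (hF.weight_conj_le (junkDefect a κ m) hX).trans ?_
    rw [mul_assoc _ t]
    have h1 := hJ.defect_le κ m (le_of_max_le_left hm)
    rw [hNκ κ] at h1
    refine mul_le_mul_of_nonneg_right (by linarith) ?_
    exact mul_nonneg ht.le (weight_nonneg hcan.posDef.posSemidef hX)
  have hgates : W = e • gateProd (eulerGates α β γ) := by
    rw [hW, eulerGates, gateProd, gateProd, gateProd, gateProd, one_mul]
  refine ⟨(hM.implementsWithFidelity hF hL hη0 hη (eulerGates α β γ) he hgates hψ hρ htr).mono
    (le_of_eq ?_), (hM.expectedSitesLE hF (eulerGates α β γ) hψ hρ htr).mono ?_⟩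
  · have : (eulerGates α β γ).length = 3 := rfl
    rw [this]
    push_cast
    field_simp
    ring
  · have : (eulerGates α β γ).length = 3 := rfl
    rw [this]
    refine mul_le_mul_of_nonneg_left ?_ (by positivity)
    have h1 : (3 : ℝ) * (2 / (N / t)) = 6 * t / N := by
      field_simp
      ring
    have h2 : 6 * t / c * (1 / ‖l‖) ^ (4 * m) = 6 * t / (c * ‖l‖ ^ (4 * m)) := by
      rw [one_div, inv_pow]
      field_simp
    push_cast
    rw [h1, h2]
    exact div_le_div_of_nonneg_left (by positivity) hcl hNl

end Uniform

end MPS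
theorem theorem1 {D : ℕ} (A : Fin 3 → Matrix (Fin D) (Fin D) ℂ) (Λ : Matrix (Fin D) (Fin D) ℂ)
    (U : MPS.Octahedral → Matrix (Fin D) (Fin D) ℂ) (hA : MPS.InSPTOPhase A Λ U) :
    -- the virtual space splits into a protected qubit and a junk space
    (∃ (n : ℕ) (V : Matrix (Fin D) (Fin 2 × Fin n) ℂ) (a : Fin 3 → Matrix (Fin n) (Fin n) ℂ),
      MPS.IsProtectedJunk A U V a) ∧
    -- every one-qubit unitary is a product of rotations about `z`, `x` and `z`
    (∀ W ∈ Matrix.unitaryGroup (Fin 2) ℂ, ∃ α β γ : ℝ, MPS.IsEuler W α β γ) ∧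
    ∀ (n : ℕ) (V : Matrix (Fin D) (Fin 2 × Fin n) ℂ) (a : Fin 3 → Matrix (Fin n) (Fin n) ℂ),
      MPS.IsProtectedJunk A U V a →
      ∀ l : ℂ, MPS.IsLeading (a 2) l → MPS.FiniteRenormCorrelation a →
      -- convergence of the renormalized junk operators to a common operator
      (∀ κ : Fin 3, ∃ (T : Matrix (Fin n) (Fin n) ℂ) (s : ℕ → ℂ), T ≠ 0 ∧
        Tendsto (fun m => s m • MPS.renormJunk a κ m (κ + 1)) atTop (𝓝 T) ∧
        Tendsto (fun m => s m • MPS.renormJunk a κ m (κ + 2)) atTop (𝓝 T) ∧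
        ∀ q : ℝ, MPS.ratio (a 2) l < q → ∃ C : ℝ, ∀ (m : ℕ) (i j : Fin n),
          ‖s m * (MPS.renormJunk a κ m (κ + 1) i j - MPS.renormJunk a κ m (κ + 2) i j)‖
            ≤ C * q ^ m) ∧
      -- fidelity of a single rotation after postselected buffering
      (∀ ρJ : Matrix (Fin n) (Fin n) ℂ, ρJ.PosDef → ρJ.trace = 1 →
        ∃ (C : ℝ) (m₀ : ℕ), ∀ m ≥ m₀, ∀ κ c : Fin 3, c ≠ κ → ∀ (θ : ℝ) (ψ : Fin 2 → ℂ),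
          star ψ ⬝ᵥ ψ = 1 →
          1 - C * MPS.ratio (a 2) l ^ m ≤
            MPS.gateFidelity (MPS.outcomeOp (MPS.renorm a κ m) (MPS.rotBasis κ θ c))
              (MPS.pauli c * MPS.rotation κ θ) ψ ρJ) ∧
      -- fidelity of the full protocol for an arbitrary one-qubit unitary
      (∃ (C : ℝ) (m₀ : ℕ), ∀ m ≥ m₀, ∀ (W : Matrix (Fin 2) (Fin 2) ℂ) (α β γ : ℝ),
        MPS.IsEuler W α β γ →
        ∀ (ψ : Fin 2 → ℂ) (ρJ : Matrix (Fin n) (Fin n) ℂ),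
          star ψ ⬝ᵥ ψ = 1 → ρJ.PosSemidef → ρJ.trace = 1 →
          MPS.ImplementsWithFidelity a (Vᴴ * Λ * V) m (MPS.eulerGates α β γ) W ψ ρJ
            (1 - C * MPS.ratio (a 2) l ^ m)) ∧
      -- expected overhead of the full protocol
      (∃ C : ℝ, ∀ ε : ℝ, 0 < ε → ε < 1 → ∃ m : ℕ,
        ∀ (W : Matrix (Fin 2) (Fin 2) ℂ) (α β γ : ℝ), MPS.IsEuler W α β γ →
        ∀ (ψ : Fin 2 → ℂ) (ρJ : Matrix (Fin n) (Fin n) ℂ),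
          star ψ ⬝ᵥ ψ = 1 → ρJ.PosSemidef → ρJ.trace = 1 →
          MPS.ImplementsWithFidelity a (Vᴴ * Λ * V) m (MPS.eulerGates α β γ) W ψ ρJ (1 - ε) ∧
          MPS.ExpectedSitesLE a (Vᴴ * Λ * V) m (MPS.eulerGates α β γ) ψ ρJ
            (C * (1 + MPS.zeta (a 2) l * Real.log (1 / ε)) *
              (1 / ε) ^ (4 * MPS.zeta (a 2) l * Real.log (1 / ‖l‖)))) := by
  refine ⟨MPS.exists_isProtectedJunk hA, fun W hW => MPS.exists_isEuler hW,
    fun n V a h l hl hgap => ?_⟩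
  have hl0 := MPS.leading_ne_zero hl hgap
  have hr0 := MPS.ratio_nonneg (a 2) l
  have hr1 := hl.ratio_lt_one hl0
  obtain ⟨C, K, m₀, hK, hP⟩ := h.exists_protocol_bounds hA hl hgap
  refine ⟨fun κ => ?_, fun ρJ hρ htr => ?_, ⟨C, m₀, ?_⟩, ?_⟩
  · obtain ⟨T, s, hJ⟩ := h.exists_junkLimit hA hl hgap κ
    exact ⟨T, s, hJ.ne_zero, hJ.tendsto_left, hJ.tendsto_right, hJ.decay⟩
  · obtain ⟨C, c, m₀, hJ⟩ := h.exists_junkBounds hA hl hgap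
    exact hJ.exists_gateFidelity_ge hl0 hr0 hr1 hρ htr
  · exact fun m hm W α β γ hW ψ ρJ hψ hρ htr => (hP m hm W α β γ hW ψ ρJ hψ hρ htr).1
  · obtain ⟨C', hC'⟩ :=
      MPS.exists_buffer_length hr0 hr1 (one_div_pos.2 (norm_pos_iff.2 hl0)) hK C m₀
    refine ⟨C', fun ε hε hε1 => ?_⟩
    obtain ⟨m, hm, hfid, hsites⟩ := hC' ε hε hε1
    refine ⟨m, fun W α β γ hW ψ ρJ hψ hρ htr => ?_⟩
    have h1 := hP m hm W α β γ hW ψ ρJ hψ hρ htr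
    exact ⟨h1.1.mono (sub_le_sub_left hfid 1), h1.2.mono hsites⟩
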